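/- Let $n\ge 1$. A *nodal scaled marked line* over a field $k$ is a nodal curve of genus zero whose components are projective lines over $k$, with markings $z_0,\dots,z_n$ that are distinct $k$-points different from the nodes, together with, on each component $C_\alpha$ minus its special point closest to $z_0$ (an affine line), a translation invariant form $\phi_\alpha=c_\alpha\,dz$ with $c_\alpha\in k\cup\{\infty\}$. It is required that every path of components from a marking $z_1,\dots,z_n$ to the component of $z_0$ contains exactly one component with $c_\alpha\ne 0,\infty$, and that $c_\alpha=\infty$ on the components on the root ($z_0$) side of such components and $c_\alpha=0$ on the other side. It is *stable* if components with $c_\alpha\neq 0,\infty$ have at least two, and the other components at least three, special points (nodes or markings). Let $\overline M_{n,1}(\mathbb C)$ be the set of isomorphism classes of stable nodal scaled marked lines over $\mathbb C$. For $0\le i<j<k<l\le n$ let $\rho_{ijkl}\in\mathbb P^1(\mathbb C)$ be the cross-ratio $\frac{(w_j-w_k)(w_l-w_i)}{(w_i-w_j)(w_k-w_l)}$, where $w_m$ is the marking $z_m$ or the node closest to $z_m$ on a component on which at least three of $w_i,w_j,w_k,w_l$ are distinct; for $1\le i<j\le n$ let $\rho_{ij}=(c_\alpha(w_j-w_i))^{-1}\in\mathbb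 P^1(\mathbb C)$ on the component $C_\alpha$ on which $w_0=\infty,w_i,w_j$ are distinct, with $\rho_{ij}=0$ if $c_\alpha=\infty$ and $\rho_{ij}=\infty$ if $c_\alpha=0$. Let $\rho$ be the map from $\overline M_{n,1}(\mathbb C)$ to a product of projective lines with all these components, and give $\overline M_{n,1}(\mathbb C)$ the topology pulled back along $\rho$. Let $\overline M_{n,1}$, the multiplihedron, be the moduli space of stable nodal quilted disks with boundary markings $z_0,\dots,z_n$ in this order. That is: the components are closed disks, which we identify with the closed upper half-plane together with $\infty$, the special point closest to $z_0$ being $\infty$ and the other special points being real; some components are quilted, i.e. carry a circle tangent to the boundary at $\infty$, which is a horizontal line at some height $y>0$; every path from a marking $z_1,\dots,z_n$ to the root contains exactly one quilted component; quilted (unquilted) components have at least two (three) special points; isomorphisms are $z\mapsto az+b$, $a>0$, on the components. Its topology is pulled back along the real cross-ratios $\rho_{ijkl}$ and $\rho_{ij}=y/(z_j-z_i)$ (with $0$ resp. $\infty$ on unquilted components on the root side resp. the other side of the quilted ones). Put the form $dz/y$ on the quilted components, and the forms $\infty$ resp. $0$ on the unquilted ones on the root side resp. the other side; this defines a map $\iota:\overline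 M_{n,1}\to\overline M_{n,1}(\mathbb C)$ into the real locus $\overline M_{n,1}(\mathbb C)^{\mathbb R}$, the fixed point set of the involution induced by complex conjugation. The symmetric group $S_n$ acts by permuting $z_1,\dots,z_n$. **Theorem 1.2.** (a) The map $\rho$ is injective and its image is a Zariski closed irreducible subset of the product of projective lines, so that $\overline M_{n,1}(\mathbb C)$ is a complex projective variety. It has at most toric singularities: each point has a Zariski open neighbourhood isomorphic to a Zariski open subset of a normal affine toric variety. (b) The map $\iota:\overline M_{n,1}\to\overline M_{n,1}(\mathbb C)^{\mathbb R}$ is a topological embedding, and its image $D$ is a fundamental domain for the action of $S_n$ on $\overline M_{n,1}(\mathbb C)^{\mathbb R}$: $D$ is closed, it is the closure of its interior, its translates cover $\overline M_{n,1}(\mathbb C)^{\mathbb R}$, and $\operatorname{int} D\cap\sigma(\operatorname{int} D)=\emptyset$ for all $\sigma\in S_n$, $\sigma\ne 1$. -/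

import Mathlib

open scoped OnePoint

namespace ScaledLines

noncomputable section

/-! ### The projective line and cross-ratios

The projective line over a field `K` is `OnePoint K = K ∪ {∞}`. -/

/-- Homogeneous coordinates of a point of the projective line: `z ↦ (z, 1)`, `∞ ↦ (1, 0)`. -/
def homPair {K : Type} [Field K] : OnePoint K → Fin 2 → K
  | ∞ => ![1, 0]
  | (z : K) => ![z, 1]

open Classical in
/-- The point `[p : q]` of the projective line (only used when `(p, q) ≠ (0, 0)`). -/
def ofPair {K : Type} [Field K] (p q : K) : OnePoint K :=
  if q = 0 then ∞ else ((p / q : K) : OnePoint K)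

/-- The determinant of the homogeneous coordinates of two points; it is `z - w` if both points
are finite. -/
def bracket {K : Type} [Field K] (z w : OnePoint K) : K :=
  homPair z 0 * homPair w 1 - homPair w 0 * homPair z 1

/-- The cross-ratio `(w₂ - w₃)(w₄ - w₁) / ((w₁ - w₂)(w₃ - w₄))` of four points of the projective
line, no three of which are equal.  It is `∞` if `w₁ = w₂` or `w₃ = w₄`, it is `1` if
`w₁ = w₃` or `w₂ = w₄`, and it is `0` if `w₁ = w₄` or `w₂ = w₃`. -/
def crossRatio {K : Type} [Field K] (w₁ w₂ w₃ w₄ : OnePoint K) : OnePoint K :=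
  ofPair (bracket w₂ w₃ * bracket w₄ w₁) (bracket w₁ w₂ * bracket w₃ w₄)

/-! ### Nodal curves of genus zero, with a root marking

The components of the curve are the vertices of a finite rooted tree, given as a finite partial
order with a greatest element (the root, which is the component that carries the marking `z₀`)
in which the elements above a given one form a chain.  On each component we use a coordinate in
which the special point closest to `z₀` is `∞`, so that the complement of this point is the affine
line `K`.  The coordinate is unique up to `z ↦ a z + b`. -/

/-- A nodal curve of genus zero with markings `z₀, z₁, …, zₙ`.  The marking `z₀` is the point `∞`
of the component `⊤`; the marking `z_{i+1}` is the point `mark i` of the component `comp i`.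
A component `v ≠ ⊤` is attached, by its point `∞`, to the point `node v` of the next component
towards the root (the value `node ⊤` is not used). -/
structure NodalLine (K : Type) [Field K] (n : ℕ) where
  V : Type
  [order : PartialOrder V]
  [top : OrderTop V]
  [fin : Finite V]
  chain : ∀ u v w : V, u ≤ v → u ≤ w → v ≤ w ∨ w ≤ v
  node : V → K
  comp : Fin n → V
  mark : Fin n → K
  node_ne_node : ∀ u v w : V, v ⋖ u → w ⋖ u → v ≠ w → node v ≠ node w
  node_ne_mark : ∀ (u v : V) (i : Fin n), v ⋖ u → comp i = u → node v ≠ mark i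
  mark_ne_mark : ∀ i j : Fin n, i ≠ j → comp i = comp j → mark i ≠ mark j

attribute [instance] NodalLine.order NodalLine.top NodalLine.fin

namespace NodalLine

variable {K : Type} [Field K] {n : ℕ}

/-- The number of special points (markings and nodes) on the component `v`: the point `∞`, the
nodes that join `v` to components further away from the root, and the markings `z₁, …, zₙ`
on `v`. -/
def numSpecial (C : NodalLine K n) (v : C.V) : ℕ :=
  1 + Nat.card {w : C.V // w ⋖ v} + Nat.card {i : Fin n // C.comp i = v}

open Classical in
/-- The special point of the component `v` that is the marking `z_k`, or the node closest
to `z_k`. -/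
def pt (C : NodalLine K n) (v : C.V) : Fin (n + 1) → OnePoint K :=
  Fin.cases ∞ fun i =>
    if C.comp i = v then (C.mark i : OnePoint K)
    else if h : ∃ w, w ⋖ v ∧ C.comp i ≤ w then (C.node h.choose : OnePoint K)
    else ∞

/-- Isomorphisms of nodal curves preserving the markings: an isomorphism of the rooted trees
and, on each component, an affine map, compatible with nodes and markings. -/
structure Iso (C D : NodalLine K n) where
  f : C.V ≃o D.V
  a : C.V → Kˣ
  b : C.V → K
  node_eq : ∀ u v, v ⋖ u → D.node (f v) = a u * C.node v + b u
  comp_eq : ∀ i, D.comp i = f (C.comp i)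
  mark_eq : ∀ i, D.mark i = a (C.comp i) * C.mark i + b (C.comp i)

def Iso.refl (C : NodalLine K n) : Iso C C where
  f := OrderIso.refl _
  a := fun _ => 1
  b := fun _ => 0
  node_eq := by intros; simp
  comp_eq := by intros; simp
  mark_eq := by intros; simp

def Iso.symm {C D : NodalLine K n} (e : Iso C D) : Iso D C where
  f := e.f.symm
  a := fun v => (e.a (e.f.symm v))⁻¹
  b := fun v => -((e.a (e.f.symm v))⁻¹ : Kˣ) * e.b (e.f.symm v)
  node_eq := by
    intro u v h
    have h' : e.f.symm v ⋖ e.f.symm u := (apply_covBy_apply_iff e.f.symm).2 h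
    have := e.node_eq _ _ h'
    rw [OrderIso.apply_symm_apply] at this
    rw [this, mul_add, ← mul_assoc, Units.inv_mul]
    ring
  comp_eq := by intro i; rw [e.comp_eq, OrderIso.symm_apply_apply]
  mark_eq := by
    intro i
    rw [e.comp_eq, OrderIso.symm_apply_apply, e.mark_eq, mul_add, ← mul_assoc, Units.inv_mul]
    ring

def Iso.trans {C D E : NodalLine K n} (e : Iso C D) (e' : Iso D E) : Iso C E where
  f := e.f.trans e'.f
  a := fun v => e'.a (e.f v) * e.a v
  b := fun v => e'.a (e.f v) * e.b v + e'.b (e.f v)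
  node_eq := by
    intro u v h
    have h' : e.f v ⋖ e.f u := (apply_covBy_apply_iff e.f).2 h
    rw [OrderIso.trans_apply, e'.node_eq _ _ h', e.node_eq _ _ h]
    push_cast
    ring
  comp_eq := by intro i; rw [e'.comp_eq, e.comp_eq, OrderIso.trans_apply]
  mark_eq := by
    intro i
    rw [e'.mark_eq, e.mark_eq, e.comp_eq]
    push_cast
    ring

/-- Base change along a homomorphism of fields. -/
def map {L : Type} [Field L] (φ : K →+* L) (C : NodalLine K n) : NodalLine L n where
  V := C.V
  chain := C.chain
  node := fun v => φ (C.node v)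
  comp := C.comp
  mark := fun i => φ (C.mark i)
  node_ne_node := fun u v w h h' hn he => C.node_ne_node u v w h h' hn (φ.injective he)
  node_ne_mark := fun u v i h h' he => C.node_ne_mark u v i h h' (φ.injective he)
  mark_ne_mark := fun i j h h' he => C.mark_ne_mark i j h h' (φ.injective he)

/-- Renumbering of the markings `z₁, …, zₙ`. -/
def permute (σ : Equiv.Perm (Fin n)) (C : NodalLine K n) : NodalLine K n where
  V := C.V
  chain := C.chain
  node := C.node
  comp := fun i => C.comp (σ⁻¹ i)
  mark := fun i => C.mark (σ⁻¹ i)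
  node_ne_node := C.node_ne_node
  node_ne_mark := fun u v _ h h' => C.node_ne_mark u v _ h h'
  mark_ne_mark := fun _ _ h h' => C.mark_ne_mark _ _ (fun he => h (σ⁻¹.injective he)) h'

def Iso.mapField {L : Type} [Field L] (φ : K →+* L) {C D : NodalLine K n} (e : Iso C D) :
    Iso (C.map φ) (D.map φ) where
  f := e.f
  a := fun v => Units.map φ.toMonoidHom (e.a v)
  b := fun v => φ (e.b v)
  node_eq := by
    intro u v h
    change φ (D.node (e.f v)) = φ (e.a u) * φ (C.node v) + φ (e.b u)
    rw [e.node_eq u v h, map_add, map_mul]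
  comp_eq := e.comp_eq
  mark_eq := by
    intro i
    change φ (D.mark i) = φ (e.a (C.comp i)) * φ (C.mark i) + φ (e.b (C.comp i))
    rw [e.mark_eq i, map_add, map_mul]

def Iso.permute (σ : Equiv.Perm (Fin n)) {C D : NodalLine K n} (e : Iso C D) :
    Iso (C.permute σ) (D.permute σ) where
  f := e.f
  a := e.a
  b := e.b
  node_eq := e.node_eq
  comp_eq := fun i => e.comp_eq (σ⁻¹ i)
  mark_eq := fun i => e.mark_eq (σ⁻¹ i)

theorem numSpecial_iso {C D : NodalLine K n} (e : Iso C D) (v : C.V) :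
    D.numSpecial (e.f v) = C.numSpecial v := by
  unfold numSpecial
  congr 1
  · congr 1
    refine Nat.card_congr (Equiv.subtypeEquiv e.f.symm.toEquiv fun w => ?_)
    rw [← apply_covBy_apply_iff e.f.symm, OrderIso.symm_apply_apply]
    rfl
  · refine Nat.card_congr (Equiv.subtypeEquiv (Equiv.refl _) fun i => ?_)
    rw [e.comp_eq]
    simp

/-- The node through which a marking is seen from `v` is unique. -/
theorem covBy_unique (C : NodalLine K n) {u v w w' : C.V} (hw : w ⋖ v) (hw' : w' ⋖ v)
    (h : u ≤ w) (h' : u ≤ w') : w = w' := by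
  rcases C.chain u w w' h h' with hh | hh
  · rcases hh.eq_or_lt with h1 | h1
    · exact h1
    · exact absurd hw'.lt (hw.2 h1)
  · rcases hh.eq_or_lt with h1 | h1
    · exact h1.symm
    · exact absurd hw.lt (hw'.2 h1)

theorem pt_iso {C D : NodalLine K n} (e : Iso C D) (v : C.V) (k : Fin (n + 1)) :
    D.pt (e.f v) k = (C.pt v k).map (fun z => e.a v * z + e.b v) := by
  refine Fin.cases ?_ (fun i => ?_) k
  · simp [pt]
  · simp only [pt, Fin.cases_succ]
    by_cases h : C.comp i = v
    · have h' : D.comp i = e.f v := by rw [e.comp_eq, h]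
      rw [if_pos h, if_pos h', OnePoint.map_some, e.mark_eq, h]
    · have h' : D.comp i ≠ e.f v := by
        rw [e.comp_eq]; exact fun hh => h (e.f.injective hh)
      rw [if_neg h, if_neg h']
      by_cases hc : ∃ w, w ⋖ v ∧ C.comp i ≤ w
      · have hd : ∃ w, w ⋖ e.f v ∧ D.comp i ≤ w :=
          ⟨e.f hc.choose, (apply_covBy_apply_iff e.f).2 hc.choose_spec.1, by
            rw [e.comp_eq]; exact e.f.monotone hc.choose_spec.2⟩
        rw [dif_pos hc, dif_pos hd, OnePoint.map_some]
        have : hd.choose = e.f hc.choose :=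
          D.covBy_unique hd.choose_spec.1 ((apply_covBy_apply_iff e.f).2 hc.choose_spec.1)
            hd.choose_spec.2 (by rw [e.comp_eq]; exact e.f.monotone hc.choose_spec.2)
        rw [this, e.node_eq _ _ hc.choose_spec.1]
      · have hd : ¬ ∃ w, w ⋖ e.f v ∧ D.comp i ≤ w := by
          rintro ⟨w, hw, hi⟩
          refine hc ⟨e.f.symm w, ?_, ?_⟩
          · rw [← apply_covBy_apply_iff e.f, OrderIso.apply_symm_apply]; exact hw
          · rw [OrderIso.le_symm_apply, ← e.comp_eq]; exact hi
        rw [dif_neg hc, dif_neg hd, OnePoint.map_infty]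

end NodalLine

/-! ### Stable nodal scaled marked lines -/

/-- A translation invariant area form `c dz` on an affine line, possibly infinite, is
non-degenerate if `c` is neither `0` nor `∞`. -/
def Nondegenerate {K : Type} [Field K] (c : OnePoint K) : Prop :=
  c ≠ ((0 : K) : OnePoint K) ∧ c ≠ ∞

/-- A stable nodal scaled marked line over `K`.  The component `v`, minus its point closest
to `z₀`, carries the translation invariant form `scale v • dz`, which may be zero or infinite.
The components with non-degenerate form are the coloured vertices of the tree: each path from
a marking `z₁, …, zₙ` to the root contains exactly one of them.  The forms are infinite on the root
side of the coloured components and zero on the other side. -/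
structure ScaledLine (K : Type) [Field K] (n : ℕ) extends NodalLine K n where
  scale : V → OnePoint K
  colored_path : ∀ i, ∃! v, comp i ≤ v ∧ Nondegenerate (scale v)
  scale_above : ∀ v w, Nondegenerate (scale v) → v < w → scale w = ∞
  scale_below : ∀ v w, Nondegenerate (scale v) → w < v → scale w = ((0 : K) : OnePoint K)
  stable_colored : ∀ v, Nondegenerate (scale v) → 2 ≤ toNodalLine.numSpecial v
  stable_uncolored : ∀ v, ¬ Nondegenerate (scale v) → 3 ≤ toNodalLine.numSpecial v

theorem nondegenerate_map {K L : Type} [Field K] [Field L] (φ : K →+* L) (c : OnePoint K) :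
    Nondegenerate (c.map φ) ↔ Nondegenerate c := by
  induction c using OnePoint.rec with
  | infty => simp [Nondegenerate]
  | coe c => simp [Nondegenerate]

namespace ScaledLine

variable {K : Type} [Field K] {n : ℕ}

/-- Two scaled lines are isomorphic if there is an isomorphism of the marked nodal curves that
pulls back the forms of the second one to those of the first one: the pull-back
of `c dz` under `z ↦ a z + b` is `c a dz`. -/
def Isomorphic (C D : ScaledLine K n) : Prop :=
  ∃ e : NodalLine.Iso C.toNodalLine D.toNodalLine,
    ∀ v, C.scale v = (D.scale (e.f v)).map (fun c => c * (e.a v : K))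

theorem Isomorphic.refl (C : ScaledLine K n) : Isomorphic C C := by
  refine ⟨NodalLine.Iso.refl _, fun v => ?_⟩
  change C.scale v = (C.scale v).map (fun c => c * ((1 : Kˣ) : K))
  simp only [Units.val_one, mul_one]
  exact (congrFun OnePoint.map_id (C.scale v)).symm

theorem Isomorphic.symm {C D : ScaledLine K n} (h : Isomorphic C D) : Isomorphic D C := by
  obtain ⟨e, he⟩ := h
  refine ⟨e.symm, fun v => ?_⟩
  change D.scale v = (C.scale (e.f.symm v)).map (fun c => c * (((e.a (e.f.symm v))⁻¹ : Kˣ) : K))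
  rw [he, OrderIso.apply_symm_apply]
  induction D.scale v using OnePoint.rec with
  | infty => rfl
  | coe c => simp only [OnePoint.map_some]; rw [mul_assoc, Units.mul_inv, mul_one]

theorem Isomorphic.trans {C D E : ScaledLine K n} (h : Isomorphic C D) (h' : Isomorphic D E) :
    Isomorphic C E := by
  obtain ⟨e, he⟩ := h
  obtain ⟨e', he'⟩ := h'
  refine ⟨e.trans e', fun v => ?_⟩
  change C.scale v =
    (E.scale (e'.f (e.f v))).map (fun c => c * ((e'.a (e.f v) * e.a v : Kˣ) : K))
  rw [he, he']
  induction E.scale (e'.f (e.f v)) using OnePoint.rec with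
  | infty => rfl
  | coe c => simp only [OnePoint.map_some]; push_cast; rw [mul_assoc]

instance setoid (K : Type) [Field K] (n : ℕ) : Setoid (ScaledLine K n) where
  r := Isomorphic
  iseqv := ⟨Isomorphic.refl, Isomorphic.symm, Isomorphic.trans⟩

/-- Base change along a homomorphism of fields. -/
def map {L : Type} [Field L] (φ : K →+* L) (C : ScaledLine K n) : ScaledLine L n where
  toNodalLine := C.toNodalLine.map φ
  scale := fun v => (C.scale v).map φ
  colored_path := by simp only [nondegenerate_map]; exact C.colored_path
  scale_above := by
    intro v w h hlt
    rw [nondegenerate_map] at h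
    rw [C.scale_above v w h hlt, OnePoint.map_infty]
  scale_below := by
    intro v w h hlt
    rw [nondegenerate_map] at h
    rw [C.scale_below v w h hlt, OnePoint.map_some, map_zero]
  stable_colored := by simp only [nondegenerate_map]; exact C.stable_colored
  stable_uncolored := by simp only [nondegenerate_map]; exact C.stable_uncolored

theorem Isomorphic.map {L : Type} [Field L] (φ : K →+* L) {C D : ScaledLine K n}
    (h : Isomorphic C D) : Isomorphic (C.map φ) (D.map φ) := by
  obtain ⟨e, he⟩ := h
  refine ⟨e.mapField φ, fun v => ?_⟩
  change (C.scale v).map φ = ((D.scale (e.f v)).map φ).map (fun c => c * φ (e.a v))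
  have hv := he v
  generalize D.scale (e.f v) = s at hv
  generalize C.scale v = r at hv
  subst hv
  induction s using OnePoint.rec with
  | infty => rfl
  | coe c => simp

/-- Renumbering of the markings `z₁, …, zₙ`. -/
def permute (σ : Equiv.Perm (Fin n)) (C : ScaledLine K n) : ScaledLine K n where
  toNodalLine := C.toNodalLine.permute σ
  scale := C.scale
  colored_path := fun i => C.colored_path (σ⁻¹ i)
  scale_above := C.scale_above
  scale_below := C.scale_below
  stable_colored := by
    intro v h
    refine (C.stable_colored v h).trans_eq ?_
    unfold NodalLine.numSpecial
    congr 1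
    exact Nat.card_congr (Equiv.subtypeEquiv σ fun i => by simp [NodalLine.permute])
  stable_uncolored := by
    intro v h
    refine (C.stable_uncolored v h).trans_eq ?_
    unfold NodalLine.numSpecial
    congr 1
    exact Nat.card_congr (Equiv.subtypeEquiv σ fun i => by simp [NodalLine.permute])

theorem Isomorphic.permute (σ : Equiv.Perm (Fin n)) {C D : ScaledLine K n}
    (h : Isomorphic C D) : Isomorphic (C.permute σ) (D.permute σ) := by
  obtain ⟨e, he⟩ := h
  exact ⟨e.permute σ, he⟩

/-- The coordinate `ρ_{ijkl}`: the cross-ratio of the special points `z_{vi}, z_{vj}, z_{vk}, z_{vl}`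
on a component `v` on which at least three of them are distinct. -/
def rhoFour (C : ScaledLine K n) (q : Fin 4 → Fin (n + 1)) : OnePoint K :=
  Classical.epsilon fun r => ∃ v : C.V,
    3 ≤ (Set.range fun t => C.pt v (q t)).ncard ∧
      r = crossRatio (C.pt v (q 0)) (C.pt v (q 1)) (C.pt v (q 2)) (C.pt v (q 3))

open Classical in
/-- The inverse `(c d)⁻¹` of the length of `d ≠ 0` with respect to the form `c dz`; it is `0` if
`c = ∞` and `∞` if `c = 0`. -/
def invLength : OnePoint K → K → OnePoint K
  | ∞, _ => ((0 : K) : OnePoint K)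
  | (c : K), d => if c = 0 then ∞ else (((c * d)⁻¹ : K) : OnePoint K)

/-- The coordinate `ρ_{ij}`: the number `(φ(1) (z_j - z_i))⁻¹`, evaluated at the component `v` on
which `z_{vi}, z_{vj}, z_{v0} = ∞` are distinct. -/
def rhoTwo (C : ScaledLine K n) (p : Fin 2 → Fin n) : OnePoint K :=
  Classical.epsilon fun r => ∃ (v : C.V) (x y : K), x ≠ y ∧
    C.pt v (p 0).succ = (x : OnePoint K) ∧ C.pt v (p 1).succ = (y : OnePoint K) ∧
      r = invLength (C.scale v) (y - x)

end ScaledLine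

/-! ### The moduli space and its coordinates -/

/-- The moduli space of stable scaled marked lines over `K`: the set of isomorphism classes of
stable nodal scaled marked lines. -/
def Moduli (K : Type) [Field K] (n : ℕ) : Type 1 := Quotient (ScaledLine.setoid K n)

/-- The indices `i < j < k < l` in `{0, …, n}` of the coordinates `ρ_{ijkl}` together with
the indices `i < j` in `{1, …, n}` of the coordinates `ρ_{ij}`. -/
abbrev Index (n : ℕ) : Type := (Fin 4 ↪o Fin (n + 1)) ⊕ (Fin 2 ↪o Fin n)

/-- All coordinates of a scaled line. -/
def ScaledLine.rho {K : Type} [Field K] {n : ℕ} (C : ScaledLine K n) : Index n → OnePoint K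
  | .inl q => C.rhoFour q
  | .inr p => C.rhoTwo p

section invariance

variable {K : Type} [Field K] {n : ℕ}

theorem crossRatio_affine (a : Kˣ) (b : K) (w₁ w₂ w₃ w₄ : OnePoint K) :
    crossRatio (w₁.map fun z => a * z + b) (w₂.map fun z => a * z + b)
      (w₃.map fun z => a * z + b) (w₄.map fun z => a * z + b) = crossRatio w₁ w₂ w₃ w₄ := by
  have key : ∀ (s p q : K), s ≠ 0 → ofPair (s * p) (s * q) = ofPair p q := by
    intro s p q hs
    unfold ofPair
    by_cases hq : q = 0
    · simp [hq]
    · rw [if_neg hq, if_neg (mul_ne_zero hs hq), mul_div_mul_left _ _ hs]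
  have ha : (a : K) ≠ 0 := a.ne_zero
  have b0 : ∀ z w : K, bracket (z : OnePoint K) (w : OnePoint K) = z - w := by
    intro z w
    simp [bracket, homPair]
  have b1 : ∀ z : K, bracket (z : OnePoint K) ∞ = -1 := by
    intro z
    simp [bracket, homPair]
  have b2 : ∀ z : K, bracket ∞ (z : OnePoint K) = 1 := by
    intro z
    simp [bracket, homPair]
  have b3 : bracket (∞ : OnePoint K) (∞ : OnePoint K) = 0 := by simp [bracket, homPair]
  have red : ∀ (s p q p' q' : K), s ≠ 0 → p' = s * p → q' = s * q → ofPair p' q' = ofPair p q := by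
    rintro s p q p' q' hs rfl rfl
    exact key s p q hs
  induction w₁ using OnePoint.rec <;> induction w₂ using OnePoint.rec <;>
    induction w₃ using OnePoint.rec <;> induction w₄ using OnePoint.rec <;>
    simp only [OnePoint.map_infty, OnePoint.map_some, crossRatio, b0, b1, b2, b3] <;>
    first
      | (refine red 1 _ _ _ _ one_ne_zero ?_ ?_ <;> ring1)
      | (refine red a _ _ _ _ ha ?_ ?_ <;> ring1)
      | (refine red (a * a) _ _ _ _ (mul_ne_zero ha ha) ?_ ?_ <;> ring1)

theorem affine_injective (a : Kˣ) (b : K) :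
    Function.Injective (OnePoint.map fun z : K => a * z + b) := by
  intro x y h
  induction x using OnePoint.rec <;> induction y using OnePoint.rec <;> simp_all

theorem ScaledLine.rho_imp {C D : ScaledLine K n} (h : ScaledLine.Isomorphic C D)
    (q : Fin 4 → Fin (n + 1)) (r : OnePoint K)
    (hr : ∃ v : C.V, 3 ≤ (Set.range fun t => C.pt v (q t)).ncard ∧
      r = crossRatio (C.pt v (q 0)) (C.pt v (q 1)) (C.pt v (q 2)) (C.pt v (q 3))) :
    ∃ v : D.V, 3 ≤ (Set.range fun t => D.pt v (q t)).ncard ∧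
      r = crossRatio (D.pt v (q 0)) (D.pt v (q 1)) (D.pt v (q 2)) (D.pt v (q 3)) := by
  obtain ⟨e, -⟩ := h
  obtain ⟨v, h1, h2⟩ := hr
  refine ⟨e.f v, ?_, ?_⟩
  · simp only [NodalLine.pt_iso]
    have : (Set.range fun t => (C.pt v (q t)).map fun z => (e.a v : K) * z + e.b v) =
        (OnePoint.map fun z => (e.a v : K) * z + e.b v) '' Set.range fun t => C.pt v (q t) := by
      rw [← Set.range_comp]; rfl
    rw [this, Set.ncard_image_of_injective _ (affine_injective _ _)]
    exact h1
  · simp only [NodalLine.pt_iso]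
    rw [crossRatio_affine]
    exact h2

theorem ScaledLine.rho_imp_two {C D : ScaledLine K n} (h : ScaledLine.Isomorphic C D)
    (p : Fin 2 → Fin n) (r : OnePoint K)
    (hr : ∃ (v : C.V) (x y : K), x ≠ y ∧
      C.pt v (p 0).succ = (x : OnePoint K) ∧ C.pt v (p 1).succ = (y : OnePoint K) ∧
        r = ScaledLine.invLength (C.scale v) (y - x)) :
    ∃ (v : D.V) (x y : K), x ≠ y ∧
      D.pt v (p 0).succ = (x : OnePoint K) ∧ D.pt v (p 1).succ = (y : OnePoint K) ∧
        r = ScaledLine.invLength (D.scale v) (y - x) := by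
  obtain ⟨e, he⟩ := h
  obtain ⟨v, x, y, hxy, hx, hy, h2⟩ := hr
  refine ⟨e.f v, e.a v * x + e.b v, e.a v * y + e.b v, ?_, ?_, ?_, ?_⟩
  · simpa using hxy
  · rw [NodalLine.pt_iso, hx, OnePoint.map_some]
  · rw [NodalLine.pt_iso, hy, OnePoint.map_some]
  · rw [h2, he]
    induction D.scale (e.f v) using OnePoint.rec with
    | infty => rfl
    | coe c =>
      simp only [OnePoint.map_some, ScaledLine.invLength]
      have : c * (e.a v : K) * (y - x) =
          c * ((e.a v : K) * y + e.b v - ((e.a v : K) * x + e.b v)) := by ring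
      rw [this]
      by_cases hc : c = 0
      · rw [if_pos hc, if_pos (by rw [hc, zero_mul])]
      · rw [if_neg hc, if_neg (mul_ne_zero hc (e.a v).ne_zero)]

theorem ScaledLine.rho_eq {C D : ScaledLine K n} (h : ScaledLine.Isomorphic C D) :
    C.rho = D.rho := by
  funext m
  rcases m with q | p
  · exact congrArg Classical.epsilon (funext fun r => propext
      ⟨ScaledLine.rho_imp h q r, ScaledLine.rho_imp h.symm q r⟩)
  · exact congrArg Classical.epsilon (funext fun r => propext
      ⟨ScaledLine.rho_imp_two h p r, ScaledLine.rho_imp_two h.symm p r⟩)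

end invariance

namespace Moduli

variable {K : Type} [Field K] {n : ℕ}

/-- The map from the moduli space to a product of projective lines given by all the
coordinates `ρ_{ijkl}` and `ρ_{ij}`. -/
def rho : Moduli K n → Index n → OnePoint K :=
  Quotient.lift ScaledLine.rho fun _ _ h => ScaledLine.rho_eq h

/-- The topology of the moduli space is the pull-back of the product topology along `rho`. -/
instance [TopologicalSpace K] : TopologicalSpace (Moduli K n) :=
  TopologicalSpace.induced rho inferInstance

/-- Base change along a homomorphism of fields. -/
def map {L : Type} [Field L] (φ : K →+* L) : Moduli K n → Moduli L n :=
  Quotient.map (ScaledLine.map φ) fun _ _ h => ScaledLine.Isomorphic.map φ h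

/-- The symmetric group acts by permuting the markings `z₁, …, zₙ`. -/
instance : MulAction (Equiv.Perm (Fin n)) (Moduli K n) where
  smul σ := Quotient.map (ScaledLine.permute σ) fun _ _ h => ScaledLine.Isomorphic.permute σ h
  one_smul := by
    rintro ⟨C⟩
    rfl
  mul_smul := by
    rintro σ τ ⟨C⟩
    rfl

theorem map_smul {L : Type} [Field L] (φ : K →+* L) (σ : Equiv.Perm (Fin n)) (x : Moduli K n) :
    map φ (σ • x) = σ • map φ x := by
  obtain ⟨C⟩ := x
  rfl

/-- The antiholomorphic involution of the complex moduli space, induced by complex conjugation. -/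
def conj : Moduli ℂ n → Moduli ℂ n := map (starRingEnd ℂ)

end Moduli

/-- The real locus of the complex moduli space: the fixed point set of the antiholomorphic
involution. -/
def RealLocus (n : ℕ) : Type 1 := {x : Moduli ℂ n // x.conj = x}

instance (n : ℕ) : TopologicalSpace (RealLocus n) :=
  inferInstanceAs (TopologicalSpace {x : Moduli ℂ n // x.conj = x})

/-- The action of the symmetric group on the real locus, by permutation of the markings. -/
instance (n : ℕ) : MulAction (Equiv.Perm (Fin n)) (RealLocus n) where
  smul σ x := ⟨σ • x.1, (Moduli.map_smul _ σ x.1).trans (congrArg (σ • ·) x.2)⟩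
  one_smul x := Subtype.ext (one_smul _ x.1)
  mul_smul σ τ x := Subtype.ext (mul_smul σ τ x.1)

/-! ### The multiplihedron as the moduli space of stable quilted disks -/

/-- A stable nodal quilted disk with markings `z₀, …, zₙ`.  Each disk component is identified with
the closed upper half-plane together with `∞`, in such a way that the special point closest to
`z₀` is `∞`; the other special points are then on the real line.  The component `v` is
quilted if `seam v = some y`; its seam, a circle tangent to the boundary at `∞`, is the horizontal
line of height `y > 0`.  It is unquilted if `seam v = none`.  Each path from a marking
`z₁, …, zₙ` to the root contains exactly one quilted component.  The markings are in the order
`z₀, z₁, …, zₙ` around the boundary: whenever the special points in the direction of `z_i` and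
`z_j` with `i < j` are finite points of a component, the first one is at most the second one. -/
structure QuiltedDisk (n : ℕ) extends NodalLine ℝ n where
  seam : V → Option ℝ
  seam_pos : ∀ v y, seam v = some y → 0 < y
  quilted_path : ∀ i, ∃! v, comp i ≤ v ∧ seam v ≠ none
  stable_quilted : ∀ v, seam v ≠ none → 2 ≤ toNodalLine.numSpecial v
  stable_unquilted : ∀ v, seam v = none → 3 ≤ toNodalLine.numSpecial v
  ordered : ∀ (v : V) (i j : Fin n) (x y : ℝ), i < j →
    toNodalLine.pt v i.succ = (x : OnePoint ℝ) → toNodalLine.pt v j.succ = (y : OnePoint ℝ) → x ≤ y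

namespace QuiltedDisk

variable {n : ℕ}

/-- Two nodal quilted disks are isomorphic if there is an isomorphism of trees and, on each disk,
a holomorphic isomorphism `z ↦ a z + b` with `a > 0` that preserves nodes, markings and seams. -/
def Isomorphic (C D : QuiltedDisk n) : Prop :=
  ∃ e : NodalLine.Iso C.toNodalLine D.toNodalLine,
    (∀ v, 0 < (e.a v : ℝ)) ∧ ∀ v, D.seam (e.f v) = (C.seam v).map fun y => (e.a v : ℝ) * y

theorem Isomorphic.refl (C : QuiltedDisk n) : Isomorphic C C := by
  refine ⟨NodalLine.Iso.refl _, fun _ => ?_, fun v => ?_⟩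
  · change (0 : ℝ) < ((1 : ℝˣ) : ℝ); simp
  · change C.seam v = (C.seam v).map fun y => ((1 : ℝˣ) : ℝ) * y
    cases C.seam v <;> simp

theorem Isomorphic.symm {C D : QuiltedDisk n} (h : Isomorphic C D) : Isomorphic D C := by
  obtain ⟨e, h0, he⟩ := h
  refine ⟨e.symm, fun v => ?_, fun v => ?_⟩
  · change (0 : ℝ) < (((e.a (e.f.symm v))⁻¹ : ℝˣ) : ℝ)
    rw [Units.val_inv_eq_inv_val]
    exact inv_pos.2 (h0 _)
  · change C.seam (e.f.symm v) = (D.seam v).map fun y => (((e.a (e.f.symm v))⁻¹ : ℝˣ) : ℝ) * y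
    have := he (e.f.symm v)
    rw [OrderIso.apply_symm_apply] at this
    rw [this]
    cases C.seam (e.f.symm v) <;> simp

theorem Isomorphic.trans {C D E : QuiltedDisk n} (h : Isomorphic C D) (h' : Isomorphic D E) :
    Isomorphic C E := by
  obtain ⟨e, h0, he⟩ := h
  obtain ⟨e', h0', he'⟩ := h'
  refine ⟨e.trans e', fun v => ?_, fun v => ?_⟩
  · change (0 : ℝ) < ((e'.a (e.f v) * e.a v : ℝˣ) : ℝ)
    push_cast
    exact mul_pos (h0' _) (h0 _)
  · change E.seam (e'.f (e.f v)) = (C.seam v).map fun y => ((e'.a (e.f v) * e.a v : ℝˣ) : ℝ) * y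
    rw [he', he]
    cases C.seam v <;> simp [mul_assoc]

instance setoid (n : ℕ) : Setoid (QuiltedDisk n) where
  r := Isomorphic
  iseqv := ⟨Isomorphic.refl, Isomorphic.symm, Isomorphic.trans⟩

/-- By stability, every component is on the path from some marking to the root. -/
theorem exists_marking (C : QuiltedDisk n) (v : C.V) : ∃ i, C.comp i ≤ v := by
  obtain ⟨u, huv, hu⟩ := (Set.toFinite {w : C.V | w ≤ v}).exists_le_minimal
    (show v ∈ {w : C.V | w ≤ v} from le_refl v)
  have hs : 2 ≤ C.toNodalLine.numSpecial u := by
    by_cases h : C.seam u = none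
    · exact le_trans (by norm_num) (C.stable_unquilted u h)
    · exact C.stable_quilted u h
  have hc : IsEmpty {w : C.V // w ⋖ u} :=
    ⟨fun w => absurd (hu.2 (le_trans w.2.le huv) w.2.le) (not_le_of_gt w.2.lt)⟩
  have hm : Nonempty {i : Fin n // C.comp i = u} := by
    by_contra hne
    rw [not_nonempty_iff] at hne
    simp [NodalLine.numSpecial] at hs
  obtain ⟨i, hi⟩ := hm
  exact ⟨i, hi.le.trans huv⟩

theorem seam_eq_none (C : QuiltedDisk n) {v w : C.V} (hlt : v < w) :
    C.seam v = none ∨ C.seam w = none := by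
  by_contra! h
  obtain ⟨i, hi⟩ := C.exists_marking v
  exact hlt.ne ((C.quilted_path i).unique ⟨hi, h.1⟩ ⟨hi.trans hlt.le, h.2⟩)

open Classical in
/-- The form of the scaled line associated to a quilted disk: `dz / y` if the seam is the line of
height `y`, infinite on the root side of the quilted components, zero on the other side. -/
def form (C : QuiltedDisk n) (v : C.V) : OnePoint ℝ :=
  match C.seam v with
  | some y => ((y⁻¹ : ℝ) : OnePoint ℝ)
  | none => if ∃ w, w < v ∧ C.seam w ≠ none then ∞ else ((0 : ℝ) : OnePoint ℝ)

theorem nondegenerate_form (C : QuiltedDisk n) (v : C.V) :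
    Nondegenerate (C.form v) ↔ C.seam v ≠ none := by
  unfold form Nondegenerate
  cases h : C.seam v with
  | none =>
    simp only [ne_eq, not_true_eq_false, iff_false]
    split_ifs <;> simp
  | some y => simp [(C.seam_pos v y h).ne']

/-- The real scaled line associated to a quilted disk. -/
def toScaledLine (C : QuiltedDisk n) : ScaledLine ℝ n where
  toNodalLine := C.toNodalLine
  scale := C.form
  colored_path := by simp only [nondegenerate_form]; exact C.quilted_path
  scale_above := by
    intro v w h hlt
    rw [nondegenerate_form] at h
    have hw := (C.seam_eq_none hlt).resolve_left h
    unfold form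
    simp only [hw]
    exact if_pos ⟨v, hlt, h⟩
  scale_below := by
    intro v w h hlt
    rw [nondegenerate_form] at h
    have hw := (C.seam_eq_none hlt).resolve_right h
    unfold form
    simp only [hw]
    refine if_neg ?_
    rintro ⟨u, hu, hu'⟩
    exact ((C.seam_eq_none (hu.trans hlt)).resolve_left hu' ▸ h) rfl
  stable_colored := by simp only [nondegenerate_form]; exact C.stable_quilted
  stable_uncolored := by simp only [nondegenerate_form, not_not]; exact C.stable_unquilted

theorem Isomorphic.toScaledLine {C D : QuiltedDisk n} (h : Isomorphic C D) :
    ScaledLine.Isomorphic C.toScaledLine D.toScaledLine := by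
  obtain ⟨e, h0, he⟩ := h
  refine ⟨e, fun (v : C.V) => ?_⟩
  change C.form v = (D.form (e.f v)).map fun c => c * (e.a v : ℝ)
  have hiff : (∃ w, w < e.f v ∧ D.seam w ≠ none) ↔ ∃ w, w < v ∧ C.seam w ≠ none := by
    constructor
    · rintro ⟨w, hw, hs⟩
      refine ⟨e.f.symm w, ?_, ?_⟩
      · rw [← e.f.lt_iff_lt, OrderIso.apply_symm_apply]; exact hw
      · intro hn
        have := he (e.f.symm w)
        rw [OrderIso.apply_symm_apply, hn] at this
        exact hs this
    · rintro ⟨w, hw, hs⟩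
      refine ⟨e.f w, e.f.lt_iff_lt.2 hw, ?_⟩
      rw [he]
      simpa using hs
  unfold form
  rw [he]
  cases h : C.seam v with
  | none =>
    by_cases hc : ∃ w, w < v ∧ C.seam w ≠ none
    · have hd := hiff.2 hc
      simp only [Option.map_none]
      rw [if_pos hc, if_pos hd, OnePoint.map_infty]
    · have hd := fun h => hc (hiff.1 h)
      simp only [Option.map_none]
      rw [if_neg hc, if_neg hd, OnePoint.map_some, zero_mul]
  | some y =>
    simp only [Option.map_some, OnePoint.map_some]
    congr 1
    have := (h0 v).ne'
    field_simp

end QuiltedDisk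

/-- The multiplihedron: the moduli space of stable nodal quilted disks with `n + 1` markings. -/
def Multiplihedron (n : ℕ) : Type 1 := Quotient (QuiltedDisk.setoid n)

namespace Multiplihedron

variable {n : ℕ}

/-- The real scaled line associated to a quilted disk, on isomorphism classes. -/
def toReal : Multiplihedron n → Moduli ℝ n :=
  Quotient.map QuiltedDisk.toScaledLine fun _ _ h => QuiltedDisk.Isomorphic.toScaledLine h

/-- The topology of the multiplihedron is the pull-back of the product topology along the map
given by all real cross-ratios `ρ_{ijkl}` and `ρ_{ij} = y / (z_j - z_i)`. -/
instance : TopologicalSpace (Multiplihedron n) :=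
  TopologicalSpace.induced (fun x => Moduli.rho x.toReal) inferInstance

/-- The map from the multiplihedron to the real locus of the complex moduli space: extend the
scalars of the real scaled line associated to a quilted disk. -/
def toRealLocus (x : Multiplihedron n) : RealLocus n :=
  ⟨Moduli.map Complex.ofRealHom x.toReal, by
    generalize x.toReal = y
    obtain ⟨C⟩ := y
    refine Quotient.sound ⟨⟨OrderIso.refl _, fun _ => 1, fun _ => 0, ?_, ?_, ?_⟩, ?_⟩
    · intro u v _
      change (C.node v : ℂ) = ((1 : ℂˣ) : ℂ) * (starRingEnd ℂ) (C.node v : ℂ) + 0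
      simp
    · intro i
      rfl
    · intro i
      change (C.mark i : ℂ) = ((1 : ℂˣ) : ℂ) * (starRingEnd ℂ) (C.mark i : ℂ) + 0
      simp
    · intro v
      change ((C.scale v).map Complex.ofRealHom).map (starRingEnd ℂ) =
        ((C.scale v).map Complex.ofRealHom).map fun c => c * ((1 : ℂˣ) : ℂ)
      induction C.scale v using OnePoint.rec with
      | infty => rfl
      | coe c => simp⟩

end Multiplihedron

/-! ### Complex projective varieties in products of projective lines -/

/-- All homogeneous coordinates of a point of a product of complex projective lines. -/
def homCoord {I : Type} (x : I → OnePoint ℂ) : I × Fin 2 → ℂ := fun p => homPair (x p.1) p.2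

/-- Multihomogeneous polynomials of multidegree `d` on a product of projective lines. -/
def IsMultihomogeneous {I : Type} (P : MvPolynomial (I × Fin 2) ℂ) (d : I →₀ ℕ) : Prop :=
  MvPolynomial.IsWeightedHomogeneous (fun p : I × Fin 2 => Finsupp.single p.1 1) P d

/-- The Zariski topology on a product of projective lines: its basic open sets are the
complements of the zero sets of multihomogeneous polynomials. -/
abbrev zariski (I : Type) : TopologicalSpace (I → OnePoint ℂ) :=
  TopologicalSpace.generateFrom
    {U | ∃ d P, IsMultihomogeneous P d ∧ U = {x | MvPolynomial.eval (homCoord x) P ≠ 0}}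

/-- A subset of a product of projective lines is a projective variety if it is closed and
irreducible in the Zariski topology. -/
def IsProjectiveVariety {I : Type} (X : Set (I → OnePoint ℂ)) : Prop :=
  @IsClosed _ (zariski I) X ∧ @IsIrreducible _ (zariski I) X

/-- Regular maps from a subset `U` of a product of projective lines to another such product:
locally, each component is `[G : H]` with multihomogeneous polynomials `G` and `H` of the same
multidegree that have no common zero. -/
def IsRegularMap {I J : Type} (U : Set (I → OnePoint ℂ))
    (F : (I → OnePoint ℂ) → (J → OnePoint ℂ)) : Prop :=
  ∀ x ∈ U, ∀ j, ∃ d G H, IsMultihomogeneous G d ∧ IsMultihomogeneous H d ∧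
    (MvPolynomial.eval (homCoord x) G ≠ 0 ∨ MvPolynomial.eval (homCoord x) H ≠ 0) ∧
    ∀ y ∈ U, (MvPolynomial.eval (homCoord y) G ≠ 0 ∨ MvPolynomial.eval (homCoord y) H ≠ 0) →
      F y j = ofPair (MvPolynomial.eval (homCoord y) G) (MvPolynomial.eval (homCoord y) H)

/-- Isomorphisms of (locally closed) subvarieties of products of projective lines. -/
def AreIsomorphic {I J : Type} (U : Set (I → OnePoint ℂ)) (W : Set (J → OnePoint ℂ)) : Prop :=
  ∃ (F : (I → OnePoint ℂ) → (J → OnePoint ℂ)) (G : (J → OnePoint ℂ) → (I → OnePoint ℂ)),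
    Set.MapsTo F U W ∧ Set.MapsTo G W U ∧ Set.InvOn G F U W ∧ IsRegularMap U F ∧ IsRegularMap W G

/-- The affine toric variety given by `m` characters of the torus `(ℂˣ)ᵈ`: the closure in `ℂᵐ` of
the image of the torus, where `ℂᵐ` is the set of finite points of the product of `m` projective
lines. -/
def affineToric {m d : ℕ} (A : Fin m → Fin d → ℤ) : Set (Fin m → OnePoint ℂ) :=
  @closure _ (zariski (Fin m))
      {x | ∃ t : Fin d → ℂˣ, ∀ j, x j = (((∏ k, t k ^ A j k : ℂˣ) : ℂ) : OnePoint ℂ)} ∩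
    {x | ∀ j, x j ≠ ∞}

/-- The semigroup of the affine toric variety is saturated; this means that the variety
is normal. -/
def IsSaturated {m d : ℕ} (A : Fin m → Fin d → ℤ) : Prop :=
  ∀ c ∈ AddSubgroup.closure (Set.range A), ∀ k : ℕ, 0 < k →
    k • c ∈ AddSubmonoid.closure (Set.range A) → c ∈ AddSubmonoid.closure (Set.range A)

/-- A variety has at most toric singularities if each point has a Zariski open neighbourhood
that is isomorphic to a Zariski open subset of a normal affine toric variety. -/
def HasToricSingularities {I : Type} (X : Set (I → OnePoint ℂ)) : Prop :=
  ∀ x ∈ X, ∃ (m d : ℕ) (A : Fin m → Fin d → ℤ), IsSaturated A ∧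
    ∃ (U : Set (I → OnePoint ℂ)) (W : Set (Fin m → OnePoint ℂ)),
      @IsOpen _ (zariski I) U ∧ x ∈ U ∧ @IsOpen _ (zariski (Fin m)) W ∧
        AreIsomorphic (X ∩ U) (affineToric A ∩ W)

/-! ### Fundamental domains -/

/-- A subset `D` of a topological space with an action of `G` is a fundamental domain if it is
closed, it is the closure of its interior, its translates cover the space, and the interiors
of different translates are disjoint. -/
structure IsFundamentalDomain (G : Type) [Group G] {Y : Type 1} [TopologicalSpace Y]
    [MulAction G Y] (D : Set Y) : Prop where
  isClosed : IsClosed D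
  closure_interior : closure (interior D) = D
  covers : ∀ y : Y, ∃ g : G, ∃ x ∈ D, g • x = y
  disjoint : ∀ g : G, g ≠ 1 → Disjoint (interior D) ((fun x => g • x) '' interior D)

end

end ScaledLines

open ScaledLines

namespace ScaledLines

noncomputable section

/-! ### Points of the projective line and cross-ratios -/

section ProjectiveLine

variable {K : Type} [Field K]

/-! The coordinates are read as positions. A coordinate `ρ_{0ijk}` places three markings on an
affine line up to affine maps, and `ρ_{ij}` compares `z_j - z_i` with the unit of length given by
the form. The functions `tripleDiff`, `pairDiff` and `pairUnit` are these differences and units,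
known up to a factor that depends only on the index set. They satisfy multihomogeneous equations,
collected in `IsConsistent`. The remaining `ρ_{ijkl}` are determined by the others
(`IsConsistent.ext`).

Injectivity of `ρ`: a component is determined by the set of markings behind it and by its level
(form zero, finite, infinite). Both can be read off from the coordinates, and so can the positions
of the special points up to an affine map (`exists_matching`, `isomorphic_of_rho_eq`).

Image of `ρ`: given a consistent point, the vanishing of differences says which of two distances
from `z_i` is of larger order, with the unit of length as one more distance to compare. The balls
for these distances form a tree, as in an ultrametric space, and this tree carries a scaled line
with the given coordinates (`IsConsistent.exists_scaledLine`). Conversely, gluing the nodes with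
small parameters exhibits every scaled line as a limit of affine lines with distinct markings
(`ScaledLine.rho_mem_closure`), so the closed equations hold for it. The image is therefore both the
set of solutions and the Zariski closure of the open stratum. The latter is the image of a
configuration space under a regular map, hence irreducible.

Toric singularities: near a nodal curve the coordinates are polynomials in the gluing parameters
`t_w` and the positions of the special points that are not used for normalization. The parameters
are not independent. If `d_v` is the unit of the coordinate on `v`, then `t_w = d_w / d_u` for a
node joining `w` to `u`, and `d_v = 1` on all coloured components. These relations describe a torus
whose characters generate the semigroup of a forest, which is saturated
(`mem_closure_forestGenerators_of_nsmul`). Ratios of differences of reference markings invert the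
chart. Both maps are regular and are mutually inverse on dense subsets, hence on closures
(`hasToricSingularities_range_rho`).

Real locus: a point fixed by conjugation has real coordinates, and the reconstruction over `ℝ` gives
a real curve (`RealLocus.exists_eq_ofReal`). The image of the multiplihedron is the closed set where
`ρ_{ij}` and `-ρ_{0ijk}` are nonnegative or infinite (`range_toRealLocus`), since on an ordered real
curve each component can be reflected so that its markings increase and its form is positive. Where
all `ρ_{ij}` are positive the curve is one affine line with increasing markings; this set is open,
and smoothing shows that it is dense in the image. Sorting the markings of smoothings gives the
covering property and the disjointness of interiors. -/

@[simp] theorem homPair_coe_zero (z : K) : homPair (z : OnePoint K) 0 = z := rfl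
@[simp] theorem homPair_coe_one (z : K) : homPair (z : OnePoint K) 1 = 1 := rfl
@[simp] theorem homPair_infty_zero : homPair (∞ : OnePoint K) 0 = 1 := rfl
@[simp] theorem homPair_infty_one : homPair (∞ : OnePoint K) 1 = 0 := rfl

theorem homPair_ne_zero (x : OnePoint K) : ¬ (homPair x 0 = 0 ∧ homPair x 1 = 0) := by
  induction x using OnePoint.rec <;> simp

theorem ofPair_mul_mul (s p q : K) (hs : s ≠ 0) : ofPair (s * p) (s * q) = ofPair p q := by
  unfold ofPair
  by_cases hq : q = 0
  · simp [hq]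
  · rw [if_neg hq, if_neg (mul_ne_zero hs hq), mul_div_mul_left _ _ hs]

theorem ofPair_one_right (p : K) : ofPair p 1 = (p : OnePoint K) := by simp [ofPair]

theorem ofPair_of_ne (p : K) {q : K} (h : q ≠ 0) : ofPair p q = ((p / q : K) : OnePoint K) := by
  simp [ofPair, h]

theorem ofPair_zero_right (p : K) : ofPair p 0 = ∞ := by simp [ofPair]

theorem ofPair_homPair (x : OnePoint K) : ofPair (homPair x 0) (homPair x 1) = x := by
  induction x using OnePoint.rec <;> simp [ofPair]

/-- `homPair` fixes one representative of each point; the factor `c` is the price for using other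
homogeneous coordinates, and it cancels in all multihomogeneous equations. -/
theorem exists_homPair_ofPair {p q : K} (h : ¬ (p = 0 ∧ q = 0)) :
    ∃ c : K, c ≠ 0 ∧ homPair (ofPair p q) 0 = c * p ∧ homPair (ofPair p q) 1 = c * q := by
  by_cases hq : q = 0
  · have hp : p ≠ 0 := fun hp => h ⟨hp, hq⟩
    exact ⟨p⁻¹, inv_ne_zero hp, by simp [ofPair, hq, hp], by simp [ofPair, hq]⟩
  · exact ⟨q⁻¹, inv_ne_zero hq, by simp [ofPair, hq, div_eq_inv_mul], by simp [ofPair, hq]⟩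

theorem ofPair_eq_of_mul_eq {p q p' q' : K} (h : ¬ (p = 0 ∧ q = 0)) (h' : ¬ (p' = 0 ∧ q' = 0))
    (he : p * q' = p' * q) : ofPair p q = ofPair p' q' := by
  by_cases hq : q = 0
  · have hp : p ≠ 0 := fun hp => h ⟨hp, hq⟩
    have : q' = 0 := by
      rw [hq, mul_zero] at he
      exact (mul_eq_zero.1 he).resolve_left hp
    simp [ofPair, hq, this]
  · have hq' : q' ≠ 0 := by
      intro hq'
      rw [hq', mul_zero] at he
      exact h' ⟨(mul_eq_zero.1 he.symm).resolve_right hq, hq'⟩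
    rw [ofPair_of_ne _ hq, ofPair_of_ne _ hq', (div_eq_div_iff hq hq').2 he]

theorem mul_eq_of_ofPair_eq {p q p' q' : K} (h : ¬ (p = 0 ∧ q = 0)) (h' : ¬ (p' = 0 ∧ q' = 0))
    (he : ofPair p q = ofPair p' q') : p * q' = p' * q := by
  obtain ⟨c, hc, h1, h2⟩ := exists_homPair_ofPair h
  obtain ⟨c', hc', h1', h2'⟩ := exists_homPair_ofPair h'
  rw [he] at h1 h2
  have e1 : c' * p' = c * p := h1'.symm.trans h1
  have e2 : c' * q' = c * q := h2'.symm.trans h2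
  have : c' * c * (p * q') = c' * c * (p' * q) := by
    calc c' * c * (p * q') = (c * p) * (c' * q') := by ring
      _ = (c' * p') * (c * q) := by rw [e1, e2]
      _ = c' * c * (p' * q) := by ring
  exact mul_left_cancel₀ (mul_ne_zero hc' hc) this

theorem bracket_eq_zero {z w : OnePoint K} : bracket z w = 0 ↔ z = w := by
  induction z using OnePoint.rec <;> induction w using OnePoint.rec <;>
    simp [bracket, sub_eq_zero]

theorem bracket_self (z : OnePoint K) : bracket z z = 0 := bracket_eq_zero.2 rfl

theorem bracket_comm (z w : OnePoint K) : bracket z w = - bracket w z := by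
  unfold bracket; ring

@[simp] theorem bracket_coe_coe (z w : K) : bracket (z : OnePoint K) (w : OnePoint K) = z - w := by
  simp [bracket]

@[simp] theorem bracket_coe_infty (z : K) : bracket (z : OnePoint K) ∞ = -1 := by
  simp [bracket]

@[simp] theorem bracket_infty_coe (z : K) : bracket ∞ (z : OnePoint K) = 1 := by
  simp [bracket]

theorem ncard_range_le_two {α : Type} {w : Fin 4 → α} (a b : α) (h : ∀ t, w t = a ∨ w t = b) :
    (Set.range w).ncard ≤ 2 := by
  have : Set.range w ⊆ {a, b} := by
    rintro _ ⟨t, rfl⟩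
    exact h t
  exact (Set.ncard_le_ncard this (Set.toFinite _)).trans ((Set.ncard_insert_le a {b}).trans (by simp))

/-- If both products vanish, one coincidence comes from each of them, and any two such coincidences
leave at most two distinct points among the four. -/
theorem crossRatio_pair_ne_zero {w : Fin 4 → OnePoint K} (h : 3 ≤ (Set.range w).ncard) :
    ¬ (bracket (w 1) (w 2) * bracket (w 3) (w 0) = 0 ∧
      bracket (w 0) (w 1) * bracket (w 2) (w 3) = 0) := by
  rintro ⟨h1, h2⟩
  simp only [mul_eq_zero, bracket_eq_zero] at h1 h2
  have : ∃ a b, ∀ t, w t = a ∨ w t = b := by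
    simp only [Fin.forall_fin_succ]
    rcases h1 with h1 | h1 <;> rcases h2 with h2 | h2
    · exact ⟨w 0, w 3, by simp [← h1, h2]⟩
    · exact ⟨w 0, w 3, by simp [← h2, h1]⟩
    · exact ⟨w 0, w 2, by simp [← h2, h1]⟩
    · exact ⟨w 0, w 1, by simp [h2, h1]⟩
  obtain ⟨a, b, hab⟩ := this
  have := ncard_range_le_two a b hab
  omega

/-- Two quadruples of which complementary pairs coincide have the same cross-ratio. -/
theorem crossRatio_eq_of_complementary {w w' : Fin 4 → OnePoint K}
    (h : 3 ≤ (Set.range w).ncard) (h' : 3 ≤ (Set.range w').ncard) (p p' : OnePoint K)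
    (hpp : ∀ t, w t = p ∨ w' t = p') :
    crossRatio (w 0) (w 1) (w 2) (w 3) = crossRatio (w' 0) (w' 1) (w' 2) (w' 3) := by
  refine ofPair_eq_of_mul_eq (crossRatio_pair_ne_zero h) (crossRatio_pair_ne_zero h') ?_
  have three : ∀ (u : Fin 4 → OnePoint K) (r : OnePoint K) (t : Fin 4),
      3 ≤ (Set.range u).ncard → (∀ s, s ≠ t → u s = r) → False := by
    intro u r t hu ht
    have := ncard_range_le_two (w := u) r (u t) (fun s => by
      by_cases hs : s = t
      · exact Or.inr (by rw [hs])
      · exact Or.inl (ht s hs))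
    omega
  have b0 := bracket_self p
  have b0' := bracket_self p'
  have c : ∀ r, bracket r p = - bracket p r := fun r => bracket_comm r p
  have c' : ∀ r, bracket r p' = - bracket p' r := fun r => bracket_comm r p'
  have t0 := three w p 0 h
  have t1 := three w p 1 h
  have t2 := three w p 2 h
  have t3 := three w p 3 h
  have t0' := three w' p' 0 h'
  have t1' := three w' p' 1 h'
  have t2' := three w' p' 2 h'
  have t3' := three w' p' 3 h'
  simp only [Fin.forall_fin_succ] at hpp t0 t1 t2 t3 t0' t1' t2' t3'
  obtain ⟨h0, h1, h2, h3, -⟩ := hpp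
  simp only [Fin.succ_zero_eq_one, Fin.succ_one_eq_two] at h1 h2 h3
  have e3 : (Fin.succ 2 : Fin 4) = 3 := rfl
  simp only [e3] at h3
  -- At most two of the `w t` equal `p` and at most two of the `w' t` equal `p'`, so only the
  -- splittings of the indices into two pairs survive. For each of them both cross-ratios take the
  -- same value among `0`, `1`, `∞`.
  rcases h0 with h0 | h0 <;> rcases h1 with h1 | h1 <;> rcases h2 with h2 | h2 <;>
    rcases h3 with h3 | h3 <;>
    first
      | (exfalso; simp [h0, h1, h2, h3, e3] at t0 t1 t2 t3 t0' t1' t2' t3'; done)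
      | (simp only [h0, h1, h2, h3, b0, b0']; ring1)
      | (simp only [h0, h1, h2, h3, c, c']; ring1)

/-- Cross-ratios can be computed with arbitrary homogeneous coordinates. -/
theorem ofPair_eq_crossRatio {w : Fin 4 → OnePoint K} {H : Fin 4 → Fin 2 → K} {c : Fin 4 → K}
    (hc : ∀ t, c t ≠ 0) (h : ∀ t s, H t s = c t * homPair (w t) s) :
    ofPair ((H 1 0 * H 2 1 - H 2 0 * H 1 1) * (H 3 0 * H 0 1 - H 0 0 * H 3 1))
      ((H 0 0 * H 1 1 - H 1 0 * H 0 1) * (H 2 0 * H 3 1 - H 3 0 * H 2 1)) =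
      crossRatio (w 0) (w 1) (w 2) (w 3) := by
  rw [crossRatio, ← ofPair_mul_mul (c 0 * c 1 * c 2 * c 3)
    (bracket (w 1) (w 2) * bracket (w 3) (w 0)) _ (by simp [hc])]
  unfold bracket
  simp only [h]
  congr 1 <;> ring

theorem ofPair_map {L : Type} [Field L] (φ : K →+* L) (p q : K) :
    (ofPair p q).map φ = ofPair (φ p) (φ q) := by
  by_cases hq : q = 0
  · simp [hq, ofPair]
  · have : φ q ≠ 0 := by simpa using hq
    rw [ofPair_of_ne _ hq, ofPair_of_ne _ this, OnePoint.map_some, map_div₀]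

theorem homPair_map {L : Type} [Field L] (φ : K →+* L) (x : OnePoint K) (s : Fin 2) :
    homPair (x.map φ) s = φ (homPair x s) := by
  induction x using OnePoint.rec <;> fin_cases s <;> simp

theorem bracket_map {L : Type} [Field L] (φ : K →+* L) (x y : OnePoint K) :
    bracket (x.map φ) (y.map φ) = φ (bracket x y) := by
  simp [bracket, homPair_map]

theorem crossRatio_map {L : Type} [Field L] (φ : K →+* L) (a b c d : OnePoint K) :
    crossRatio (a.map φ) (b.map φ) (c.map φ) (d.map φ) = (crossRatio a b c d).map φ := by
  simp [crossRatio, ofPair_map, bracket_map]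

theorem onePoint_map_injective {α β : Type} {f : α → β} (hf : Function.Injective f) :
    Function.Injective (OnePoint.map f) := by
  intro x y h
  induction x using OnePoint.rec <;> induction y using OnePoint.rec <;>
    simp_all [hf.eq_iff]

end ProjectiveLine

/-! ### The tree of components -/

namespace NodalLine

variable {K : Type} [Field K] {n : ℕ} (C : NodalLine K n)

open Classical in
/-- The next component on the way from `u` down to `v < u`. -/
def child (u v : C.V) : C.V := if h : ∃ w, w ⋖ u ∧ v ≤ w then h.choose else u

variable {C}

theorem exists_child {u v : C.V} (h : v < u) : ∃ w, w ⋖ u ∧ v ≤ w := by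
  obtain ⟨w, hw, hm⟩ := (Set.toFinite {w : C.V | v ≤ w ∧ w < u}).exists_le_maximal
    (show v ∈ {w : C.V | v ≤ w ∧ w < u} from ⟨le_refl v, h⟩)
  refine ⟨w, ⟨hm.1.2, fun x hx hxu => ?_⟩, hm.1.1⟩
  exact absurd (hm.2 ⟨hm.1.1.trans hx.le, hxu⟩ hx.le) (not_le_of_gt hx)

theorem child_eq {u v w : C.V} (hw : w ⋖ u) (hv : v ≤ w) : C.child u v = w := by
  have h : ∃ w, w ⋖ u ∧ v ≤ w := ⟨w, hw, hv⟩
  rw [child, dif_pos h]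
  exact C.covBy_unique h.choose_spec.1 hw h.choose_spec.2 hv

theorem child_covBy {u v : C.V} (h : v < u) : C.child u v ⋖ u := by
  obtain ⟨w, hw, hv⟩ := exists_child h
  rwa [child_eq hw hv]

theorem le_child {u v : C.V} (h : v < u) : v ≤ C.child u v := by
  obtain ⟨w, hw, hv⟩ := exists_child h
  rwa [child_eq hw hv]

theorem child_lt {u v : C.V} (h : v < u) : C.child u v < u := (child_covBy h).lt

variable (C) in
open Classical in
/-- The next component towards the root. -/
def par (v : C.V) : C.V := if h : ∃ u, v ⋖ u then h.choose else v

theorem par_eq {u v : C.V} (h : v ⋖ u) : C.par v = u := by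
  have h' : ∃ u, v ⋖ u := ⟨u, h⟩
  rw [par, dif_pos h']
  have h1 := h'.choose_spec
  rcases C.chain v _ _ h1.le h.le with hh | hh
  · rcases hh.eq_or_lt with h2 | h2
    · exact h2
    · exact absurd h2 (h.2 h1.lt)
  · rcases hh.eq_or_lt with h2 | h2
    · exact h2.symm
    · exact absurd h2 (h1.2 h.lt)

theorem covBy_par {v : C.V} (h : v ≠ ⊤) : v ⋖ C.par v := by
  obtain ⟨w, hw, hm⟩ := (Set.toFinite {w : C.V | v < w}).exists_le_minimal
    (show (⊤ : C.V) ∈ {w : C.V | v < w} from lt_top_iff_ne_top.2 h)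
  have : v ⋖ w := ⟨hm.1, fun x hx hxw => absurd (hm.2 hx hxw.le) (not_le_of_gt hxw)⟩
  rwa [par_eq this]

/-- The common upper bounds lie above `v`, hence form a chain, and a minimal one is least. -/
theorem exists_join (v w : C.V) : ∃ u, v ≤ u ∧ w ≤ u ∧ ∀ x, v ≤ x → w ≤ x → u ≤ x := by
  obtain ⟨u, -, hm⟩ := (Set.toFinite {u : C.V | v ≤ u ∧ w ≤ u}).exists_le_minimal
    (show (⊤ : C.V) ∈ {u : C.V | v ≤ u ∧ w ≤ u} from ⟨le_top, le_top⟩)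
  refine ⟨u, hm.1.1, hm.1.2, fun x hx hx' => ?_⟩
  rcases C.chain v u x hm.1.1 hx with h | h
  · exact h
  · exact hm.2 ⟨hx, hx'⟩ h

variable (C) in
/-- The component at which the paths from `v` and `w` to the root meet. -/
def join (v w : C.V) : C.V := (exists_join v w).choose

theorem le_join_left (v w : C.V) : v ≤ C.join v w := (exists_join v w).choose_spec.1
theorem le_join_right (v w : C.V) : w ≤ C.join v w := (exists_join v w).choose_spec.2.1
theorem join_le {v w x : C.V} (h : v ≤ x) (h' : w ≤ x) : C.join v w ≤ x :=
  (exists_join v w).choose_spec.2.2 x h h'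

theorem join_eq_left {v w : C.V} (h : w ≤ v) : C.join v w = v :=
  le_antisymm (join_le le_rfl h) (le_join_left v w)

/-- A common child would be an upper bound of both components strictly below their join. -/
theorem child_join_ne {v w : C.V} (h : v < C.join v w) (h' : w < C.join v w) :
    C.child (C.join v w) v ≠ C.child (C.join v w) w := by
  intro he
  have := join_le (le_child h) (he ▸ le_child h')
  exact absurd (child_lt h) (not_lt_of_ge this)

variable (C) in
open Classical in
/-- The position on the component `v` of the special point in the direction of a marking
behind `v`. -/
def fpt (v : C.V) (i : Fin n) : K := if C.comp i = v then C.mark i else C.node (C.child v (C.comp i))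

@[simp] theorem pt_zero (v : C.V) : C.pt v 0 = ∞ := rfl

theorem pt_succ_of_le {v : C.V} {i : Fin n} (h : C.comp i ≤ v) :
    C.pt v i.succ = (C.fpt v i : OnePoint K) := by
  simp only [pt, Fin.cases_succ, fpt]
  by_cases hi : C.comp i = v
  · rw [if_pos hi, if_pos hi]
  · have h1 : ∃ w, w ⋖ v ∧ C.comp i ≤ w := exists_child (lt_of_le_of_ne h hi)
    rw [if_neg hi, if_neg hi, dif_pos h1, child, dif_pos h1]

theorem pt_succ_of_not_le {v : C.V} {i : Fin n} (h : ¬ C.comp i ≤ v) : C.pt v i.succ = ∞ := by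
  simp only [pt, Fin.cases_succ]
  rw [if_neg (fun hh => h hh.le), dif_neg]
  rintro ⟨w, hw, hi⟩
  exact h (hi.trans hw.le)

theorem le_of_pt_succ_eq {v : C.V} {i : Fin n} {x : K} (h : C.pt v i.succ = (x : OnePoint K)) :
    C.comp i ≤ v ∧ C.fpt v i = x := by
  by_cases hi : C.comp i ≤ v
  · rw [pt_succ_of_le hi] at h
    exact ⟨hi, OnePoint.coe_injective h⟩
  · rw [pt_succ_of_not_le hi] at h
    exact absurd h (OnePoint.infty_ne_coe x)

theorem fpt_of_eq {v : C.V} {i : Fin n} (h : C.comp i = v) : C.fpt v i = C.mark i := if_pos h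

theorem fpt_of_covBy {v w : C.V} {i : Fin n} (hw : w ⋖ v) (h : C.comp i ≤ w) :
    C.fpt v i = C.node w := by
  rw [fpt, if_neg (h.trans_lt hw.lt).ne, child_eq hw h]

theorem fpt_of_lt {v w : C.V} {i : Fin n} (hw : w < v) (h : C.comp i ≤ w) :
    C.fpt v i = C.node (C.child v w) :=
  fpt_of_covBy (child_covBy hw) (h.trans (le_child hw))

/-- Special points of one component are distinct, so two different markings can be seen at one point
only through a common node. -/
theorem eq_or_exists_of_fpt_eq {v : C.V} {i j : Fin n} (hi : C.comp i ≤ v) (hj : C.comp j ≤ v)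
    (h : C.fpt v i = C.fpt v j) : i = j ∨ ∃ w, w ⋖ v ∧ C.comp i ≤ w ∧ C.comp j ≤ w := by
  by_cases hij : i = j
  · exact Or.inl hij
  right
  rcases hi.eq_or_lt with hi' | hi' <;> rcases hj.eq_or_lt with hj' | hj'
  · rw [fpt_of_eq hi', fpt_of_eq hj'] at h
    exact absurd h (C.mark_ne_mark i j hij (hi'.trans hj'.symm))
  · rw [fpt_of_eq hi', fpt_of_covBy (child_covBy hj') (le_child hj')] at h
    exact absurd h.symm (C.node_ne_mark _ _ _ (child_covBy hj') hi')
  · rw [fpt_of_eq hj', fpt_of_covBy (child_covBy hi') (le_child hi')] at h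
    exact absurd h (C.node_ne_mark _ _ _ (child_covBy hi') hj')
  · rw [fpt_of_covBy (child_covBy hi') (le_child hi'),
      fpt_of_covBy (child_covBy hj') (le_child hj')] at h
    refine ⟨_, child_covBy hi', le_child hi', ?_⟩
    by_contra hne
    refine C.node_ne_node _ _ _ (child_covBy hi') (child_covBy hj') (fun he => hne ?_) h
    rw [he]
    exact le_child hj'

theorem fpt_eq_of_le {v w : C.V} {i j : Fin n} (hw : w < v) (hi : C.comp i ≤ w)
    (hj : C.comp j ≤ w) : C.fpt v i = C.fpt v j := by
  rw [fpt_of_lt hw hi, fpt_of_lt hw hj]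

/-- The witness is the join of the two components: if both markings were seen there through one
node, the component behind that node would be a smaller upper bound. -/
theorem exists_fpt_ne {i j : Fin n} (hij : i ≠ j) :
    ∃ v, C.comp i ≤ v ∧ C.comp j ≤ v ∧ C.fpt v i ≠ C.fpt v j := by
  refine ⟨C.join (C.comp i) (C.comp j), le_join_left _ _, le_join_right _ _, fun h => ?_⟩
  rcases eq_or_exists_of_fpt_eq (le_join_left _ _) (le_join_right _ _) h with h | ⟨w, hw, h1, h2⟩
  · exact hij h
  · exact absurd hw.lt (not_lt_of_ge (join_le h1 h2))

theorem le_of_fpt_ne {i j : Fin n} {v w : C.V} (hi : C.comp i ≤ v)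
    (h : C.fpt v i ≠ C.fpt v j) (hi' : C.comp i ≤ w) (hj' : C.comp j ≤ w) : v ≤ w := by
  rcases C.chain _ v w hi hi' with hh | hh
  · exact hh
  · rcases hh.eq_or_lt with h1 | h1
    · exact h1.ge
    · exact absurd (fpt_eq_of_le h1 hi' hj') h

/-- Together with `exists_fpt_ne` this makes the component in the definition of `ρ_{ij}` exist
uniquely, so that the choice in `rhoTwo` has a computable value. -/
theorem fpt_ne_unique {i j : Fin n} {v w : C.V} (hi : C.comp i ≤ v) (hj : C.comp j ≤ v)
    (h : C.fpt v i ≠ C.fpt v j) (hi' : C.comp i ≤ w) (hj' : C.comp j ≤ w)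
    (h' : C.fpt w i ≠ C.fpt w j) : v = w :=
  le_antisymm (le_of_fpt_ne hi h hi' hj') (le_of_fpt_ne hi' h' hi hj)

/-- Seen from `v`, the special points not in the direction of `w` all lie in one direction
from `w`. -/
theorem exists_separation {v w : C.V} (h : v ≠ w) :
    ∃ p p' : OnePoint K, ∀ a, C.pt v a = p ∨ C.pt w a = p' := by
  have key : ∀ v w : C.V, v < w → ∃ p p' : OnePoint K, ∀ a, C.pt v a = p ∨ C.pt w a = p' := by
    intro v w h
    -- For `v < w`, a marking that is not behind `v` is seen from `v` at `∞`, and a marking behind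
    -- `v` is seen from `w` at the node towards `v`.
    refine ⟨∞, C.node (C.child w v), fun a => ?_⟩
    refine Fin.cases (Or.inl rfl) (fun i => ?_) a
    by_cases hi : C.comp i ≤ v
    · right
      rw [pt_succ_of_le (hi.trans h.le), fpt_of_lt h hi]
    · exact Or.inl (pt_succ_of_not_le hi)
  by_cases h1 : v ≤ w
  · exact key v w (lt_of_le_of_ne h1 h)
  by_cases h2 : w ≤ v
  · obtain ⟨p, p', hp⟩ := key w v (lt_of_le_of_ne h2 h.symm)
    exact ⟨p', p, fun a => (hp a).symm⟩
  -- For incomparable components no marking is behind both, because the components above a given one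
  -- form a chain.
  refine ⟨∞, ∞, fun a => ?_⟩
  refine Fin.cases (Or.inl rfl) (fun i => ?_) a
  by_cases hi : C.comp i ≤ v
  · right
    refine pt_succ_of_not_le fun hi' => ?_
    rcases C.chain _ _ _ hi hi' with h | h
    · exact h1 h
    · exact h2 h
  · exact Or.inl (pt_succ_of_not_le hi)

theorem three_le_ncard {α : Type} {w : Fin 4 → α} (a b c : Fin 4) (h1 : w a ≠ w b)
    (h2 : w a ≠ w c) (h3 : w b ≠ w c) : 3 ≤ (Set.range w).ncard := by
  have h : ({w a, w b, w c} : Set α) ⊆ Set.range w := by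
    rintro x (rfl | rfl | rfl) <;> exact Set.mem_range_self _
  have : ({w a, w b, w c} : Set α).ncard = 3 := Set.ncard_eq_three.2 ⟨_, _, _, h1, h2, h3, rfl⟩
  exact this ▸ Set.ncard_le_ncard h (Set.toFinite _)

theorem pt_ne_of_fpt_ne {v : C.V} {i j : Fin n} (hi : C.comp i ≤ v) (hj : C.comp j ≤ v)
    (h : C.fpt v i ≠ C.fpt v j) : C.pt v i.succ ≠ C.pt v j.succ := by
  rw [pt_succ_of_le hi, pt_succ_of_le hj]
  exact fun he => h (OnePoint.coe_injective he)

/-- For each quadruple of markings there is a component on which three of them are separated. -/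
theorem exists_three_le_ncard {q : Fin 4 → Fin (n + 1)} (hq : Function.Injective q) :
    ∃ v, 3 ≤ (Set.range fun t => C.pt v (q t)).ncard := by
  classical
  -- At most one of the four indices is the root marking; `a` and `b` avoid it, while `c` may be it.
  obtain ⟨a, b, c, hab, hac, hbc, ha, hb⟩ : ∃ a b c : Fin 4, a ≠ b ∧ a ≠ c ∧ b ≠ c ∧
      q a ≠ 0 ∧ q b ≠ 0 := by
    by_cases h : ∃ t, q t = 0
    · obtain ⟨t, ht⟩ := h
      have hne : ∀ s, s ≠ t → q s ≠ 0 := fun s hs h => hs (hq (h.trans ht.symm))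
      have : ∃ a b : Fin 4, a ≠ b ∧ a ≠ t ∧ b ≠ t := by
        clear hne ht
        revert t; decide
      obtain ⟨a, b, h1, h2, h3⟩ := this
      exact ⟨a, b, t, h1, h2, h3, hne a h2, hne b h3⟩
    · push Not at h
      exact ⟨0, 1, 2, by decide, by decide, by decide, h 0, h 1⟩
  obtain ⟨i, hi⟩ := Fin.exists_succ_eq.2 ha
  obtain ⟨j, hj⟩ := Fin.exists_succ_eq.2 hb
  have hij : i ≠ j := by
    rintro rfl
    exact hab (hq (hi.symm.trans hj))
  have inf_of : ∀ (u : C.V) (k : Fin n), C.comp k ≤ u → C.pt u k.succ ≠ ∞ := by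
    intro u k hk
    rw [pt_succ_of_le hk]
    exact OnePoint.coe_ne_infty _
  obtain ⟨v, h1, h2, h3⟩ := C.exists_fpt_ne hij
  have hne := pt_ne_of_fpt_ne h1 h2 h3
  have n1 := inf_of v i h1
  have n2 := inf_of v j h2
  rw [hi] at hne n1
  rw [hj] at hne n2
  by_cases hc : C.pt v (q c) = ∞
  · exact ⟨v, three_le_ncard a b c hne (by rwa [hc]) (by rwa [hc])⟩
  have hc0 : q c ≠ 0 := by
    intro h; rw [h] at hc; exact hc rfl
  obtain ⟨k, hk⟩ := Fin.exists_succ_eq.2 hc0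
  rw [← hk] at hc
  have hkv : C.comp k ≤ v := by
    by_contra hh
    exact hc (pt_succ_of_not_le hh)
  -- If `z_k` is seen in the direction of `z_i`, the component that separates these two lies behind
  -- the common node. There the other marking is seen at `∞`, so that three points are distinct.
  by_cases e1 : C.fpt v k = C.fpt v i
  · have hki : k ≠ i := by
      rintro rfl
      exact hac (hq (hi.symm.trans hk))
    obtain ⟨w, hw, g1, g2⟩ := (eq_or_exists_of_fpt_eq hkv h1 e1).resolve_left hki
    obtain ⟨u, k1, k2, k3⟩ := C.exists_fpt_ne hki
    have huw := le_of_fpt_ne k1 k3 g1 g2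
    have hj' : C.pt u (q b) = ∞ := by
      rw [← hj]
      refine pt_succ_of_not_le fun hju => h3 ?_
      exact fpt_eq_of_le hw.lt g2 (hju.trans huw)
    have := pt_ne_of_fpt_ne k1 k2 k3
    have m1 := inf_of u i k2
    have m2 := inf_of u k k1
    rw [hk] at this m2
    rw [hi] at this m1
    exact ⟨u, three_le_ncard c a b this (by rwa [hj']) (by rwa [hj'])⟩
  · by_cases e2 : C.fpt v k = C.fpt v j
    · have hki : k ≠ j := by
        rintro rfl
        exact hbc (hq (hj.symm.trans hk))
      obtain ⟨w, hw, g1, g2⟩ := (eq_or_exists_of_fpt_eq hkv h2 e2).resolve_left hki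
      obtain ⟨u, k1, k2, k3⟩ := C.exists_fpt_ne hki
      have huw := le_of_fpt_ne k1 k3 g1 g2
      have hj' : C.pt u (q a) = ∞ := by
        rw [← hi]
        refine pt_succ_of_not_le fun hju => h3 ?_
        exact fpt_eq_of_le hw.lt (hju.trans huw) g2
      have := pt_ne_of_fpt_ne k1 k2 k3
      have m1 := inf_of u j k2
      have m2 := inf_of u k k1
      rw [hk] at this m2
      rw [hj] at this m1
      exact ⟨u, three_le_ncard c b a this (by rwa [hj']) (by rwa [hj'])⟩
    · have g1 := pt_ne_of_fpt_ne hkv h1 e1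
      have g2 := pt_ne_of_fpt_ne hkv h2 e2
      rw [hk, hi] at g1
      rw [hk, hj] at g2
      exact ⟨v, three_le_ncard a b c hne g1.symm g2.symm⟩

/-- Two different components cut the quadruple in complementary ways by `exists_separation`. Hence
the cross-ratio does not depend on the component on which it is evaluated. -/
theorem crossRatio_pt_eq {q : Fin 4 → Fin (n + 1)} {v w : C.V}
    (hv : 3 ≤ (Set.range fun t => C.pt v (q t)).ncard)
    (hw : 3 ≤ (Set.range fun t => C.pt w (q t)).ncard) :
    crossRatio (C.pt v (q 0)) (C.pt v (q 1)) (C.pt v (q 2)) (C.pt v (q 3)) =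
      crossRatio (C.pt w (q 0)) (C.pt w (q 1)) (C.pt w (q 2)) (C.pt w (q 3)) := by
  by_cases h : v = w
  · rw [h]
  · obtain ⟨p, p', hp⟩ := exists_separation h
    exact crossRatio_eq_of_complementary hv hw p p' fun t => hp (q t)

/-- A minimal component below `v` has no special points other than `∞` and markings, so stability
puts a marking on it. -/
theorem exists_comp_le (hs : ∀ v, 2 ≤ C.numSpecial v) (v : C.V) : ∃ i, C.comp i ≤ v := by
  obtain ⟨u, huv, hu⟩ := (Set.toFinite {w : C.V | w ≤ v}).exists_le_minimal
    (show v ∈ {w : C.V | w ≤ v} from le_refl v)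
  have hs := hs u
  have hc : IsEmpty {w : C.V // w ⋖ u} :=
    ⟨fun w => absurd (hu.2 (le_trans w.2.le huv) w.2.le) (not_le_of_gt w.2.lt)⟩
  have hm : Nonempty {i : Fin n // C.comp i = u} := by
    by_contra hne
    rw [not_nonempty_iff] at hne
    simp [NodalLine.numSpecial] at hs
  obtain ⟨i, hi⟩ := hm
  exact ⟨i, hi.le.trans huv⟩

/-- Besides `∞` there are two more special points, and each of them is a marking or a node with a
marking behind it. -/
theorem exists_fpt_ne_of_three_le (hs : ∀ v, 2 ≤ C.numSpecial v) {v : C.V}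
    (h : 3 ≤ C.numSpecial v) : ∃ i j, C.comp i ≤ v ∧ C.comp j ≤ v ∧ C.fpt v i ≠ C.fpt v j := by
  have hcard : 2 ≤ Nat.card ({w : C.V // w ⋖ v} ⊕ {i : Fin n // C.comp i = v}) := by
    rw [Nat.card_sum]
    unfold numSpecial at h
    omega
  have : Nontrivial ({w : C.V // w ⋖ v} ⊕ {i : Fin n // C.comp i = v}) :=
    Finite.one_lt_card_iff_nontrivial.1 hcard
  obtain ⟨a, b, hab⟩ := exists_pair_ne ({w : C.V // w ⋖ v} ⊕ {i : Fin n // C.comp i = v})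
  rcases a with ⟨a, ha⟩ | ⟨a, ha⟩ <;> rcases b with ⟨b, hb⟩ | ⟨b, hb⟩
  · obtain ⟨i, hi⟩ := exists_comp_le hs a
    obtain ⟨j, hj⟩ := exists_comp_le hs b
    refine ⟨i, j, hi.trans ha.le, hj.trans hb.le, ?_⟩
    rw [fpt_of_covBy ha hi, fpt_of_covBy hb hj]
    exact C.node_ne_node _ _ _ ha hb (fun he => hab (by subst he; rfl))
  · obtain ⟨i, hi⟩ := exists_comp_le hs a
    refine ⟨i, b, hi.trans ha.le, hb.le, ?_⟩
    rw [fpt_of_covBy ha hi, fpt_of_eq hb]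
    exact C.node_ne_mark _ _ _ ha hb
  · obtain ⟨i, hi⟩ := exists_comp_le hs b
    refine ⟨i, a, hi.trans hb.le, ha.le, ?_⟩
    rw [fpt_of_covBy hb hi, fpt_of_eq ha]
    exact C.node_ne_mark _ _ _ hb ha
  · refine ⟨a, b, ha.le, hb.le, ?_⟩
    rw [fpt_of_eq ha, fpt_of_eq hb]
    exact C.mark_ne_mark _ _ (fun he => hab (by subst he; rfl)) (ha.trans hb.symm)

end NodalLine

/-! ### Scaled lines -/

open Classical in
/-- The position of a component relative to the coloured ones: `0` on the side of the markings,
`1` for the coloured components, `2` on the root side. -/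
def scaleLevel {K : Type} [Field K] (c : OnePoint K) : ℕ :=
  if c = ((0 : K) : OnePoint K) then 0 else if c = ∞ then 2 else 1

theorem scaleLevel_eq_one {K : Type} [Field K] {c : OnePoint K} :
    scaleLevel c = 1 ↔ Nondegenerate c := by
  unfold scaleLevel Nondegenerate
  split_ifs <;> simp_all

theorem scaleLevel_eq_zero {K : Type} [Field K] {c : OnePoint K} :
    scaleLevel c = 0 ↔ c = ((0 : K) : OnePoint K) := by
  unfold scaleLevel
  split_ifs <;> simp_all

theorem scaleLevel_eq_two {K : Type} [Field K] {c : OnePoint K} :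
    scaleLevel c = 2 ↔ c = ∞ := by
  unfold scaleLevel
  split_ifs with h1 h2 <;> simp_all

theorem scaleLevel_le_two {K : Type} [Field K] (c : OnePoint K) : scaleLevel c ≤ 2 := by
  unfold scaleLevel
  split_ifs <;> simp

namespace ScaledLine

open NodalLine

variable {K : Type} [Field K] {n : ℕ} {C : ScaledLine K n}

theorem two_le_numSpecial (v : C.V) : 2 ≤ C.numSpecial v := by
  by_cases h : Nondegenerate (C.scale v)
  · exact C.stable_colored v h
  · exact le_trans (by norm_num) (C.stable_uncolored v h)

theorem exists_comp_le (v : C.V) : ∃ i, C.comp i ≤ v :=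
  NodalLine.exists_comp_le two_le_numSpecial v

theorem exists_fpt_ne_of_uncolored {v : C.V} (h : ¬ Nondegenerate (C.scale v)) :
    ∃ i j, C.comp i ≤ v ∧ C.comp j ≤ v ∧ C.fpt v i ≠ C.fpt v j :=
  exists_fpt_ne_of_three_le two_le_numSpecial (C.stable_uncolored v h)

variable (C) in
/-- The coloured component on the path from a marking to the root. -/
def col (i : Fin n) : C.V := (C.colored_path i).choose

theorem comp_le_col (i : Fin n) : C.comp i ≤ C.col i := (C.colored_path i).choose_spec.1.1
theorem nondegenerate_col (i : Fin n) : Nondegenerate (C.scale (C.col i)) :=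
  (C.colored_path i).choose_spec.1.2
theorem eq_col {i : Fin n} {v : C.V} (h : C.comp i ≤ v) (h' : Nondegenerate (C.scale v)) :
    v = C.col i := (C.colored_path i).choose_spec.2 v ⟨h, h'⟩

theorem scale_of_lt_col {i : Fin n} {v : C.V} (h : v < C.col i) :
    C.scale v = ((0 : K) : OnePoint K) := C.scale_below _ _ (nondegenerate_col i) h
theorem scale_of_col_lt {i : Fin n} {v : C.V} (h : C.col i < v) :
    C.scale v = ∞ := C.scale_above _ _ (nondegenerate_col i) h

theorem col_lt_iff {i : Fin n} {v : C.V} (hi : C.comp i ≤ v) : C.col i < v ↔ C.scale v = ∞ := by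
  refine ⟨scale_of_col_lt, fun h => ?_⟩
  rcases C.chain _ _ _ hi (comp_le_col i) with h1 | h1
  · rcases h1.eq_or_lt with h2 | h2
    · rw [h2] at h
      exact absurd h (nondegenerate_col i).2
    · rw [scale_of_lt_col h2] at h
      exact absurd h (OnePoint.coe_ne_infty _)
  · refine lt_of_le_of_ne h1 fun h2 => (nondegenerate_col i).2 (by rw [h2, h])

theorem lt_col_iff {i : Fin n} {v : C.V} (hi : C.comp i ≤ v) :
    v < C.col i ↔ C.scale v = ((0 : K) : OnePoint K) := by
  refine ⟨scale_of_lt_col, fun h => ?_⟩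
  rcases C.chain _ _ _ hi (comp_le_col i) with h1 | h1
  · refine lt_of_le_of_ne h1 fun h2 => (nondegenerate_col i).1 (by rw [← h2, h])
  · rcases h1.eq_or_lt with h2 | h2
    · rw [← h2] at h
      exact absurd h (nondegenerate_col i).1
    · rw [scale_of_col_lt h2] at h
      exact absurd h (OnePoint.infty_ne_coe _)

/-- For a marking behind `v`, the level of a component above it tells whether that component is
below, equal to or above the coloured one on the path of this marking. -/
theorem scaleLevel_mono {v w : C.V} (h : v ≤ w) : scaleLevel (C.scale v) ≤ scaleLevel (C.scale w) := by
  obtain ⟨i, hi⟩ := exists_comp_le v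
  rcases lt_trichotomy (scaleLevel (C.scale v)) 1 with h1 | h1 | h1
  · omega
  · have hv := eq_col hi (scaleLevel_eq_one.1 h1)
    rcases h.eq_or_lt with h2 | h2
    · rw [h2]
    · rw [h1, scaleLevel_eq_two.2 (scale_of_col_lt (hv ▸ h2))]
      norm_num
  · have h2 : scaleLevel (C.scale v) = 2 := le_antisymm (scaleLevel_le_two _) h1
    have h3 := (col_lt_iff hi).2 (scaleLevel_eq_two.1 h2)
    rw [scaleLevel_eq_two.2 (scale_of_col_lt (h3.trans_le h))]
    exact scaleLevel_le_two _

/-- The order of the components is determined by the sets of markings behind them and by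
their levels. -/
theorem le_iff_leaves {v w : C.V} : v ≤ w ↔
    (∀ i, C.comp i ≤ v → C.comp i ≤ w) ∧ scaleLevel (C.scale v) ≤ scaleLevel (C.scale w) := by
  refine ⟨fun h => ⟨fun i hi => hi.trans h, scaleLevel_mono h⟩, fun ⟨h, hl⟩ => ?_⟩
  obtain ⟨i, hi⟩ := exists_comp_le v
  rcases C.chain _ _ _ hi (h i hi) with h1 | h1
  · exact h1
  rcases h1.eq_or_lt with h1 | h1
  · exact h1.ge
  -- It remains to exclude `w < v`. If `v` is coloured, the level of `w` is smaller. Otherwise `v`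
  -- separates two markings, which would both be behind `w` and hence be seen from `v` through one
  -- node.
  by_cases hv : Nondegenerate (C.scale v)
  · have := C.scale_below _ _ hv h1
    rw [scaleLevel_eq_zero.2 this, scaleLevel_eq_one.2 hv] at hl
    omega
  · obtain ⟨a, b, ha, hb, hab⟩ := exists_fpt_ne_of_uncolored hv
    exact absurd (fpt_eq_of_le h1 (h a ha) (h b hb)) hab

theorem rhoFour_eq {q : Fin 4 → Fin (n + 1)} {v : C.V}
    (hv : 3 ≤ (Set.range fun t => C.pt v (q t)).ncard) :
    C.rhoFour q = crossRatio (C.pt v (q 0)) (C.pt v (q 1)) (C.pt v (q 2)) (C.pt v (q 3)) := by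
  have h : ∃ r, ∃ v : C.V, 3 ≤ (Set.range fun t => C.pt v (q t)).ncard ∧
      r = crossRatio (C.pt v (q 0)) (C.pt v (q 1)) (C.pt v (q 2)) (C.pt v (q 3)) := ⟨_, v, hv, rfl⟩
  obtain ⟨w, hw, he⟩ := Classical.epsilon_spec h
  exact he.trans (crossRatio_pt_eq hw hv)

theorem rhoTwo_eq {p : Fin 2 → Fin n} {v : C.V} (h0 : C.comp (p 0) ≤ v) (h1 : C.comp (p 1) ≤ v)
    (h : C.fpt v (p 0) ≠ C.fpt v (p 1)) :
    C.rhoTwo p = invLength (C.scale v) (C.fpt v (p 1) - C.fpt v (p 0)) := by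
  have hex : ∃ r, ∃ (v : C.V) (x y : K), x ≠ y ∧
    C.pt v (p 0).succ = (x : OnePoint K) ∧ C.pt v (p 1).succ = (y : OnePoint K) ∧
      r = invLength (C.scale v) (y - x) :=
    ⟨_, v, _, _, h, pt_succ_of_le h0, pt_succ_of_le h1, rfl⟩
  obtain ⟨w, x, y, hxy, hx, hy, he⟩ := Classical.epsilon_spec hex
  obtain ⟨hx', rfl⟩ := le_of_pt_succ_eq hx
  obtain ⟨hy', rfl⟩ := le_of_pt_succ_eq hy
  have := fpt_ne_unique h0 h1 h hx' hy' hxy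
  subst this
  exact he

end ScaledLine

/-! ### Homogeneous coordinates of differences of markings -/

section Differences

variable {K : Type} [Field K] {n : ℕ}

/-- The set of the root marking and three further markings. -/
def tripleSet (i j k : Fin n) : Finset (Fin (n + 1)) := {0, i.succ, j.succ, k.succ}

open Classical in
/-- The relative position of the marking `m` among three markings, as determined by a
coordinate `ρ_{0ijk}`. -/
def tripleLoc (x : Index n → OnePoint K) (s : Finset (Fin (n + 1))) (m : Fin n) : K :=
  if h : s.card = 4 then
    -- For sorted markings `a < b < c` the coordinate is `[z_b - z_a : z_b - z_c]`. Putting `z_a` at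
    -- `0` places `z_b` at the first homogeneous coordinate and `z_c` at the difference of the two.
    if m.succ = s.orderEmbOfFin h 1 then 0
    else if m.succ = s.orderEmbOfFin h 2 then homPair (x (.inl (s.orderEmbOfFin h))) 0
    else homPair (x (.inl (s.orderEmbOfFin h))) 0 - homPair (x (.inl (s.orderEmbOfFin h))) 1
  else 0

/-- The difference `z_j - z_i`, up to a factor that depends on the set `{i, j, k}`. -/
def tripleDiff (x : Index n → OnePoint K) (i j k : Fin n) : K :=
  tripleLoc x (tripleSet i j k) j - tripleLoc x (tripleSet i j k) i

theorem tripleSet_comm (i j k : Fin n) : tripleSet j i k = tripleSet i j k := by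
  unfold tripleSet; ext; simp; tauto

theorem tripleSet_rotate (i j k : Fin n) : tripleSet j k i = tripleSet i j k := by
  unfold tripleSet; ext; simp; tauto

theorem tripleSet_swap (i j k : Fin n) : tripleSet i k j = tripleSet i j k := by
  unfold tripleSet; ext; simp; tauto

theorem tripleDiff_comm (x : Index n → OnePoint K) (i j k : Fin n) :
    tripleDiff x j i k = - tripleDiff x i j k := by
  unfold tripleDiff; rw [tripleSet_comm]; ring

theorem tripleDiff_rotate (x : Index n → OnePoint K) (i j k : Fin n) :
    tripleDiff x j k i = tripleDiff x i k j - tripleDiff x i j k := by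
  unfold tripleDiff; rw [tripleSet_rotate, tripleSet_swap]; ring

theorem card_tripleSet {i j k : Fin n} (hij : i ≠ j) (hik : i ≠ k) (hjk : j ≠ k) :
    (tripleSet i j k).card = 4 := by
  unfold tripleSet
  rw [Finset.card_insert_of_notMem, Finset.card_insert_of_notMem, Finset.card_insert_of_notMem,
    Finset.card_singleton]
  · simpa using hjk
  · simp [hij, hik]
  · simp [(Fin.succ_ne_zero _).symm]

theorem mem_tripleSet {i j k : Fin n} {a : Fin (n + 1)} :
    a ∈ tripleSet i j k ↔ a = 0 ∨ a = i.succ ∨ a = j.succ ∨ a = k.succ := by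
  simp [tripleSet]

/-- The sorted enumeration of the root marking and three further ones. -/
theorem exists_triple_enum {i j k : Fin n} (h : (tripleSet i j k).card = 4) :
    ∃ a b c : Fin n, (tripleSet i j k).orderEmbOfFin h 0 = 0 ∧
      (tripleSet i j k).orderEmbOfFin h 1 = a.succ ∧
      (tripleSet i j k).orderEmbOfFin h 2 = b.succ ∧
      (tripleSet i j k).orderEmbOfFin h 3 = c.succ ∧
      (∀ m, m = i ∨ m = j ∨ m = k → m = a ∨ m = b ∨ m = c) ∧
      (a = i ∨ a = j ∨ a = k) ∧ (b = i ∨ b = j ∨ b = k) ∧ (c = i ∨ c = j ∨ c = k) ∧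
      a ≠ b ∧ a ≠ c ∧ b ≠ c := by
  set q := (tripleSet i j k).orderEmbOfFin h with hq
  have hr : Set.range q = tripleSet i j k := Finset.range_orderEmbOfFin _ h
  have h0 : q 0 = 0 := by
    have : (0 : Fin (n + 1)) ∈ Set.range q := by
      rw [hr]; exact mem_tripleSet.2 (Or.inl rfl)
    obtain ⟨t, ht⟩ := this
    have h2 : q 0 ≤ q t := q.monotone (Fin.zero_le t)
    rw [ht] at h2
    exact le_antisymm h2 (Fin.zero_le _)
  have hs : ∀ t, t ≠ 0 → ∃ a : Fin n, q t = a.succ ∧ (a = i ∨ a = j ∨ a = k) := by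
    intro t ht
    have hne : q t ≠ 0 := fun h' => ht (q.injective (h'.trans h0.symm))
    obtain ⟨a, ha⟩ := Fin.exists_succ_eq.2 hne
    refine ⟨a, ha.symm, ?_⟩
    have : q t ∈ tripleSet i j k := by
      rw [← Finset.mem_coe, ← hr]; exact Set.mem_range_self _
    rcases mem_tripleSet.1 this with h' | h' | h' | h'
    · exact absurd h' hne
    · exact Or.inl (Fin.succ_injective _ (ha.trans h'))
    · exact Or.inr (Or.inl (Fin.succ_injective _ (ha.trans h')))
    · exact Or.inr (Or.inr (Fin.succ_injective _ (ha.trans h')))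
  obtain ⟨a, ha, ha'⟩ := hs 1 (by decide)
  obtain ⟨b, hb, hb'⟩ := hs 2 (by decide)
  obtain ⟨c, hc, hc'⟩ := hs 3 (by decide)
  refine ⟨a, b, c, h0, ha, hb, hc, ?_, ha', hb', hc', ?_, ?_, ?_⟩
  · intro m hm
    have : m.succ ∈ Set.range q := by
      rw [hr, Finset.mem_coe, mem_tripleSet]
      rcases hm with rfl | rfl | rfl <;> simp
    obtain ⟨t, ht⟩ := this
    fin_cases t
    · exact absurd (ht.symm.trans h0) (Fin.succ_ne_zero _)
    · exact Or.inl (Fin.succ_injective _ (ht.symm.trans ha))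
    · exact Or.inr (Or.inl (Fin.succ_injective _ (ht.symm.trans hb)))
    · exact Or.inr (Or.inr (Fin.succ_injective _ (ht.symm.trans hc)))
  · rintro rfl
    exact absurd (q.injective (ha.trans hb.symm)) (by decide)
  · rintro rfl
    exact absurd (q.injective (ha.trans hc.symm)) (by decide)
  · rintro rfl
    exact absurd (q.injective (hb.trans hc.symm)) (by decide)

theorem exists_tripleLoc {i j k : Fin n} (h : (tripleSet i j k).card = 4)
    (x : Index n → OnePoint K) :
    ∃ a b c : Fin n, (tripleSet i j k).orderEmbOfFin h 0 = 0 ∧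
      (tripleSet i j k).orderEmbOfFin h 1 = a.succ ∧
      (tripleSet i j k).orderEmbOfFin h 2 = b.succ ∧
      (tripleSet i j k).orderEmbOfFin h 3 = c.succ ∧
      (∀ m, m = i ∨ m = j ∨ m = k → m = a ∨ m = b ∨ m = c) ∧
      (a = i ∨ a = j ∨ a = k) ∧ (b = i ∨ b = j ∨ b = k) ∧ (c = i ∨ c = j ∨ c = k) ∧
      tripleLoc x (tripleSet i j k) a = 0 ∧
      tripleLoc x (tripleSet i j k) b =
        homPair (x (.inl ((tripleSet i j k).orderEmbOfFin h))) 0 ∧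
      tripleLoc x (tripleSet i j k) c =
        homPair (x (.inl ((tripleSet i j k).orderEmbOfFin h))) 0 -
          homPair (x (.inl ((tripleSet i j k).orderEmbOfFin h))) 1 := by
  obtain ⟨a, b, c, h0, h1, h2, h3, hm, ha, hb, hc, hab, hac, hbc⟩ := exists_triple_enum h
  refine ⟨a, b, c, h0, h1, h2, h3, hm, ha, hb, hc, ?_, ?_, ?_⟩ <;>
    rw [tripleLoc, dif_pos h, h1, h2] <;> simp [hab.symm, hac.symm, hbc.symm]

/-- If both differences vanish, all three positions coincide, and then both homogeneous coordinates
of the point of the projective line are zero. -/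
theorem tripleDiff_ne_zero (x : Index n → OnePoint K) {i j k : Fin n} (hij : i ≠ j) (hik : i ≠ k)
    (hjk : j ≠ k) : ¬ (tripleDiff x i j k = 0 ∧ tripleDiff x i k j = 0) := by
  rintro ⟨h1, h2⟩
  have h := card_tripleSet hij hik hjk
  obtain ⟨a, b, c, -, -, -, -, -, ha, hb, hc, la, lb, lc⟩ := exists_tripleLoc h x
  unfold tripleDiff at h1 h2
  rw [tripleSet_swap] at h2
  have key : ∀ m, m = i ∨ m = j ∨ m = k →
      tripleLoc x (tripleSet i j k) m = tripleLoc x (tripleSet i j k) i := by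
    rintro m (rfl | rfl | rfl)
    · rfl
    · exact sub_eq_zero.1 h1
    · exact sub_eq_zero.1 h2
  have e1 := (key b hb).trans (key a ha).symm
  have e2 := (key c hc).trans (key b hb).symm
  rw [la, lb] at e1
  rw [lc, lb] at e2
  exact homPair_ne_zero _ ⟨e1, by simpa using e2⟩

/-- If the coordinate `ρ_{0ijk}` is a cross-ratio of finite points, then the differences are
proportional to those of these points. -/
theorem exists_tripleLoc_eq {x : Index n → OnePoint K} {i j k : Fin n} (hij : i ≠ j) (hik : i ≠ k)
    (hjk : j ≠ k) (X : Fin n → K) (hX : ¬ (X i = X j ∧ X i = X k))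
    (hx : ∀ (q : Fin 4 ↪o Fin (n + 1)) (a b c : Fin n), q 0 = 0 → q 1 = a.succ → q 2 = b.succ →
      q 3 = c.succ → (a = i ∨ a = j ∨ a = k) → (b = i ∨ b = j ∨ b = k) →
      (c = i ∨ c = j ∨ c = k) → x (.inl q) = crossRatio ∞ (X a) (X b) (X c)) :
    ∃ r s : K, r ≠ 0 ∧ ∀ m, m = i ∨ m = j ∨ m = k →
      tripleLoc x (tripleSet i j k) m = r * X m + s := by
  have h := card_tripleSet hij hik hjk
  obtain ⟨a, b, c, h0, h1, h2, h3, hm, ha, hb, hc, la, lb, lc⟩ := exists_tripleLoc h x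
  have he := hx _ a b c h0 h1 h2 h3 ha hb hc
  rw [he] at lb lc
  unfold crossRatio at lb lc
  simp only [bracket_coe_coe, bracket_coe_infty, bracket_infty_coe] at lb lc
  have hne : ¬ ((X a - X b) * -1 = 0 ∧ 1 * (X b - X c) = 0) := by
    rintro ⟨e1, e2⟩
    have e1 : X a = X b := by linear_combination -e1
    have e2 : X b = X c := by linear_combination e2
    have : ∀ m, m = i ∨ m = j ∨ m = k → X m = X a := by
      intro m hm'
      rcases hm m hm' with rfl | rfl | rfl
      · rfl
      · exact e1.symm
      · exact (e1.trans e2).symm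
    refine hX ⟨(this i (Or.inl rfl)).trans (this j (Or.inr (Or.inl rfl))).symm,
      (this i (Or.inl rfl)).trans (this k (Or.inr (Or.inr rfl))).symm⟩
  obtain ⟨r, hr, e1, e2⟩ := exists_homPair_ofPair hne
  rw [e1] at lb
  rw [e1, e2] at lc
  refine ⟨r, - r * X a, hr, fun m hm' => ?_⟩
  rcases hm m hm' with rfl | rfl | rfl
  · rw [la]; ring
  · rw [lb]; ring
  · rw [lc]; ring

theorem tripleDiff_eq_of_loc {x : Index n → OnePoint K} {i j k : Fin n} {X : Fin n → K} {r s : K}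
    (h : ∀ m, m = i ∨ m = j ∨ m = k → tripleLoc x (tripleSet i j k) m = r * X m + s) :
    tripleDiff x i j k = r * (X j - X i) ∧ tripleDiff x i k j = r * (X k - X i) ∧
      tripleDiff x j k i = r * (X k - X j) := by
  unfold tripleDiff
  rw [tripleSet_swap i j k, tripleSet_rotate i j k, h i (by simp), h j (by simp), h k (by simp)]
  refine ⟨?_, ?_, ?_⟩ <;> ring

open Classical in
/-- The unit of length, up to a factor that depends on `{i, j}`. -/
def pairUnit (x : Index n → OnePoint K) (i j : Fin n) : K :=
  -- The default `1`, together with the default `0` of the difference, makes the distance from a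
  -- marking to itself zero in comparison with the unit of length.
  if h : ({i, j} : Finset (Fin n)).card = 2 then
    homPair (x (.inr (Finset.orderEmbOfFin {i, j} h))) 0 else 1

open Classical in
/-- The difference `z_j - z_i`, up to a factor that depends on `{i, j}`. -/
def pairDiff (x : Index n → OnePoint K) (i j : Fin n) : K :=
  if h : ({i, j} : Finset (Fin n)).card = 2 then
    -- The coordinate belongs to the sorted pair; the sign makes the difference antisymmetric.
    (if i < j then 1 else -1) * homPair (x (.inr (Finset.orderEmbOfFin {i, j} h))) 1 else 0

theorem pairUnit_comm (x : Index n → OnePoint K) (i j : Fin n) :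
    pairUnit x j i = pairUnit x i j := by
  have : ({j, i} : Finset (Fin n)) = {i, j} := Finset.pair_comm _ _
  unfold pairUnit
  simp only [this]

theorem pairDiff_comm (x : Index n → OnePoint K) (i j : Fin n) :
    pairDiff x j i = - pairDiff x i j := by
  have : ({j, i} : Finset (Fin n)) = {i, j} := Finset.pair_comm _ _
  unfold pairDiff
  simp only [this]
  by_cases h : ({i, j} : Finset (Fin n)).card = 2
  · have hij : i ≠ j := by
      rintro rfl; simp at h
    simp only [dif_pos h]
    rcases lt_or_gt_of_ne hij with h1 | h1
    · simp [h1, h1.not_gt]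
    · simp [h1, h1.not_gt]
  · simp [h]

theorem pairUnit_self (x : Index n → OnePoint K) (i : Fin n) : pairUnit x i i = 1 := by
  simp [pairUnit]

theorem pairDiff_self (x : Index n → OnePoint K) (i : Fin n) : pairDiff x i i = 0 := by
  simp [pairDiff]

theorem orderEmb_pair {i j : Fin n} (hij : i < j) (h : ({i, j} : Finset (Fin n)).card = 2) :
    (Finset.orderEmbOfFin {i, j} h) 0 = i ∧ (Finset.orderEmbOfFin {i, j} h) 1 = j := by
  set p := (Finset.orderEmbOfFin {i, j} h) with hp
  have hr : Set.range p = (({i, j} : Finset (Fin n)) : Set (Fin n)) :=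
    Finset.range_orderEmbOfFin _ h
  have h0 : p 0 ∈ ({i, j} : Finset (Fin n)) := by
    rw [← Finset.mem_coe, ← hr]; exact Set.mem_range_self _
  have h1 : p 1 ∈ ({i, j} : Finset (Fin n)) := by
    rw [← Finset.mem_coe, ← hr]; exact Set.mem_range_self _
  have h2 : p 0 < p 1 := p.strictMono (by decide)
  rw [Finset.mem_insert, Finset.mem_singleton] at h0 h1
  rcases h0 with h0 | h0 <;> rcases h1 with h1 | h1 <;> rw [h0, h1] at h2
  · exact absurd h2 (lt_irrefl _)
  · exact ⟨h0, h1⟩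
  · exact absurd h2 hij.not_gt
  · exact absurd h2 (lt_irrefl _)

theorem card_pair {i j : Fin n} (hij : i ≠ j) : ({i, j} : Finset (Fin n)).card = 2 :=
  Finset.card_pair hij

theorem pair_ne_zero (x : Index n → OnePoint K) (i j : Fin n) :
    ¬ (pairUnit x i j = 0 ∧ pairDiff x i j = 0) := by
  rintro ⟨h1, h2⟩
  by_cases hij : i = j
  · subst hij
    rw [pairUnit_self] at h1
    exact one_ne_zero h1
  · rw [pairUnit, dif_pos (card_pair hij)] at h1
    rw [pairDiff, dif_pos (card_pair hij)] at h2
    refine homPair_ne_zero _ ⟨h1, ?_⟩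
    split_ifs at h2 <;> simpa using h2

/-- The coordinates determine the unit of length and the difference, up to a factor. -/
theorem exists_pair_eq {x : Index n → OnePoint K} {i j : Fin n} (hij : i ≠ j) {a b : K}
    (hab : ¬ (a = 0 ∧ b = 0))
    (hx : ∀ p : Fin 2 ↪o Fin n, (p 0 = i → p 1 = j → x (.inr p) = ofPair a b) ∧
      (p 0 = j → p 1 = i → x (.inr p) = ofPair a (-b))) :
    ∃ r, r ≠ 0 ∧ pairUnit x i j = r * a ∧ pairDiff x i j = r * b := by
  rw [pairUnit, dif_pos (card_pair hij), pairDiff, dif_pos (card_pair hij)]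
  rcases lt_or_gt_of_ne hij with h | h
  · obtain ⟨h0, h1⟩ := orderEmb_pair h (card_pair hij)
    rw [(hx _).1 h0 h1]
    obtain ⟨r, hr, e1, e2⟩ := exists_homPair_ofPair hab
    exact ⟨r, hr, e1, by rw [e2, if_pos h, one_mul]⟩
  · have hc : ({j, i} : Finset (Fin n)) = {i, j} := Finset.pair_comm _ _
    obtain ⟨h0, h1⟩ := orderEmb_pair h (card_pair hij.symm)
    simp only [hc] at h0 h1
    rw [(hx _).2 h0 h1]
    obtain ⟨r, hr, e1, e2⟩ := exists_homPair_ofPair (p := a) (q := -b) (by simpa using hab)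
    exact ⟨r, hr, e1, by rw [e2, if_neg h.not_gt]; ring⟩

theorem apply_inr_eq (x : Index n → OnePoint K) (p : Fin 2 ↪o Fin n) :
    x (.inr p) = ofPair (pairUnit x (p 0) (p 1)) (pairDiff x (p 0) (p 1)) := by
  have h : p 0 < p 1 := p.strictMono (by decide)
  have he : Finset.orderEmbOfFin {p 0, p 1} (card_pair h.ne) = p := by
    obtain ⟨h0, h1⟩ := orderEmb_pair h (card_pair h.ne)
    refine RelEmbedding.ext fun t => ?_
    fin_cases t
    · exact h0
    · exact h1
  rw [pairUnit, dif_pos (card_pair h.ne), pairDiff, dif_pos (card_pair h.ne), he, if_pos h,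
    one_mul, ofPair_homPair]

theorem apply_inl_eq (x : Index n → OnePoint K) (q : Fin 4 ↪o Fin (n + 1)) (a b c : Fin n)
    (h0 : q 0 = 0) (h1 : q 1 = a.succ) (h2 : q 2 = b.succ) (h3 : q 3 = c.succ) :
    x (.inl q) = ofPair (tripleDiff x a b c) (- tripleDiff x b c a) := by
  have hab : a ≠ b := by
    rintro rfl
    exact absurd (q.injective (h1.trans h2.symm)) (by decide)
  have hac : a ≠ c := by
    rintro rfl
    exact absurd (q.injective (h1.trans h3.symm)) (by decide)
  have hbc : b ≠ c := by
    rintro rfl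
    exact absurd (q.injective (h2.trans h3.symm)) (by decide)
  have h := card_tripleSet hab hac hbc
  have he : (tripleSet a b c).orderEmbOfFin h = q := by
    symm
    refine Finset.orderEmbOfFin_unique' h fun t => ?_
    rw [mem_tripleSet]
    fin_cases t
    · exact Or.inl h0
    · exact Or.inr (Or.inl h1)
    · exact Or.inr (Or.inr (Or.inl h2))
    · exact Or.inr (Or.inr (Or.inr h3))
  unfold tripleDiff
  rw [tripleSet_rotate a b c]
  unfold tripleLoc
  simp only [dif_pos h, he, h1, h2, Fin.succ_inj, if_true, hab.symm, if_false, hac.symm, hbc.symm,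
    sub_zero, sub_sub_cancel_left, neg_neg, ofPair_homPair]

end Differences

/-! ### The equations of the moduli space -/

section Equations

variable {K : Type} [Field K] {n : ℕ}

/-- The equations satisfied by the coordinates of scaled lines. -/
structure IsConsistent (x : Index n → OnePoint K) : Prop where
  -- The ratios `(z_j - z_i)/(z_k - z_i)`, `(z_k - z_i)/(z_l - z_i)` and `(z_l - z_i)/(z_j - z_i)`
  -- have product `1`.
  star : ∀ i j k l : Fin n, i ≠ j → i ≠ k → i ≠ l → j ≠ k → j ≠ l → k ≠ l →
    tripleDiff x i j k * tripleDiff x i k l * tripleDiff x i l j =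
      tripleDiff x i k j * tripleDiff x i l k * tripleDiff x i j l
  -- The analogue of the previous equation with the unit of length in place of the difference
  -- between `z_l` and `z_i`.
  scale : ∀ i j k : Fin n, i ≠ j → i ≠ k → j ≠ k →
    tripleDiff x i j k * pairDiff x i k * pairUnit x i j =
      tripleDiff x i k j * pairDiff x i j * pairUnit x i k
  -- The cross-ratio of four finite points is computed from two triples. The two equations use the
  -- triples that contain `i, k` and those that contain `j, l`; either equation alone may be
  -- trivial.
  cross : ∀ (q : Fin 4 ↪o Fin (n + 1)) (i j k l : Fin n), q 0 = i.succ → q 1 = j.succ →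
    q 2 = k.succ → q 3 = l.succ →
    homPair (x (.inl q)) 0 * (tripleDiff x j i k * tripleDiff x l k i) =
      homPair (x (.inl q)) 1 * (tripleDiff x k j i * tripleDiff x i l k) ∧
    homPair (x (.inl q)) 0 * (tripleDiff x j i l * tripleDiff x l k j) =
      homPair (x (.inl q)) 1 * (tripleDiff x k j l * tripleDiff x i l j)

theorem tripleDiff_congr {x y : Index n → OnePoint K}
    (h : ∀ q : Fin 4 ↪o Fin (n + 1), q 0 = 0 → x (.inl q) = y (.inl q)) (i j k : Fin n) :
    tripleDiff x i j k = tripleDiff y i j k := by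
  have : ∀ m, tripleLoc x (tripleSet i j k) m = tripleLoc y (tripleSet i j k) m := by
    intro m
    unfold tripleLoc
    by_cases hc : (tripleSet i j k).card = 4
    · obtain ⟨a, b, c, h0, -⟩ := exists_triple_enum hc
      simp only [dif_pos hc, h _ h0]
    · simp [hc]
  unfold tripleDiff
  rw [this, this]

/-- If all coefficients vanished, definite pairs of points would coincide in each of the four
triples. In each of the four possible patterns one side of the equation `star` at `k` or at `i` is
zero while the other is a product of nonzero factors. -/
theorem IsConsistent.cross_ne_zero {x : Index n → OnePoint K} (hx : IsConsistent x)
    {i j k l : Fin n} (hij : i ≠ j) (hik : i ≠ k) (hil : i ≠ l) (hjk : j ≠ k) (hjl : j ≠ l)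
    (hkl : k ≠ l) :
    ¬ ((tripleDiff x j i k * tripleDiff x l k i = 0 ∧
      tripleDiff x k j i * tripleDiff x i l k = 0) ∧
      (tripleDiff x j i l * tripleDiff x l k j = 0 ∧
      tripleDiff x k j l * tripleDiff x i l j = 0)) := by
  have nd : ∀ {a b c : Fin n}, a ≠ b → a ≠ c → b ≠ c → tripleDiff x a b c = 0 →
      tripleDiff x a c b ≠ 0 := fun h1 h2 h3 h4 h5 => tripleDiff_ne_zero x h1 h2 h3 ⟨h4, h5⟩
  have cm : ∀ {a b c : Fin n}, tripleDiff x a b c = 0 → tripleDiff x b a c = 0 := fun h => by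
    rw [tripleDiff_comm, h, neg_zero]
  have sk := hx.star k i j l hik.symm hjk.symm hkl hij hil hjl
  have si := hx.star i j k l hij hik hil hjk hjl hkl
  simp only [mul_eq_zero]
  rintro ⟨⟨h1, h2⟩, ⟨h3, h4⟩⟩
  have c1 : (tripleDiff x j i k = 0 ∧ tripleDiff x i l k = 0) ∨
      (tripleDiff x l k i = 0 ∧ tripleDiff x k j i = 0) := by
    rcases h1 with h1 | h1 <;> rcases h2 with h2 | h2
    · exact absurd (cm h2) (nd hij.symm hjk hik h1)
    · exact Or.inl ⟨h1, h2⟩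
    · exact Or.inr ⟨h1, h2⟩
    · exact absurd (cm h2) (nd hkl.symm hil.symm hik.symm h1)
  have c2 : (tripleDiff x j i l = 0 ∧ tripleDiff x k j l = 0) ∨
      (tripleDiff x l k j = 0 ∧ tripleDiff x i l j = 0) := by
    rcases h3 with h3 | h3 <;> rcases h4 with h4 | h4
    · exact Or.inl ⟨h3, h4⟩
    · exact absurd h4 (nd hij hil hjl (cm h3))
    · exact absurd h4 (nd hkl hjk.symm hjl.symm (cm h3))
    · exact Or.inr ⟨h3, h4⟩
  rcases c1 with ⟨a1, a2⟩ | ⟨a1, a2⟩ <;> rcases c2 with ⟨b1, b2⟩ | ⟨b1, b2⟩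
  · rw [b2, mul_zero, zero_mul] at sk
    have e1 : tripleDiff x k j i ≠ 0 := fun h => nd hij.symm hjk hik a1 (cm h)
    have e2 : tripleDiff x k l j ≠ 0 := nd hjk.symm hkl hjl b2
    have e3 : tripleDiff x k i l ≠ 0 := fun h => nd hil hik hkl.symm a2 (cm h)
    exact mul_ne_zero (mul_ne_zero e1 e2) e3 sk.symm
  · rw [cm b1, mul_zero, zero_mul] at sk
    have e1 : tripleDiff x k i j ≠ 0 := fun h => nd hij hik hjk (cm a1) (cm h)
    have e2 : tripleDiff x k j l ≠ 0 := nd hkl hjk.symm hjl.symm (cm b1)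
    have e3 : tripleDiff x k l i ≠ 0 := fun h => nd hil.symm hkl.symm hik (cm a2) (cm h)
    exact mul_ne_zero (mul_ne_zero e1 e2) e3 sk
  · rw [cm b1, mul_zero] at si
    have e1 : tripleDiff x i j k ≠ 0 := fun h => nd hjk hij.symm hik.symm (cm a2) (cm h)
    have e2 : tripleDiff x i k l ≠ 0 := fun h => nd hkl hik.symm hil.symm (cm a1) (cm h)
    have e3 : tripleDiff x i l j ≠ 0 := nd hij hil hjl (cm b1)
    exact mul_ne_zero (mul_ne_zero e1 e2) e3 si
  · rw [b2, mul_zero] at si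
    have e1 : tripleDiff x i k j ≠ 0 := fun h => nd hjk.symm hik.symm hij.symm a2 (cm h)
    have e2 : tripleDiff x i l k ≠ 0 := fun h => nd hkl.symm hil.symm hik.symm a1 (cm h)
    have e3 : tripleDiff x i j l ≠ 0 := nd hil hij hjl.symm b2
    exact mul_ne_zero (mul_ne_zero e1 e2) e3 si.symm

theorem mul_eq_of_linear {p q p' q' a b : K} (hab : ¬ (a = 0 ∧ b = 0)) (h : p * a = q * b)
    (h' : p' * a = q' * b) : p * q' = p' * q := by
  by_cases ha : a = 0
  · have hb : b ≠ 0 := fun hb => hab ⟨ha, hb⟩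
    refine mul_right_cancel₀ hb ?_
    linear_combination (-p) * h' + p' * h
  · refine mul_right_cancel₀ ha ?_
    linear_combination q' * h - q * h'

/-- The coordinates `ρ_{0ijk}` and `ρ_{ij}` determine the others. -/
theorem IsConsistent.ext {x y : Index n → OnePoint K} (hx : IsConsistent x) (hy : IsConsistent y)
    (h : ∀ q : Fin 4 ↪o Fin (n + 1), q 0 = 0 → x (.inl q) = y (.inl q))
    (h' : ∀ p : Fin 2 ↪o Fin n, x (.inr p) = y (.inr p)) : x = y := by
  funext e
  rcases e with q | p
  swap
  · exact h' p
  by_cases h0 : q 0 = 0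
  · exact h q h0
  have hne : ∀ t, q t ≠ 0 := fun t ht => h0 (le_antisymm
    (ht ▸ q.monotone (Fin.zero_le t)) (Fin.zero_le _))
  obtain ⟨i, hi⟩ := Fin.exists_succ_eq.2 (hne 0)
  obtain ⟨j, hj⟩ := Fin.exists_succ_eq.2 (hne 1)
  obtain ⟨k, hk⟩ := Fin.exists_succ_eq.2 (hne 2)
  obtain ⟨l, hl⟩ := Fin.exists_succ_eq.2 (hne 3)
  obtain ⟨x1, x2⟩ := hx.cross q i j k l hi.symm hj.symm hk.symm hl.symm
  obtain ⟨y1, y2⟩ := hy.cross q i j k l hi.symm hj.symm hk.symm hl.symm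
  have ne : ∀ {s t : Fin 4} {a b : Fin n}, a.succ = q s → b.succ = q t → s ≠ t → a ≠ b := by
    rintro s t a b ha hb hst rfl
    exact hst (q.injective (ha.symm.trans hb))
  have hz := hx.cross_ne_zero (ne hi hj (by decide)) (ne hi hk (by decide)) (ne hi hl (by decide))
    (ne hj hk (by decide)) (ne hj hl (by decide)) (ne hk hl (by decide))
  have hD := fun a b c => (tripleDiff_congr h a b c).symm
  simp only [hD] at y1 y2
  rw [← ofPair_homPair (x _), ← ofPair_homPair (y _)]
  refine ofPair_eq_of_mul_eq (homPair_ne_zero _) (homPair_ne_zero _) ?_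
  -- The equations `cross` for `x` and for `y` have the same coefficients, and at least one of the
  -- two linear equations is nontrivial, which determines the ratio.
  rw [not_and_or] at hz
  rcases hz with hz | hz
  · exact mul_eq_of_linear hz x1 y1
  · exact mul_eq_of_linear hz x2 y2

theorem tripleDiff_map {L : Type} [Field L] (φ : K →+* L) (x : Index n → OnePoint K)
    (i j k : Fin n) :
    tripleDiff (fun e => (x e).map φ) i j k = φ (tripleDiff x i j k) := by
  have : ∀ s m, tripleLoc (fun e => (x e).map φ) s m = φ (tripleLoc x s m) := by
    intro s m
    unfold tripleLoc
    split_ifs <;> simp [homPair_map]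
  simp [tripleDiff, this]

theorem pairDiff_map {L : Type} [Field L] (φ : K →+* L) (x : Index n → OnePoint K)
    (i j : Fin n) : pairDiff (fun e => (x e).map φ) i j = φ (pairDiff x i j) := by
  unfold pairDiff
  split_ifs <;> simp [homPair_map]

theorem pairUnit_map {L : Type} [Field L] (φ : K →+* L) (x : Index n → OnePoint K)
    (i j : Fin n) : pairUnit (fun e => (x e).map φ) i j = φ (pairUnit x i j) := by
  unfold pairUnit
  split_ifs <;> simp [homPair_map]

/-- The equations have integral coefficients and homomorphisms of fields are injective. This passes
between `ℝ` and `ℂ`. -/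
theorem isConsistent_map {L : Type} [Field L] (φ : K →+* L) {x : Index n → OnePoint K} :
    IsConsistent (fun e => (x e).map φ) ↔ IsConsistent x := by
  constructor
  · rintro ⟨h1, h2, h3⟩
    simp only [tripleDiff_map, pairDiff_map, pairUnit_map, homPair_map, ← map_mul,
      φ.injective.eq_iff] at h1 h2 h3
    exact ⟨h1, h2, h3⟩
  · rintro ⟨h1, h2, h3⟩
    constructor <;>
      simp only [tripleDiff_map, pairDiff_map, pairUnit_map, homPair_map, ← map_mul,
        φ.injective.eq_iff] <;> assumption

/-! ### Marked affine lines -/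

/-- The coordinates of a scaled line with only one component. -/
def rhoOfPoints (z : Fin n → K) : Index n → OnePoint K
  | .inl q => crossRatio (Fin.cases ∞ (fun i => (z i : OnePoint K)) (q 0))
      (Fin.cases ∞ (fun i => (z i : OnePoint K)) (q 1))
      (Fin.cases ∞ (fun i => (z i : OnePoint K)) (q 2))
      (Fin.cases ∞ (fun i => (z i : OnePoint K)) (q 3))
  | .inr p => ofPair 1 (z (p 1) - z (p 0))

theorem tripleDiff_rhoOfPoints {z : Fin n → K} (hz : Function.Injective z) {i j k : Fin n}
    (hij : i ≠ j) (hik : i ≠ k) (hjk : j ≠ k) :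
    ∃ r, r ≠ 0 ∧ tripleDiff (rhoOfPoints z) i j k = r * (z j - z i) ∧
      tripleDiff (rhoOfPoints z) i k j = r * (z k - z i) ∧
      tripleDiff (rhoOfPoints z) j k i = r * (z k - z j) := by
  obtain ⟨r, s, hr, h⟩ := exists_tripleLoc_eq (x := rhoOfPoints z) hij hik hjk z
    (fun h => hij (hz h.1)) (by
      intro q a b c h0 h1 h2 h3 _ _ _
      simp [rhoOfPoints, h0, h1, h2, h3])
  exact ⟨r, hr, tripleDiff_eq_of_loc h⟩

theorem pair_rhoOfPoints (z : Fin n → K) (i j : Fin n) :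
    ∃ r, r ≠ 0 ∧ pairUnit (rhoOfPoints z) i j = r ∧
      pairDiff (rhoOfPoints z) i j = r * (z j - z i) := by
  by_cases hij : i = j
  · subst hij
    exact ⟨1, one_ne_zero, pairUnit_self _ _, by rw [pairDiff_self]; ring⟩
  · obtain ⟨r, hr, h1, h2⟩ := exists_pair_eq (x := rhoOfPoints z) hij (a := 1) (b := z j - z i)
      (by simp) (fun p => ⟨by rintro rfl rfl; rfl, by rintro rfl rfl; simp [rhoOfPoints]⟩)
    exact ⟨r, hr, by rw [h1, mul_one], h2⟩

/-- The unknown factors depend only on the sets of indices, and the same sets occur on both sides of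
each equation. -/
theorem isConsistent_rhoOfPoints {z : Fin n → K} (hz : Function.Injective z) :
    IsConsistent (rhoOfPoints z) := by
  constructor
  · intro i j k l hij hik hil hjk hjl hkl
    obtain ⟨r, -, a1, a2, -⟩ := tripleDiff_rhoOfPoints hz hij hik hjk
    obtain ⟨s, -, b1, b2, -⟩ := tripleDiff_rhoOfPoints hz hik hil hkl
    obtain ⟨t, -, c1, c2, -⟩ := tripleDiff_rhoOfPoints hz hil hij hjl.symm
    rw [a1, a2, b1, b2, c1, c2]; ring
  · intro i j k hij hik hjk
    obtain ⟨r, -, a1, a2, -⟩ := tripleDiff_rhoOfPoints hz hij hik hjk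
    obtain ⟨s, -, b1, b2⟩ := pair_rhoOfPoints z i j
    obtain ⟨t, -, c1, c2⟩ := pair_rhoOfPoints z i k
    rw [a1, a2, b1, b2, c1, c2]; ring
  · intro q i j k l h0 h1 h2 h3
    have ne : ∀ {s t : Fin 4} {a b : Fin n}, q s = a.succ → q t = b.succ → s ≠ t → a ≠ b := by
      rintro s t a b ha hb hst rfl
      exact hst (q.injective (ha.trans hb.symm))
    have hij := ne h0 h1 (by decide)
    have hik := ne h0 h2 (by decide)
    have hil := ne h0 h3 (by decide)
    have hjk := ne h1 h2 (by decide)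
    have hjl := ne h1 h3 (by decide)
    have hkl := ne h2 h3 (by decide)
    obtain ⟨r, -, a1, a2, a3⟩ := tripleDiff_rhoOfPoints hz hij hik hjk
    obtain ⟨s, -, b1, b2, b3⟩ := tripleDiff_rhoOfPoints hz hik hil hkl
    obtain ⟨t, -, c1, c2, c3⟩ := tripleDiff_rhoOfPoints hz hij hil hjl
    obtain ⟨u, -, d1, d2, d3⟩ := tripleDiff_rhoOfPoints hz hjk hjl hkl
    have hd : ¬ ((z j - z k) * (z l - z i) = 0 ∧ (z i - z j) * (z k - z l) = 0) := by
      rintro ⟨h, -⟩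
      exact mul_ne_zero (sub_ne_zero.2 (hz.ne hjk)) (sub_ne_zero.2 (hz.ne hil.symm)) h
    obtain ⟨w, -, e1, e2⟩ := exists_homPair_ofPair hd
    have he : rhoOfPoints z (.inl q) =
        ofPair ((z j - z k) * (z l - z i)) ((z i - z j) * (z k - z l)) := by
      simp [rhoOfPoints, h0, h1, h2, h3, crossRatio]
    rw [he, e1, e2, tripleDiff_comm _ i j k, tripleDiff_comm _ k l i, tripleDiff_comm _ j k i,
      tripleDiff_comm _ i j l, tripleDiff_comm _ k l j, tripleDiff_comm _ j k l, a1, a3, b2, b3,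
      c1, c2, d1, d3]
    constructor <;> ring

end Equations

namespace ScaledLine

open NodalLine

variable {K : Type} [Field K] {n : ℕ}

/-- The homogeneous form treats finite, zero and infinite forms at once. -/
theorem invLength_eq {c : OnePoint K} {d : K} (hd : d ≠ 0) :
    invLength c d = ofPair (homPair c 1) (homPair c 0 * d) := by
  induction c using OnePoint.rec with
  | infty => simp [invLength, ofPair, hd]
  | coe c =>
    by_cases hc : c = 0
    · simp [invLength, ofPair, hc]
    · simp [invLength, ofPair, hc, hd]

/-- The scaled line with one component, with form `dz` and with given markings. -/
def single (hn : 1 ≤ n) (z : Fin n → K) (hz : Function.Injective z) : ScaledLine K n where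
  V := Unit
  chain := fun _ _ _ _ _ => Or.inl le_rfl
  node := fun _ => 0
  comp := fun _ => ()
  mark := z
  node_ne_node := fun _ _ _ h _ _ => absurd h.lt (lt_irrefl _)
  node_ne_mark := fun _ _ _ h _ => absurd h.lt (lt_irrefl _)
  mark_ne_mark := fun _ _ h _ => hz.ne h
  scale := fun _ => ((1 : K) : OnePoint K)
  colored_path := fun _ => ⟨(), ⟨le_rfl, by simp [Nondegenerate]⟩, fun _ _ => rfl⟩
  scale_above := fun _ _ _ h => absurd h (lt_irrefl _)
  scale_below := fun _ _ _ h => absurd h (lt_irrefl _)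
  stable_colored := by
    intro v _
    have : Nat.card {i : Fin n // (fun _ => ()) i = v} = n := by
      rw [Nat.card_congr (Equiv.subtypeUnivEquiv fun _ => rfl), Nat.card_eq_fintype_card,
        Fintype.card_fin]
    unfold numSpecial
    simp only at this ⊢
    rw [this]
    omega
  stable_uncolored := fun _ h => absurd (by simp [Nondegenerate]) h

/-- The coordinates of a scaled line, if one component separates all markings. -/
theorem rho_eq_rhoOfPoints {C : ScaledLine K n} {v : C.V} (hv : ∀ i, C.comp i ≤ v)
    (hinj : Function.Injective (C.fpt v)) {c : K} (hc : C.scale v = (c : OnePoint K))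
    (hc0 : c ≠ 0) : C.rho = rhoOfPoints fun i => c * C.fpt v i := by
  funext e
  rcases e with q | p
  · have hpt : ∀ a, (Fin.cases ∞ (fun i => ((c * C.fpt v i : K) : OnePoint K)) a : OnePoint K) =
        (C.pt v a).map fun z => (Units.mk0 c hc0 : K) * z + 0 := by
      intro a
      refine Fin.cases ?_ (fun i => ?_) a
      · simp
      · rw [pt_succ_of_le (hv i)]; simp
    have hi : Function.Injective (C.pt v) := by
      intro a b
      refine Fin.cases ?_ (fun i => ?_) a <;> refine Fin.cases ?_ (fun j => ?_) b
      · simp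
      · rw [pt_zero, pt_succ_of_le (hv j)]
        exact fun h => absurd h (OnePoint.infty_ne_coe _)
      · rw [pt_zero, pt_succ_of_le (hv i)]
        exact fun h => absurd h (OnePoint.coe_ne_infty _)
      · rw [pt_succ_of_le (hv i), pt_succ_of_le (hv j)]
        exact fun h => congrArg _ (hinj (OnePoint.coe_injective h))
    have h3 : 3 ≤ (Set.range fun t => C.pt v (q t)).ncard :=
      three_le_ncard 0 1 2 (hi.ne (q.injective.ne (by decide)))
        (hi.ne (q.injective.ne (by decide))) (hi.ne (q.injective.ne (by decide)))
    simp only [rho, rhoOfPoints, hpt]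
    rw [rhoFour_eq h3, crossRatio_affine]
  · have hp : p 0 ≠ p 1 := p.injective.ne (by decide)
    simp only [rho, rhoOfPoints]
    rw [rhoTwo_eq (hv _) (hv _) (hinj.ne hp), hc, invLength_eq (sub_ne_zero.2 (hinj.ne hp.symm)),
      homPair_coe_zero, homPair_coe_one, mul_sub]

theorem rho_single (hn : 1 ≤ n) (z : Fin n → K) (hz : Function.Injective z) :
    (single hn z hz).rho = rhoOfPoints z := by
  have hf : ∀ v i, (single hn z hz).fpt v i = z i := fun v i => fpt_of_eq rfl
  rw [rho_eq_rhoOfPoints (C := single hn z hz) (v := ()) (fun _ => le_rfl)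
    (by rw [show (single hn z hz).fpt () = z from funext (hf ())]; exact hz) rfl one_ne_zero]
  simp only [one_mul]
  exact congrArg rhoOfPoints (funext (hf ()))

/-! ### Differences for a scaled line -/

variable {C : ScaledLine K n}

theorem three_le_ncard_of_fpt_ne {q : Fin 4 → Fin (n + 1)} (hq0 : q 0 = 0)
    {a b c : Fin n} (h1 : q 1 = a.succ) (h2 : q 2 = b.succ) (h3 : q 3 = c.succ) {v : C.V}
    (ha : C.comp a ≤ v) (hb : C.comp b ≤ v) (hc : C.comp c ≤ v)
    (hne : ¬ (C.fpt v a = C.fpt v b ∧ C.fpt v b = C.fpt v c)) :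
    3 ≤ (Set.range fun t => C.pt v (q t)).ncard := by
  have inf : ∀ i, C.comp i ≤ v → C.pt v (q 0) ≠ C.pt v i.succ := by
    intro i hi
    rw [hq0, pt_zero, pt_succ_of_le hi]
    exact OnePoint.infty_ne_coe _
  rw [not_and_or] at hne
  rcases hne with h | h
  · have := pt_ne_of_fpt_ne ha hb h
    exact three_le_ncard 0 1 2 (by rw [h1]; exact inf a ha) (by rw [h2]; exact inf b hb)
      (by rwa [h1, h2])
  · have := pt_ne_of_fpt_ne hb hc h
    exact three_le_ncard 0 2 3 (by rw [h2]; exact inf b hb) (by rw [h3]; exact inf c hc)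
      (by rwa [h2, h3])

/-- The component only has to separate some two of the three markings. Together with `∞` this gives
three distinct points, so the cross-ratio can be evaluated there. -/
theorem tripleDiff_rho {v : C.V} {i j k : Fin n} (hij : i ≠ j) (hik : i ≠ k) (hjk : j ≠ k)
    (hi : C.comp i ≤ v) (hj : C.comp j ≤ v) (hk : C.comp k ≤ v)
    (hne : ¬ (C.fpt v i = C.fpt v j ∧ C.fpt v i = C.fpt v k)) :
    ∃ r, r ≠ 0 ∧ tripleDiff C.rho i j k = r * (C.fpt v j - C.fpt v i) ∧
      tripleDiff C.rho i k j = r * (C.fpt v k - C.fpt v i) ∧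
      tripleDiff C.rho j k i = r * (C.fpt v k - C.fpt v j) := by
  obtain ⟨r, s, hr, h⟩ := exists_tripleLoc_eq (x := C.rho) hij hik hjk (C.fpt v) hne (by
      intro q a b c h0 h1 h2 h3 ha hb hc
      have hle : ∀ m, m = i ∨ m = j ∨ m = k → C.comp m ≤ v := by
        rintro m (rfl | rfl | rfl) <;> assumption
      have hab : a ≠ b := by
        rintro rfl
        exact absurd (q.injective (h1.trans h2.symm)) (by decide)
      have hac : a ≠ c := by
        rintro rfl
        exact absurd (q.injective (h1.trans h3.symm)) (by decide)
      have hbc : b ≠ c := by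
        rintro rfl
        exact absurd (q.injective (h2.trans h3.symm)) (by decide)
      have h3' := three_le_ncard_of_fpt_ne (C := C) h0 h1 h2 h3 (hle a ha) (hle b hb) (hle c hc) (by
        rintro ⟨e1, e2⟩
        have : ∀ m, m = a ∨ m = b ∨ m = c → C.fpt v m = C.fpt v a := by
          rintro m (rfl | rfl | rfl)
          · rfl
          · exact e1.symm
          · exact (e1.trans e2).symm
        have hm : ∀ m, m = i ∨ m = j ∨ m = k → m = a ∨ m = b ∨ m = c := by
          clear h0 h1 h2 h3 e1 e2 this hle
          rintro m (rfl | rfl | rfl) <;> rcases ha with rfl | rfl | rfl <;>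
            rcases hb with rfl | rfl | rfl <;> rcases hc with rfl | rfl | rfl <;> simp_all
        have t := fun m h => this m (hm m h)
        exact hne ⟨(t i (by simp)).trans (t j (by simp)).symm,
          (t i (by simp)).trans (t k (by simp)).symm⟩)
      change C.rhoFour q = _
      rw [rhoFour_eq h3', h0, h1, h2, h3, pt_zero, pt_succ_of_le (hle a ha),
        pt_succ_of_le (hle b hb), pt_succ_of_le (hle c hc)])
  exact ⟨r, hr, tripleDiff_eq_of_loc h⟩

theorem pair_rho {v : C.V} {i j : Fin n} (hi : C.comp i ≤ v) (hj : C.comp j ≤ v)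
    (hne : C.fpt v i ≠ C.fpt v j) :
    ∃ r, r ≠ 0 ∧ pairUnit C.rho i j = r * homPair (C.scale v) 1 ∧
      pairDiff C.rho i j = r * (homPair (C.scale v) 0 * (C.fpt v j - C.fpt v i)) := by
  have hd : C.fpt v j - C.fpt v i ≠ 0 := sub_ne_zero.2 hne.symm
  refine exists_pair_eq (fun h => hne (by rw [h])) ?_ (fun p => ⟨?_, ?_⟩)
  · rintro ⟨h1, h2⟩
    exact homPair_ne_zero _ ⟨(mul_eq_zero.1 h2).resolve_right hd, h1⟩
  · rintro rfl rfl
    change C.rhoTwo p = _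
    rw [rhoTwo_eq hi hj hne, invLength_eq hd]
  · rintro rfl rfl
    change C.rhoTwo p = _
    rw [rhoTwo_eq hj hi hne.symm, invLength_eq (sub_ne_zero.2 hne)]
    congr 1
    ring

/-- The component that separates the two markings is compared with the coloured one. Below it the
form is zero and the markings have the same position on the coloured component; above it the form is
infinite and the unit vanishes. So nonvanishing of the unit detects the markings behind the coloured
component. -/
theorem pair_rho_col {i j : Fin n} {c : K} (hc : C.scale (C.col i) = (c : OnePoint K)) :
    (C.comp j ≤ C.col i → pairUnit C.rho i j ≠ 0 ∧
      pairDiff C.rho i j = pairUnit C.rho i j * (c * (C.fpt (C.col i) j - C.fpt (C.col i) i))) ∧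
    (¬ C.comp j ≤ C.col i → pairUnit C.rho i j = 0) := by
  have hc0 : c ≠ 0 := by
    rintro rfl
    exact (nondegenerate_col i).1 hc
  by_cases hij : i = j
  · subst hij
    rw [pairUnit_self, pairDiff_self]
    exact ⟨fun _ => ⟨one_ne_zero, by ring⟩, fun h => absurd (comp_le_col i) h⟩
  obtain ⟨v, hi, hj, hne⟩ := C.exists_fpt_ne hij
  obtain ⟨r, hr, h1, h2⟩ := pair_rho hi hj hne
  constructor
  · intro hj'
    by_cases he : C.fpt (C.col i) i = C.fpt (C.col i) j
    · have hlt : v < C.col i := by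
        refine lt_of_le_of_ne (le_of_fpt_ne hi hne (comp_le_col i) hj') ?_
        rintro rfl
        exact hne he
      rw [scale_of_lt_col hlt] at h1 h2
      simp only [homPair_coe_zero, homPair_coe_one] at h1 h2
      rw [h1, h2, he]
      exact ⟨by simpa using hr, by ring⟩
    · have := fpt_ne_unique hi hj hne (comp_le_col i) hj' he
      subst this
      rw [hc] at h1 h2
      simp only [homPair_coe_zero, homPair_coe_one] at h1 h2
      rw [h1, h2]
      exact ⟨by simpa using hr, by ring⟩
  · intro hj'
    have hlt : C.col i < v := by
      rcases C.chain _ _ _ hi (comp_le_col i) with h | h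
      · exact absurd (hj.trans h) hj'
      · exact lt_of_le_of_ne h (fun h => hj' (h ▸ hj))
    rw [h1, scale_of_col_lt hlt]
    simp

end ScaledLine

/-! ### The coordinates determine the scaled line -/

namespace ScaledLine

open NodalLine

variable {K : Type} [Field K] {n : ℕ}

/-- A marking `z_k` that is not behind `v` is separated from `z_i` on a component above `v`, and
there `z_i` and `z_j` coincide. -/
theorem comp_le_iff_tripleDiff {C : ScaledLine K n} {v : C.V} {i j : Fin n} (hi : C.comp i ≤ v)
    (hj : C.comp j ≤ v) (hne : C.fpt v i ≠ C.fpt v j) (k : Fin n) :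
    C.comp k ≤ v ↔ k = i ∨ k = j ∨ tripleDiff C.rho i j k ≠ 0 := by
  have hij : i ≠ j := fun h => hne (by rw [h])
  by_cases hki : k = i
  · subst hki; simp [hi]
  by_cases hkj : k = j
  · subst hkj; simp [hj]
  simp only [hki, hkj, false_or]
  constructor
  · intro hk
    obtain ⟨r, hr, h1, -, -⟩ := tripleDiff_rho hij (Ne.symm hki) (Ne.symm hkj) hi hj hk
      (fun h => hne h.1)
    rw [h1]
    exact mul_ne_zero hr (sub_ne_zero.2 hne.symm)
  · intro h
    by_contra hk
    obtain ⟨u, hiu, hku, hneu⟩ := C.exists_fpt_ne (Ne.symm hki)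
    have hvu : v < u := by
      rcases C.chain _ _ _ hi hiu with h1 | h1
      · exact lt_of_le_of_ne h1 (fun h => hk (h ▸ hku))
      · exact absurd (hku.trans h1) hk
    obtain ⟨r, hr, h1, -, -⟩ := tripleDiff_rho hij (Ne.symm hki) (Ne.symm hkj) hiu
      (hj.trans hvu.le) hku (fun h => hneu h.2)
    rw [fpt_eq_of_le hvu hi hj, sub_self, mul_zero] at h1
    exact h h1

/-- Two scaled lines with the same coordinates have matching components. -/
theorem exists_matching {C D : ScaledLine K n} (h : C.rho = D.rho) (v : C.V) :
    ∃ v' : D.V, (∀ k, C.comp k ≤ v ↔ D.comp k ≤ v') ∧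
      scaleLevel (C.scale v) = scaleLevel (D.scale v') ∧
      ∃ (a : Kˣ) (b : K), (∀ k, C.comp k ≤ v → D.fpt v' k = a * C.fpt v k + b) ∧
        C.scale v = (D.scale v').map fun c => c * (a : K) := by
  by_cases hv : Nondegenerate (C.scale v)
  · obtain ⟨i, hi⟩ := exists_comp_le v
    obtain rfl := eq_col hi hv
    obtain ⟨c, hc⟩ := OnePoint.ne_infty_iff_exists.1 hv.2
    have hw := D.nondegenerate_col i
    obtain ⟨d, hd⟩ := OnePoint.ne_infty_iff_exists.1 hw.2
    have hc0 : c ≠ 0 := by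
      rintro rfl; exact hv.1 hc.symm
    have hd0 : d ≠ 0 := by
      rintro rfl; exact hw.1 hd.symm
    have hlv : ∀ k, C.comp k ≤ C.col i ↔ D.comp k ≤ D.col i := by
      intro k
      obtain ⟨h1, h2⟩ := pair_rho_col (j := k) hc.symm
      obtain ⟨h1', h2'⟩ := pair_rho_col (j := k) hd.symm
      rw [h] at h1 h2
      constructor
      · intro hk
        by_contra hk'
        exact (h1 hk).1 (h2' hk')
      · intro hk
        by_contra hk'
        exact (h1' hk).1 (h2 hk')
    -- The factor `c / d` is forced by the forms, and the translation by the position of `z_i`.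
    refine ⟨D.col i, hlv, ?_, Units.mk0 (c / d) (div_ne_zero hc0 hd0),
      D.fpt (D.col i) i - c / d * C.fpt (C.col i) i, fun k hk => ?_, ?_⟩
    · rw [scaleLevel_eq_one.2 hv, scaleLevel_eq_one.2 hw]
    · have h1 := (pair_rho_col (j := k) hc.symm).1 hk
      have h2 := (pair_rho_col (j := k) hd.symm).1 ((hlv k).1 hk)
      rw [h] at h1
      have := mul_left_cancel₀ h1.1 (h1.2.symm.trans h2.2)
      rw [Units.val_mk0]
      field_simp
      linear_combination -this
    · rw [← hc, ← hd, OnePoint.map_some, Units.val_mk0, mul_div_cancel₀ _ hd0]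
  · obtain ⟨i, j, hi, hj, hne⟩ := exists_fpt_ne_of_uncolored hv
    have hij : i ≠ j := fun h => hne (by rw [h])
    obtain ⟨v', hi', hj', hne'⟩ := D.exists_fpt_ne hij
    have hlv : ∀ k, C.comp k ≤ v ↔ D.comp k ≤ v' := fun k => by
      rw [comp_le_iff_tripleDiff hi hj hne, comp_le_iff_tripleDiff hi' hj' hne', h]
    obtain ⟨r, hr, h1, h2⟩ := pair_rho hi hj hne
    obtain ⟨r', hr', h1', h2'⟩ := pair_rho hi' hj' hne'
    rw [h] at h1 h2
    have hd := sub_ne_zero.2 hne.symm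
    have hd' := sub_ne_zero.2 hne'.symm
    -- A form that is zero or infinite is visible as the vanishing of the difference or of the unit
    -- in `ρ_{ij}`, where `z_i` and `z_j` are separated by the component. The affine map below is
    -- the one that matches these two markings.
    have hsc : C.scale v = D.scale v' ∧ (C.scale v = ((0 : K) : OnePoint K) ∨ C.scale v = ∞) := by
      unfold Nondegenerate at hv
      rw [not_and_or, not_not, not_not] at hv
      rcases hv with hv | hv
      · refine ⟨?_, Or.inl hv⟩
        rw [hv] at h2 ⊢
        rw [homPair_coe_zero, zero_mul, mul_zero] at h2
        have : homPair (D.scale v') 0 = 0 := by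
          by_contra h3
          exact mul_ne_zero hr' (mul_ne_zero h3 hd') (h2'.symm.trans h2)
        rw [← ofPair_homPair (D.scale v'), this, ofPair_of_ne _
          (fun h => homPair_ne_zero _ ⟨this, h⟩), zero_div]
      · refine ⟨?_, Or.inr hv⟩
        rw [hv] at h1 ⊢
        rw [homPair_infty_one, mul_zero] at h1
        have : homPair (D.scale v') 1 = 0 := by
          by_contra h3
          exact mul_ne_zero hr' h3 (h1'.symm.trans h1)
        rw [← ofPair_homPair (D.scale v'), this, ofPair_zero_right]
    refine ⟨v', hlv, by rw [hsc.1],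
      Units.mk0 ((D.fpt v' j - D.fpt v' i) / (C.fpt v j - C.fpt v i)) (div_ne_zero hd' hd),
      D.fpt v' i - (D.fpt v' j - D.fpt v' i) / (C.fpt v j - C.fpt v i) * C.fpt v i,
      fun k hk => ?_, ?_⟩
    · rw [Units.val_mk0]
      suffices (D.fpt v' k - D.fpt v' i) * (C.fpt v j - C.fpt v i) =
          (D.fpt v' j - D.fpt v' i) * (C.fpt v k - C.fpt v i) by
        field_simp
        linear_combination this
      by_cases hki : k = i
      · subst hki; ring
      by_cases hkj : k = j
      · subst hkj; ring
      obtain ⟨s, hs, e1, e2, -⟩ := tripleDiff_rho hij (Ne.symm hki) (Ne.symm hkj) hi hj hk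
        (fun h => hne h.1)
      obtain ⟨s', hs', e1', e2', -⟩ := tripleDiff_rho hij (Ne.symm hki) (Ne.symm hkj) hi' hj'
        ((hlv k).1 hk) (fun h => hne' h.1)
      rw [h, e1'] at e1
      rw [h, e2'] at e2
      refine mul_left_cancel₀ (mul_ne_zero hs hs') ?_
      linear_combination s * (C.fpt v j - C.fpt v i) * e2 - s * (C.fpt v k - C.fpt v i) * e1
    · rw [← hsc.1]
      rcases hsc.2 with h3 | h3 <;> rw [h3]
      · simp
      · rfl

theorem eq_of_leaves {C : ScaledLine K n} {v w : C.V} (h : ∀ i, C.comp i ≤ v ↔ C.comp i ≤ w)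
    (h' : scaleLevel (C.scale v) = scaleLevel (C.scale w)) : v = w :=
  le_antisymm (le_iff_leaves.2 ⟨fun i => (h i).1, h'.le⟩)
    (le_iff_leaves.2 ⟨fun i => (h i).2, h'.ge⟩)

/-- The matching of components is an isomorphism of trees because `le_iff_leaves` describes the
order by the data that the matching preserves. The component of a marking is the least one that has
this marking behind it, so it is matched as well. -/
theorem isomorphic_of_rho_eq {C D : ScaledLine K n} (h : C.rho = D.rho) : Isomorphic C D := by
  choose f hl hs a b hab hsc using exists_matching h
  have hle : ∀ {v w}, f v ≤ f w ↔ v ≤ w := by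
    intro v w
    rw [le_iff_leaves, le_iff_leaves, hs, hs]
    simp only [hl]
  have hsurj : Function.Surjective f := by
    intro v'
    obtain ⟨v, hl', hs', -⟩ := exists_matching h.symm v'
    refine ⟨v, eq_of_leaves (fun i => ?_) ?_⟩
    · rw [← hl, ← hl']
    · rw [← hs, hs']
  let F : C.V ≃o D.V := RelIso.ofSurjective (OrderEmbedding.ofMapLEIff f fun _ _ => hle) hsurj
  have hF : ∀ v, F v = f v := fun _ => rfl
  have hcomp : ∀ i, D.comp i = F (C.comp i) := by
    intro i
    refine le_antisymm ((hl _ i).1 le_rfl) ?_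
    rw [← OrderIso.le_symm_apply, hl, ← hF, OrderIso.apply_symm_apply]
  refine ⟨⟨F, a, b, ?_, hcomp, ?_⟩, hsc⟩
  · intro u v hvu
    obtain ⟨i, hi⟩ := exists_comp_le v
    have h1 := hab u i (hi.trans hvu.le)
    have hvu' : F v ⋖ F u := (apply_covBy_apply_iff F).2 hvu
    rwa [fpt_of_covBy hvu hi, ← hF, fpt_of_covBy hvu' ((hl v i).1 hi)] at h1
  · intro i
    have h1 := hab (C.comp i) i le_rfl
    rwa [fpt_of_eq rfl, ← hF, fpt_of_eq (hcomp i)] at h1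

end ScaledLine

theorem Moduli.rho_injective {K : Type} [Field K] {n : ℕ} :
    Function.Injective (Moduli.rho : Moduli K n → Index n → OnePoint K) := by
  rintro ⟨C⟩ ⟨D⟩ h
  exact Quotient.sound (ScaledLine.isomorphic_of_rho_eq h)

/-! ### Reconstruction of a scaled line from its coordinates -/

section Reconstruction

variable {K : Type} [Field K] {n : ℕ}

/-- Comparison of the distances from `z_i` to other markings, or to the unit of length (`none`). -/
def distLE (x : Index n → OnePoint K) (i : Fin n) : Option (Fin n) → Option (Fin n) → Prop
  | some j, some k => j = k ∨ tripleDiff x i k j ≠ 0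
  | some j, none => pairUnit x i j ≠ 0
  | none, some k => pairDiff x i k ≠ 0
  | none, none => True

theorem distLE_refl (x : Index n → OnePoint K) (i : Fin n) (e : Option (Fin n)) :
    distLE x i e e := by
  cases e <;> simp [distLE]

/-- If both comparisons failed, a pair of homogeneous coordinates would vanish. -/
theorem distLE_total (x : Index n → OnePoint K) {i : Fin n} {e f : Option (Fin n)}
    (he : e ≠ some i) (hf : f ≠ some i) : distLE x i e f ∨ distLE x i f e := by
  rcases e with _ | j <;> rcases f with _ | k <;> simp only [distLE, true_or]
  · by_contra! h
    exact pair_ne_zero x i k ⟨h.2, h.1⟩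
  · by_contra! h
    exact pair_ne_zero x i j h
  · by_contra! h
    exact tripleDiff_ne_zero x (fun h => he (by rw [h])) (fun h => hf (by rw [h])) h.1.1
      ⟨h.2.2, h.1.2⟩

/-- If the conclusion failed, one side of `star` or `scale` would be zero and the other a product of
nonzero factors. -/
theorem IsConsistent.distLE_trans {x : Index n → OnePoint K} (hx : IsConsistent x) {i : Fin n}
    {e f g : Option (Fin n)} (he : e ≠ some i) (hf : f ≠ some i) (hg : g ≠ some i)
    (h : distLE x i e f) (h' : distLE x i f g) : distLE x i e g := by
  have nd : ∀ {a b c : Fin n}, a ≠ b → a ≠ c → b ≠ c → tripleDiff x a b c = 0 →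
      tripleDiff x a c b ≠ 0 := fun h1 h2 h3 h4 h5 => tripleDiff_ne_zero x h1 h2 h3 ⟨h4, h5⟩
  rcases e with _ | j <;> rcases f with _ | k <;> rcases g with _ | l
  · exact h
  · exact h'
  · trivial
  · have hik : i ≠ k := fun h => hf (by rw [h])
    have hil : i ≠ l := fun h => hg (by rw [h])
    by_cases hkl : k = l
    · subst hkl; exact h
    replace h' := h'.resolve_left hkl
    intro hb
    have hs := hx.scale i k l hik hil hkl
    rw [hb, mul_zero, zero_mul] at hs
    exact mul_ne_zero (mul_ne_zero h' h) (fun h => pair_ne_zero x i l ⟨h, hb⟩) hs.symm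
  · exact h
  · have hij : i ≠ j := fun h => he (by rw [h])
    have hil : i ≠ l := fun h => hg (by rw [h])
    by_cases hjl : j = l
    · exact Or.inl hjl
    refine Or.inr fun hb => ?_
    have hs := hx.scale i j l hij hil hjl
    rw [hb, zero_mul, zero_mul] at hs
    exact mul_ne_zero (mul_ne_zero (nd hil hij (Ne.symm hjl) hb) h') h hs
  · have hik : i ≠ k := fun h => hf (by rw [h])
    have hij : i ≠ j := fun h => he (by rw [h])
    rcases h with h | h
    · subst h; exact h'
    by_cases hjk : j = k
    · subst hjk; exact h'
    intro hb
    have hs := hx.scale i j k hij hik hjk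
    rw [hb, mul_zero] at hs
    exact mul_ne_zero (mul_ne_zero h (fun h => pair_ne_zero x i j ⟨hb, h⟩)) h' hs.symm
  · have hik : i ≠ k := fun h => hf (by rw [h])
    have hij : i ≠ j := fun h => he (by rw [h])
    have hil : i ≠ l := fun h => hg (by rw [h])
    by_cases hjk : j = k
    · subst hjk; exact h'
    by_cases hkl : k = l
    · subst hkl; exact h
    by_cases hjl : j = l
    · exact Or.inl hjl
    replace h' := h'.resolve_left hkl
    replace h := h.resolve_left hjk
    refine Or.inr fun hb => ?_
    have hs := hx.star i j k l hij hik hil hjk hjl hkl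
    rw [hb, mul_zero] at hs
    exact mul_ne_zero (mul_ne_zero h h') (nd hil hij (Ne.symm hjl) hb) hs.symm

open Classical in
/-- The markings in a ball with center `z_i`. -/
def ball (x : Index n → OnePoint K) (i : Fin n) (e : Option (Fin n)) : Finset (Fin n) :=
  Finset.univ.filter fun k => k = i ∨ distLE x i (some k) e

open Classical in
/-- The level of a ball: `0`, `1` or `2` if its radius is less than, equal to or greater than the
unit of length. -/
def ballLevel (x : Index n → OnePoint K) (i : Fin n) (e : Option (Fin n)) : ℕ :=
  (if distLE x i none e then 1 else 0) + (if distLE x i e none then 0 else 1)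

/-- The component of the scaled line that corresponds to a ball. -/
def ballVertex (x : Index n → OnePoint K) (i : Fin n) (e : Option (Fin n)) :
    Finset (Fin n) × ℕ := (ball x i e, ballLevel x i e)

variable {x : Index n → OnePoint K}

theorem mem_ball {i k : Fin n} {e : Option (Fin n)} :
    k ∈ ball x i e ↔ k = i ∨ distLE x i (some k) e := by simp [ball]

/-- A radius given by a marking is detected by the set of markings in the ball. The radius `none` is
not, and is compared by means of the level. -/
theorem IsConsistent.ballVertex_le (hx : IsConsistent x) {i : Fin n} {e f : Option (Fin n)}
    (he : e ≠ some i) (hf : f ≠ some i) : ballVertex x i e ≤ ballVertex x i f ↔ distLE x i e f := by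
  constructor
  · rintro ⟨h1, h2⟩
    rcases e with _ | j
    · change ballLevel x i none ≤ ballLevel x i f at h2
      rcases f with _ | k
      · trivial
      · unfold ballLevel at h2
        by_contra h3
        rw [if_pos (distLE_refl x i none), if_neg h3,
          if_pos ((distLE_total x (by simp) hf).resolve_left h3)] at h2
        simp at h2
    · have hj : j ∈ ball x i (some j) := mem_ball.2 (Or.inr (distLE_refl _ _ _))
      exact (mem_ball.1 (h1 hj)).resolve_left (fun h => he (by rw [h]))
  · intro h
    refine ⟨fun k hk => ?_, ?_⟩
    · rcases mem_ball.1 hk with hk | hk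
      · exact mem_ball.2 (Or.inl hk)
      · by_cases hki : k = i
        · exact mem_ball.2 (Or.inl hki)
        · exact mem_ball.2 (Or.inr (hx.distLE_trans (by simpa using hki) he hf hk h))
    · change ballLevel x i e ≤ ballLevel x i f
      unfold ballLevel
      refine add_le_add ?_ ?_
      · split_ifs with h1 h2
        · exact le_rfl
        · exact absurd (hx.distLE_trans (by simp) he hf h1 h) h2
        · simp
        · exact le_rfl
      · split_ifs with h1 h2 h2
        · exact le_rfl
        · simp
        · exact absurd (hx.distLE_trans he hf (by simp) h h2) h1
        · exact le_rfl

theorem ballVertex_comm (i j : Fin n) :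
    ballVertex x i (some j) = ballVertex x j (some i) := by
  refine Prod.ext ?_ ?_
  · change ball x i (some j) = ball x j (some i)
    ext k
    simp only [mem_ball, distLE]
    rw [tripleDiff_comm x i j k]
    by_cases h1 : k = i <;> by_cases h2 : k = j <;> simp [h1, h2]
  · have h1 : distLE x i none (some j) ↔ distLE x j none (some i) := by
      simp only [distLE]
      rw [pairDiff_comm, neg_ne_zero]
    have h2 : distLE x i (some j) none ↔ distLE x j (some i) none := by
      simp only [distLE]
      rw [pairUnit_comm]
    change ballLevel x i (some j) = ballLevel x j (some i)
    unfold ballLevel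
    by_cases h3 : distLE x i none (some j) <;> by_cases h4 : distLE x i (some j) none
    · rw [if_pos h3, if_pos h4, if_pos (h1.1 h3), if_pos (h2.1 h4)]
    · rw [if_pos h3, if_neg h4, if_pos (h1.1 h3), if_neg (mt h2.2 h4)]
    · rw [if_neg h3, if_pos h4, if_neg (mt h1.2 h3), if_pos (h2.1 h4)]
    · rw [if_neg h3, if_neg h4, if_neg (mt h1.2 h3), if_neg (mt h2.2 h4)]

/-- This is the ultrametric property at the unit radius: if exactly one of three mutual distances
were larger than the unit, `scale` at its two ends would make both of them coincide with the third
point within the triple, which is excluded. -/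
theorem IsConsistent.ballVertex_none (hx : IsConsistent x) {i j : Fin n} (h : pairUnit x i j ≠ 0) :
    ballVertex x i none = ballVertex x j none := by
  by_cases hij : i = j
  · rw [hij]
  have key : ∀ {i j k : Fin n}, i ≠ j → pairUnit x i j ≠ 0 → pairUnit x i k ≠ 0 →
      pairUnit x j k ≠ 0 := by
    intro i j k hij h1 h2 h3
    by_cases hjk : j = k
    · subst hjk; rw [pairUnit_self] at h3; exact one_ne_zero h3
    by_cases hik : i = k
    · subst hik; rw [pairUnit_comm] at h3; exact h1 h3
    have hb : pairDiff x j k ≠ 0 := fun h => pair_ne_zero x j k ⟨h3, h⟩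
    have hb' : pairDiff x k j ≠ 0 := by rwa [pairDiff_comm, neg_ne_zero]
    have s1 := hx.scale j i k (Ne.symm hij) hjk hik
    have s2 := hx.scale k i j (Ne.symm hik) (Ne.symm hjk) hij
    rw [h3, mul_zero, mul_eq_zero, mul_eq_zero, pairUnit_comm x i j] at s1
    rw [pairUnit_comm x j k, h3, mul_zero, mul_eq_zero, mul_eq_zero, pairUnit_comm x i k] at s2
    have t1 := (s1.resolve_right h1).resolve_right hb
    have t2 := (s2.resolve_right h2).resolve_right hb'
    refine tripleDiff_ne_zero x hij hik hjk ⟨?_, ?_⟩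
    · rw [tripleDiff_comm, t1, neg_zero]
    · rw [tripleDiff_comm, t2, neg_zero]
  refine Prod.ext ?_ rfl
  change ball x i none = ball x j none
  ext k
  simp only [mem_ball, distLE]
  have h' : pairUnit x j i ≠ 0 := by rwa [pairUnit_comm]
  constructor
  · rintro (rfl | hk)
    · exact Or.inr h'
    · exact Or.inr (key hij h hk)
  · rintro (rfl | hk)
    · exact Or.inr h
    · exact Or.inr (key (Ne.symm hij) h' hk)

/-- Any marking in a ball is a center of it. -/
theorem IsConsistent.exists_recenter (hx : IsConsistent x) {i j : Fin n} {e : Option (Fin n)}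
    (he : e ≠ some i) (hj : j ∈ ball x i e) :
    ∃ f, f ≠ some j ∧ ballVertex x i e = ballVertex x j f := by
  by_cases hij : i = j
  · subst hij; exact ⟨e, he, rfl⟩
  replace hj := (mem_ball.1 hj).resolve_left (Ne.symm hij)
  rcases e with _ | l
  · exact ⟨none, by simp, hx.ballVertex_none hj⟩
  have hil : i ≠ l := fun h => he (by rw [h])
  by_cases hjl : j = l
  · subst hjl
    exact ⟨some i, by simpa using hij, ballVertex_comm i j⟩
  replace hj : tripleDiff x i l j ≠ 0 := hj.resolve_left hjl
  have s : ∀ {a b : Fin n}, a ≠ b → some a ≠ some b := fun h => by simpa using h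
  -- If `z_j` and `z_l` coincide in comparison with `z_i`, the distance of `z_i` and `z_j` is the
  -- radius. Otherwise the distance of `z_j` and `z_l` is of the same order as the radius.
  by_cases h0 : tripleDiff x j l i = 0
  · refine ⟨some i, s hij, ?_⟩
    rw [ballVertex_comm j i]
    have hj' : tripleDiff x i j l ≠ 0 := by
      have := tripleDiff_rotate x i j l
      rw [h0] at this
      rwa [← sub_eq_zero.1 this.symm]
    exact le_antisymm ((hx.ballVertex_le he (s (Ne.symm hij))).2 (Or.inr hj'))
      ((hx.ballVertex_le (s (Ne.symm hij)) he).2 (Or.inr hj))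
  · refine ⟨some l, s (Ne.symm hjl), ?_⟩
    rw [ballVertex_comm i l, ballVertex_comm j l]
    have h1 : tripleDiff x l j i ≠ 0 := by rwa [tripleDiff_comm, neg_ne_zero]
    have h2 : tripleDiff x l i j ≠ 0 := by rwa [tripleDiff_comm, neg_ne_zero]
    exact le_antisymm ((hx.ballVertex_le (s hil) (s hjl)).2 (Or.inr h1))
      ((hx.ballVertex_le (s hjl) (s hil)).2 (Or.inr h2))

/-- The components of the scaled line with given coordinates. -/
abbrev BallTree (x : Index n → OnePoint K) : Type :=
  {v : Finset (Fin n) × ℕ // ∃ i e, e ≠ some i ∧ v = ballVertex x i e}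

instance (x : Index n → OnePoint K) : Finite (BallTree x) := by
  have : Set.Finite {v : Finset (Fin n) × ℕ | ∃ i e, e ≠ some i ∧ v = ballVertex x i e} :=
    (Set.finite_range fun p : Fin n × Option (Fin n) => ballVertex x p.1 p.2).subset (by
      rintro _ ⟨i, e, -, rfl⟩
      exact ⟨(i, e), rfl⟩)
  exact this.to_subtype

/-- The component of a ball. -/
def toBall (x : Index n → OnePoint K) (i : Fin n) (e : Option (Fin n)) (he : e ≠ some i) :
    BallTree x := ⟨ballVertex x i e, i, e, he, rfl⟩

theorem IsConsistent.exists_center (hx : IsConsistent x) {v : BallTree x} {j : Fin n}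
    (hj : j ∈ v.1.1) : ∃ (f : Option (Fin n)) (hf : f ≠ some j), v = toBall x j f hf := by
  obtain ⟨_, i, e, he, rfl⟩ := v
  obtain ⟨f, hf, h⟩ := hx.exists_recenter he hj
  exact ⟨f, hf, Subtype.ext h⟩

theorem mem_toBall {i : Fin n} {e : Option (Fin n)} (he : e ≠ some i) : i ∈ (toBall x i e he).1.1 :=
  mem_ball.2 (Or.inl rfl)

theorem BallTree.exists_mem (v : BallTree x) : ∃ i, i ∈ v.1.1 := by
  obtain ⟨_, i, e, he, rfl⟩ := v
  exact ⟨i, mem_toBall he⟩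

/-- Both balls can be centered at the common marking, and then their radii are comparable. -/
theorem IsConsistent.le_total (hx : IsConsistent x) {v w : BallTree x} {i : Fin n}
    (hv : i ∈ v.1.1) (hw : i ∈ w.1.1) : v ≤ w ∨ w ≤ v := by
  obtain ⟨e, he, rfl⟩ := hx.exists_center hv
  obtain ⟨f, hf, rfl⟩ := hx.exists_center hw
  rcases distLE_total x he hf with h | h
  · exact Or.inl ((hx.ballVertex_le he hf).2 h)
  · exact Or.inr ((hx.ballVertex_le hf he).2 h)

theorem IsConsistent.pair_le (hx : IsConsistent x) {v : BallTree x} {i j : Fin n} (hij : i ≠ j)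
    (hi : i ∈ v.1.1) (hj : j ∈ v.1.1) : toBall x i (some j) (by simpa using hij.symm) ≤ v := by
  obtain ⟨e, he, rfl⟩ := hx.exists_center hi
  exact (hx.ballVertex_le (by simpa using hij.symm) he).2 ((mem_ball.1 hj).resolve_left hij.symm)

/-- A maximal ball contains every marking `z_j`: otherwise the ball of radius the distance from its
center to `z_j` would be larger. Balls that share a marking are comparable, so a maximal ball with
all markings is greatest. -/
theorem IsConsistent.exists_greatest (hx : IsConsistent x) (hn : 1 ≤ n) :
    ∃ t : BallTree x, ∀ v, v ≤ t := by
  obtain ⟨t, -, ht⟩ := (Set.toFinite (Set.univ : Set (BallTree x))).exists_le_maximal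
    (Set.mem_univ (toBall x ⟨0, hn⟩ none (by simp)))
  have hmax : ∀ v, t ≤ v → v ≤ t := fun v h => ht.2 (Set.mem_univ _) h
  have hmem : ∀ j, j ∈ t.1.1 := by
    intro j
    obtain ⟨i, hi⟩ := t.exists_mem
    obtain ⟨e, he, rfl⟩ := hx.exists_center hi
    by_cases hij : j = i
    · subst hij; exact hi
    have hj : some j ≠ some i := by simpa using hij
    rcases distLE_total x he hj with h | h
    · exact (hmax (toBall x i (some j) hj) ((hx.ballVertex_le he hj).2 h)).1
        (mem_ball.2 (Or.inr (distLE_refl _ _ _)))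
    · exact mem_ball.2 (Or.inr h)
  refine ⟨t, fun v => ?_⟩
  obtain ⟨i, hi⟩ := v.exists_mem
  exact (hx.le_total hi (hmem i)).elim id (hmax v)

theorem IsConsistent.exists_least (hx : IsConsistent x) (i : Fin n) :
    ∃ c : BallTree x, i ∈ c.1.1 ∧ ∀ v : BallTree x, i ∈ v.1.1 → c ≤ v := by
  obtain ⟨c, -, hc⟩ := (Set.toFinite {v : BallTree x | i ∈ v.1.1}).exists_le_minimal
    (show toBall x i none (by simp) ∈ _ from mem_toBall (by simp))
  refine ⟨c, hc.1, fun v hv => ?_⟩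
  rcases hx.le_total hc.1 hv with h | h
  · exact h
  · exact hc.2 hv h

theorem toBall_none_level (i : Fin n) : (toBall x i none (by simp)).1.2 = 1 := by
  simp [toBall, ballVertex, ballLevel, distLE]

theorem IsConsistent.level_eq_one (hx : IsConsistent x) {v : BallTree x} (h : v.1.2 = 1) {i : Fin n}
    (hi : i ∈ v.1.1) : v = toBall x i none (by simp) := by
  obtain ⟨e, he, rfl⟩ := hx.exists_center hi
  have h1 : distLE x i none e ∧ distLE x i e none := by
    change ballLevel x i e = 1 at h
    unfold ballLevel at h
    have := distLE_total x he (show none ≠ some i by simp)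
    split_ifs at h with h1 h2 h2
    · exact ⟨h1, h2⟩
    · omega
    · omega
    · tauto
  exact le_antisymm ((hx.ballVertex_le he (by simp)).2 h1.2)
    ((hx.ballVertex_le (by simp) he).2 h1.1)

theorem IsConsistent.exists_base (hx : IsConsistent x) (v : BallTree x) :
    ∃ (i : Fin n) (e : Option (Fin n)) (he : e ≠ some i),
      v = toBall x i e he ∧ (v.1.2 = 1 ↔ e = none) := by
  by_cases h : v.1.2 = 1
  · obtain ⟨i, hi⟩ := v.exists_mem
    exact ⟨i, none, by simp, hx.level_eq_one h hi, by simp [h]⟩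
  · obtain ⟨i, hi⟩ := v.exists_mem
    obtain ⟨e, he, rfl⟩ := hx.exists_center hi
    refine ⟨i, e, he, rfl, by simp only [h, false_iff]; rintro rfl; exact h (toBall_none_level i)⟩

/-- Proportionality of differences for three points follows from proportionality of
distances to a fourth point. -/
theorem IsConsistent.sub_mul_tripleDiff (hx : IsConsistent x) {X : Fin n → K} {i : Fin n}
    {T : Finset (Fin n)} (hX : X i = 0)
    (h : ∀ k ∈ T, ∀ l ∈ T, k ≠ i → l ≠ i → k ≠ l →
      X l * tripleDiff x i k l = X k * tripleDiff x i l k)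
    {k l m : Fin n} (hk : k ∈ T) (hl : l ∈ T) (hm : m ∈ T) (hkl : k ≠ l) (hkm : k ≠ m)
    (hlm : l ≠ m) :
    (X l - X k) * tripleDiff x k m l = (X m - X k) * tripleDiff x k l m := by
  by_cases hki : k = i
  · subst hki
    rw [hX, sub_zero, sub_zero]
    exact h m hm l hl hkm.symm hkl.symm hlm.symm
  by_cases hli : l = i
  · subst hli
    have h1 := h k hk m hm hkl hlm.symm hkm
    rw [hX, tripleDiff_rotate x l k m, tripleDiff_comm x l k m]
    linear_combination h1
  by_cases hmi : m = i
  · subst hmi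
    have h1 := h k hk l hl hki hli hkl
    rw [hX, tripleDiff_rotate x m k l, tripleDiff_comm x m k l]
    linear_combination -h1
  -- If `z_k` is not at the base point, `star` at `k` for `i, l, m` gives the claim, after
  -- cancelling `tripleDiff x i k l` and `tripleDiff x i k m`, which are nonzero.
  have G : ∀ {k l m : Fin n}, k ∈ T → l ∈ T → m ∈ T → k ≠ l → k ≠ m → l ≠ m → k ≠ i → l ≠ i →
      m ≠ i → X k ≠ 0 →
      (X l - X k) * tripleDiff x k m l = (X m - X k) * tripleDiff x k l m := by
    intro k l m hk hl hm hkl hkm hlm hki hli hmi h0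
    have nz : ∀ {l : Fin n}, l ∈ T → k ≠ l → l ≠ i → tripleDiff x i k l ≠ 0 := by
      intro l hl hkl hli h2
      have h1 := h k hk l hl hki hli hkl
      rw [h2, mul_zero] at h1
      exact mul_ne_zero h0 (fun h3 => tripleDiff_ne_zero x (Ne.symm hki) (Ne.symm hli) hkl
        ⟨h2, h3⟩) h1.symm
    have n1 := nz hl hkl hli
    have n2 := nz hm hkm hmi
    have h1 := h k hk l hl hki hli hkl
    have h2 := h k hk m hm hki hmi hkm
    have s := hx.star k i l m hki hkl hkm (Ne.symm hli) (Ne.symm hmi) hlm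
    rw [tripleDiff_comm x i k l, tripleDiff_comm x i k m, tripleDiff_rotate x i k l,
      tripleDiff_rotate x i k m] at s
    refine mul_left_cancel₀ (mul_ne_zero n1 n2) ?_
    linear_combination X k * s + tripleDiff x i k m * tripleDiff x k m l * h1 -
      tripleDiff x i k l * tripleDiff x k l m * h2
  -- The claim is symmetric in the three points up to the relations between the differences, so any
  -- of them that is not at the base point can play the role of `z_k`.
  by_cases h0 : X k = 0
  · by_cases h1 : X l = 0
    · by_cases h2 : X m = 0
      · rw [h0, h1, h2]; ring
      · have := G hm hk hl hkm.symm hlm.symm hkl hmi hki hli h2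
        have r1 : tripleDiff x m k l = - tripleDiff x k m l := tripleDiff_comm x k m l
        have r2 : tripleDiff x m l k = tripleDiff x k l m - tripleDiff x k m l :=
          tripleDiff_rotate x k m l
        rw [r1, r2] at this
        linear_combination this
    · have := G hl hk hm hkl.symm hlm hkm hli hki hmi h1
      rw [tripleDiff_comm x k l m, tripleDiff_rotate x k l m] at this
      linear_combination -this
  · exact G hk hl hm hkl hkm hlm hki hli hmi h0

/-- On each component there is a coordinate in which the differences of the markings are
those given by the coordinates `x`. -/
theorem IsConsistent.exists_position (hx : IsConsistent x) (v : BallTree x) :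
    ∃ X : Fin n → K,
      (∀ k ∈ v.1.1, ∀ l ∈ v.1.1, ∀ m ∈ v.1.1, k ≠ l → k ≠ m → l ≠ m →
        (X l - X k) * tripleDiff x k m l = (X m - X k) * tripleDiff x k l m) ∧
      (v.1.2 = 1 → ∀ k ∈ v.1.1, ∀ l ∈ v.1.1,
        (X l - X k) * pairUnit x k l = pairDiff x k l) ∧
      ∀ k ∈ v.1.1, ∀ l ∈ v.1.1, ∀ hkl : k ≠ l,
        (X k ≠ X l ↔ v ≤ toBall x k (some l) (by simpa using hkl.symm)) := by
  classical
  obtain ⟨i, e, he, hv, hlev⟩ := hx.exists_base v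
  have hiv : i ∈ v.1.1 := by rw [hv]; exact mem_toBall he
  rcases e with _ | m
  · have hl1 : v.1.2 = 1 := hlev.2 rfl
    have hU : ∀ k ∈ v.1.1, pairUnit x i k ≠ 0 := by
      intro k hk
      rw [hv] at hk
      rcases mem_ball.1 hk with rfl | h
      · rw [pairUnit_self]; exact one_ne_zero
      · exact h
    -- On a ball of unit radius the coordinate is centered at `z_i` and the form is `dz`.
    let X : Fin n → K := fun k => pairDiff x i k / pairUnit x i k
    have hXm : ∀ k ∈ v.1.1, X k * pairUnit x i k = pairDiff x i k := fun k hk =>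
      div_mul_cancel₀ _ (hU k hk)
    have hXi : X i = 0 := by simp only [X, pairDiff_self, zero_div]
    have hc : ∀ k ∈ v.1.1, ∀ l ∈ v.1.1, k ≠ i → l ≠ i → k ≠ l →
        X l * tripleDiff x i k l = X k * tripleDiff x i l k := by
      intro k hk l hl hki hli hkl
      have s := hx.scale i k l (Ne.symm hki) (Ne.symm hli) hkl
      rw [← hXm k hk, ← hXm l hl] at s
      refine mul_left_cancel₀ (mul_ne_zero (hU k hk) (hU l hl)) ?_
      linear_combination s
    have hP1 : ∀ k ∈ v.1.1, ∀ l ∈ v.1.1, ∀ m ∈ v.1.1, k ≠ l → k ≠ m → l ≠ m →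
        (X l - X k) * tripleDiff x k m l = (X m - X k) * tripleDiff x k l m :=
      fun k hk l hl m hm => hx.sub_mul_tripleDiff hXi hc hk hl hm
    have hUU : ∀ k ∈ v.1.1, ∀ l ∈ v.1.1, pairUnit x k l ≠ 0 := by
      intro k hk l hl
      by_cases hkl : l = k
      · subst hkl; rw [pairUnit_self]; exact one_ne_zero
      · rw [hx.level_eq_one hl1 hk] at hl
        exact (mem_ball.1 hl).resolve_left hkl
    have hP2 : ∀ k ∈ v.1.1, ∀ l ∈ v.1.1, (X l - X k) * pairUnit x k l = pairDiff x k l := by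
      intro k hk l hl
      by_cases hki : k = i
      · subst hki; rw [hXi, sub_zero]; exact hXm l hl
      by_cases hli : l = i
      · subst hli
        rw [hXi, pairUnit_comm x l k, pairDiff_comm x l k, ← hXm k hk]; ring
      by_cases hkl : k = l
      · subst hkl; rw [pairDiff_self]; ring
      have G : ∀ {k l : Fin n}, k ∈ v.1.1 → l ∈ v.1.1 → k ≠ i → l ≠ i → k ≠ l → X k ≠ 0 →
          (X l - X k) * pairUnit x k l = pairDiff x k l := by
        intro k l hk hl hki hli hkl h0
        have h1 := hc k hk l hl hki hli hkl
        have n1 : tripleDiff x i k l ≠ 0 := by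
          intro h2
          rw [h2, mul_zero] at h1
          exact mul_ne_zero h0 (fun h3 => tripleDiff_ne_zero x (Ne.symm hki) (Ne.symm hli) hkl
            ⟨h2, h3⟩) h1.symm
        have s := hx.scale k i l hki hkl (Ne.symm hli)
        rw [tripleDiff_comm x i k l, tripleDiff_rotate x i k l, pairDiff_comm x i k,
          pairUnit_comm x i k, ← hXm k hk] at s
        refine mul_left_cancel₀ (mul_ne_zero n1 (hU k hk)) ?_
        linear_combination s + pairUnit x i k * pairUnit x k l * h1
      by_cases h0 : X k = 0
      · by_cases h1 : X l = 0
        · rw [h0, h1, sub_zero, zero_mul]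
          -- Both points are at the position of `z_i`. If their difference did not vanish, `scale`
          -- at `k` and at `l` would make each of them coincide with `z_i` in the triple `i, k, l`,
          -- which `tripleDiff_ne_zero` forbids.
          by_contra hb
          have hb := Ne.symm hb
          have z : ∀ k ∈ v.1.1, X k = 0 → pairDiff x i k = 0 := fun k hk h0 => by
            rw [← hXm k hk, h0, zero_mul]
          have s1 := hx.scale k i l hki hkl (Ne.symm hli)
          have s2 := hx.scale l i k hli (Ne.symm hkl) (Ne.symm hki)
          rw [pairDiff_comm x i k, z k hk h0, neg_zero, mul_zero, zero_mul, mul_eq_zero,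
            mul_eq_zero] at s1
          rw [pairDiff_comm x i l, z l hl h1, neg_zero, mul_zero, zero_mul, mul_eq_zero,
            mul_eq_zero, pairDiff_comm x k l, neg_eq_zero] at s2
          have t1 := (s1.resolve_right (hUU k hk i hiv)).resolve_right hb
          have t2 := (s2.resolve_right (hUU l hl i hiv)).resolve_right hb
          refine tripleDiff_ne_zero x (Ne.symm hki) (Ne.symm hli) hkl ⟨?_, ?_⟩
          · rw [tripleDiff_comm, t1, neg_zero]
          · rw [tripleDiff_comm, t2, neg_zero]
        · have := G hl hk hli hki (Ne.symm hkl) h1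
          rw [pairUnit_comm, pairDiff_comm x k l] at this
          linear_combination -this
      · exact G hk hl hki hli hkl h0
    refine ⟨X, hP1, fun _ => hP2, fun k hk l hl hkl => ?_⟩
    have h2 := hP2 k hk l hl
    have h3 : v ≤ toBall x k (some l) (by simpa using hkl.symm) ↔ pairDiff x k l ≠ 0 := by
      rw [hx.level_eq_one hl1 hk]
      exact hx.ballVertex_le (by simp) (by simpa using hkl.symm)
    rw [h3, ← h2, mul_ne_zero_iff, sub_ne_zero]
    exact ⟨fun h => ⟨h.symm, hUU k hk l hl⟩, fun h => h.1.symm⟩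
  · have hl1 : v.1.2 ≠ 1 := by simp [hlev]
    have hmi : m ≠ i := by simpa using he
    have hmv : m ∈ v.1.1 := by
      rw [hv]; exact mem_ball.2 (Or.inr (distLE_refl _ _ _))
    have hU : ∀ k ∈ v.1.1, k ≠ i → k ≠ m → tripleDiff x i m k ≠ 0 := by
      intro k hk hki hkm
      rw [hv] at hk
      exact ((mem_ball.1 hk).resolve_left hki).resolve_left hkm
    -- On other balls the coordinate is normalized by putting the center `z_i` at `0` and `z_m`,
    -- which realizes the radius, at `1`.
    let X : Fin n → K := fun k => if k = i then 0 else if k = m then 1 else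
      tripleDiff x i k m / tripleDiff x i m k
    have hXi : X i = 0 := by simp only [X, if_true]
    have hXM : X m = 1 := by simp only [X, if_true, if_neg hmi]
    have hXm : ∀ k ∈ v.1.1, k ≠ i → k ≠ m → X k * tripleDiff x i m k = tripleDiff x i k m :=
      fun k hk hki hkm => by
        simp only [X, if_neg hki, if_neg hkm]
        exact div_mul_cancel₀ _ (hU k hk hki hkm)
    have hc : ∀ k ∈ v.1.1, ∀ l ∈ v.1.1, k ≠ i → l ≠ i → k ≠ l →
        X l * tripleDiff x i k l = X k * tripleDiff x i l k := by
      intro k hk l hl hki hli hkl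
      by_cases hkm : k = m
      · subst hkm
        rw [hXM, one_mul]
        exact hXm l hl hli (Ne.symm hkl)
      by_cases hlm : l = m
      · subst hlm
        rw [hXM, one_mul]
        exact (hXm k hk hki hkm).symm
      have s := hx.star i k l m (Ne.symm hki) (Ne.symm hli) (Ne.symm hmi) hkl hkm hlm
      rw [← hXm k hk hki hkm, ← hXm l hl hli hlm] at s
      refine mul_left_cancel₀ (mul_ne_zero (hU k hk hki hkm) (hU l hl hli hlm)) ?_
      linear_combination s
    have hP1 : ∀ k ∈ v.1.1, ∀ l ∈ v.1.1, ∀ m ∈ v.1.1, k ≠ l → k ≠ m → l ≠ m →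
        (X l - X k) * tripleDiff x k m l = (X m - X k) * tripleDiff x k l m :=
      fun k hk l hl m hm => hx.sub_mul_tripleDiff hXi hc hk hl hm
    refine ⟨X, hP1, fun h => absurd h hl1, fun k hk l hl hkl => ?_⟩
    obtain ⟨f, hf, hvf⟩ := hx.exists_center hk
    constructor
    · intro hne
      rcases f with _ | p
      · exact absurd (hvf ▸ toBall_none_level k) hl1
      rw [hvf]
      refine (hx.ballVertex_le hf (by simpa using hkl.symm)).2 ?_
      by_cases hpl : p = l
      · exact Or.inl hpl
      refine Or.inr fun h0 => ?_
      have hpk : p ≠ k := by simpa using hf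
      have hpv : p ∈ v.1.1 := by
        rw [hvf]; exact mem_ball.2 (Or.inr (distLE_refl _ _ _))
      have h1 := hP1 k hk l hl p hpv hkl hpk.symm (Ne.symm hpl)
      rw [h0, mul_zero, mul_eq_zero] at h1
      exact tripleDiff_ne_zero x hkl hpk.symm (Ne.symm hpl)
        ⟨h0, h1.resolve_left (sub_ne_zero.2 hne.symm)⟩
    · intro hle heq
      -- Both `0` and `1` occur as positions, so some marking is away from the common position of
      -- `z_k` and `z_l`.
      have : ∃ p ∈ v.1.1, X p ≠ X k := by
        by_cases h0 : X k = 0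
        · exact ⟨m, hmv, by rw [h0, hXM]; exact one_ne_zero⟩
        · exact ⟨i, hiv, by rw [hXi]; exact Ne.symm h0⟩
      obtain ⟨p, hp, hpk⟩ := this
      have h1 : p ≠ k := fun h => hpk (by rw [h])
      have h2 : p ≠ l := fun h => hpk (by rw [h, heq])
      have h3 := hP1 k hk l hl p hp hkl (Ne.symm h1) (Ne.symm h2)
      rw [heq, sub_self, zero_mul, ← heq] at h3
      have h4 := (mul_eq_zero.1 h3.symm).resolve_left (sub_ne_zero.2 hpk)
      have h5 := (mem_ball.1 (hle.1 hp)).resolve_left h1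
      exact h5.resolve_left h2 h4

end Reconstruction

/-! ### Counting special points through the markings behind a component -/

namespace NodalLine

variable {K : Type} [Field K] {n : ℕ} {C : NodalLine K n}

open Classical in
/-- The special point of `v` in the direction of a marking behind `v`. -/
theorem exists_special {v : C.V} {i : Fin n} (h : C.comp i ≤ v) :
    ∃ s : {w : C.V // w ⋖ v} ⊕ {i : Fin n // C.comp i = v},
      C.fpt v i = Sum.elim (fun w => C.node w.1) (fun i => C.mark i.1) s := by
  rcases h.eq_or_lt with h | h
  · exact ⟨.inr ⟨i, h⟩, fpt_of_eq h⟩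
  · exact ⟨.inl ⟨_, child_covBy h⟩, fpt_of_covBy (child_covBy h) (le_child h)⟩

theorem numSpecial_eq (v : C.V) :
    C.numSpecial v = 1 + Nat.card ({w : C.V // w ⋖ v} ⊕ {i : Fin n // C.comp i = v}) := by
  rw [Nat.card_sum, numSpecial, add_assoc]

theorem two_le_numSpecial_of_comp_le {v : C.V} {i : Fin n} (h : C.comp i ≤ v) :
    2 ≤ C.numSpecial v := by
  obtain ⟨s, -⟩ := exists_special h
  have : Nonempty ({w : C.V // w ⋖ v} ⊕ {i : Fin n // C.comp i = v}) := ⟨s⟩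
  have := Nat.card_pos (α := {w : C.V // w ⋖ v} ⊕ {i : Fin n // C.comp i = v})
  rw [numSpecial_eq]
  omega

theorem three_le_numSpecial_of_fpt_ne {v : C.V} {i j : Fin n} (hi : C.comp i ≤ v)
    (hj : C.comp j ≤ v) (h : C.fpt v i ≠ C.fpt v j) : 3 ≤ C.numSpecial v := by
  obtain ⟨s, hs⟩ := exists_special hi
  obtain ⟨t, ht⟩ := exists_special hj
  have : Nontrivial ({w : C.V // w ⋖ v} ⊕ {i : Fin n // C.comp i = v}) :=
    ⟨s, t, fun hst => h (by rw [hs, ht, hst])⟩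
  have := Finite.one_lt_card_iff_nontrivial.2 this
  rw [numSpecial_eq]
  omega

/-- The components separating `z_i` from `z_j` and `z_i` from `z_k` both lie above that of `z_i`;
the larger of the two has all three markings behind it. -/
theorem exists_not_all_fpt_eq {i j k : Fin n} (hij : i ≠ j) (hik : i ≠ k) :
    ∃ v, C.comp i ≤ v ∧ C.comp j ≤ v ∧ C.comp k ≤ v ∧
      ¬ (C.fpt v i = C.fpt v j ∧ C.fpt v i = C.fpt v k) := by
  obtain ⟨v, h1, h2, h3⟩ := C.exists_fpt_ne hij
  obtain ⟨w, h1', h2', h3'⟩ := C.exists_fpt_ne hik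
  rcases C.chain _ _ _ h1 h1' with h | h
  · exact ⟨w, h1', h2.trans h, h2', fun hh => h3' hh.2⟩
  · exact ⟨v, h1, h2, h2'.trans h, fun hh => h3 hh.1⟩

end NodalLine

/-! ### The curve whose components are the balls -/

section Reconstruction

variable {K : Type} [Field K] {n : ℕ} {x : Index n → OnePoint K}

/-- The form on a component of given level. -/
def levelScale (l : ℕ) : OnePoint K :=
  if l = 0 then ((0 : K) : OnePoint K) else if l = 1 then ((1 : K) : OnePoint K) else ∞

theorem levelScale_zero : levelScale 0 = ((0 : K) : OnePoint K) := rfl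
theorem levelScale_one : levelScale 1 = ((1 : K) : OnePoint K) := rfl
theorem levelScale_of_two_le {l : ℕ} (h : 2 ≤ l) : levelScale l = (∞ : OnePoint K) := by
  rw [levelScale, if_neg (by omega), if_neg (by omega)]

theorem nondegenerate_levelScale (l : ℕ) :
    Nondegenerate (levelScale l : OnePoint K) ↔ l = 1 := by
  obtain rfl | rfl | h : l = 0 ∨ l = 1 ∨ 2 ≤ l := by omega
  · simp [levelScale_zero, Nondegenerate]
  · simp [levelScale_one, Nondegenerate]
  · rw [levelScale_of_two_le h]
    simp only [Nondegenerate, ne_eq, not_true_eq_false, and_false, false_iff]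
    omega

open Classical in
/-- The scaled line whose components are the balls defined by the coordinates `x`. -/
theorem IsConsistent.exists_ballLine (hx : IsConsistent x) (hn : 1 ≤ n)
    {X : BallTree x → Fin n → K} (hX3 : ∀ v, ∀ k ∈ v.1.1, ∀ l ∈ v.1.1, ∀ hkl : k ≠ l,
      (X v k ≠ X v l ↔ v ≤ toBall x k (some l) (by simpa using hkl.symm))) :
    ∃ (C : ScaledLine K n) (F : C.V → BallTree x),
      (∀ v k, C.comp k ≤ v ↔ k ∈ (F v).1.1) ∧
      (∀ v k, k ∈ (F v).1.1 → C.fpt v k = X (F v) k) ∧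
      ∀ v, C.scale v = levelScale (F v).1.2 := by
  obtain ⟨t, ht⟩ := hx.exists_greatest hn
  -- The marking `z_i` is put on the smallest ball `c i` that contains it; `r v` is an arbitrary
  -- marking in the ball `v`.
  choose c hc hcl using hx.exists_least
  choose r hr using fun v : BallTree x => v.exists_mem
  let _ : OrderTop (BallTree x) := { top := t, le_top := ht }
  have hcle : ∀ i (v : BallTree x), c i ≤ v ↔ i ∈ v.1.1 := fun i v =>
    ⟨fun h => h.1 (hc i), hcl i v⟩
  -- This statement and the next one say that two distinct markings have the same position on `v`
  -- exactly if a strictly smaller ball contains both. The distinctness of nodes and markings is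
  -- deduced from this.
  have hXeq : ∀ {v w : BallTree x} {k l : Fin n}, w < v → k ∈ w.1.1 → l ∈ w.1.1 →
      X v k = X v l := by
    intro v w k l hw hk hl
    by_cases hkl : k = l
    · rw [hkl]
    by_contra hne
    have h1 := (hX3 v k (hw.le.1 hk) l (hw.le.1 hl) hkl).1 hne
    exact absurd (h1.trans (hx.pair_le hkl hk hl)) (not_le_of_gt hw)
  have hXne : ∀ {v : BallTree x} {k l : Fin n}, k ∈ v.1.1 → l ∈ v.1.1 → k ≠ l →
      X v k = X v l → ∃ w : BallTree x, w < v ∧ k ∈ w.1.1 ∧ l ∈ w.1.1 := by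
    intro v k l hk hl hkl he
    have h1 : ¬ v ≤ toBall x k (some l) (by simpa using hkl.symm) :=
      fun h => (hX3 v k hk l hl hkl).2 h he
    exact ⟨_, lt_of_le_of_ne (hx.pair_le hkl hk hl) (fun h => h1 h.ge), mem_toBall _,
      mem_ball.2 (Or.inr (distLE_refl _ _ _))⟩
  have hchain : ∀ u v w : BallTree x, u ≤ v → u ≤ w → v ≤ w ∨ w ≤ v := fun u v w hv hw =>
    hx.le_total (hv.1 (hr u)) (hw.1 (hr u))
  have huniq : ∀ {v w u : BallTree x}, v ⋖ u → w ⋖ u → ∀ i, i ∈ v.1.1 → i ∈ w.1.1 → v = w := by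
    intro v w u hv hw i hiv hiw
    rcases hx.le_total hiv hiw with h | h
    · rcases h.eq_or_lt with h | h
      · exact h
      · exact absurd hw.lt (hv.2 h)
    · rcases h.eq_or_lt with h | h
      · exact h.symm
      · exact absurd hv.lt (hw.2 h)
  have hbelow : ∀ {v w u : BallTree x}, v ⋖ u → w < u → ∀ i, i ∈ v.1.1 → i ∈ w.1.1 → w ≤ v := by
    intro v w u hv hw i hiv hiw
    rcases hx.le_total hiv hiw with h | h
    · rcases h.eq_or_lt with h | h
      · exact h.ge
      · exact absurd hw (hv.2 h)
    · exact h
  -- The node lies at the common position, on the next larger ball, of all markings in `w`.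
  let nd : BallTree x → K := fun w => if h : ∃ u, w ⋖ u then X h.choose (r w) else 0
  have hnd : ∀ {w u : BallTree x}, w ⋖ u → nd w = X u (r w) := by
    intro w u h
    have h' : ∃ u, w ⋖ u := ⟨u, h⟩
    simp only [nd, dif_pos h']
    have h1 := h'.choose_spec
    congr 1
    rcases hchain w _ _ h1.le h.le with hh | hh
    · rcases hh.eq_or_lt with h2 | h2
      · rw [h2]
      · exact absurd h2 (h.2 h1.lt)
    · rcases hh.eq_or_lt with h2 | h2
      · rw [← h2]
      · exact absurd h2 (h1.2 h.lt)
  let N : NodalLine K n :=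
    { V := BallTree x
      chain := hchain
      node := nd
      comp := c
      mark := fun i => X (c i) i
      node_ne_node := by
        intro u v w hv hw hne he
        rw [hnd hv, hnd hw] at he
        have h1 : r v ≠ r w := fun h => hne (huniq hv hw (r v) (hr v) (h ▸ hr w))
        obtain ⟨y, hy, hy1, hy2⟩ := hXne (hv.le.1 (hr v)) (hw.le.1 (hr w)) h1 he
        exact hne (huniq hv hw (r w) ((hbelow hv hy (r v) (hr v) hy1).1 hy2) (hr w))
      node_ne_mark := by
        rintro u v i hv rfl he
        rw [hnd hv] at he
        have h1 : i ∉ v.1.1 := fun h => absurd hv.lt (not_lt_of_ge (hcl i v h))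
        have h2 : r v ≠ i := fun h => h1 (h ▸ hr v)
        obtain ⟨y, hy, hy1, hy2⟩ := hXne (hv.le.1 (hr v)) (hc i) h2 he
        exact absurd hy (not_lt_of_ge (hcl i y hy2))
      mark_ne_mark := by
        intro i j hij hc' he
        have hj : j ∈ (c i).1.1 := by rw [hc']; exact hc j
        rw [← hc'] at he
        obtain ⟨y, hy, hy1, hy2⟩ := hXne (hc i) hj hij he
        exact absurd hy (not_lt_of_ge (hcl i y hy1)) }
  have hfpt : ∀ (v : BallTree x) (k : Fin n), k ∈ v.1.1 → N.fpt v k = X v k := by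
    intro v k hk
    rcases (hcl k v hk).eq_or_lt with h | h
    · rw [NodalLine.fpt_of_eq (C := N) h]
      change X (c k) k = X v k
      rw [h]
    · obtain ⟨w, hw, hle⟩ := NodalLine.exists_child (C := N) h
      rw [NodalLine.fpt_of_covBy hw hle]
      exact (hnd hw).trans (hXeq hw.lt (hr w) (hle.1 (hc k)))
  let C : ScaledLine K n :=
    { toNodalLine := N
      scale := fun v => levelScale v.1.2
      colored_path := by
        intro i
        refine ⟨toBall x i none (by simp), ⟨(hcle i _).2 (mem_toBall _), ?_⟩, ?_⟩
        · exact (nondegenerate_levelScale _).2 (toBall_none_level i)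
        · rintro v ⟨h1, h2⟩
          exact hx.level_eq_one ((nondegenerate_levelScale _).1 h2) ((hcle i v).1 h1)
      scale_above := by
        intro v w hv hlt
        rw [nondegenerate_levelScale] at hv
        have h1 : v.1.2 ≤ w.1.2 := hlt.le.2
        have h2 : w.1.2 ≠ 1 := fun h => hlt.ne
          ((hx.level_eq_one hv (hr v)).trans (hx.level_eq_one h (hlt.le.1 (hr v))).symm)
        exact levelScale_of_two_le (by omega)
      scale_below := by
        intro v w hv hlt
        rw [nondegenerate_levelScale] at hv
        have h1 : w.1.2 ≤ v.1.2 := hlt.le.2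
        have h2 : w.1.2 ≠ 1 := fun h => hlt.ne
          ((hx.level_eq_one h (hr w)).trans (hx.level_eq_one hv (hlt.le.1 (hr w))).symm)
        rw [show w.1.2 = 0 by omega, levelScale_zero]
      stable_colored := fun v _ =>
        NodalLine.two_le_numSpecial_of_comp_le (C := N) ((hcle (r v) v).2 (hr v))
      stable_uncolored := by
        intro v hv
        rw [nondegenerate_levelScale] at hv
        obtain ⟨e, he, hve⟩ := hx.exists_center (hr v)
        rcases e with _ | j
        · exact absurd (hve ▸ toBall_none_level (r v)) hv
        have hj : j ∈ v.1.1 := by rw [hve]; exact mem_ball.2 (Or.inr (distLE_refl _ _ _))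
        have hne := (hX3 v _ (hr v) j hj (fun h => he (by rw [← h]))).2 hve.le
        refine NodalLine.three_le_numSpecial_of_fpt_ne (C := N) ((hcle (r v) v).2 (hr v))
          ((hcle j v).2 hj) ?_
        rwa [hfpt v _ (hr v), hfpt v _ hj] }
  exact ⟨C, id, fun v k => hcle k v, hfpt, fun _ => rfl⟩

open Classical in
/-- Every consistent system of coordinates is that of a scaled line. -/
theorem IsConsistent.exists_scaledLine (hx : IsConsistent x) (hn : 1 ≤ n) :
    ∃ C : ScaledLine K n, (∀ q : Fin 4 ↪o Fin (n + 1), q 0 = 0 → C.rho (.inl q) = x (.inl q)) ∧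
      ∀ p : Fin 2 ↪o Fin n, C.rho (.inr p) = x (.inr p) := by
  choose X hX1 hX2 hX3 using hx.exists_position
  obtain ⟨C, F, hcle, hfpt, hsc⟩ := hx.exists_ballLine hn hX3
  refine ⟨C, ?_, ?_⟩
  · intro q h0
    have hs : ∀ s, s ≠ 0 → ∃ a : Fin n, q s = a.succ := by
      intro s hs
      have hne : q s ≠ 0 := fun h' => hs (q.injective (h'.trans h0.symm))
      obtain ⟨a, ha⟩ := Fin.exists_succ_eq.2 hne
      exact ⟨a, ha.symm⟩
    obtain ⟨i, h1⟩ := hs 1 (by decide)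
    obtain ⟨j, h2⟩ := hs 2 (by decide)
    obtain ⟨k, h3⟩ := hs 3 (by decide)
    have hij : i ≠ j := by
      rintro rfl
      exact absurd (q.injective (h1.trans h2.symm)) (by decide)
    have hik : i ≠ k := by
      rintro rfl
      exact absurd (q.injective (h1.trans h3.symm)) (by decide)
    have hjk : j ≠ k := by
      rintro rfl
      exact absurd (q.injective (h2.trans h3.symm)) (by decide)
    rw [apply_inl_eq C.rho q i j k h0 h1 h2 h3, apply_inl_eq x q i j k h0 h1 h2 h3]
    obtain ⟨v, hi, hj, hk, hne⟩ := NodalLine.exists_not_all_fpt_eq (C := C.toNodalLine) hij hik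
    obtain ⟨s, hs, e1, -, e3⟩ := ScaledLine.tripleDiff_rho (C := C) hij hik hjk hi hj hk hne
    have hi' := (hcle v i).1 hi
    have hj' := (hcle v j).1 hj
    have hk' := (hcle v k).1 hk
    have hne' := hne
    rw [hfpt v i hi', hfpt v j hj', hfpt v k hk'] at hne'
    have f1 := hX1 (F v) i hi' j hj' k hk' hij hik hjk
    rw [hfpt v j hj', hfpt v i hi'] at e1
    rw [hfpt v j hj', hfpt v k hk'] at e3
    rw [e1, e3, tripleDiff_rotate x i j k]
    -- On the component where the three markings do not all coincide, the positions were chosen so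
    -- that their differences are proportional to those prescribed by `x`.
    refine ofPair_eq_of_mul_eq ?_ ?_ ?_
    · rintro ⟨g1, g2⟩
      have g1' := sub_eq_zero.1 ((mul_eq_zero.1 g1).resolve_left hs)
      have g2' := sub_eq_zero.1 ((mul_eq_zero.1 (neg_eq_zero.1 g2)).resolve_left hs)
      exact hne' ⟨g1'.symm, (g2'.trans g1').symm⟩
    · rintro ⟨g1, g2⟩
      rw [g1, sub_zero, neg_eq_zero] at g2
      exact tripleDiff_ne_zero x hij hik hjk ⟨g1, g2⟩
    · linear_combination (-s) * f1
  · intro p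
    have hp : p 0 ≠ p 1 := p.injective.ne (by decide)
    set i := p 0 with hi0
    set j := p 1 with hj0
    rw [apply_inr_eq C.rho p, apply_inr_eq x p, ← hi0, ← hj0]
    obtain ⟨v, hi, hj, hne⟩ := C.exists_fpt_ne hp
    obtain ⟨s, hs, e1, e2⟩ := ScaledLine.pair_rho (C := C) hi hj hne
    have hi' := (hcle v i).1 hi
    have hj' := (hcle v j).1 hj
    rw [hfpt v i hi', hfpt v j hj'] at hne
    rw [hfpt v j hj', hfpt v i hi'] at e2
    -- The component that separates two markings is the smallest ball containing both, so its level
    -- is determined by `ρ_{ij}`.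
    have hv : F v = toBall x i (some j) (by simpa using hp.symm) :=
      le_antisymm ((hX3 (F v) i hi' j hj' hp).1 hne) (hx.pair_le hp hi' hj')
    have hlev : (F v).1.2 = ballLevel x i (some j) := by rw [hv]; rfl
    have hdis : (pairDiff x i j = 0 → (F v).1.2 = 0) ∧ (pairUnit x i j = 0 → (F v).1.2 = 2) ∧
        (pairDiff x i j ≠ 0 → pairUnit x i j ≠ 0 → (F v).1.2 = 1) := by
      rw [hlev]
      have hnz := pair_ne_zero x i j
      have d1 : distLE x i none (some j) ↔ pairDiff x i j ≠ 0 := Iff.rfl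
      have d2 : distLE x i (some j) none ↔ pairUnit x i j ≠ 0 := Iff.rfl
      unfold ballLevel
      refine ⟨fun h => ?_, fun h => ?_, fun h h' => ?_⟩
      · rw [if_neg (mt d1.1 (not_not.2 h)), if_pos (d2.2 fun h' => hnz ⟨h', h⟩)]
      · rw [if_pos (d1.2 fun h' => hnz ⟨h, h'⟩), if_neg (mt d2.1 (not_not.2 h))]
      · rw [if_pos (d1.2 h), if_pos (d2.2 h')]
    have hne0 : X (F v) j - X (F v) i ≠ 0 := sub_ne_zero.2 hne.symm
    have hscv := hsc v
    rw [e1, e2, hscv]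
    by_cases hd : pairDiff x i j = 0
    · have hl := hdis.1 hd
      rw [hl, levelScale_zero, hd]
      simp [ofPair]
    by_cases hu : pairUnit x i j = 0
    · have hl := hdis.2.1 hu
      rw [hl, levelScale_of_two_le le_rfl, hu, ofPair_of_ne _ hd, homPair_infty_one, homPair_infty_zero, mul_zero, one_mul,
        ofPair_of_ne _ (mul_ne_zero hs hne0), zero_div, zero_div]
    · have hl := hdis.2.2 hd hu
      have f2 := hX2 (F v) hl i hi' j hj'
      rw [hl, levelScale_one, homPair_coe_one, homPair_coe_zero, one_mul]
      refine ofPair_eq_of_mul_eq ?_ (pair_ne_zero x i j) ?_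
      · rintro ⟨g1, -⟩
        exact hs (by simpa using g1)
      · rw [← f2]; ring

end Reconstruction

/-! ### Smoothing the nodes of a curve -/

namespace NodalLine

variable {K : Type} [Field K] {n : ℕ} {C : NodalLine K n}

section Frames

variable {R : Type} [CommRing R]

open Classical in
/-- The position, in the coordinate of the component `u`, of the point `x` of the component `p`,
if `w` is glued into the next component at `nd w` with gluing parameter `t w`. -/
def pos (t nd : C.V → R) (p : C.V) (x : R) (u : C.V) : R :=
  if p = u then x
  else if _h : p < u then nd (C.child u p) + t (C.child u p) * pos t nd p x (C.child u p)
  else 0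
termination_by (wellFounded_lt : WellFounded ((· < ·) : C.V → C.V → Prop)).wrap u
decreasing_by exact child_lt _h

open Classical in
/-- The product of the gluing parameters on the path from `p` to `u`. -/
def glue (t : C.V → R) (p u : C.V) : R :=
  if p = u then 1
  else if _h : p < u then t (C.child u p) * glue t p (C.child u p)
  else 0
termination_by (wellFounded_lt : WellFounded ((· < ·) : C.V → C.V → Prop)).wrap u
decreasing_by exact child_lt _h

theorem pos_self (t nd : C.V → R) (p : C.V) (x : R) : pos t nd p x p = x := by
  rw [pos, if_pos rfl]

theorem pos_of_lt (t nd : C.V → R) {p u : C.V} (x : R) (h : p < u) :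
    pos t nd p x u = nd (C.child u p) + t (C.child u p) * pos t nd p x (C.child u p) := by
  rw [pos, if_neg h.ne, dif_pos h]

theorem glue_self (t : C.V → R) (p : C.V) : glue t p p = 1 := by
  rw [glue, if_pos rfl]

theorem glue_of_lt (t : C.V → R) {p u : C.V} (h : p < u) :
    glue t p u = t (C.child u p) * glue t p (C.child u p) := by
  rw [glue, if_neg h.ne, dif_pos h]

theorem pos_eq (t nd : C.V → R) {p u : C.V} (x : R) (h : p ≤ u) :
    pos t nd p x u = glue t p u * x + pos t nd p 0 u := by
  induction u using WellFoundedLT.induction with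
  | ind u ih =>
    rcases h.eq_or_lt with h | h
    · subst h; simp [pos_self, glue_self]
    · rw [pos_of_lt t nd x h, pos_of_lt t nd 0 h, glue_of_lt t h, ih _ (child_lt h) (le_child h)]
      ring

theorem pos_trans (t nd : C.V → R) {p v u : C.V} (x : R) (h : p ≤ v) (h' : v ≤ u) :
    pos t nd p x u = pos t nd v (pos t nd p x v) u := by
  induction u using WellFoundedLT.induction with
  | ind u ih =>
    rcases h'.eq_or_lt with h' | h'
    · subst h'; rw [pos_self]
    · have hc : C.child u p = C.child u v := child_eq (child_covBy h') (h.trans (le_child h'))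
      rw [pos_of_lt t nd x (h.trans_lt h'), pos_of_lt t nd _ h', hc, ih _ (child_lt h')
        (le_child h')]

theorem pos_of_not_le (t nd : C.V → R) {p u : C.V} (x : R) (h : ¬ p ≤ u) : pos t nd p x u = 0 := by
  rw [pos, if_neg fun he => h he.le, dif_neg fun hl => h hl.le]

theorem glue_of_not_le (t : C.V → R) {p u : C.V} (h : ¬ p ≤ u) : glue t p u = 0 := by
  rw [glue, if_neg fun he => h he.le, dif_neg fun hl => h hl.le]

theorem map_pos {S : Type} [CommRing S] (φ : R →+* S) (t nd : C.V → R) (p : C.V) (x : R)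
    (u : C.V) : φ (pos t nd p x u) = pos (fun v => φ (t v)) (fun v => φ (nd v)) p (φ x) u := by
  induction u using WellFoundedLT.induction with
  | ind u ih =>
    by_cases h : p ≤ u
    · rcases h.eq_or_lt with h | h
      · subst h; rw [pos_self, pos_self]
      · rw [pos_of_lt _ _ _ h, pos_of_lt _ _ _ h, map_add, map_mul, ih _ (child_lt h)]
    · rw [pos_of_not_le _ _ _ h, pos_of_not_le _ _ _ h, map_zero]

theorem map_glue {S : Type} [CommRing S] (φ : R →+* S) (t : C.V → R) (p u : C.V) :
    φ (glue t p u) = glue (fun v => φ (t v)) p u := by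
  induction u using WellFoundedLT.induction with
  | ind u ih =>
    by_cases h : p ≤ u
    · rcases h.eq_or_lt with h | h
      · subst h; rw [glue_self, glue_self, map_one]
      · rw [glue_of_lt _ h, glue_of_lt _ h, map_mul, ih _ (child_lt h)]
    · rw [glue_of_not_le _ h, glue_of_not_le _ h, map_zero]

theorem pos_zero_of_lt {t : C.V → R} (ht : ∀ w u, w ⋖ u → t w = 0) (nd : C.V → R) {p u : C.V}
    (x : R) (h : p < u) : pos t nd p x u = nd (C.child u p) := by
  rw [pos_of_lt t nd x h, ht _ _ (child_covBy h), zero_mul, add_zero]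

theorem glue_zero_of_lt {t : C.V → R} (ht : ∀ w u, w ⋖ u → t w = 0) {p u : C.V} (h : p < u) :
    glue t p u = 0 := by
  rw [glue_of_lt t h, ht _ _ (child_covBy h), zero_mul]

/-- The hypothesis says `t w = d w / d u` without division, so the product along a path telescopes.
-/
theorem glue_mul {t d : C.V → R} (ht : ∀ w u, w ⋖ u → t w * d u = d w) {p u : C.V} (h : p ≤ u) :
    glue t p u * d u = d p := by
  induction u using WellFoundedLT.induction with
  | ind u ih =>
    rcases h.eq_or_lt with h | h
    · subst h; rw [glue_self, one_mul]
    · rw [glue_of_lt t h, mul_right_comm, ht _ _ (child_covBy h), mul_comm,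
        ih _ (child_lt h) (le_child h)]

variable (C) in
/-- Homogeneous coordinates of a marking, as seen from the component `m`. -/
def homPos (t nd : C.V → R) (mk : Fin n → R) (m : C.V) : Fin (n + 1) → Fin 2 → R :=
  Fin.cases ![1, 0] fun i =>
    -- The marking and the origin of `m` are both expressed in the coordinate of their join.
    -- Dividing by the slope would give the position in the coordinate of `m`; the homogeneous form
    -- also makes sense if the slope is zero, and then gives `∞`.
    ![pos t nd (C.comp i) (mk i) (C.join m (C.comp i)) - pos t nd m 0 (C.join m (C.comp i)),
      glue t m (C.join m (C.comp i))]

theorem map_homPos {S : Type} [CommRing S] (φ : R →+* S) (t nd : C.V → R) (mk : Fin n → R)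
    (m : C.V) (a : Fin (n + 1)) (s : Fin 2) : φ (C.homPos t nd mk m a s) =
      C.homPos (fun v => φ (t v)) (fun v => φ (nd v)) (fun i => φ (mk i)) m a s := by
  refine Fin.cases ?_ (fun i => ?_) a <;> fin_cases s <;>
    simp [homPos, map_pos, map_glue]

end Frames

theorem pos_zero_eq_fpt {t : C.V → K} (ht : ∀ w u, w ⋖ u → t w = 0) {i : Fin n} {u : C.V}
    (h : C.comp i ≤ u) : pos t C.node (C.comp i) (C.mark i) u = C.fpt u i := by
  rcases h.eq_or_lt with h | h
  · rw [← h, pos_self, fpt_of_eq rfl]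
  · rw [pos_zero_of_lt ht _ _ h, fpt_of_covBy (child_covBy h) (le_child h)]

/-- If all gluing parameters are zero, one sees the nodal curve. -/
theorem exists_homPos_zero {t : C.V → K} (ht : ∀ w u, w ⋖ u → t w = 0) (m : C.V)
    (a : Fin (n + 1)) :
    ∃ c : K, c ≠ 0 ∧ ∀ s, C.homPos t C.node C.mark m a s = c * homPair (C.pt m a) s := by
  refine Fin.cases ⟨1, one_ne_zero, fun s => ?_⟩ (fun i => ?_) a
  · fin_cases s <;> simp [homPos]
  by_cases h : C.comp i ≤ m
  · refine ⟨1, one_ne_zero, fun s => ?_⟩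
    have hj := join_eq_left h
    rw [pt_succ_of_le h]
    fin_cases s
    · simp [homPos, hj, pos_self, pos_zero_eq_fpt ht h]
    · simp [homPos, hj, glue_self]
  · have hlt : m < C.join m (C.comp i) := by
      refine lt_of_le_of_ne (le_join_left _ _) fun he => h ?_
      rw [he]; exact le_join_right _ _
    set u := C.join m (C.comp i) with hu
    -- A marking that is not behind `m` has slope zero. The numerator does not vanish, because on
    -- the join the marking and `m` lie in the directions of different special points.
    have hne : pos t C.node (C.comp i) (C.mark i) u - pos t C.node m 0 u ≠ 0 := by
      rw [pos_zero_of_lt ht _ _ hlt, sub_ne_zero]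
      rcases (le_join_right m (C.comp i)).eq_or_lt with h1 | h1
      · rw [← hu] at h1
        rw [← h1, pos_self, h1]
        exact (C.node_ne_mark _ _ _ (child_covBy hlt) h1).symm
      · rw [pos_zero_of_lt ht _ _ h1]
        exact C.node_ne_node _ _ _ (child_covBy h1) (child_covBy hlt) (child_join_ne hlt h1).symm
    refine ⟨_, hne, fun s => ?_⟩
    rw [pt_succ_of_not_le h]
    fin_cases s
    · simp [homPos, ← hu]
    · simp [homPos, ← hu, glue_zero_of_lt ht hlt]

variable (C) in
/-- The markings on the smoothed curve, if `d v` is the unit of the coordinate on `v`. -/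
def smoothPt (t nd d : C.V → K) (mk : Fin n → K) (i : Fin n) : K :=
  d ⊤ * pos t nd (C.comp i) (mk i) ⊤

/-- Multiplied by their units, the coordinates on all components of the glued curve agree up to
translation. Differences on the smoothed line can hence be computed on any component behind which
both markings lie. -/
theorem mul_pos_sub {t nd d : C.V → K} (ht : ∀ w u, w ⋖ u → t w * d u = d w) {p v : C.V} (x : K)
    (h : p ≤ v) : d ⊤ * pos t nd p x ⊤ = d v * pos t nd p x v + d ⊤ * pos t nd v 0 ⊤ := by
  rw [pos_trans t nd x h le_top, pos_eq t nd _ (le_top : v ≤ ⊤), ← glue_mul ht (le_top : v ≤ ⊤)]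
  ring

theorem smoothPt_sub {t nd d : C.V → K} (ht : ∀ w u, w ⋖ u → t w * d u = d w) (mk : Fin n → K)
    {i j : Fin n} {v : C.V} (hi : C.comp i ≤ v) (hj : C.comp j ≤ v) :
    C.smoothPt t nd d mk j - C.smoothPt t nd d mk i =
      d v * (pos t nd (C.comp j) (mk j) v - pos t nd (C.comp i) (mk i) v) := by
  unfold smoothPt
  rw [mul_pos_sub ht _ hi, mul_pos_sub ht _ hj]
  ring

/-- If the gluing parameters are nonzero, one sees the smoothed curve. -/
theorem homPos_eq_of_smooth {t nd d : C.V → K}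
    (ht : ∀ w u, w ⋖ u → t w * d u = d w) (mk : Fin n → K) (m : C.V) (i : Fin n) :
    d (C.join m (C.comp i)) * C.homPos t nd mk m i.succ 0 =
      C.smoothPt t nd d mk i - d ⊤ * pos t nd m 0 ⊤ ∧
    d (C.join m (C.comp i)) * C.homPos t nd mk m i.succ 1 = d m := by
  constructor
  · unfold smoothPt
    rw [mul_pos_sub ht _ (le_join_right m (C.comp i)), mul_pos_sub ht 0 (le_join_left m (C.comp i))]
    simp [homPos]
    ring
  · rw [mul_comm]
    exact glue_mul ht (le_join_left m (C.comp i))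

end NodalLine

namespace ScaledLine

open NodalLine

variable {K : Type} [Field K] {n : ℕ} (C : ScaledLine K n)

/-- A component on which three of four markings are separated. -/
def sep (q : Fin 4 ↪o Fin (n + 1)) : C.V := (C.exists_three_le_ncard q.injective).choose

theorem three_le_ncard_sep (q : Fin 4 ↪o Fin (n + 1)) :
    3 ≤ (Set.range fun t => C.pt (C.sep q) (q t)).ncard :=
  (C.exists_three_le_ncard q.injective).choose_spec

section

variable {R : Type} [CommRing R]

/-- Numerators of the coordinates of a smoothing. -/
def smoothNum (t nd : C.V → R) (mk : Fin n → R) : Index n → R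
  | .inl q =>
    let H := fun s => C.homPos t nd mk (C.sep q) (q s)
    (H 1 0 * H 2 1 - H 2 0 * H 1 1) * (H 3 0 * H 0 1 - H 0 0 * H 3 1)
  | .inr p =>
    let H := fun s => C.homPos t nd mk (C.col (p 0)) (p s).succ
    -- The positions are `H s 0 / H s 1`; the pair with the corresponding denominator below is `1 /
    -- (κ (z_j - z_i))`, cleared of fractions.
    H 1 1 * H 0 1

/-- Denominators of the coordinates of a smoothing; `κ` is the value of the form on the
coloured components. -/
def smoothDen (κ t nd : C.V → R) (mk : Fin n → R) : Index n → R
  | .inl q =>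
    let H := fun s => C.homPos t nd mk (C.sep q) (q s)
    (H 0 0 * H 1 1 - H 1 0 * H 0 1) * (H 2 0 * H 3 1 - H 3 0 * H 2 1)
  | .inr p =>
    let H := fun s => C.homPos t nd mk (C.col (p 0)) (p s).succ
    κ (C.col (p 0)) * (H 1 0 * H 0 1 - H 0 0 * H 1 1)

theorem map_smoothNum {S : Type} [CommRing S] (φ : R →+* S) (t nd : C.V → R) (mk : Fin n → R)
    (e : Index n) : φ (C.smoothNum t nd mk e) =
      C.smoothNum (fun v => φ (t v)) (fun v => φ (nd v)) (fun i => φ (mk i)) e := by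
  rcases e with q | p <;> simp [smoothNum, map_homPos]

theorem map_smoothDen {S : Type} [CommRing S] (φ : R →+* S) (κ t nd : C.V → R) (mk : Fin n → R)
    (e : Index n) : φ (C.smoothDen κ t nd mk e) = C.smoothDen (fun v => φ (κ v))
      (fun v => φ (t v)) (fun v => φ (nd v)) (fun i => φ (mk i)) e := by
  rcases e with q | p <;> simp [smoothDen, map_homPos]

end

variable {C}

/-- If all gluing parameters are zero, the coordinates are those of the nodal curve. -/
theorem smooth_zero {κ t : C.V → K} (ht : ∀ w u, w ⋖ u → t w = 0)
    (hκ : ∀ v, Nondegenerate (C.scale v) → C.scale v = (κ v : OnePoint K)) (e : Index n) :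
    ¬ (C.smoothNum t C.node C.mark e = 0 ∧ C.smoothDen κ t C.node C.mark e = 0) ∧
      ofPair (C.smoothNum t C.node C.mark e) (C.smoothDen κ t C.node C.mark e) = C.rho e := by
  rcases e with q | p
  · choose c hc h using fun s => exists_homPos_zero ht (C.sep q) (q s)
    have h3 := C.three_le_ncard_sep q
    have he := ofPair_eq_crossRatio hc h
    refine ⟨?_, ?_⟩
    · have hnz := crossRatio_pair_ne_zero h3
      rintro ⟨h1, h2⟩
      simp only [smoothNum, smoothDen, h] at h1 h2
      refine hnz ⟨?_, ?_⟩
      · refine (mul_eq_zero.1 (show (c 0 * c 1 * c 2 * c 3) * _ = 0 from ?_)).resolve_left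
          (by simp [hc])
        rw [← h1]; unfold bracket; ring
      · refine (mul_eq_zero.1 (show (c 0 * c 1 * c 2 * c 3) * _ = 0 from ?_)).resolve_left
          (by simp [hc])
        rw [← h2]; unfold bracket; ring
    · change _ = C.rhoFour q
      rw [rhoFour_eq h3, ← he]
      rfl
  · have hκ' := hκ _ (C.nondegenerate_col (p 0))
    have hκ0 : κ (C.col (p 0)) ≠ 0 := by
      intro h0
      rw [h0] at hκ'
      exact (C.nondegenerate_col (p 0)).1 hκ'
    obtain ⟨g1, g2⟩ := pair_rho_col (j := p 1) hκ'
    rw [apply_inr_eq C.rho p]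
    have hi := C.comp_le_col (p 0)
    have i0 : C.homPos t C.node C.mark (C.col (p 0)) (p 0).succ 0 = C.fpt (C.col (p 0)) (p 0) := by
      simp [homPos, join_eq_left hi, pos_self, pos_zero_eq_fpt ht hi]
    have i1 : C.homPos t C.node C.mark (C.col (p 0)) (p 0).succ 1 = 1 := by
      simp [homPos, join_eq_left hi, glue_self]
    simp only [smoothNum, smoothDen, i0, i1, mul_one]
    by_cases hj : C.comp (p 1) ≤ C.col (p 0)
    · have j0 : C.homPos t C.node C.mark (C.col (p 0)) (p 1).succ 0 =
          C.fpt (C.col (p 0)) (p 1) := by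
        simp [homPos, join_eq_left hj, pos_self, pos_zero_eq_fpt ht hj]
      have j1 : C.homPos t C.node C.mark (C.col (p 0)) (p 1).succ 1 = 1 := by
        simp [homPos, join_eq_left hj, glue_self]
      rw [j0, j1, (g1 hj).2]
      refine ⟨fun h => one_ne_zero h.1, ?_⟩
      rw [← ofPair_mul_mul _ 1 _ (g1 hj).1, mul_one, mul_one]
    -- A marking that is not behind the coloured component is seen from it at `∞`, so the numerator
    -- vanishes, in agreement with the vanishing of the unit.
    · obtain ⟨c, hc, h⟩ := exists_homPos_zero ht (C.col (p 0)) (p 1).succ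
      rw [pt_succ_of_not_le hj] at h
      have h0 := h 0
      have h1 := h 1
      rw [homPair_infty_zero, mul_one] at h0
      rw [homPair_infty_one, mul_zero] at h1
      have hu := g2 hj
      have hd : pairDiff C.rho (p 0) (p 1) ≠ 0 := fun h => pair_ne_zero _ _ _ ⟨hu, h⟩
      rw [h0, h1, hu, mul_zero, sub_zero, ofPair_of_ne _ (mul_ne_zero hκ0 hc), ofPair_of_ne _ hd,
        zero_div, zero_div]
      exact ⟨fun h => mul_ne_zero hκ0 hc h.2, rfl⟩

/-- If the gluing parameters are nonzero, the coordinates are those of the smoothed curve. -/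
theorem smooth_eq {κ t nd d : C.V → K} (hd : ∀ v, d v ≠ 0)
    (ht : ∀ w u, w ⋖ u → t w * d u = d w) (mk : Fin n → K)
    (hκ : ∀ v, Nondegenerate (C.scale v) → κ v = d v) (e : Index n) :
    ofPair (C.smoothNum t nd mk e) (C.smoothDen κ t nd mk e) =
      rhoOfPoints (C.smoothPt t nd d mk) e := by
  rcases e with q | p
  · set m := C.sep q
    -- These are the markings of the smoothed line in the coordinate of `m`. They differ from the
    -- markings in the common coordinate by an affine map, under which the cross-ratio is invariant.
    let w : Fin (n + 1) → OnePoint K := fun a =>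
      ((Fin.cases ∞ (fun i => ((C.smoothPt t nd d mk i : K) : OnePoint K)) a : OnePoint K)).map
        fun z => ((Units.mk0 (d m) (hd m))⁻¹ : Kˣ) * z + -(d ⊤ * pos t nd m 0 ⊤) / d m
    have hw : ∀ a, ∃ c : K, c ≠ 0 ∧ ∀ s, C.homPos t nd mk m a s = c * homPair (w a) s := by
      intro a
      refine Fin.cases ⟨1, one_ne_zero, fun s => ?_⟩ (fun i => ?_) a
      · fin_cases s <;> simp [homPos, w]
      · obtain ⟨h0, h1⟩ := homPos_eq_of_smooth ht (nd := nd) mk m i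
        have hu := hd (C.join m (C.comp i))
        have hm := hd m
        refine ⟨d m / d (C.join m (C.comp i)), div_ne_zero (hd _) (hd _), fun s => ?_⟩
        fin_cases s
        · simp only [w, Fin.cases_succ, OnePoint.map_some, Fin.zero_eta, homPair_coe_zero,
            Units.val_inv_eq_inv_val, Units.val_mk0]
          rw [div_mul_eq_mul_div, eq_div_iff hu, mul_comm, h0]
          field_simp
          ring
        · simp only [w, Fin.cases_succ, OnePoint.map_some, Fin.mk_one, homPair_coe_one, mul_one]
          rw [eq_div_iff hu, mul_comm, h1]
    choose c hc h using hw
    have he := ofPair_eq_crossRatio (fun s => hc (q s)) (fun s => h (q s))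
    rw [crossRatio_affine] at he
    exact he
  · have hc := hd (C.col (p 0))
    obtain ⟨h0, h1⟩ := homPos_eq_of_smooth ht (nd := nd) mk (C.col (p 0)) (p 0)
    obtain ⟨h0', h1'⟩ := homPos_eq_of_smooth ht (nd := nd) mk (C.col (p 0)) (p 1)
    have hu := hd (C.join (C.col (p 0)) (C.comp (p 0)))
    have hu' := hd (C.join (C.col (p 0)) (C.comp (p 1)))
    simp only [smoothNum, smoothDen, rhoOfPoints, hκ _ (C.nondegenerate_col (p 0))]
    rw [← ofPair_mul_mul (d (C.join (C.col (p 0)) (C.comp (p 0))) *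
      d (C.join (C.col (p 0)) (C.comp (p 1)))) _ _ (mul_ne_zero hu hu'),
      ← ofPair_mul_mul (d (C.col (p 0)) * d (C.col (p 0))) 1 _ (mul_ne_zero hc hc)]
    generalize C.homPos t nd mk (C.col (p 0)) (p 0).succ 0 = a0 at *
    generalize C.homPos t nd mk (C.col (p 0)) (p 0).succ 1 = a1 at *
    generalize C.homPos t nd mk (C.col (p 0)) (p 1).succ 0 = b0 at *
    generalize C.homPos t nd mk (C.col (p 0)) (p 1).succ 1 = b1 at *
    generalize d (C.join (C.col (p 0)) (C.comp (p 0))) = u at *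
    generalize d (C.join (C.col (p 0)) (C.comp (p 1))) = u' at *
    congr 1
    · linear_combination u' * b1 * h1 + d (C.col (p 0)) * h1'
    · linear_combination d (C.col (p 0)) * (u * a1 * h0' +
        (C.smoothPt t nd d mk (p 1) - d ⊤ * pos t nd (C.col (p 0)) 0 ⊤) * h1 - u' * b1 * h0 -
        (C.smoothPt t nd d mk (p 0) - d ⊤ * pos t nd (C.col (p 0)) 0 ⊤) * h1')

end ScaledLine

/-! ### Forms on products of projective lines -/

section Forms

open scoped Topology

variable {I J : Type}

/-- Multihomogeneous forms, as functions of the points of a product of projective lines. -/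
def IsForm (d : I →₀ ℕ) (f : (I → OnePoint ℂ) → ℂ) : Prop :=
  ∃ P, IsMultihomogeneous P d ∧ f = fun x => MvPolynomial.eval (homCoord x) P

namespace IsForm

variable {d e : I →₀ ℕ} {f g : (I → OnePoint ℂ) → ℂ}

theorem mul (hf : IsForm d f) (hg : IsForm e g) : IsForm (d + e) (fun x => f x * g x) := by
  obtain ⟨P, hP, rfl⟩ := hf
  obtain ⟨Q, hQ, rfl⟩ := hg
  exact ⟨P * Q, MvPolynomial.IsWeightedHomogeneous.mul hP hQ, by simp⟩

theorem add (hf : IsForm d f) (hg : IsForm d g) : IsForm d (fun x => f x + g x) := by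
  obtain ⟨P, hP, rfl⟩ := hf
  obtain ⟨Q, hQ, rfl⟩ := hg
  exact ⟨P + Q, (MvPolynomial.weightedHomogeneousSubmodule ℂ _ d).add_mem hP hQ, by simp⟩

theorem const_mul (c : ℂ) (hf : IsForm d f) : IsForm d (fun x => c * f x) := by
  obtain ⟨P, hP, rfl⟩ := hf
  exact ⟨c • P, (MvPolynomial.weightedHomogeneousSubmodule ℂ _ d).smul_mem c hP, by
    simp [MvPolynomial.smul_eval]⟩

theorem neg (hf : IsForm d f) : IsForm d (fun x => - f x) := by
  simpa using hf.const_mul (-1)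

theorem sub (hf : IsForm d f) (hg : IsForm d g) : IsForm d (fun x => f x - g x) := by
  simpa [sub_eq_add_neg] using hf.add hg.neg

theorem const (c : ℂ) : IsForm (0 : I →₀ ℕ) (fun _ => c) :=
  ⟨MvPolynomial.C c, MvPolynomial.isWeightedHomogeneous_C _ _, by simp⟩

theorem zero (d : I →₀ ℕ) : IsForm d (fun _ => 0) :=
  ⟨0, MvPolynomial.isWeightedHomogeneous_zero _ _ _, by simp⟩

theorem coord (i : I) (s : Fin 2) : IsForm (Finsupp.single i 1) (fun x => homPair (x i) s) :=
  ⟨MvPolynomial.X (i, s), MvPolynomial.isWeightedHomogeneous_X _ _ _, by simp [homCoord]⟩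

theorem prod {A : Type} (s : Finset A) {d : A → I →₀ ℕ} {f : A → (I → OnePoint ℂ) → ℂ}
    (h : ∀ a ∈ s, IsForm (d a) (f a)) : IsForm (∑ a ∈ s, d a) (fun x => ∏ a ∈ s, f a x) := by
  classical
  induction s using Finset.induction_on with
  | empty => simpa using const (I := I) 1
  | insert a s ha ih =>
    simp only [Finset.sum_insert ha, Finset.prod_insert ha]
    exact (h a (by simp)).mul (ih fun b hb => h b (by simp [hb]))

theorem sum {A : Type} (s : Finset A) {f : A → (I → OnePoint ℂ) → ℂ}
    (h : ∀ a ∈ s, IsForm d (f a)) : IsForm d (fun x => ∑ a ∈ s, f a x) := by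
  classical
  induction s using Finset.induction_on with
  | empty => simpa using zero d
  | insert a s ha ih =>
    simp only [Finset.sum_insert ha]
    exact (h a (by simp)).add (ih fun b hb => h b (by simp [hb]))

theorem pow (hf : IsForm d f) (k : ℕ) : IsForm (k • d) (fun x => f x ^ k) := by
  have := prod (Finset.range k) (fun _ _ => hf)
  simpa using this

theorem congr_deg (hf : IsForm d f) (h : d = e) : IsForm e f := h ▸ hf

end IsForm

/-- Every monomial has degree `e j` in the two variables of the factor `j`. So a weight that depends
only on the factor is the same for all monomials; this is used for degrees and, written
multiplicatively, for rescaling of homogeneous coordinates. -/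
theorem monomial_weight_sum {M : Type} [AddCommMonoid M] {e : J →₀ ℕ} {P : MvPolynomial (J × Fin 2) ℂ}
    (hP : IsMultihomogeneous P e) {m : J × Fin 2 →₀ ℕ} (hm : m ∈ P.support) (d : J → M) :
    (m.sum fun p k => k • d p.1) = e.sum fun j k => k • d j := by
  have h : Finsupp.weight (fun p : J × Fin 2 => Finsupp.single p.1 1) m = e :=
    hP (MvPolynomial.mem_support_iff.1 hm)
  rw [← h, Finsupp.weight_apply, Finsupp.sum_sum_index (h := fun j k => k • d j) (fun _ => zero_smul _ _) (fun _ _ _ => add_smul _ _ _)]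
  refine Finsupp.sum_congr fun p _ => ?_
  rw [Finsupp.smul_single, smul_eq_mul, mul_one, Finsupp.sum_single_index (h := fun j k => k • d j) (zero_smul _ _)]

theorem monomial_weight_prod {M : Type} [CommMonoid M] {e : J →₀ ℕ}
    {P : MvPolynomial (J × Fin 2) ℂ}
    (hP : IsMultihomogeneous P e) {m : J × Fin 2 →₀ ℕ} (hm : m ∈ P.support) (c : J → M) :
    (m.prod fun p k => c p.1 ^ k) = e.prod fun j k => c j ^ k :=
  monomial_weight_sum (M := Additive M) hP hm c

theorem eval_eq_sum (P : MvPolynomial (J × Fin 2) ℂ) (a : J × Fin 2 → ℂ) :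
    MvPolynomial.eval a P = ∑ m ∈ P.support, P.coeff m * m.prod fun p k => a p ^ k := by
  rw [MvPolynomial.eval_eq]; rfl

/-- Substitution of forms in a multihomogeneous polynomial. -/
theorem isForm_subst {e : J →₀ ℕ} {P : MvPolynomial (J × Fin 2) ℂ} (hP : IsMultihomogeneous P e)
    {d : J → I →₀ ℕ} {a : J × Fin 2 → (I → OnePoint ℂ) → ℂ} (ha : ∀ p, IsForm (d p.1) (a p)) :
    IsForm (e.sum fun j k => k • d j) (fun x => MvPolynomial.eval (fun p => a p x) P) := by
  simp only [eval_eq_sum]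
  refine IsForm.sum _ fun m hm => IsForm.const_mul _ ?_
  rw [← monomial_weight_sum hP hm]
  exact IsForm.prod _ fun p _ => (ha p).pow _

theorem eval_scale {e : J →₀ ℕ} {P : MvPolynomial (J × Fin 2) ℂ} (hP : IsMultihomogeneous P e)
    (c : J → ℂ) (a : J × Fin 2 → ℂ) :
    MvPolynomial.eval (fun p => c p.1 * a p) P =
      (e.prod fun j k => c j ^ k) * MvPolynomial.eval a P := by
  rw [eval_eq_sum, eval_eq_sum, Finset.mul_sum]
  refine Finset.sum_congr rfl fun m hm => ?_
  rw [← monomial_weight_prod hP hm, mul_left_comm, ← Finsupp.prod_mul]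
  simp only [mul_pow]

/-- Homogenization of polynomials in the coordinates of finite points. -/
theorem exists_homogenization [Fintype J] (P Q : MvPolynomial J ℂ) :
    ∃ (d : J →₀ ℕ) (f g : (J → OnePoint ℂ) → ℂ), IsForm d f ∧ IsForm d g ∧
      ∀ y, (∀ j, y j ≠ ∞) → f y = MvPolynomial.eval (fun j => homPair (y j) 0) P ∧
        g y = MvPolynomial.eval (fun j => homPair (y j) 0) Q := by
  classical
  -- The bound `N` is used as the degree in every factor and for both polynomials, so that the two
  -- forms have equal multidegree.
  obtain ⟨N, hN⟩ : ∃ N : ℕ, ∀ m ∈ P.support ∪ Q.support, ∀ j, m j ≤ N := by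
    refine ⟨(P.support ∪ Q.support).sup fun m => Finset.univ.sup m, fun m hm j => ?_⟩
    exact (Finset.le_sup (f := m) (Finset.mem_univ j)).trans
      (Finset.le_sup (f := fun m : J →₀ ℕ => Finset.univ.sup m) hm)
  have key : ∀ R : MvPolynomial J ℂ, R.support ⊆ P.support ∪ Q.support →
      ∃ f, IsForm (∑ j : J, N • Finsupp.single j 1) f ∧
        ∀ y, (∀ j, y j ≠ ∞) → f y = MvPolynomial.eval (fun j => homPair (y j) 0) R := by
    intro R hR
    refine ⟨fun y => ∑ m ∈ R.support, R.coeff m *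
      ∏ j, homPair (y j) 0 ^ m j * homPair (y j) 1 ^ (N - m j), ?_, ?_⟩
    · refine IsForm.sum _ fun m hm => IsForm.const_mul _ (IsForm.prod _ fun j _ => ?_)
      refine (((IsForm.coord j 0).pow (m j)).mul ((IsForm.coord j 1).pow (N - m j))).congr_deg ?_
      rw [← add_smul, Nat.add_sub_cancel' (hN m (hR hm) j)]
    · intro y hy
      rw [MvPolynomial.eval_eq']
      refine Finset.sum_congr rfl fun m _ => ?_
      congr 1
      refine Finset.prod_congr rfl fun j _ => ?_
      obtain ⟨z, hz⟩ := OnePoint.ne_infty_iff_exists.1 (hy j)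
      simp [← hz]
  obtain ⟨f, hf, hf'⟩ := key P Finset.subset_union_left
  obtain ⟨g, hg, hg'⟩ := key Q Finset.subset_union_right
  exact ⟨_, f, g, hf, hg, fun y hy => ⟨hf' y hy, hg' y hy⟩⟩

/-! ### The Zariski topology -/

theorem isOpen_form_ne {d : I →₀ ℕ} {f : (I → OnePoint ℂ) → ℂ} (hf : IsForm d f) :
    IsOpen[zariski I] {x | f x ≠ 0} := by
  obtain ⟨P, hP, rfl⟩ := hf
  exact TopologicalSpace.isOpen_generateFrom_of_mem ⟨d, P, hP, rfl⟩

theorem isClosed_form_eq {d : I →₀ ℕ} {f g : (I → OnePoint ℂ) → ℂ} (hf : IsForm d f)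
    (hg : IsForm d g) : IsClosed[zariski I] {x | f x = g x} := by
  rw [← @isOpen_compl_iff _ _ (zariski I)]
  have : {x | f x = g x}ᶜ = {x | f x - g x ≠ 0} := by
    ext x; simp [sub_eq_zero]
  rw [this]
  exact isOpen_form_ne (hf.sub hg)

/-- A product of forms is a form, so the nonvanishing loci of single forms are a basis of the
topology and not only a subbasis. -/
theorem exists_form_of_isOpen {U : Set (I → OnePoint ℂ)} (hU : IsOpen[zariski I] U)
    {x : I → OnePoint ℂ} (hx : x ∈ U) : ∃ d f, IsForm d f ∧ f x ≠ 0 ∧ ∀ y, f y ≠ 0 → y ∈ U := by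
  induction hU with
  | basic V hV =>
    obtain ⟨d, P, hP, rfl⟩ := hV
    exact ⟨d, _, ⟨P, hP, rfl⟩, hx, fun y hy => hy⟩
  | univ => exact ⟨0, _, IsForm.const 1, one_ne_zero, fun _ _ => trivial⟩
  | inter V W _ _ h1 h2 =>
    obtain ⟨d, f, hf, hfx, h1⟩ := h1 hx.1
    obtain ⟨e, g, hg, hgx, h2⟩ := h2 hx.2
    exact ⟨_, _, hf.mul hg, mul_ne_zero hfx hgx, fun y hy =>
      ⟨h1 y (left_ne_zero_of_mul hy), h2 y (right_ne_zero_of_mul hy)⟩⟩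
  | sUnion S _ h =>
    obtain ⟨V, hV, hxV⟩ := hx
    obtain ⟨d, f, hf, hfx, h⟩ := h V hV hxV
    exact ⟨d, f, hf, hfx, fun y hy => ⟨V, hV, h y hy⟩⟩

theorem mem_zariski_closure {S : Set (I → OnePoint ℂ)} {x : I → OnePoint ℂ} :
    x ∈ @closure _ (zariski I) S ↔
      ∀ d f, IsForm d f → f x ≠ 0 → ∃ y ∈ S, f y ≠ 0 := by
  rw [@mem_closure_iff _ (zariski I)]
  constructor
  · intro h d f hf hx
    obtain ⟨y, hy, hy'⟩ := h _ (isOpen_form_ne hf) hx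
    exact ⟨y, hy', hy⟩
  · intro h U hU hx
    obtain ⟨d, f, hf, hfx, hfU⟩ := exists_form_of_isOpen hU hx
    obtain ⟨y, hy, hy'⟩ := h d f hf hfx
    exact ⟨y, hfU y hy', hy⟩

/-! ### Regular maps -/

theorem isRegularMap_iff {U : Set (I → OnePoint ℂ)} {F : (I → OnePoint ℂ) → (J → OnePoint ℂ)} :
    IsRegularMap U F ↔ ∀ x ∈ U, ∀ j, ∃ d g h, IsForm d g ∧ IsForm d h ∧ (g x ≠ 0 ∨ h x ≠ 0) ∧
      ∀ y ∈ U, (g y ≠ 0 ∨ h y ≠ 0) → F y j = ofPair (g y) (h y) := by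
  constructor
  · intro hF x hx j
    obtain ⟨d, G, H, hG, hH, h⟩ := hF x hx j
    exact ⟨d, _, _, ⟨G, hG, rfl⟩, ⟨H, hH, rfl⟩, h⟩
  · intro hF x hx j
    obtain ⟨d, g, h, ⟨G, hG, rfl⟩, ⟨H, hH, rfl⟩, h⟩ := hF x hx j
    exact ⟨d, G, H, hG, hH, h⟩

theorem IsRegularMap.mono {U V : Set (I → OnePoint ℂ)} {F : (I → OnePoint ℂ) → (J → OnePoint ℂ)}
    (hF : IsRegularMap V F) (h : U ⊆ V) : IsRegularMap U F := fun x hx j => by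
  obtain ⟨d, G, H, hG, hH, hx', h'⟩ := hF x (h hx) j
  exact ⟨d, G, H, hG, hH, hx', fun y hy => h' y (h hy)⟩

theorem isRegularMap_id (U : Set (I → OnePoint ℂ)) : IsRegularMap U (fun x => x) := by
  rw [isRegularMap_iff]
  refine fun x _ i => ⟨_, _, _, IsForm.coord i 0, IsForm.coord i 1, ?_, fun y _ _ => ?_⟩
  · rw [← not_and_or]; exact homPair_ne_zero _
  · exact (ofPair_homPair _).symm

/-- A regular map has, near each point, a lift to homogeneous coordinates. -/
theorem IsRegularMap.exists_lift [Finite J] {U : Set (I → OnePoint ℂ)}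
    {F : (I → OnePoint ℂ) → (J → OnePoint ℂ)} (hF : IsRegularMap U F) {x : I → OnePoint ℂ}
    (hx : x ∈ U) : ∃ (d : J → I →₀ ℕ) (a : J × Fin 2 → (I → OnePoint ℂ) → ℂ) (e : I →₀ ℕ)
      (b : (I → OnePoint ℂ) → ℂ), (∀ p, IsForm (d p.1) (a p)) ∧ IsForm e b ∧ b x ≠ 0 ∧
      ∀ y ∈ U, b y ≠ 0 → ∃ c : J → ℂ, (∀ j, c j ≠ 0) ∧
        ∀ p : J × Fin 2, homCoord (F y) p = c p.1 * a p y := by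
  have := Fintype.ofFinite J
  rw [isRegularMap_iff] at hF
  choose d g h hg hh hx' hy using hF x hx
  have hb : ∀ j, ∃ b, IsForm (d j) b ∧ b x ≠ 0 ∧ ∀ y, b y ≠ 0 → g j y ≠ 0 ∨ h j y ≠ 0 := by
    intro j
    rcases hx' j with h0 | h0
    · exact ⟨g j, hg j, h0, fun y => Or.inl⟩
    · exact ⟨h j, hh j, h0, fun y => Or.inr⟩
  choose b hb1 hb2 hb3 using hb
  refine ⟨d, fun p => if p.2 = 0 then g p.1 else h p.1, _, _, fun p => ?_,
    IsForm.prod Finset.univ fun j _ => hb1 j, Finset.prod_ne_zero_iff.2 fun j _ => hb2 j,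
    fun y hyU hby => ?_⟩
  · dsimp only
    split_ifs
    · exact hg _
    · exact hh _
  · have hne := fun j => hb3 j y (Finset.prod_ne_zero_iff.1 hby j (Finset.mem_univ _))
    choose c hc hc0 hc1 using fun j =>
      exists_homPair_ofPair (show ¬ (g j y = 0 ∧ h j y = 0) by rw [not_and_or]; exact hne j)
    refine ⟨c, hc, ?_⟩
    rintro ⟨j, s⟩
    simp only [homCoord]
    rw [hy j y hyU (hne j)]
    fin_cases s
    · simpa using hc0 j
    · simpa using hc1 j

theorem prod_pow_ne_zero {e : J →₀ ℕ} {c : J → ℂ} (hc : ∀ j, c j ≠ 0) :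
    (e.prod fun j k => c j ^ k) ≠ 0 :=
  Finset.prod_ne_zero_iff.2 fun j _ => pow_ne_zero _ (hc j)

/-- Substituting a local lift into a form gives a form again. On the neighbourhood where the lift is
valid it differs from the pulled back form by a nonzero factor. -/
theorem IsRegularMap.continuousOn [Finite J] {U : Set (I → OnePoint ℂ)}
    {F : (I → OnePoint ℂ) → (J → OnePoint ℂ)} (hF : IsRegularMap U F) :
    @ContinuousOn _ _ (zariski I) (zariski J) F U := by
  let _ := zariski I
  let _ := zariski J
  rw [continuousOn_iff]
  intro x hx V hV hxV
  obtain ⟨e, f, ⟨P, hP, rfl⟩, hfx, hfV⟩ := exists_form_of_isOpen hV hxV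
  obtain ⟨d, a, e', b, ha, hb, hbx, hy⟩ := hF.exists_lift hx
  refine ⟨{y | MvPolynomial.eval (fun p => a p y) P * b y ≠ 0},
    isOpen_form_ne ((isForm_subst hP ha).mul hb), ?_, ?_⟩
  · obtain ⟨c, hc, hc'⟩ := hy x hx hbx
    refine mul_ne_zero ?_ hbx
    change MvPolynomial.eval (homCoord (F x)) P ≠ 0 at hfx
    rw [show homCoord (F x) = fun p => c p.1 * a p x from funext hc', eval_scale hP] at hfx
    exact right_ne_zero_of_mul hfx
  · rintro y ⟨hy1, hyU⟩
    obtain ⟨c, hc, hc'⟩ := hy y hyU (right_ne_zero_of_mul hy1)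
    refine hfV _ ?_
    change MvPolynomial.eval (homCoord (F y)) P ≠ 0
    rw [show homCoord (F y) = fun p => c p.1 * a p y from funext hc', eval_scale hP]
    exact mul_ne_zero (prod_pow_ne_zero hc) (left_ne_zero_of_mul hy1)

/-- The local lift of `F` is valid only where `b` does not vanish. Multiplying both substituted
forms by `b` makes them vanish together elsewhere, so the required identity is restricted to that
neighbourhood. -/
theorem IsRegularMap.comp [Finite J] {L : Type} {U : Set (I → OnePoint ℂ)}
    {V : Set (J → OnePoint ℂ)} {F : (I → OnePoint ℂ) → (J → OnePoint ℂ)}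
    {G : (J → OnePoint ℂ) → (L → OnePoint ℂ)} (hG : IsRegularMap V G) (hF : IsRegularMap U F)
    (h : Set.MapsTo F U V) : IsRegularMap U (fun x => G (F x)) := by
  intro x hx l
  obtain ⟨e, P, Q, hP, hQ, hPQ, hy⟩ := hG _ (h hx) l
  obtain ⟨d, a, e', b, ha, hb, hbx, hy'⟩ := hF.exists_lift hx
  have h1 := (isForm_subst hP ha).mul hb
  have h2 := (isForm_subst hQ ha).mul hb
  have key : ∀ y ∈ U, b y ≠ 0 → ∃ c, c ≠ 0 ∧
      MvPolynomial.eval (homCoord (F y)) P = c * MvPolynomial.eval (fun p => a p y) P ∧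
      MvPolynomial.eval (homCoord (F y)) Q = c * MvPolynomial.eval (fun p => a p y) Q := by
    intro y hyU hby
    obtain ⟨c, hc, hc'⟩ := hy' y hyU hby
    refine ⟨_, prod_pow_ne_zero (e := e) hc, ?_, ?_⟩ <;>
      rw [show homCoord (F y) = fun p => c p.1 * a p y from funext hc']
    · exact eval_scale hP _ _
    · exact eval_scale hQ _ _
  obtain ⟨P', hP', e1⟩ := h1
  obtain ⟨Q', hQ', e2⟩ := h2
  refine ⟨_, P', Q', hP', hQ', ?_, ?_⟩
  · rw [← congrFun e1 x, ← congrFun e2 x]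
    obtain ⟨c, hc, c1, c2⟩ := key x hx hbx
    rw [c1, c2] at hPQ
    exact hPQ.imp (fun h => mul_ne_zero (right_ne_zero_of_mul h) hbx)
      (fun h => mul_ne_zero (right_ne_zero_of_mul h) hbx)
  · intro y hyU hne
    rw [← congrFun e1 y, ← congrFun e2 y] at hne ⊢
    have hby : b y ≠ 0 := hne.elim right_ne_zero_of_mul right_ne_zero_of_mul
    obtain ⟨c, hc, c1, c2⟩ := key y hyU hby
    change G (F y) l = _
    rw [hy _ (h hyU), c1, c2, ofPair_mul_mul _ _ _ hc, mul_comm _ (b y), mul_comm _ (b y),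
      ofPair_mul_mul _ _ _ hby]
    rw [c1, c2]
    exact hne.imp (fun h => mul_ne_zero hc (left_ne_zero_of_mul h))
      (fun h => mul_ne_zero hc (left_ne_zero_of_mul h))

/-- Regular maps that agree on a dense set are equal. -/
theorem IsRegularMap.eq_of_mem_closure {U S : Set (I → OnePoint ℂ)}
    {F G : (I → OnePoint ℂ) → (J → OnePoint ℂ)} (hF : IsRegularMap U F) (hG : IsRegularMap U G)
    (hS : S ⊆ U) (h : ∀ y ∈ S, F y = G y) {x : I → OnePoint ℂ} (hx : x ∈ U)
    (hx' : x ∈ @closure _ (zariski I) S) : F x = G x := by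
  rw [isRegularMap_iff] at hF hG
  funext j
  obtain ⟨d, p, q, hp, hq, hpq, hy⟩ := hF x hx j
  obtain ⟨d', p', q', hp', hq', hpq', hy'⟩ := hG x hx j
  rw [hy x hx hpq, hy' x hx hpq']
  rw [← not_and_or] at hpq hpq'
  refine ofPair_eq_of_mul_eq hpq hpq' ?_
  by_contra hne
  have hb : ∃ e b, IsForm e b ∧ b x ≠ 0 ∧ ∀ y, b y ≠ 0 → p y ≠ 0 ∨ q y ≠ 0 := by
    rcases not_and_or.1 hpq with h0 | h0
    · exact ⟨d, p, hp, h0, fun y => Or.inl⟩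
    · exact ⟨d, q, hq, h0, fun y => Or.inr⟩
  have hb' : ∃ e b, IsForm e b ∧ b x ≠ 0 ∧ ∀ y, b y ≠ 0 → p' y ≠ 0 ∨ q' y ≠ 0 := by
    rcases not_and_or.1 hpq' with h0 | h0
    · exact ⟨d', p', hp', h0, fun y => Or.inl⟩
    · exact ⟨d', q', hq', h0, fun y => Or.inr⟩
  obtain ⟨e, b, hb, hbx, hby⟩ := hb
  obtain ⟨e', b', hb', hbx', hby'⟩ := hb'
  -- If the values at `x` differed, the form `p q' - p' q`, multiplied by forms that keep both
  -- representations valid, would be nonzero at `x`, hence at a point of `S`, where the maps agree.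
  obtain ⟨y, hyS, hne'⟩ := mem_zariski_closure.1 hx' _ _
    ((((hp.mul hq').sub ((hp'.mul hq).congr_deg (add_comm _ _)))).mul (hb.mul hb'))
    (mul_ne_zero (sub_ne_zero.2 hne) (mul_ne_zero hbx hbx'))
  have h1 := hby y (left_ne_zero_of_mul (right_ne_zero_of_mul hne'))
  have h2 := hby' y (right_ne_zero_of_mul (right_ne_zero_of_mul hne'))
  refine left_ne_zero_of_mul hne' (sub_eq_zero.2 ?_)
  refine mul_eq_of_ofPair_eq (not_and_or.2 h1) (not_and_or.2 h2) ?_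
  rw [← hy y (hS hyS) h1, ← hy' y (hS hyS) h2, h y hyS]

/-- Maps given by polynomials in the coordinates of finite points are regular. -/
theorem isRegularMap_of_polynomial [Finite I] {U : Set (I → OnePoint ℂ)} (hU : ∀ y ∈ U, ∀ i, y i ≠ ∞)
    (P Q : J → MvPolynomial I ℂ)
    (h : ∀ y ∈ U, ∀ j, ¬ (MvPolynomial.eval (fun i => homPair (y i) 0) (P j) = 0 ∧
      MvPolynomial.eval (fun i => homPair (y i) 0) (Q j) = 0)) :
    IsRegularMap U (fun y j => ofPair (MvPolynomial.eval (fun i => homPair (y i) 0) (P j))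
      (MvPolynomial.eval (fun i => homPair (y i) 0) (Q j))) := by
  have := Fintype.ofFinite I
  rw [isRegularMap_iff]
  intro x hx j
  obtain ⟨d, f, g, hf, hg, hfg⟩ := exists_homogenization (P j) (Q j)
  refine ⟨d, f, g, hf, hg, ?_, fun y hy _ => ?_⟩
  · rw [(hfg x (hU x hx)).1, (hfg x (hU x hx)).2, ← not_and_or]
    exact h x hx j
  · rw [(hfg y (hU y hy)).1, (hfg y (hU y hy)).2]

theorem isOpen_finite [Finite I] : IsOpen[zariski I] {y : I → OnePoint ℂ | ∀ i, y i ≠ ∞} := by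
  have := Fintype.ofFinite I
  have h : {y : I → OnePoint ℂ | ∀ i, y i ≠ ∞} = {y | ∏ i, homPair (y i) 1 ≠ 0} := by
    ext y
    simp only [Set.mem_ofPred_eq, Finset.prod_ne_zero_iff, Finset.mem_univ, true_imp_iff]
    refine forall_congr' fun i => ?_
    induction y i using OnePoint.rec <;> simp
  rw [h]
  exact isOpen_form_ne (IsForm.prod _ fun i _ => IsForm.coord i 1)

theorem isOpen_polynomial_ne [Finite I] (P : MvPolynomial I ℂ) :
    IsOpen[zariski I] {y : I → OnePoint ℂ | (∀ i, y i ≠ ∞) ∧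
      MvPolynomial.eval (fun i => homPair (y i) 0) P ≠ 0} := by
  have := Fintype.ofFinite I
  let _ := zariski I
  obtain ⟨d, f, _, hf, _, hfg⟩ := exists_homogenization P P
  have h := (isOpen_finite (I := I)).inter (isOpen_form_ne hf)
  convert h using 1
  ext y
  constructor
  · rintro ⟨h1, h2⟩
    exact ⟨h1, fun h3 => h2 ((hfg y h1).1.symm.trans h3)⟩
  · rintro ⟨h1, h2⟩
    exact ⟨h1, fun h3 => h2 ((hfg y h1).1.trans h3)⟩

end Forms

/-! ### Forms given by differences of markings -/

section DifferenceForms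

open scoped Topology

variable {n : ℕ}

open Classical in
/-- The multidegree of the forms `tripleDiff`. -/
def tripleDeg (s : Finset (Fin (n + 1))) : Index n →₀ ℕ :=
  if h : s.card = 4 then Finsupp.single (.inl (s.orderEmbOfFin h)) 1 else 0

open Classical in
/-- The multidegree of the forms `pairDiff` and `pairUnit`. -/
def pairDeg (s : Finset (Fin n)) : Index n →₀ ℕ :=
  if h : s.card = 2 then Finsupp.single (.inr (s.orderEmbOfFin h)) 1 else 0

theorem isForm_tripleDiff (i j k : Fin n) :
    IsForm (tripleDeg (tripleSet i j k)) (fun x => tripleDiff x i j k) := by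
  have : ∀ m, IsForm (tripleDeg (tripleSet i j k)) (fun x => tripleLoc x (tripleSet i j k) m) := by
    intro m
    unfold tripleDeg tripleLoc
    split_ifs
    · exact IsForm.zero _
    · exact IsForm.coord _ _
    · exact (IsForm.coord _ _).sub (IsForm.coord _ _)
    · exact IsForm.zero _
  exact (this j).sub (this i)

theorem isForm_pairUnit (i j : Fin n) : IsForm (pairDeg {i, j}) (fun x => pairUnit x i j) := by
  unfold pairDeg pairUnit
  split_ifs
  · exact IsForm.coord _ _
  · exact IsForm.const _

theorem isForm_pairDiff (i j : Fin n) : IsForm (pairDeg {i, j}) (fun x => pairDiff x i j) := by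
  unfold pairDeg pairDiff
  split_ifs
  · exact (IsForm.coord _ _).const_mul _
  · exact (IsForm.coord _ _).const_mul _
  · exact IsForm.zero _

theorem isForm_tripleDiff_swap (i j k : Fin n) :
    IsForm (tripleDeg (tripleSet i j k)) (fun x => tripleDiff x i k j) := by
  rw [← tripleSet_swap]; exact isForm_tripleDiff i k j

theorem isForm_tripleDiff_comm (i j k : Fin n) :
    IsForm (tripleDeg (tripleSet i j k)) (fun x => tripleDiff x j i k) := by
  rw [← tripleSet_comm]; exact isForm_tripleDiff j i k

theorem isForm_tripleDiff_flip (i j k : Fin n) :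
    IsForm (tripleDeg (tripleSet i j k)) (fun x => tripleDiff x k j i) := by
  rw [← tripleSet_rotate, ← tripleSet_comm]; exact isForm_tripleDiff k j i

/-- On both sides of each equation the same coordinates occur with the same degrees, so each
equation is an equality of forms of one multidegree. -/
theorem isClosed_isConsistent :
    IsClosed[zariski (Index n)] {x : Index n → OnePoint ℂ | IsConsistent x} := by
  let _ := zariski (Index n)
  have h : {x : Index n → OnePoint ℂ | IsConsistent x} =
      ({x | ∀ i j k l : Fin n, i ≠ j → i ≠ k → i ≠ l → j ≠ k → j ≠ l → k ≠ l →
        tripleDiff x i j k * tripleDiff x i k l * tripleDiff x i l j =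
          tripleDiff x i k j * tripleDiff x i l k * tripleDiff x i j l} ∩
      {x | ∀ i j k : Fin n, i ≠ j → i ≠ k → j ≠ k →
        tripleDiff x i j k * pairDiff x i k * pairUnit x i j =
          tripleDiff x i k j * pairDiff x i j * pairUnit x i k}) ∩
      {x | ∀ (q : Fin 4 ↪o Fin (n + 1)) (i j k l : Fin n), q 0 = i.succ → q 1 = j.succ →
        q 2 = k.succ → q 3 = l.succ →
        homPair (x (.inl q)) 0 * (tripleDiff x j i k * tripleDiff x l k i) =
          homPair (x (.inl q)) 1 * (tripleDiff x k j i * tripleDiff x i l k) ∧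
        homPair (x (.inl q)) 0 * (tripleDiff x j i l * tripleDiff x l k j) =
          homPair (x (.inl q)) 1 * (tripleDiff x k j l * tripleDiff x i l j)} := by
    ext x
    exact ⟨fun h => ⟨⟨h.1, h.2⟩, h.3⟩, fun h => ⟨h.1.1, h.1.2, h.2⟩⟩
  rw [h]
  refine (IsClosed.inter ?_ ?_).inter ?_
  · simp only [Set.ofPred_forall]
    refine isClosed_iInter fun i => isClosed_iInter fun j => isClosed_iInter fun k =>
      isClosed_iInter fun l => isClosed_iInter fun _ => isClosed_iInter fun _ =>
      isClosed_iInter fun _ => isClosed_iInter fun _ => isClosed_iInter fun _ =>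
      isClosed_iInter fun _ => ?_
    exact isClosed_form_eq
      (((isForm_tripleDiff i j k).mul (isForm_tripleDiff i k l)).mul (isForm_tripleDiff i l j))
      (((isForm_tripleDiff_swap i j k).mul (isForm_tripleDiff_swap i k l)).mul
        (isForm_tripleDiff_swap i l j))
  · simp only [Set.ofPred_forall]
    refine isClosed_iInter fun i => isClosed_iInter fun j => isClosed_iInter fun k =>
      isClosed_iInter fun _ => isClosed_iInter fun _ => isClosed_iInter fun _ => ?_
    exact isClosed_form_eq
      (((isForm_tripleDiff i j k).mul (isForm_pairDiff i k)).mul (isForm_pairUnit i j))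
      ((((isForm_tripleDiff_swap i j k).mul (isForm_pairDiff i j)).mul
        (isForm_pairUnit i k)).congr_deg (add_right_comm _ _ _))
  · simp only [Set.ofPred_forall, Set.ofPred_and]
    refine isClosed_iInter fun q => isClosed_iInter fun i => isClosed_iInter fun j =>
      isClosed_iInter fun k => isClosed_iInter fun l => isClosed_iInter fun _ =>
      isClosed_iInter fun _ => isClosed_iInter fun _ => isClosed_iInter fun _ =>
      IsClosed.inter ?_ ?_
    · exact isClosed_form_eq
        ((IsForm.coord _ _).mul ((isForm_tripleDiff_comm i j k).mul (isForm_tripleDiff_flip i k l)))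
        ((IsForm.coord _ _).mul ((isForm_tripleDiff_flip i j k).mul (isForm_tripleDiff_swap i k l)))
    · exact isClosed_form_eq
        ((IsForm.coord _ _).mul ((isForm_tripleDiff_comm i j l).mul (isForm_tripleDiff_flip j k l)))
        ((IsForm.coord _ _).mul (((isForm_tripleDiff_comm j k l).mul
          (isForm_tripleDiff_swap i j l)).congr_deg (add_comm _ _)))

end DifferenceForms

/-! ### One-parameter smoothings -/

namespace NodalLine

variable {K : Type} [Field K] {n : ℕ} {C : NodalLine K n} {R Y : Type} [CommRing R]
  [TopologicalSpace R] [IsTopologicalRing R] [TopologicalSpace Y]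

theorem continuous_pos {t nd : Y → C.V → R} {x : Y → R} (ht : ∀ v, Continuous fun y => t y v)
    (hnd : ∀ v, Continuous fun y => nd y v) (hx : Continuous x) (p u : C.V) :
    Continuous fun y => pos (t y) (nd y) p (x y) u := by
  induction u using WellFoundedLT.induction with
  | ind u ih =>
    by_cases h : p ≤ u
    · rcases h.eq_or_lt with h | h
      · subst h; simpa only [pos_self] using hx
      · simp only [pos_of_lt _ _ _ h]
        exact (hnd _).add ((ht _).mul (ih _ (child_lt h)))
    · simp only [pos_of_not_le _ _ _ h]
      exact continuous_const

theorem continuous_glue {t : Y → C.V → R} (ht : ∀ v, Continuous fun y => t y v) (p u : C.V) :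
    Continuous fun y => glue (t y) p u := by
  induction u using WellFoundedLT.induction with
  | ind u ih =>
    by_cases h : p ≤ u
    · rcases h.eq_or_lt with h | h
      · subst h; simpa only [glue_self] using continuous_const
      · simp only [glue_of_lt _ h]
        exact (ht _).mul (ih _ (child_lt h))
    · simp only [glue_of_not_le _ h]
      exact continuous_const

theorem continuous_homPos {t nd : Y → C.V → R} {mk : Y → Fin n → R}
    (ht : ∀ v, Continuous fun y => t y v) (hnd : ∀ v, Continuous fun y => nd y v)
    (hmk : ∀ i, Continuous fun y => mk y i) (m : C.V) (a : Fin (n + 1)) (s : Fin 2) :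
    Continuous fun y => C.homPos (t y) (nd y) (mk y) m a s := by
  refine Fin.cases ?_ (fun i => ?_) a
  · exact continuous_const
  · fin_cases s
    · exact (continuous_pos ht hnd (hmk i) _ _).sub (continuous_pos ht hnd continuous_const _ _)
    · exact continuous_glue ht _ _

end NodalLine

namespace ScaledLine

open NodalLine

variable {K : Type} [Field K] {n : ℕ} (C : ScaledLine K n)

theorem continuous_smoothNum {R Y : Type} [CommRing R] [TopologicalSpace R] [IsTopologicalRing R]
    [TopologicalSpace Y] {t nd : Y → C.V → R} {mk : Y → Fin n → R}
    (ht : ∀ v, Continuous fun y => t y v) (hnd : ∀ v, Continuous fun y => nd y v)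
    (hmk : ∀ i, Continuous fun y => mk y i) (e : Index n) :
    Continuous fun y => C.smoothNum (t y) (nd y) (mk y) e := by
  have h := fun m a s => continuous_homPos (C := C.toNodalLine) ht hnd hmk m a s
  rcases e with q | p <;> simp only [smoothNum] <;> fun_prop

theorem continuous_smoothDen {R Y : Type} [CommRing R] [TopologicalSpace R] [IsTopologicalRing R]
    [TopologicalSpace Y] {κ : C.V → R} {t nd : Y → C.V → R} {mk : Y → Fin n → R}
    (ht : ∀ v, Continuous fun y => t y v) (hnd : ∀ v, Continuous fun y => nd y v)
    (hmk : ∀ i, Continuous fun y => mk y i) (e : Index n) :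
    Continuous fun y => C.smoothDen κ (t y) (nd y) (mk y) e := by
  have h := fun m a s => continuous_homPos (C := C.toNodalLine) ht hnd hmk m a s
  rcases e with q | p <;> simp only [smoothDen] <;> fun_prop

open Classical in
/-- The value of the form on the coloured components, and `1` on the others. -/
def unit (v : C.V) : K := if Nondegenerate (C.scale v) then homPair (C.scale v) 0 else 1

variable {C} in
theorem unit_ne_zero (v : C.V) : C.unit v ≠ 0 := by
  unfold unit
  split_ifs with h
  · intro h0
    obtain ⟨c, hc⟩ := OnePoint.ne_infty_iff_exists.1 h.2
    rw [← hc] at h h0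
    rw [homPair_coe_zero] at h0
    exact h.1 (by rw [h0])
  · exact one_ne_zero

variable {C} in
theorem scale_eq_unit {v : C.V} (h : Nondegenerate (C.scale v)) :
    C.scale v = (C.unit v : OnePoint K) := by
  rw [unit, if_pos h]
  obtain ⟨c, hc⟩ := OnePoint.ne_infty_iff_exists.1 h.2
  rw [← hc, homPair_coe_zero]

open Classical in
/-- The order of growth of the unit of the coordinate on a component: a strictly decreasing
function that vanishes on the coloured components. -/
def height (v : C.V) : ℤ :=
  if Nondegenerate (C.scale v) then 0
  -- The number of components above `v` decreases towards the root. Subtracting the total number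
  -- makes the height negative on the root side of the coloured components.
  else if C.scale v = ∞ then (Nat.card {w : C.V // v < w} : ℤ) - Nat.card C.V
  else Nat.card {w : C.V // v < w}

variable {C} in
theorem height_eq_zero {v : C.V} (h : Nondegenerate (C.scale v)) : C.height v = 0 := if_pos h

variable {C} in
-- Strict monotonicity makes the exponents of the gluing parameters positive, so that these vanish
-- at `0`.
theorem height_lt {v w : C.V} (h : w < v) : C.height v < C.height w := by
  have hcard : Nat.card {x : C.V // v < x} < Nat.card {x : C.V // w < x} := by
    have hs : {x : C.V | v < x} ⊂ {x : C.V | w < x} :=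
      ⟨fun x hx => h.trans hx, fun hh => lt_irrefl v (hh h)⟩
    exact Set.ncard_lt_ncard hs (Set.toFinite _)
  have hlt : Nat.card {x : C.V // v < x} < Nat.card C.V := by
    have hs : {x : C.V | v < x} ⊂ Set.univ :=
      ⟨fun _ _ => trivial, fun hh => lt_irrefl v (hh (Set.mem_univ v))⟩
    have := Set.ncard_lt_ncard hs (Set.toFinite _)
    rwa [Set.ncard_univ] at this
  unfold height
  by_cases hw : Nondegenerate (C.scale w)
  · have hv := C.scale_above w v hw h
    rw [if_neg (fun hn => hn.2 hv), if_pos hv, if_pos hw]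
    omega
  · by_cases hw' : C.scale w = ∞
    · have hv : C.scale v = ∞ := by
        have h2 := scaleLevel_mono h.le
        rw [scaleLevel_eq_two.2 hw'] at h2
        exact scaleLevel_eq_two.1 (le_antisymm (scaleLevel_le_two _) h2)
      rw [if_neg (fun hn => hn.2 hv), if_pos hv, if_neg hw, if_pos hw']
      omega
    · rw [if_neg hw, if_neg hw']
      split_ifs <;> omega

/-- The gluing parameters of a one-parameter smoothing. -/
def gluing (ε : K) (w : C.V) : K :=
  C.unit w / C.unit (C.par w) * ε ^ (C.height w - C.height (C.par w)).toNat

/-- The units of the coordinates for a one-parameter smoothing. -/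
def units (ε : K) (v : C.V) : K := C.unit v * ε ^ C.height v

/-- The markings on the members of a one-parameter smoothing. -/
def smoothing (ε : K) : Fin n → K := C.smoothPt (C.gluing ε) C.node (C.units ε) C.mark

variable {C}

theorem units_ne_zero {ε : K} (hε : ε ≠ 0) (v : C.V) : C.units ε v ≠ 0 :=
  mul_ne_zero (unit_ne_zero v) (zpow_ne_zero _ hε)

theorem gluing_mul_units {ε : K} (hε : ε ≠ 0) (w u : C.V) (h : w ⋖ u) :
    C.gluing ε w * C.units ε u = C.units ε w := by
  unfold gluing units
  rw [par_eq h]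
  have h1 := height_lt h.lt
  have h2 := C.unit_ne_zero u
  have h3 : ε ^ (C.height w - C.height u).toNat * ε ^ C.height u = ε ^ C.height w := by
    rw [← zpow_natCast, ← zpow_add₀ hε]
    congr 1
    omega
  rw [← h3]
  field_simp

theorem gluing_zero (w u : C.V) (h : w ⋖ u) : C.gluing 0 w = 0 := by
  unfold gluing
  rw [par_eq h]
  have h1 := height_lt h.lt
  rw [zero_pow (by omega), mul_zero]

theorem units_eq_of_nondegenerate (ε : K) (v : C.V) (h : Nondegenerate (C.scale v)) :
    C.unit v = C.units ε v := by
  rw [units, height_eq_zero h, zpow_zero, mul_one]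

theorem ofPair_smooth_eq_smoothing {ε : K} (hε : ε ≠ 0) (e : Index n) :
    ofPair (C.smoothNum (C.gluing ε) C.node C.mark e)
      (C.smoothDen C.unit (C.gluing ε) C.node C.mark e) = rhoOfPoints (C.smoothing ε) e :=
  smooth_eq (units_ne_zero hε) (gluing_mul_units hε) C.mark (units_eq_of_nondegenerate ε) e

theorem smooth_gluing_zero (e : Index n) :
    ¬ (C.smoothNum (C.gluing 0) C.node C.mark e = 0 ∧
      C.smoothDen C.unit (C.gluing 0) C.node C.mark e = 0) ∧
      ofPair (C.smoothNum (C.gluing 0) C.node C.mark e)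
        (C.smoothDen C.unit (C.gluing 0) C.node C.mark e) = C.rho e :=
  smooth_zero gluing_zero (fun _ => scale_eq_unit) e

/-- The difference of two markings on a smoothing, on the component that separates them. -/
theorem smoothing_sub {ε : K} (hε : ε ≠ 0) {i j : Fin n} {v : C.V} (hi : C.comp i ≤ v)
    (hj : C.comp j ≤ v) : C.smoothing ε j - C.smoothing ε i =
      C.units ε v * (pos (C.gluing ε) C.node (C.comp j) (C.mark j) v -
        pos (C.gluing ε) C.node (C.comp i) (C.mark i) v) :=
  smoothPt_sub (gluing_mul_units hε) C.mark hi hj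

section Topology

open Filter Topology

variable [TopologicalSpace K] [IsTopologicalRing K]

theorem continuous_gluing (w : C.V) : Continuous fun ε => C.gluing ε w := by
  unfold gluing; fun_prop

theorem continuous_smoothNum_gluing (e : Index n) :
    Continuous fun ε => C.smoothNum (C.gluing ε) C.node C.mark e :=
  C.continuous_smoothNum (t := fun ε => C.gluing ε) (nd := fun _ => C.node) (mk := fun _ => C.mark)
    continuous_gluing (fun _ => continuous_const) (fun _ => continuous_const) e

theorem continuous_smoothDen_gluing (e : Index n) :
    Continuous fun ε => C.smoothDen C.unit (C.gluing ε) C.node C.mark e :=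
  C.continuous_smoothDen (t := fun ε => C.gluing ε) (nd := fun _ => C.node) (mk := fun _ => C.mark)
    continuous_gluing (fun _ => continuous_const) (fun _ => continuous_const) e

theorem tendsto_pos_sub {i j : Fin n} {v : C.V} (hi : C.comp i ≤ v) (hj : C.comp j ≤ v) :
    Tendsto (fun ε => pos (C.gluing ε) C.node (C.comp j) (C.mark j) v -
      pos (C.gluing ε) C.node (C.comp i) (C.mark i) v) (𝓝 0) (𝓝 (C.fpt v j - C.fpt v i)) := by
  have h (i : Fin n) : Continuous fun ε => pos (C.gluing ε) C.node (C.comp i) (C.mark i) v :=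
    continuous_pos (t := fun ε => C.gluing ε) (nd := fun _ => C.node) (x := fun _ => C.mark i)
      continuous_gluing (fun _ => continuous_const) continuous_const _ _
  have := ((h j).sub (h i)).tendsto 0
  simp only [Pi.sub_apply] at this
  rwa [pos_zero_eq_fpt gluing_zero hi, pos_zero_eq_fpt gluing_zero hj] at this

/-- On the component that separates two markings, their difference is a nonzero unit times a
quantity that tends to the nonzero difference on the nodal curve. -/
theorem eventually_injective_smoothing [T1Space K] :
    ∀ᶠ ε in 𝓝[≠] (0 : K), Function.Injective (C.smoothing ε) := by
  have : ∀ p : Fin n × Fin n, ∀ᶠ ε in 𝓝[≠] (0 : K), p.1 ≠ p.2 →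
      C.smoothing ε p.1 ≠ C.smoothing ε p.2 := by
    rintro ⟨i, j⟩
    by_cases hij : i = j
    · exact Eventually.of_forall fun _ h => absurd hij h
    obtain ⟨v, hi, hj, hne⟩ := C.exists_fpt_ne hij
    have h1 := (tendsto_pos_sub hi hj).eventually_ne (sub_ne_zero.2 hne.symm)
    filter_upwards [h1.filter_mono nhdsWithin_le_nhds, self_mem_nhdsWithin] with ε h1 h2 _ he
    have := smoothing_sub h2 hi hj
    rw [he, sub_self] at this
    exact mul_ne_zero (units_ne_zero h2 v) h1 this.symm
  filter_upwards [eventually_all.2 this] with ε h i j he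
  by_contra hne
  exact h (i, j) hne he

end Topology

end ScaledLine

/-! ### The moduli space as a projective variety -/

section Variety

open Filter Topology

variable {n : ℕ}

/-- The set of coordinates of marked affine lines. -/
def openStratum (n : ℕ) : Set (Index n → OnePoint ℂ) :=
  {x | ∃ z : Fin n → ℂ, Function.Injective z ∧ x = rhoOfPoints z}

/-- A limit of points is in the Zariski closure. -/
theorem mem_zariski_closure_of_tendsto {I Y : Type} [Finite I] {l : Filter Y} [l.NeBot]
    {S : Set (I → OnePoint ℂ)} {p q : Y → I → ℂ} {p₀ q₀ : I → ℂ}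
    (hp : ∀ i, Tendsto (fun y => p y i) l (𝓝 (p₀ i)))
    (hq : ∀ i, Tendsto (fun y => q y i) l (𝓝 (q₀ i))) (h0 : ∀ i, ¬ (p₀ i = 0 ∧ q₀ i = 0))
    (hS : ∀ᶠ y in l, (fun i => ofPair (p y i) (q y i)) ∈ S) :
    (fun i => ofPair (p₀ i) (q₀ i)) ∈ @closure _ (zariski I) S := by
  have lift : ∀ {a b : I → ℂ}, (∀ i, ¬ (a i = 0 ∧ b i = 0)) → ∃ c : I → ℂ, (∀ i, c i ≠ 0) ∧
      homCoord (fun i => ofPair (a i) (b i)) = fun r => c r.1 * if r.2 = 0 then a r.1 else b r.1 := by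
    intro a b h
    choose c hc h1 h2 using fun i => exists_homPair_ofPair (h i)
    refine ⟨c, hc, funext ?_⟩
    rintro ⟨i, s⟩
    fin_cases s
    · simpa [homCoord] using h1 i
    · simpa [homCoord] using h2 i
  rw [mem_zariski_closure]
  rintro d f ⟨P, hP, rfl⟩ hf
  obtain ⟨c, hc, h⟩ := lift h0
  simp only [h, eval_scale hP] at hf
  -- A form that is nonzero at the limit is nonzero nearby by continuity of polynomials, once
  -- numerators and denominators are used as homogeneous coordinates in place of the normalized
  -- ones.
  have ht : Tendsto (fun y => MvPolynomial.eval (fun r : I × Fin 2 =>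
      if r.2 = 0 then p y r.1 else q y r.1) P) l
      (𝓝 (MvPolynomial.eval (fun r : I × Fin 2 => if r.2 = 0 then p₀ r.1 else q₀ r.1) P)) := by
    refine ((MvPolynomial.continuous_eval P).tendsto _).comp (tendsto_pi_nhds.2 fun r => ?_)
    split_ifs
    · exact hp _
    · exact hq _
  have h1 := ht.eventually_ne (right_ne_zero_of_mul hf)
  have h2 : ∀ᶠ y in l, ∀ i, ¬ (p y i = 0 ∧ q y i = 0) := by
    refine eventually_all.2 fun i => ?_
    rcases not_and_or.1 (h0 i) with h | h
    · exact ((hp i).eventually_ne h).mono fun y hy h => hy h.1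
    · exact ((hq i).eventually_ne h).mono fun y hy h => hy h.2
  obtain ⟨y, hy, hy1, hy2⟩ := (hS.and (h1.and h2)).exists
  obtain ⟨c', hc', h'⟩ := lift hy2
  refine ⟨_, hy, ?_⟩
  simp only [h', eval_scale hP]
  exact mul_ne_zero (prod_pow_ne_zero hc') hy1

/-- The one-parameter smoothing has distinct markings for small nonzero parameters and tends to the
nodal curve. -/
theorem ScaledLine.rho_mem_closure (C : ScaledLine ℂ n) :
    C.rho ∈ @closure _ (zariski (Index n)) (openStratum n) := by
  have h := fun e => C.smooth_gluing_zero e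
  rw [show C.rho = fun e => ofPair (C.smoothNum (C.gluing 0) C.node C.mark e)
    (C.smoothDen C.unit (C.gluing 0) C.node C.mark e) from funext fun e => (h e).2.symm]
  refine mem_zariski_closure_of_tendsto (l := 𝓝[≠] (0 : ℂ))
    (p := fun ε e => C.smoothNum (C.gluing ε) C.node C.mark e)
    (q := fun ε e => C.smoothDen C.unit (C.gluing ε) C.node C.mark e) (fun e => ?_) (fun e => ?_)
    (fun e => (h e).1) ?_
  · exact ((continuous_smoothNum_gluing e).tendsto 0).mono_left nhdsWithin_le_nhds
  · exact ((continuous_smoothDen_gluing e).tendsto 0).mono_left nhdsWithin_le_nhds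
  · filter_upwards [C.eventually_injective_smoothing, self_mem_nhdsWithin] with ε h1 h2
    exact ⟨_, h1, funext fun e => ofPair_smooth_eq_smoothing h2 e⟩

theorem openStratum_subset : openStratum n ⊆ {x | IsConsistent x} := by
  rintro x ⟨z, hz, rfl⟩
  exact isConsistent_rhoOfPoints hz

/-- The equations are clear for affine lines with distinct markings, and they define a closed set.
Passing to the closure replaces a case distinction over trees. -/
theorem ScaledLine.isConsistent_rho (C : ScaledLine ℂ n) : IsConsistent C.rho :=
  (@IsClosed.closure_subset_iff _ (zariski (Index n)) _ _ isClosed_isConsistent).2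
    openStratum_subset C.rho_mem_closure

/-- The reconstruction controls only the coordinates `ρ_{0ijk}` and `ρ_{ij}`; the others follow
since both points are consistent. -/
theorem exists_scaledLine_rho_eq (hn : 1 ≤ n) {x : Index n → OnePoint ℂ} (hx : IsConsistent x) :
    ∃ C : ScaledLine ℂ n, C.rho = x := by
  obtain ⟨C, h1, h2⟩ := hx.exists_scaledLine hn
  exact ⟨C, C.isConsistent_rho.ext hx h1 h2⟩

theorem range_rho (hn : 1 ≤ n) :
    Set.range (Moduli.rho : Moduli ℂ n → Index n → OnePoint ℂ) = {x | IsConsistent x} := by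
  ext x
  constructor
  · rintro ⟨⟨C⟩, rfl⟩
    exact C.isConsistent_rho
  · intro hx
    obtain ⟨C, hC⟩ := exists_scaledLine_rho_eq hn hx
    exact ⟨Quotient.mk _ C, hC⟩

theorem range_rho_eq_closure (hn : 1 ≤ n) :
    Set.range (Moduli.rho : Moduli ℂ n → Index n → OnePoint ℂ) =
      @closure _ (zariski (Index n)) (openStratum n) := by
  refine Set.Subset.antisymm ?_ ?_
  · rintro x ⟨⟨C⟩, rfl⟩
    exact C.rho_mem_closure
  · rw [range_rho hn]
    exact (@IsClosed.closure_subset_iff _ (zariski (Index n)) _ _ isClosed_isConsistent).2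
      openStratum_subset

end Variety

/-! ### Irreducibility of the open stratum -/

section Irreducible

variable {n : ℕ}

/-- Marked affine lines, as points of a product of projective lines. -/
def configurations (n : ℕ) : Set (Fin n → OnePoint ℂ) :=
  {y | ∃ z : Fin n → ℂ, Function.Injective z ∧ y = fun i => (z i : OnePoint ℂ)}

/-- On finite points forms become polynomials. Two nonempty open sets and the condition of distinct
markings are governed by nonzero polynomials, whose product is nonzero at some point of `ℂ^n`. -/
theorem isIrreducible_configurations (n : ℕ) : @IsIrreducible _ (zariski (Fin n)) (configurations n) := by
  let _ := zariski (Fin n)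
  have dehom : ∀ {d : Fin n →₀ ℕ} {f : (Fin n → OnePoint ℂ) → ℂ}, IsForm d f →
      ∃ P : MvPolynomial (Fin n) ℂ, ∀ z : Fin n → ℂ,
        f (fun i => (z i : OnePoint ℂ)) = MvPolynomial.eval z P := by
    rintro d f ⟨P, -, rfl⟩
    refine ⟨MvPolynomial.bind₁ (fun r : Fin n × Fin 2 => if r.2 = 0 then MvPolynomial.X r.1 else 1) P,
      fun z => ?_⟩
    change _ = MvPolynomial.eval₂Hom (RingHom.id ℂ) z _
    rw [MvPolynomial.eval₂Hom_bind₁]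
    change MvPolynomial.eval _ P = MvPolynomial.eval _ P
    congr 2
    funext r
    obtain ⟨i, s⟩ := r
    fin_cases s <;> simp [homCoord]
  have hne : (configurations n).Nonempty :=
    ⟨_, fun i => ((i : ℕ) : ℂ), fun i j h => Fin.ext (Nat.cast_injective h), rfl⟩
  refine ⟨hne, ?_⟩
  rintro u v hu hv ⟨_, ⟨a, ha, rfl⟩, hau⟩ ⟨_, ⟨b, hb, rfl⟩, hbv⟩
  obtain ⟨d, f, hf, hfa, hfu⟩ := exists_form_of_isOpen hu hau
  obtain ⟨e, g, hg, hgb, hgv⟩ := exists_form_of_isOpen hv hbv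
  obtain ⟨P, hP⟩ := dehom hf
  obtain ⟨Q, hQ⟩ := dehom hg
  -- This polynomial vanishes exactly if two markings coincide.
  let R : MvPolynomial (Fin n) ℂ := ∏ r ∈ Finset.univ.filter (fun r : Fin n × Fin n => r.1 ≠ r.2),
    (MvPolynomial.X r.1 - MvPolynomial.X r.2)
  have hR : ∀ z : Fin n → ℂ, MvPolynomial.eval z R ≠ 0 ↔ Function.Injective z := by
    intro z
    simp only [R, map_prod, map_sub, MvPolynomial.eval_X, Finset.prod_ne_zero_iff,
      Finset.mem_filter, Finset.mem_univ, true_and, sub_ne_zero]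
    exact ⟨fun h i j hij => by_contra fun hne => h (i, j) hne hij, fun h r hr => h.ne hr⟩
  have h0 : P * Q * R ≠ 0 := by
    refine mul_ne_zero (mul_ne_zero ?_ ?_) ?_ <;> intro h
    · rw [hP, h, map_zero] at hfa; exact hfa rfl
    · rw [hQ, h, map_zero] at hgb; exact hgb rfl
    · exact (hR a).2 ha (by rw [h, map_zero])
  obtain ⟨z, hz⟩ : ∃ z, MvPolynomial.eval z (P * Q * R) ≠ 0 := by
    by_contra! h
    exact h0 (MvPolynomial.funext fun z => by rw [h z, map_zero])
  rw [map_mul, map_mul] at hz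
  refine ⟨_, ⟨z, (hR z).1 (right_ne_zero_of_mul hz), rfl⟩, hfu _ ?_, hgv _ ?_⟩
  · rw [hP]; exact left_ne_zero_of_mul (left_ne_zero_of_mul hz)
  · rw [hQ]; exact right_ne_zero_of_mul (left_ne_zero_of_mul hz)

theorem exists_rhoOfPoints_polynomial (e : Index n) : ∃ P Q : MvPolynomial (Fin n) ℂ,
    ∀ z : Fin n → ℂ, (Function.Injective z → MvPolynomial.eval z Q ≠ 0) ∧
      rhoOfPoints z e = ofPair (MvPolynomial.eval z P) (MvPolynomial.eval z Q) := by
  rcases e with q | p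
  · let H : Fin (n + 1) → Fin 2 → MvPolynomial (Fin n) ℂ :=
      Fin.cases ![1, 0] fun i => ![MvPolynomial.X i, 1]
    have hH : ∀ (z : Fin n → ℂ) a s, MvPolynomial.eval z (H a s) =
        homPair (Fin.cases ∞ (fun i => (z i : OnePoint ℂ)) a : OnePoint ℂ) s := by
      intro z a s
      refine Fin.cases ?_ (fun i => ?_) a <;> fin_cases s <;> simp [H]
    refine ⟨(H (q 1) 0 * H (q 2) 1 - H (q 2) 0 * H (q 1) 1) *
      (H (q 3) 0 * H (q 0) 1 - H (q 0) 0 * H (q 3) 1),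
      (H (q 0) 0 * H (q 1) 1 - H (q 1) 0 * H (q 0) 1) *
      (H (q 2) 0 * H (q 3) 1 - H (q 3) 0 * H (q 2) 1), fun z => ⟨fun hz => ?_, ?_⟩⟩
    · have hi : Function.Injective
          (fun a : Fin (n + 1) => (Fin.cases ∞ (fun i => (z i : OnePoint ℂ)) a : OnePoint ℂ)) := by
        intro a b
        refine Fin.cases ?_ (fun i => ?_) a <;> refine Fin.cases ?_ (fun j => ?_) b
        · simp
        · exact fun h => absurd h (OnePoint.infty_ne_coe _)
        · exact fun h => absurd h (OnePoint.coe_ne_infty _)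
        · exact fun h => congrArg _ (hz (OnePoint.coe_injective h))
      simp only [map_mul, map_sub, hH]
      refine mul_ne_zero (fun h => ?_) (fun h => ?_)
      · exact absurd (q.injective (hi (bracket_eq_zero.1 h))) (by decide)
      · exact absurd (q.injective (hi (bracket_eq_zero.1 h))) (by decide)
    · simp only [map_mul, map_sub, hH]
      rfl
  · refine ⟨1, MvPolynomial.X (p 1) - MvPolynomial.X (p 0), fun z => ⟨fun hz => ?_, by
      simp [rhoOfPoints]⟩⟩
    simp only [map_sub, MvPolynomial.eval_X, sub_ne_zero]
    exact hz.ne (p.injective.ne (by decide))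

/-- The open stratum is the image of the configuration space under a regular map, which is
continuous in the Zariski topology. -/
theorem isIrreducible_openStratum (n : ℕ) :
    @IsIrreducible _ (zariski (Index n)) (openStratum n) := by
  choose P Q h using fun e => exists_rhoOfPoints_polynomial (n := n) e
  have hval : ∀ z : Fin n → ℂ, (fun i => homPair ((z i : ℂ) : OnePoint ℂ) 0) = z := fun z => rfl
  have hreg : IsRegularMap (configurations n) (fun y e =>
      ofPair (MvPolynomial.eval (fun i => homPair (y i) 0) (P e))
        (MvPolynomial.eval (fun i => homPair (y i) 0) (Q e))) := by
    refine isRegularMap_of_polynomial ?_ P Q ?_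
    · rintro _ ⟨z, -, rfl⟩ i
      exact OnePoint.coe_ne_infty _
    · rintro _ ⟨z, hz, rfl⟩ e h0
      exact (h e z).1 hz h0.2
  have := @IsIrreducible.image _ _ (zariski (Fin n)) (zariski (Index n)) _
    (isIrreducible_configurations n) _ hreg.continuousOn
  convert this using 1
  ext x
  constructor
  · rintro ⟨z, hz, rfl⟩
    exact ⟨_, ⟨z, hz, rfl⟩, funext fun e => (h e z).2.symm⟩
  · rintro ⟨_, ⟨z, hz, rfl⟩, rfl⟩
    exact ⟨z, hz, funext fun e => (h e z).2.symm⟩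

theorem isProjectiveVariety_range_rho (hn : 1 ≤ n) :
    IsProjectiveVariety (Set.range (Moduli.rho : Moduli ℂ n → Index n → OnePoint ℂ)) := by
  refine ⟨?_, ?_⟩
  · rw [range_rho hn]
    exact isClosed_isConsistent
  · rw [range_rho_eq_closure hn]
    exact @IsIrreducible.closure _ (zariski (Index n)) _ (isIrreducible_openStratum n)

end Irreducible

/-! ### Change of the coordinates on the components -/

section Affine

variable {K : Type} [Field K] {n : ℕ}

/-- The same nodal curve, with other coordinates on the components. -/
def NodalLine.affine (C : NodalLine K n) (a : C.V → Kˣ) (b : C.V → K) : NodalLine K n where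
  V := C.V
  chain := C.chain
  node := fun v => a (C.par v) * C.node v + b (C.par v)
  comp := C.comp
  mark := fun i => a (C.comp i) * C.mark i + b (C.comp i)
  node_ne_node := by
    intro u v w hv hw hne he
    rw [NodalLine.par_eq hv, NodalLine.par_eq hw] at he
    exact C.node_ne_node u v w hv hw hne (by simpa using he)
  node_ne_mark := by
    intro u v i hv hi he
    rw [NodalLine.par_eq hv, hi] at he
    exact C.node_ne_mark u v i hv hi (by simpa using he)
  mark_ne_mark := by
    intro i j hij hc he
    rw [hc] at he
    exact C.mark_ne_mark i j hij hc (by simpa using he)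

/-- The isomorphism given by a change of coordinates. -/
def NodalLine.affineIso (C : NodalLine K n) (a : C.V → Kˣ) (b : C.V → K) :
    NodalLine.Iso C (C.affine a b) where
  f := OrderIso.refl _
  a := a
  b := b
  node_eq := by
    intro u v h
    change (a (C.par v) : K) * C.node v + b (C.par v) = _
    rw [NodalLine.par_eq h]
  comp_eq := fun _ => rfl
  mark_eq := fun _ => rfl

/-- The same scaled line, with other coordinates on the components. -/
def ScaledLine.affine (C : ScaledLine K n) (a : C.V → Kˣ) (b : C.V → K) : ScaledLine K n :=
  have hnd : ∀ v, Nondegenerate ((C.scale v).map fun c => c * (((a v)⁻¹ : Kˣ) : K)) ↔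
      Nondegenerate (C.scale v) := by
    intro v
    induction C.scale v using OnePoint.rec <;> simp [Nondegenerate]
  { toNodalLine := C.toNodalLine.affine a b
    scale := fun v => (C.scale v).map fun c => c * (((a v)⁻¹ : Kˣ) : K)
    colored_path := fun i =>
      (existsUnique_congr fun v => and_congr_right fun _ => hnd v).2 (C.colored_path i)
    scale_above := fun v w h hlt => by
      rw [C.scale_above v w ((hnd v).1 h) hlt, OnePoint.map_infty]
    scale_below := fun v w h hlt => by
      rw [C.scale_below v w ((hnd v).1 h) hlt, OnePoint.map_some, zero_mul]
    stable_colored := fun v h => C.stable_colored v ((hnd v).1 h)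
    stable_uncolored := fun v h => C.stable_uncolored v fun h' => h ((hnd v).2 h') }

theorem ScaledLine.isomorphic_affine (C : ScaledLine K n) (a : C.V → Kˣ) (b : C.V → K) :
    ScaledLine.Isomorphic C (C.affine a b) := by
  refine ⟨C.toNodalLine.affineIso a b, fun v => ?_⟩
  change C.scale v = ((C.scale v).map fun c => c * (((a v)⁻¹ : Kˣ) : K)).map fun c => c * (a v : K)
  induction C.scale v using OnePoint.rec <;> simp

theorem NodalLine.fpt_affine (C : NodalLine K n) (a : C.V → Kˣ) (b : C.V → K) {v : C.V} {i : Fin n}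
    (h : C.comp i ≤ v) : (C.affine a b).fpt v i = a v * C.fpt v i + b v := by
  have h1 := NodalLine.pt_iso (C.affineIso a b) v i.succ
  rw [NodalLine.pt_succ_of_le h, OnePoint.map_some] at h1
  have h2 : (C.affine a b).pt v i.succ = ((C.affine a b).fpt v i : OnePoint K) :=
    NodalLine.pt_succ_of_le (C := C.affine a b) h
  exact OnePoint.coe_injective (h2.symm.trans h1)

end Affine

/-! ### Reference points on the components -/

section Frame

variable {K : Type} [Field K] {n : ℕ}

/-- A choice, on each component `v`, of markings in the direction of two special points; for
coloured components, the second one is replaced by the form. -/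
structure Frame (C : ScaledLine K n) where
  rep : C.V → Fin n
  ext : C.V → Option (Fin n)
  comp_rep : ∀ v, C.comp (rep v) ≤ v
  rep_eq : ∀ u w, w ⋖ u → C.comp (rep u) ≤ w → rep w = rep u
  ext_eq_none : ∀ v, ext v = none ↔ Nondegenerate (C.scale v)
  comp_ext : ∀ v k, ext v = some k → C.comp k ≤ v
  ext_ne : ∀ v k, ext v = some k → C.fpt v k ≠ C.fpt v (rep v)
  rep_eq_ext : ∀ u w k, w ⋖ u → ext u = some k → C.comp k ≤ w → rep w = k

/-- The first reference marking is the least one behind `v`, the second one the least in another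
direction. Minima over smaller sets stay minima where they still belong, which gives the
compatibility along nodes. -/
theorem exists_frame (C : ScaledLine K n) : Nonempty (Frame C) := by
  classical
  have h1 : ∀ v : C.V, (Finset.univ.filter fun i => C.comp i ≤ v).Nonempty := fun v => by
    obtain ⟨i, hi⟩ := C.exists_comp_le v
    exact ⟨i, by simpa using hi⟩
  let rep : C.V → Fin n := fun v => (Finset.univ.filter fun i => C.comp i ≤ v).min' (h1 v)
  have hrep : ∀ v, C.comp (rep v) ≤ v := fun v => by simpa using Finset.min'_mem _ (h1 v)
  have hmin : ∀ v i, C.comp i ≤ v → rep v ≤ i := fun v i hi => Finset.min'_le _ _ (by simpa using hi)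
  have h2 : ∀ v : C.V, ∃ o : Option (Fin n), (o = none ↔ Nondegenerate (C.scale v)) ∧
      ∀ k, o = some k → C.comp k ≤ v ∧ C.fpt v k ≠ C.fpt v (rep v) ∧
        ∀ j, C.comp j ≤ v → C.fpt v j ≠ C.fpt v (rep v) → k ≤ j := by
    intro v
    by_cases hv : Nondegenerate (C.scale v)
    · exact ⟨none, by simpa using hv, by simp⟩
    · have hne : (Finset.univ.filter fun i => C.comp i ≤ v ∧ C.fpt v i ≠ C.fpt v (rep v)).Nonempty := by
        obtain ⟨i, j, hi, hj, hij⟩ := C.exists_fpt_ne_of_uncolored hv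
        by_cases h : C.fpt v i = C.fpt v (rep v)
        · exact ⟨j, by simpa using ⟨hj, fun h' => hij (h.trans h'.symm)⟩⟩
        · exact ⟨i, by simpa using ⟨hi, h⟩⟩
      refine ⟨some (Finset.min' _ hne), by simpa using hv, fun k hk => ?_⟩
      obtain rfl := Option.some.inj hk
      have := Finset.min'_mem _ hne
      simp only [Finset.mem_filter, Finset.mem_univ, true_and] at this
      exact ⟨this.1, this.2, fun j hj hj' => Finset.min'_le _ _ (by simpa using ⟨hj, hj'⟩)⟩
  choose ext hext hext' using h2
  refine ⟨⟨rep, ext, hrep, fun u w hw h => ?_, hext, fun v k hk => (hext' v k hk).1,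
    fun v k hk => (hext' v k hk).2.1, fun u w k hw hk h => ?_⟩⟩
  · exact le_antisymm (hmin w _ h) (hmin u _ ((hrep w).trans hw.le))
  · refine le_antisymm (hmin w _ h) ((hext' u k hk).2.2 _ ((hrep w).trans hw.le) ?_)
    rw [NodalLine.fpt_of_covBy hw (hrep w), ← NodalLine.fpt_of_covBy hw h]
    exact (hext' u k hk).2.1

/-- The coordinates are adapted to the reference points. -/
structure Frame.IsNormalized {C : ScaledLine K n} (F : Frame C) : Prop where
  scale_eq : ∀ v, Nondegenerate (C.scale v) → C.scale v = ((1 : K) : OnePoint K)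
  fpt_rep : ∀ v, C.fpt v (F.rep v) = 0
  fpt_ext : ∀ v k, F.ext v = some k → C.fpt v k = 1

/-- The two parameters of an affine change of coordinate are used up by the two references: points
at `0` and `1` on uncoloured components, a point at `0` and the form `dz` on coloured ones. -/
theorem exists_isNormalized (C : ScaledLine K n) :
    ∃ (D : ScaledLine K n) (F : Frame D), D.rho = C.rho ∧ F.IsNormalized := by
  obtain ⟨F⟩ := exists_frame C
  have h : ∀ v, ∃ (a : Kˣ) (b : K),
      (Nondegenerate (C.scale v) → (C.scale v).map (fun c => c * ((a⁻¹ : Kˣ) : K)) =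
        ((1 : K) : OnePoint K)) ∧ a * C.fpt v (F.rep v) + b = 0 ∧
      ∀ k, F.ext v = some k → a * C.fpt v k + b = 1 := by
    intro v
    rcases hx : F.ext v with _ | k
    · have hv := (F.ext_eq_none v).1 hx
      refine ⟨Units.mk0 _ (C.unit_ne_zero v), -(C.unit v * C.fpt v (F.rep v)), fun h => ?_, ?_,
        by simp⟩
      · rw [ScaledLine.scale_eq_unit h, OnePoint.map_some]
        simp [ScaledLine.unit_ne_zero]
      · simp
    · have hd := sub_ne_zero.2 (F.ext_ne v k hx)
      refine ⟨(Units.mk0 _ hd)⁻¹, -((C.fpt v k - C.fpt v (F.rep v))⁻¹ * C.fpt v (F.rep v)),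
        fun h => ?_, ?_, fun k' hk' => ?_⟩
      · rw [← F.ext_eq_none, hx] at h
        exact absurd h (by simp)
      · simp
      · obtain rfl := Option.some.inj hk'
        simp only [Units.val_inv_eq_inv_val, Units.val_mk0]
        field_simp
        ring
  choose a b h1 h2 h3 using h
  have hf : ∀ (v : C.V) i, C.comp i ≤ v →
      (C.affine a b).fpt v i = a v * C.fpt v i + b v := fun v i hi =>
    C.toNodalLine.fpt_affine a b hi
  have hnd : ∀ v : C.V, Nondegenerate ((C.affine a b).scale v) ↔ Nondegenerate (C.scale v) := by
    intro v
    change Nondegenerate ((C.scale v).map fun c => c * (((a v)⁻¹ : Kˣ) : K)) ↔ _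
    induction C.scale v using OnePoint.rec <;> simp [Nondegenerate]
  refine ⟨C.affine a b, ⟨F.rep, F.ext, F.comp_rep, F.rep_eq,
    fun v => (F.ext_eq_none v).trans (hnd v).symm, F.comp_ext, fun v k hk => ?_, F.rep_eq_ext⟩,
    (ScaledLine.rho_eq (C.isomorphic_affine a b)).symm,
    ⟨fun v hv => h1 v ((hnd v).1 hv), fun v => ?_, fun v k hk => ?_⟩⟩
  · rw [hf v k (F.comp_ext v k hk), hf v _ (F.comp_rep v)]
    simpa using F.ext_ne v k hk
  · exact (hf v _ (F.comp_rep v)).trans (h2 v)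
  · exact (hf v k (F.comp_ext v k hk)).trans (h3 v k hk)

end Frame

/-! ### A saturated semigroup -/

section Saturated

variable {Q : Type}

open Classical in
/-- The basis vectors of `ℤ^Q`. -/
def delta (q : Q) : Q → ℤ := Pi.single q 1

variable [Fintype Q]

/-- The generators of the semigroup attached to a forest with parent map `p`. -/
def forestGenerators (G H : Set Q) (p : Q → Q) : Set (Q → ℤ) :=
  {c | (∃ q ∈ G, c = delta q) ∨ ∃ q ∈ H, c = delta (p q) - delta q}

theorem mem_closure_forestGenerators {G H : Set Q} {p : Q → Q} {c : Q → ℤ} :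
    c ∈ AddSubmonoid.closure (forestGenerators G H p) ↔ ∃ a b : Q → ℕ, (∀ q ∉ G, a q = 0) ∧
      (∀ q ∉ H, b q = 0) ∧ c = ∑ q, (a q : ℤ) • delta q +
        ∑ q, (b q : ℤ) • (delta (p q) - delta q) := by
  classical
  constructor
  · intro h
    induction h using AddSubmonoid.closure_induction with
    | mem c hc =>
      rcases hc with ⟨q, hq, rfl⟩ | ⟨q, hq, rfl⟩
      · refine ⟨Pi.single q 1, 0, fun r hr => ?_, fun _ _ => rfl, ?_⟩
        · exact Pi.single_eq_of_ne (by rintro rfl; exact hr hq) _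
        · rw [Finset.sum_eq_single q (fun r _ hr => by simp [Pi.single_eq_of_ne hr]) (by simp)]
          simp
      · refine ⟨0, Pi.single q 1, fun _ _ => rfl, fun r hr => ?_, ?_⟩
        · exact Pi.single_eq_of_ne (by rintro rfl; exact hr hq) _
        · have h1 : ∑ r, ((Pi.single q 1 : Q → ℕ) r : ℤ) •
              (delta (p r) - delta r) = delta (p q) - delta q := by
            rw [Finset.sum_eq_single q (fun r _ hr => by simp [Pi.single_eq_of_ne hr]) (by simp)]
            simp
          rw [h1]
          simp
    | zero => exact ⟨0, 0, fun _ _ => rfl, fun _ _ => rfl, by simp⟩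
    | add c d _ _ hc hd =>
      obtain ⟨a, b, ha, hb, rfl⟩ := hc
      obtain ⟨a', b', ha', hb', rfl⟩ := hd
      refine ⟨a + a', b + b', fun q hq => by simp [ha q hq, ha' q hq],
        fun q hq => by simp [hb q hq, hb' q hq], ?_⟩
      simp only [Pi.add_apply, Nat.cast_add, add_smul, Finset.sum_add_distrib]
      abel
  · rintro ⟨a, b, ha, hb, rfl⟩
    refine add_mem (sum_mem fun q _ => ?_) (sum_mem fun q _ => ?_)
    · by_cases hq : q ∈ G
      · rw [natCast_zsmul]
        refine nsmul_mem (AddSubmonoid.subset_closure ?_) _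
        exact Or.inl ⟨q, hq, rfl⟩
      · simp [ha q hq]
    · by_cases hq : q ∈ H
      · rw [natCast_zsmul]
        refine nsmul_mem (AddSubmonoid.subset_closure ?_) _
        exact Or.inr ⟨q, hq, rfl⟩
      · simp [hb q hq]

/-- In a representation of `k • c`, the coefficients `b` of the differences are divided by `k` with
remainder. Subtracting the quotients from `c` leaves a vector `s`, which turns out to be a
nonnegative combination of basis vectors in `G`. -/
theorem mem_closure_forestGenerators_of_nsmul {G H : Set Q} {p : Q → Q} (hHG : H ⊆ G)
    (hp : ∀ q ∈ H, p q ∈ G) {c : Q → ℤ} {k : ℕ} (hk : 0 < k)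
    (h : k • c ∈ AddSubmonoid.closure (forestGenerators G H p)) :
    c ∈ AddSubmonoid.closure (forestGenerators G H p) := by
  classical
  obtain ⟨a, b, ha, hb, hc⟩ := mem_closure_forestGenerators.1 h
  have coord : ∀ (a b : Q → ℤ) (q : Q), (∑ q, a q • delta q +
      ∑ q, b q • (delta (p q) - delta q)) q =
        a q + ∑ r with p r = q, b r - b q := by
    intro a b q
    simp only [delta, Pi.add_apply, Finset.sum_apply, Pi.smul_apply, Pi.sub_apply, smul_eq_mul, mul_sub,
      Finset.sum_sub_distrib, Pi.single_apply, mul_ite, mul_one, mul_zero]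
    rw [Finset.sum_filter, Finset.sum_ite_eq, Finset.sum_ite_eq, if_pos (Finset.mem_univ _),
      if_pos (Finset.mem_univ _)]
    simp only [eq_comm (a := q)]
    ring
  have hcq : ∀ q, (k : ℤ) * c q = a q + ∑ r with p r = q, (b r : ℤ) - b q := by
    intro q
    have := congrFun hc q
    rw [coord (fun q => (a q : ℤ)) (fun q => (b q : ℤ))] at this
    simpa using this
  let b' : Q → ℕ := fun q => b q / k
  let s : Q → ℤ := fun q => c q - ∑ r with p r = q, (b' r : ℤ) + b' q
  have hs : ∀ q, (k : ℤ) * s q = a q + ∑ r with p r = q, ((b r % k : ℕ) : ℤ) - ((b q % k : ℕ) : ℤ) := by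
    intro q
    have e : ∀ r, ((b r % k : ℕ) : ℤ) = b r - k * b' r := by
      intro r
      have := Nat.mod_add_div (b r) k
      have h' : ((b r % k : ℕ) : ℤ) + k * b' r = b r := by exact_mod_cast this
      linarith
    simp only [e, Finset.sum_sub_distrib, ← Finset.mul_sum, s]
    linear_combination hcq q
  -- The only negative contribution to `k * s q` is one remainder, which is less than `k`; as `s q`
  -- is an integer, it cannot be negative.
  have hs0 : ∀ q, 0 ≤ s q := by
    intro q
    have h1 : 0 ≤ ∑ r with p r = q, ((b r % k : ℕ) : ℤ) := Finset.sum_nonneg fun _ _ => by positivity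
    have h2 : ((b q % k : ℕ) : ℤ) < k := by exact_mod_cast Nat.mod_lt _ hk
    have h3 := hs q
    have hk' : (0 : ℤ) < k := by exact_mod_cast hk
    have h4 : (0 : ℤ) ≤ a q := by positivity
    by_contra hneg
    nlinarith
  refine mem_closure_forestGenerators.2 ⟨fun q => (s q).toNat, b', fun q hq => ?_, fun q hq => ?_, ?_⟩
  -- Outside `G` no remainder contributes, since `H` and its parents are contained in `G`.
  · have hqH : q ∉ H := fun h => hq (hHG h)
    have h1 : ∑ r with p r = q, ((b r % k : ℕ) : ℤ) = 0 := by
      refine Finset.sum_eq_zero fun r hr => ?_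
      have hr' : r ∉ H := fun h => hq ((Finset.mem_filter.1 hr).2 ▸ hp r h)
      simp [hb r hr']
    have h2 := hs q
    rw [h1, ha q hq, hb q hqH] at h2
    have hk' : (k : ℤ) ≠ 0 := by exact_mod_cast hk.ne'
    have : s q = 0 := by
      rcases mul_eq_zero.1 (h2.trans (by simp)) with h | h
      · exact absurd h hk'
      · exact h
    simp [this]
  · simp [b', hb q hq]
  · funext q
    rw [coord (fun q => ((s q).toNat : ℤ)) (fun q => (b' q : ℤ)) q, Int.toNat_of_nonneg (hs0 q)]
    simp only [s]
    ring

end Saturated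

/-! ### Ratios of differences of markings -/

section Ratios

variable {K : Type} [Field K] {n : ℕ}

/-- The difference `z_k - z_i`, or `1` if there is no `k`. -/
def offset (z : Fin n → K) (i : Fin n) : Option (Fin n) → K
  | none => 1
  | some k => z k - z i

/-- The numerator of the ratio of `offset z i k` and `offset z i l`; the denominator is obtained
by exchanging `k` and `l`. -/
def ratioNum (x : Index n → OnePoint K) (i : Fin n) : Option (Fin n) → Option (Fin n) → K
  | some k, some l => if k = l then 1 else tripleDiff x i k l
  | some k, none => pairDiff x i k
  | none, some l => pairUnit x i l
  | none, none => 1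

theorem isForm_ratioNum (i : Fin n) (k l : Option (Fin n)) : ∃ d,
    IsForm d (fun x => ratioNum x i k l) ∧ IsForm d (fun x => ratioNum x i l k) := by
  rcases k with _ | k <;> rcases l with _ | l
  · exact ⟨_, IsForm.const 1, IsForm.const 1⟩
  · exact ⟨_, isForm_pairUnit i l, isForm_pairDiff i l⟩
  · exact ⟨_, isForm_pairDiff i k, isForm_pairUnit i k⟩
  · by_cases h : k = l
    · subst h
      simp only [ratioNum, if_true]
      exact ⟨_, IsForm.const 1, IsForm.const 1⟩
    · simp only [ratioNum, if_neg h, if_neg (Ne.symm h)]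
      exact ⟨_, isForm_tripleDiff i k l, isForm_tripleDiff_swap i k l⟩

theorem offset_ne_zero {z : Fin n → K} (hz : Function.Injective z) {i : Fin n} {k : Option (Fin n)}
    (hk : k ≠ some i) : offset z i k ≠ 0 := by
  rcases k with _ | k
  · exact one_ne_zero
  · exact sub_ne_zero.2 (hz.ne fun h => hk (h ▸ rfl))

theorem ratioNum_rhoOfPoints {z : Fin n → K} (hz : Function.Injective z) {i : Fin n}
    {k l : Option (Fin n)} (hk : k ≠ some i) (hl : l ≠ some i) :
    ∃ r, r ≠ 0 ∧ ratioNum (rhoOfPoints z) i k l = r * offset z i k ∧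
      ratioNum (rhoOfPoints z) i l k = r * offset z i l := by
  rcases k with _ | k <;> rcases l with _ | l
  · exact ⟨1, one_ne_zero, by simp [ratioNum, offset], by simp [ratioNum, offset]⟩
  · obtain ⟨r, hr, h1, h2⟩ := pair_rhoOfPoints z i l
    exact ⟨r, hr, by simpa [ratioNum, offset] using h1, by simpa [ratioNum, offset] using h2⟩
  · obtain ⟨r, hr, h1, h2⟩ := pair_rhoOfPoints z i k
    exact ⟨r, hr, by simpa [ratioNum, offset] using h2, by simpa [ratioNum, offset] using h1⟩
  · by_cases h : k = l
    · subst h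
      have h0 := offset_ne_zero hz hk
      exact ⟨(offset z i (some k))⁻¹, inv_ne_zero h0, by simp [ratioNum, h0], by simp [ratioNum, h0]⟩
    · obtain ⟨r, hr, h1, h2, -⟩ := tripleDiff_rhoOfPoints hz (i := i) (j := k) (k := l)
        (fun h => hk (h ▸ rfl)) (fun h => hl (h ▸ rfl)) h
      simp only [ratioNum, if_neg h, if_neg (Ne.symm h)]
      exact ⟨r, hr, h1, h2⟩

/-- The reference `l` realizes the size of the component `u`, and `k` is a point behind `u`, or the
unit of length if this is not larger than `u`. So the ratio of the offset of `k` to that of `l` is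
finite. -/
theorem ScaledLine.ratioNum_rho_ne_zero {C : ScaledLine K n} {u : C.V} {i : Fin n}
    {k l : Option (Fin n)} (hi : C.comp i ≤ u) (hk : k ≠ some i)
    (hk0 : k = none → C.scale u ≠ ((0 : K) : OnePoint K)) (hk1 : ∀ j, k = some j → C.comp j ≤ u)
    (hl0 : l = none → Nondegenerate (C.scale u))
    (hl1 : ∀ j, l = some j → C.comp j ≤ u ∧ C.fpt u j ≠ C.fpt u i) :
    ratioNum C.rho i l k ≠ 0 := by
  rcases l with _ | l <;> rcases k with _ | k
  · exact one_ne_zero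
  · have hu := eq_col hi (hl0 rfl)
    have hc := scale_eq_unit (hl0 rfl)
    subst hu
    exact ((pair_rho_col (j := k) hc).1 (hk1 k rfl)).1
  · obtain ⟨h1, h2⟩ := hl1 l rfl
    obtain ⟨r, hr, -, h⟩ := pair_rho hi h1 h2.symm
    simp only [ratioNum]
    rw [h]
    refine mul_ne_zero hr (mul_ne_zero (fun h0 => hk0 rfl ?_) (sub_ne_zero.2 h2))
    generalize C.scale u = c at h0
    induction c using OnePoint.rec with
    | infty => simp at h0
    | coe c => rw [homPair_coe_zero] at h0; rw [h0]
  · obtain ⟨h1, h2⟩ := hl1 l rfl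
    by_cases h : l = k
    · simp [ratioNum, h]
    · simp only [ratioNum, if_neg h]
      obtain ⟨r, hr, h', -⟩ := tripleDiff_rho (C := C) (v := u) (i := i) (j := l) (k := k)
        (by rintro rfl; exact h2 rfl) (fun h => hk (h ▸ rfl)) h hi h1 (hk1 k rfl)
        (fun h => h2 h.1.symm)
      rw [h']
      exact mul_ne_zero hr (sub_ne_zero.2 h2)

end Ratios

/-! ### Charts near a nodal curve -/

section Chart

open NodalLine

variable {K : Type} [Field K] {n : ℕ}

/-- The coordinates of the chart: gluing parameters, and positions of nodes and markings. -/
abbrev ChartIndex (C : ScaledLine K n) : Type := C.V ⊕ (C.V ⊕ Fin n)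

namespace Frame

variable {C : ScaledLine K n} (F : Frame C)

/-- The node is not a reference point. -/
def NodeFree (w : C.V) : Prop := F.rep w ≠ F.rep (C.par w) ∧ F.ext (C.par w) ≠ some (F.rep w)

/-- The marking is not a reference point. -/
def MarkFree (i : Fin n) : Prop := F.rep (C.comp i) ≠ i ∧ F.ext (C.comp i) ≠ some i

section

variable {R : Type} [CommRing R] [Algebra K R]

open Classical in
/-- The positions of the nodes, in terms of the chart. -/
def nodeOf (y : ChartIndex C → R) (w : C.V) : R :=
  if F.NodeFree w then y (.inr (.inl w)) else algebraMap K R (C.node w)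

open Classical in
/-- The positions of the markings, in terms of the chart. -/
def markOf (y : ChartIndex C → R) (i : Fin n) : R :=
  if F.MarkFree i then y (.inr (.inr i)) else algebraMap K R (C.mark i)

end

open Classical in
/-- Numerators of the functions that recover the chart from the coordinates. -/
def chartNum (x : Index n → OnePoint K) : ChartIndex C → K
  | .inl w => if w = ⊤ then 1
    -- The gluing parameter is the ratio of the offsets on `w` and on its parent. If the base
    -- markings differ, the ratio is factored through the difference of the two base markings; this
    -- occurs with both orientations, whence the sign.
    else if F.rep w = F.rep (C.par w) then
      ratioNum x (F.rep (C.par w)) (F.ext w) (F.ext (C.par w))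
    else -(ratioNum x (F.rep w) (F.ext w) (some (F.rep (C.par w))) *
      ratioNum x (F.rep (C.par w)) (some (F.rep w)) (F.ext (C.par w)))
  | .inr (.inl w) => if F.NodeFree w then
      ratioNum x (F.rep (C.par w)) (some (F.rep w)) (F.ext (C.par w)) else 1
  | .inr (.inr i) => if F.MarkFree i then
      ratioNum x (F.rep (C.comp i)) (some i) (F.ext (C.comp i)) else 1

open Classical in
/-- Denominators of the functions that recover the chart from the coordinates. -/
def chartDen (x : Index n → OnePoint K) : ChartIndex C → K
  | .inl w => if w = ⊤ then 1
    else if F.rep w = F.rep (C.par w) then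
      ratioNum x (F.rep (C.par w)) (F.ext (C.par w)) (F.ext w)
    else ratioNum x (F.rep w) (some (F.rep (C.par w))) (F.ext w) *
      ratioNum x (F.rep (C.par w)) (F.ext (C.par w)) (some (F.rep w))
  | .inr (.inl w) => if F.NodeFree w then
      ratioNum x (F.rep (C.par w)) (F.ext (C.par w)) (some (F.rep w)) else 1
  | .inr (.inr i) => if F.MarkFree i then
      ratioNum x (F.rep (C.comp i)) (F.ext (C.comp i)) (some i) else 1

variable {F}

theorem NodeFree.ne_top {w : C.V} (h : F.NodeFree w) : w ≠ ⊤ := by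
  rintro rfl
  refine h.1 ?_
  rw [par, dif_neg]
  rintro ⟨u, hu⟩
  exact not_top_lt hu.lt

theorem ext_ne_rep (v : C.V) : F.ext v ≠ some (F.rep v) := fun h => F.ext_ne v _ h rfl

theorem comp_rep_not_le {w u : C.V} (hw : w ⋖ u) (h : F.rep w ≠ F.rep u) :
    ¬ C.comp (F.rep u) ≤ w := fun h' => h (F.rep_eq u w hw h')

theorem ext_ne_rep_of_eq {w u : C.V} (h : F.rep w = F.rep u) :
    F.ext w ≠ some (F.rep u) := h ▸ ext_ne_rep w

theorem fpt_rep_ne {w u : C.V} (hw : w ⋖ u) (h : F.rep w ≠ F.rep u) :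
    C.fpt u (F.rep u) ≠ C.fpt u (F.rep w) := by
  intro he
  rcases eq_or_exists_of_fpt_eq (F.comp_rep u) ((F.comp_rep w).trans hw.le) he with h' | ⟨w', h1, h2, h3⟩
  · exact h h'.symm
  · have := C.covBy_unique h1 hw h3 (F.comp_rep w)
    subst this
    exact comp_rep_not_le hw h h2

/-! #### The denominators do not vanish -/

theorem chartDen_rho_ne_zero (j : ChartIndex C) : F.chartDen C.rho j ≠ 0 := by
  have hext : ∀ u, (F.ext u = none → Nondegenerate (C.scale u)) ∧
      ∀ j, F.ext u = some j → C.comp j ≤ u ∧ C.fpt u j ≠ C.fpt u (F.rep u) := fun u =>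
    ⟨(F.ext_eq_none u).1, fun j hj => ⟨F.comp_ext u j hj, F.ext_ne u j hj⟩⟩
  -- If the second reference on `w` is the form, `w` is coloured and its parent has an infinite
  -- form.
  have hw0 : ∀ w u, w ⋖ u → F.ext w = none → C.scale u ≠ ((0 : K) : OnePoint K) := by
    intro w u hw h
    rw [C.scale_above w u ((F.ext_eq_none w).1 h) hw.lt]
    exact OnePoint.infty_ne_coe _
  have hw1 : ∀ w u, w ⋖ u → ∀ j, F.ext w = some j → C.comp j ≤ u := fun w u hw j hj =>
    (F.comp_ext w j hj).trans hw.le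
  rcases j with w | w | i
  · simp only [chartDen]
    split_ifs with h1 h2
    · exact one_ne_zero
    · have hw := covBy_par h1
      exact ScaledLine.ratioNum_rho_ne_zero (F.comp_rep _) (ext_ne_rep_of_eq h2) (hw0 _ _ hw)
        (hw1 _ _ hw) (hext _).1 (hext _).2
    · have hw := covBy_par h1
      have hle := (F.comp_rep w).trans hw.le
      refine mul_ne_zero ?_ ?_
      · refine ScaledLine.ratioNum_rho_ne_zero hle (ext_ne_rep w) (hw0 _ _ hw)
          (hw1 _ _ hw) (by simp) ?_
        intro j hj
        obtain rfl := Option.some.inj hj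
        exact ⟨F.comp_rep _, fpt_rep_ne hw h2⟩
      · refine ScaledLine.ratioNum_rho_ne_zero (F.comp_rep _) (fun h => h2 (Option.some.inj h))
          (by simp) ?_ (hext _).1 (hext _).2
        intro j hj
        obtain rfl := Option.some.inj hj
        exact hle
  · simp only [chartDen]
    split_ifs with h
    · refine ScaledLine.ratioNum_rho_ne_zero (F.comp_rep _) (fun h' => h.1 (Option.some.inj h'))
        (by simp) ?_ (hext _).1 (hext _).2
      intro j hj
      obtain rfl := Option.some.inj hj
      exact (F.comp_rep w).trans (covBy_par h.ne_top).le
    · exact one_ne_zero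
  · simp only [chartDen]
    split_ifs with h
    · refine ScaledLine.ratioNum_rho_ne_zero (F.comp_rep _) (fun h' => h.1 (Option.some.inj h').symm)
        (by simp) ?_ (hext _).1 (hext _).2
      intro j hj
      obtain rfl := Option.some.inj hj
      exact le_rfl
    · exact one_ne_zero

/-! #### The chart of a marked affine line -/

theorem chart_rhoOfPoints {z : Fin n → K} (hz : Function.Injective z) :
    (∀ j, F.chartDen (rhoOfPoints z) j ≠ 0) ∧
    (∀ w u, w ⋖ u → F.chartNum (rhoOfPoints z) (.inl w) / F.chartDen (rhoOfPoints z) (.inl w) *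
      offset z (F.rep u) (F.ext u) = offset z (F.rep w) (F.ext w)) ∧
    (∀ w, F.NodeFree w → F.chartNum (rhoOfPoints z) (.inr (.inl w)) /
      F.chartDen (rhoOfPoints z) (.inr (.inl w)) * offset z (F.rep (C.par w)) (F.ext (C.par w)) =
        z (F.rep w) - z (F.rep (C.par w))) ∧
    (∀ i, F.MarkFree i → F.chartNum (rhoOfPoints z) (.inr (.inr i)) /
      F.chartDen (rhoOfPoints z) (.inr (.inr i)) * offset z (F.rep (C.comp i)) (F.ext (C.comp i)) =
        z i - z (F.rep (C.comp i))) := by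
  have key : ∀ {i k l}, k ≠ some i → l ≠ some i → ratioNum (rhoOfPoints z) i l k ≠ 0 ∧
      ratioNum (rhoOfPoints z) i k l / ratioNum (rhoOfPoints z) i l k * offset z i l =
        offset z i k := by
    intro i k l hk hl
    obtain ⟨r, hr, h1, h2⟩ := ratioNum_rhoOfPoints hz hk hl
    have h0 := offset_ne_zero hz hl
    rw [h1, h2]
    refine ⟨mul_ne_zero hr h0, ?_⟩
    field_simp
  refine ⟨?_, ?_, ?_, ?_⟩
  · rintro (w | w | i)
    · simp only [chartDen]
      split_ifs with h1 h2
      · exact one_ne_zero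
      · exact (key (ext_ne_rep_of_eq h2) (ext_ne_rep _)).1
      · exact mul_ne_zero (key (ext_ne_rep w) (fun h => h2 (Option.some.inj h).symm)).1
          (key (fun h => h2 (Option.some.inj h)) (ext_ne_rep _)).1
    · simp only [chartDen]
      split_ifs with h
      · exact (key (fun h' => h.1 (Option.some.inj h')) (ext_ne_rep _)).1
      · exact one_ne_zero
    · simp only [chartDen]
      split_ifs with h
      · exact (key (fun h' => h.1 (Option.some.inj h').symm) (ext_ne_rep _)).1
      · exact one_ne_zero
  · intro w u hw
    have hpar := par_eq hw
    have hne : w ≠ ⊤ := hw.lt.ne_top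
    simp only [chartNum, chartDen, if_neg hne, hpar]
    split_ifs with h
    · rw [(key (ext_ne_rep_of_eq h) (ext_ne_rep _)).2, h]
    · obtain ⟨h1, h2⟩ := key (i := F.rep w) (k := F.ext w) (l := some (F.rep u)) (ext_ne_rep w)
        (fun h' => h (Option.some.inj h').symm)
      obtain ⟨h3, h4⟩ := key (i := F.rep u) (k := some (F.rep w)) (l := F.ext u)
        (fun h' => h (Option.some.inj h')) (ext_ne_rep _)
      rw [neg_div, mul_div_mul_comm, neg_mul, mul_assoc, h4, ← h2]
      simp only [offset]
      ring
  · intro w h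
    simp only [chartNum, chartDen, if_pos h]
    exact (key (fun h' => h.1 (Option.some.inj h')) (ext_ne_rep _)).2
  · intro i h
    simp only [chartNum, chartDen, if_pos h]
    exact (key (fun h' => h.1 (Option.some.inj h').symm) (ext_ne_rep _)).2

/-! #### Positions in terms of the chart -/

section

variable {y : ChartIndex C → K}

local notation "posAt" => fun i u => pos (fun w => y (Sum.inl w)) (F.nodeOf y) (C.comp i)
  (F.markOf y i) u

theorem nodeOf_eq_zero (hF : F.IsNormalized) {w u : C.V} (hw : w ⋖ u) (h : F.rep w = F.rep u) :
    F.nodeOf y w = 0 := by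
  have hn : ¬ F.NodeFree w := fun h' => h'.1 (by rw [par_eq hw, h])
  rw [nodeOf, if_neg hn]
  exact (fpt_of_covBy hw (F.comp_rep w)).symm.trans (h ▸ hF.fpt_rep u)

theorem nodeOf_eq_one (hF : F.IsNormalized) {w u : C.V} (hw : w ⋖ u) (h : F.ext u = some (F.rep w)) :
    F.nodeOf y w = 1 := by
  have hn : ¬ F.NodeFree w := fun h' => h'.2 (by rw [par_eq hw, h])
  rw [nodeOf, if_neg hn]
  exact (fpt_of_covBy hw (F.comp_rep w)).symm.trans (hF.fpt_ext u _ h)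

theorem markOf_eq_zero (hF : F.IsNormalized) {i : Fin n} (h : F.rep (C.comp i) = i) :
    F.markOf y i = 0 := by
  have hn : ¬ F.MarkFree i := fun h' => h'.1 h
  rw [markOf, if_neg hn]
  have := hF.fpt_rep (C.comp i)
  rw [h] at this
  exact (fpt_of_eq rfl).symm.trans this

theorem markOf_eq_one (hF : F.IsNormalized) {i : Fin n} (h : F.ext (C.comp i) = some i) :
    F.markOf y i = 1 := by
  have hn : ¬ F.MarkFree i := fun h' => h'.2 h
  rw [markOf, if_neg hn]
  exact (fpt_of_eq rfl).symm.trans (hF.fpt_ext _ _ h)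

/-- The base marking of `u` is the base marking of every component on the path down to it, so all
nodes on the path and the marking itself are at `0`. -/
theorem pos_rep (hF : F.IsNormalized) (u : C.V) : posAt (F.rep u) u = 0 := by
  induction u using WellFoundedLT.induction with
  | ind u ih =>
    simp only at ih ⊢
    rcases (F.comp_rep u).eq_or_lt with h | h
    · have : F.markOf y (F.rep u) = 0 := markOf_eq_zero hF (by rw [h])
      rw [this, h, pos_self]
    · have hc := child_covBy h
      have hr := F.rep_eq u _ hc (le_child h)
      rw [pos_of_lt _ _ _ h, nodeOf_eq_zero hF hc hr]
      have := ih _ hc.lt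
      rw [hr] at this
      rw [this, mul_zero, add_zero]

/-- The second reference is seen from `u` at `1`. If it is behind a node, it is the base marking of
the component behind the node, so gluing does not move it. -/
theorem pos_ext (hF : F.IsNormalized) {u : C.V} {k : Fin n} (hk : F.ext u = some k) :
    posAt k u = 1 := by
  simp only
  rcases (F.comp_ext u k hk).eq_or_lt with h | h
  · have : F.markOf y k = 1 := markOf_eq_one hF (by rw [h, hk])
    rw [this, h, pos_self]
  · have hc := child_covBy h
    have hr := F.rep_eq_ext u _ k hc hk (le_child h)
    have := pos_rep (y := y) hF (C.child u (C.comp k))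
    simp only [hr] at this
    rw [pos_of_lt _ _ _ h, nodeOf_eq_one hF hc (by rw [hr, hk]), this, mul_zero, add_zero]

/-- The chart is determined by the smoothed curve. -/
theorem offset_smoothPt (hF : F.IsNormalized) {d : C.V → K}
    (ht : ∀ w u, w ⋖ u → y (.inl w) * d u = d w)
    (hc : ∀ v, Nondegenerate (C.scale v) → d v = 1) {z : Fin n → K}
    (hz : z = C.smoothPt (fun w => y (.inl w)) (F.nodeOf y) d (F.markOf y)) :
    (∀ v, offset z (F.rep v) (F.ext v) = d v) ∧
    (∀ w u, w ⋖ u → z (F.rep w) - z (F.rep u) = d u * F.nodeOf y w) ∧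
    ∀ i, z i - z (F.rep (C.comp i)) = d (C.comp i) * F.markOf y i := by
  have key : ∀ u i, C.comp i ≤ u → z i - z (F.rep u) = d u * posAt i u := by
    intro u i hi
    rw [hz, smoothPt_sub ht _ (F.comp_rep u) hi]
    have := pos_rep (y := y) hF u
    simp only at this
    rw [this, sub_zero]
  refine ⟨fun v => ?_, fun w u hw => ?_, fun i => ?_⟩
  · rcases h : F.ext v with _ | k
    · exact (hc v ((F.ext_eq_none v).1 h)).symm
    · simp only [offset]
      rw [key v k (F.comp_ext v k h), pos_ext hF h, mul_one]
  · rw [key u _ ((F.comp_rep w).trans hw.le)]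
    have h1 := pos_rep (y := y) hF w
    simp only at h1 ⊢
    have hlt := (F.comp_rep w).trans_lt hw.lt
    rw [pos_of_lt _ _ _ hlt, child_eq hw (F.comp_rep w), h1, mul_zero, add_zero]
  · rw [key _ i le_rfl]
    simp only
    rw [pos_self]

/-- The smoothed curve is determined by the chart. -/
theorem smoothPt_eq {d : C.V → K} (ht : ∀ w u, w ⋖ u → y (.inl w) * d u = d w) {z : Fin n → K}
    (hnode : ∀ w u, w ⋖ u → d u * F.nodeOf y w = z (F.rep w) - z (F.rep u))
    (hmark : ∀ i, d (C.comp i) * F.markOf y i = z i - z (F.rep (C.comp i))) (i : Fin n) :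
    C.smoothPt (fun w => y (.inl w)) (F.nodeOf y) d (F.markOf y) i = z i - z (F.rep ⊤) := by
  have key : ∀ u, C.comp i ≤ u → d u * posAt i u = z i - z (F.rep u) := by
    intro u
    induction u using WellFoundedLT.induction with
    | ind u ih =>
      intro hi
      simp only at ih ⊢
      rcases hi.eq_or_lt with h | h
      · subst h; rw [pos_self, hmark]
      · have hc := child_covBy h
        rw [pos_of_lt _ _ _ h, mul_add, hnode _ _ hc, ← mul_assoc, mul_comm (d u), ht _ _ hc,
          ih _ hc.lt (le_child h)]
        ring
  exact key ⊤ le_top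

end

end Frame

end Chart

namespace Frame

open NodalLine

/-! ### The torus of a chart -/

section Torus

variable {n : ℕ} {C : ScaledLine ℂ n} (F : Frame C)

open Classical in
/-- The characters of the torus that give the coordinates of the chart. -/
def character : ChartIndex C → ChartIndex C → ℤ
  | .inl w => if w = ⊤ then 0
    -- Below the coloured components the gluing parameters are free. On the root side the free
    -- parameters are `s_w = 1 / d_w` for the units `d_w`, so that `t_w = d_w / d_u = s_u / s_w`.
    -- For coloured `w` one has `d_w = 1` and `t_w = s_u`.
    else if C.scale w = ((0 : ℂ) : OnePoint ℂ) then delta (.inl w)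
    else if C.scale w = ∞ then delta (.inl (C.par w)) - delta (.inl w)
    else delta (.inl (C.par w))
  | .inr (.inl w) => if F.NodeFree w then delta (.inr (.inl w)) else 0
  | .inr (.inr i) => if F.MarkFree i then delta (.inr (.inr i)) else 0

/-- The points of the torus, in terms of the chart. -/
structure IsTorusPoint (v : ChartIndex C → ℂ) : Prop where
  ne_zero : ∀ j, v j ≠ 0
  top : v (.inl ⊤) = 1
  node : ∀ w, ¬ F.NodeFree w → v (.inr (.inl w)) = 1
  mark : ∀ i, ¬ F.MarkFree i → v (.inr (.inr i)) = 1
  exists_units : ∃ d : C.V → ℂ, (∀ w, d w ≠ 0) ∧ (∀ w, Nondegenerate (C.scale w) → d w = 1) ∧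
    ∀ w u, w ⋖ u → v (.inl w) * d u = d w

theorem scale_eq_infty_of_le {w u : C.V} (h : C.scale w = ∞) (hwu : w ≤ u) : C.scale u = ∞ := by
  have h2 := ScaledLine.scaleLevel_mono hwu
  rw [scaleLevel_eq_two.2 h] at h2
  exact scaleLevel_eq_two.1 (le_antisymm (scaleLevel_le_two _) h2)

theorem scale_eq_zero_of_le {w u : C.V} (h : C.scale u = ((0 : ℂ) : OnePoint ℂ)) (hwu : w ≤ u) :
    C.scale w = ((0 : ℂ) : OnePoint ℂ) := by
  have h2 := ScaledLine.scaleLevel_mono hwu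
  rw [scaleLevel_eq_zero.2 h] at h2
  exact scaleLevel_eq_zero.1 (Nat.le_zero.1 h2)

theorem scale_par_eq_infty {w u : C.V} (hw : w ⋖ u) (h : C.scale w ≠ ((0 : ℂ) : OnePoint ℂ)) :
    C.scale u = ∞ := by
  by_cases h' : C.scale w = ∞
  · exact scale_eq_infty_of_le h' hw.le
  · exact C.scale_above w u ⟨h, h'⟩ hw.lt

theorem prod_zpow_delta {Q : Type} [Fintype Q] (s : Q → ℂˣ) (a : Q) :
    ∏ k, s k ^ delta a k = s a := by
  classical
  unfold delta
  rw [Finset.prod_eq_single a (fun b _ hb => by simp [Pi.single_eq_of_ne hb]) (by simp)]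
  simp

open Classical in
-- The existence of units encodes that the products of gluing parameters from different coloured
-- components up to a common component agree. Solving for the units turns these relations into a
-- parametrization by a torus.
theorem isTorusPoint_iff [Fintype (ChartIndex C)] {v : ChartIndex C → ℂ} :
    F.IsTorusPoint v ↔
      ∃ s : ChartIndex C → ℂˣ, ∀ j, v j = ((∏ k, s k ^ F.character j k : ℂˣ) : ℂ) := by
  have : Fintype C.V := Fintype.ofFinite _
  constructor
  · rintro ⟨h0, h1, h2, h3, d, d0, d1, hd⟩
    refine ⟨fun j => match j with
      | .inl w => if C.scale w = ((0 : ℂ) : OnePoint ℂ) then Units.mk0 _ (h0 (.inl w))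
        else (Units.mk0 _ (d0 w))⁻¹
      | .inr p => Units.mk0 _ (h0 (.inr p)), ?_⟩
    rintro (w | w | i)
    · simp only [character]
      split_ifs with c1 c2 c3
      · subst c1; simpa using h1
      · rw [prod_zpow_delta]; simp [c2]
      · have hw := covBy_par c1
        have hu : C.scale (C.par w) ≠ ((0 : ℂ) : OnePoint ℂ) := by
          rw [scale_par_eq_infty hw c2]; exact OnePoint.infty_ne_coe _
        simp only [Pi.sub_apply, zpow_sub, Finset.prod_mul_distrib, Finset.prod_inv_distrib]
        rw [prod_zpow_delta, prod_zpow_delta]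
        simp only [if_neg c2, if_neg hu]
        simp only [inv_inv, Units.val_mul, Units.val_inv_eq_inv_val, Units.val_mk0]
        rw [← hd _ _ hw]
        have := d0 (C.par w)
        field_simp
      · have hw := covBy_par c1
        have hu : C.scale (C.par w) ≠ ((0 : ℂ) : OnePoint ℂ) := by
          rw [scale_par_eq_infty hw c2]; exact OnePoint.infty_ne_coe _
        rw [prod_zpow_delta]
        simp only [if_neg hu, Units.val_inv_eq_inv_val, Units.val_mk0]
        have h4 := hd _ _ hw
        rw [d1 w ⟨c2, c3⟩] at h4
        exact eq_inv_of_mul_eq_one_left h4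
    · simp only [character]
      split_ifs with c1
      · rw [prod_zpow_delta]; simp
      · simpa using h2 w c1
    · simp only [character]
      split_ifs with c1
      · rw [prod_zpow_delta]; simp
      · simpa using h3 i c1
  · rintro ⟨s, hs⟩
    refine ⟨fun j => by rw [hs]; exact Units.ne_zero _, by rw [hs]; simp [character],
      fun w hw => by rw [hs]; simp [character, hw], fun i hi => by rw [hs]; simp [character, hi],
      -- The units recovered from the parameters: a product over the path to the coloured component
      -- where the form is zero, `1` on coloured components, and the inverse parameter where the
      -- form is infinite.
      fun w => (((∏ x with w ≤ x ∧ C.scale x = ((0 : ℂ) : OnePoint ℂ), s (.inl x)) *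
        (if C.scale w = ∞ then (s (.inl w))⁻¹ else 1) : ℂˣ) : ℂ), fun w => Units.ne_zero _, ?_, ?_⟩
    · intro w hw
      dsimp only
      rw [if_neg hw.2, mul_one, Finset.prod_eq_one, Units.val_one]
      intro x hx
      simp only [Finset.mem_filter, Finset.mem_univ, true_and] at hx
      exact absurd (scale_eq_zero_of_le hx.2 hx.1) hw.1
    · intro w u hw
      have hne : w ≠ ⊤ := hw.lt.ne_top
      have hempty : ∀ x : C.V, C.scale x ≠ ((0 : ℂ) : OnePoint ℂ) →
          ∏ y with x ≤ y ∧ C.scale y = ((0 : ℂ) : OnePoint ℂ), s (.inl y) = 1 := by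
        intro x hx
        refine Finset.prod_eq_one fun y hy => ?_
        simp only [Finset.mem_filter, Finset.mem_univ, true_and] at hy
        exact absurd (scale_eq_zero_of_le hy.2 hy.1) hx
      have hinf : ∞ ≠ ((0 : ℂ) : OnePoint ℂ) := OnePoint.infty_ne_coe _
      rw [hs, ← Units.val_mul, Units.val_inj]
      simp only [character, if_neg hne, par_eq hw]
      by_cases c1 : C.scale w = ((0 : ℂ) : OnePoint ℂ)
      · have c2 : C.scale w ≠ ∞ := by rw [c1]; exact hinf.symm
        have hins : (Finset.univ.filter fun x : C.V => w ≤ x ∧ C.scale x = ((0 : ℂ) : OnePoint ℂ)) =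
            insert w (Finset.univ.filter fun x : C.V => u ≤ x ∧ C.scale x = ((0 : ℂ) : OnePoint ℂ)) := by
          ext x
          simp only [Finset.mem_filter, Finset.mem_univ, true_and, Finset.mem_insert]
          constructor
          · rintro ⟨h1, h2⟩
            rcases h1.eq_or_lt with h | h
            · exact Or.inl h.symm
            · exact Or.inr ⟨(C.chain w x u h.le hw.le).elim
                (fun h' => (h'.eq_or_lt).elim (fun h => h.ge) fun h' => absurd h' (hw.2 h)) id, h2⟩
          · rintro (rfl | ⟨h1, h2⟩)
            · exact ⟨le_rfl, c1⟩
            · exact ⟨hw.le.trans h1, h2⟩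
        rw [if_pos c1, if_neg c2, mul_one, prod_zpow_delta, hins, Finset.prod_insert]
        · have hu : C.scale u ≠ ∞ := by
            intro hu
            obtain ⟨i, hi⟩ := C.exists_comp_le w
            have hlt := (ScaledLine.lt_col_iff hi).2 c1
            have hle : u ≤ C.col i := (C.chain w _ _ hlt.le hw.le).elim
              (fun h => (h.eq_or_lt).elim (fun h => h.ge) fun h => absurd h (hw.2 hlt)) id
            exact (C.nondegenerate_col i).2 (scale_eq_infty_of_le hu hle)
          rw [if_neg hu, mul_one]
        · simp only [Finset.mem_filter, Finset.mem_univ, true_and, not_and]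
          exact fun h => absurd hw.lt (not_lt_of_ge h)
      · have hu := scale_par_eq_infty hw c1
        rw [if_neg c1, hempty w c1, hempty u (by rw [hu]; exact hinf), if_pos hu]
        by_cases c2 : C.scale w = ∞
        · simp only [if_pos c2, Pi.sub_apply, zpow_sub, Finset.prod_mul_distrib,
            Finset.prod_inv_distrib]
          rw [prod_zpow_delta, prod_zpow_delta]
          simp [mul_comm]
        · simp only [if_neg c2]
          rw [prod_zpow_delta]
          simp

/-- The semigroup generated by the characters is that of a forest. -/
theorem closure_range_character [Fintype (ChartIndex C)] :
    ∃ (G H : Set (ChartIndex C)) (p : ChartIndex C → ChartIndex C), H ⊆ G ∧ (∀ q ∈ H, p q ∈ G) ∧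
      AddSubmonoid.closure (Set.range F.character) =
        AddSubmonoid.closure (forestGenerators G H p) := by
  -- The characters on the path from a coloured component up to `u` telescope to the basis vector of
  -- `u`; this uses that every component with infinite form has a coloured one below it.
  have hG : ∀ u, C.scale u = ∞ →
      delta (.inl u) ∈ AddSubmonoid.closure (Set.range F.character) := by
    intro u
    induction u using WellFoundedLT.induction with
    | ind u ih =>
      intro hu
      obtain ⟨i, hi⟩ := C.exists_comp_le u
      have hlt := (ScaledLine.col_lt_iff hi).2 hu
      have hw := child_covBy hlt
      set w := C.child u (C.col i)
      have h0 : C.scale w ≠ ((0 : ℂ) : OnePoint ℂ) := fun h =>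
        (C.nondegenerate_col i).1 (scale_eq_zero_of_le h (le_child hlt))
      have hmem : F.character (.inl w) ∈ AddSubmonoid.closure (Set.range F.character) :=
        AddSubmonoid.subset_closure ⟨_, rfl⟩
      simp only [character, if_neg hw.lt.ne_top, if_neg h0, par_eq hw] at hmem
      split_ifs at hmem with h
      · simpa using add_mem hmem (ih w hw.lt h)
      · exact hmem
  refine ⟨{j | match j with
      | .inl w => (w ≠ ⊤ ∧ C.scale w = ((0 : ℂ) : OnePoint ℂ)) ∨ C.scale w = ∞
      | .inr (.inl w) => F.NodeFree w
      | .inr (.inr i) => F.MarkFree i},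
    {j | ∃ w, j = .inl w ∧ w ≠ ⊤ ∧ C.scale w = ∞}, Sum.map C.par id, ?_, ?_, ?_⟩
  · rintro _ ⟨w, rfl, -, hw⟩
    exact Or.inr hw
  · rintro _ ⟨w, rfl, hw, hw'⟩
    exact Or.inr (scale_eq_infty_of_le hw' (covBy_par hw).le)
  refine le_antisymm (AddSubmonoid.closure_le.2 ?_) (AddSubmonoid.closure_le.2 ?_)
  · rintro _ ⟨w | w | i, rfl⟩
    · simp only [character]
      split_ifs with c1 c2 c3
      · exact zero_mem _
      · exact AddSubmonoid.subset_closure (Or.inl ⟨_, Or.inl ⟨c1, c2⟩, rfl⟩)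
      · exact AddSubmonoid.subset_closure (Or.inr ⟨_, ⟨w, rfl, c1, c3⟩, rfl⟩)
      · exact AddSubmonoid.subset_closure
          (Or.inl ⟨_, Or.inr (scale_par_eq_infty (covBy_par c1) c2), rfl⟩)
    · simp only [character]
      split_ifs with c1
      · exact AddSubmonoid.subset_closure (Or.inl ⟨_, c1, rfl⟩)
      · exact zero_mem _
    · simp only [character]
      split_ifs with c1
      · exact AddSubmonoid.subset_closure (Or.inl ⟨_, c1, rfl⟩)
      · exact zero_mem _
  · rintro _ (⟨w | w | i, hq, rfl⟩ | ⟨_, ⟨w, rfl, hw, hw'⟩, rfl⟩)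
    · rcases hq with ⟨h1, h2⟩ | h
      · refine AddSubmonoid.subset_closure ⟨.inl w, ?_⟩
        simp only [character, if_neg h1, if_pos h2]
      · exact hG w h
    · refine AddSubmonoid.subset_closure ⟨.inr (.inl w), ?_⟩
      simp only [character]
      exact if_pos hq
    · refine AddSubmonoid.subset_closure ⟨.inr (.inr i), ?_⟩
      simp only [character]
      exact if_pos hq
    · refine AddSubmonoid.subset_closure ⟨.inl w, ?_⟩
      have h0 : C.scale w ≠ ((0 : ℂ) : OnePoint ℂ) := by rw [hw']; exact OnePoint.infty_ne_coe _
      simp only [character, if_neg hw, if_neg h0, if_pos hw', Sum.map_inl]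

theorem isSaturated_character {m : ℕ} (e : ChartIndex C ≃ Fin m) :
    IsSaturated fun j k => F.character (e.symm j) (e.symm k) := by
  classical
  have : Fintype (ChartIndex C) := Fintype.ofEquiv _ e.symm
  obtain ⟨G, H, p, h1, h2, h3⟩ := F.closure_range_character
  let φ : (ChartIndex C → ℤ) →+ (Fin m → ℤ) :=
    { toFun := fun c k => c (e.symm k), map_zero' := rfl, map_add' := fun _ _ => rfl }
  have hr : AddSubmonoid.closure (Set.range fun j k => F.character (e.symm j) (e.symm k)) =
      (AddSubmonoid.closure (Set.range F.character)).map φ := by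
    rw [AddMonoidHom.map_mclosure, ← Set.range_comp]
    congr 1
    exact (e.symm.surjective.range_comp (φ ∘ F.character))
  have hφ : ∀ c, φ (fun j => c (e j)) = c := fun c => by
    funext k
    exact congrArg c (e.apply_symm_apply k)
  have hinj : Function.Injective φ := fun c c' h => by
    funext j
    have := congrFun h (e j)
    simpa [φ] using this
  intro c _ k hk hkc
  rw [hr] at hkc ⊢
  obtain ⟨b, hb, hbc⟩ := hkc
  refine ⟨fun j => c (e j), ?_, hφ c⟩
  have : b = k • fun j => c (e j) := hinj (by rw [hbc, map_nsmul, hφ])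
  rw [this] at hb
  rw [h3] at hb ⊢
  exact mem_closure_forestGenerators_of_nsmul h1 h2 hk hb

end Torus

end Frame

namespace Frame

open NodalLine

/-! ### The chart as a pair of regular maps -/

section ToricChart

open Filter Topology

variable {n m : ℕ} {C : ScaledLine ℂ n} {F : Frame C}

theorem mem_torus_iff (e : ChartIndex C ≃ Fin m) {x : Fin m → OnePoint ℂ} :
    (∃ t : Fin m → ℂˣ, ∀ j, x j =
      (((∏ k, t k ^ F.character (e.symm j) (e.symm k) : ℂˣ) : ℂ) : OnePoint ℂ)) ↔
      ∃ v, F.IsTorusPoint v ∧ ∀ j, x (e j) = (v j : OnePoint ℂ) := by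
  have : Fintype (ChartIndex C) := Fintype.ofEquiv _ e.symm
  constructor
  · rintro ⟨t, ht⟩
    refine ⟨_, F.isTorusPoint_iff.2 ⟨fun j => t (e j), fun j => rfl⟩, fun j => ?_⟩
    rw [ht, e.symm_apply_apply]
    congr 2
    exact (Fintype.prod_equiv e _ _ fun k => by rw [e.symm_apply_apply]).symm
  · rintro ⟨v, hv, hx⟩
    obtain ⟨s, hs⟩ := F.isTorusPoint_iff.1 hv
    refine ⟨fun k => s (e.symm k), fun j => ?_⟩
    have := hx (e.symm j)
    rw [e.apply_symm_apply] at this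
    rw [this, hs]
    congr 2
    exact Fintype.prod_equiv e _ _ fun k => by simp only [e.symm_apply_apply]

/-- The finite coordinates of a point, indexed by the chart. -/
def value (e : ChartIndex C ≃ Fin m) (y : Fin m → OnePoint ℂ) (j : ChartIndex C) : ℂ :=
  homPair (y (e j)) 0

variable (F) in
/-- Numerators of the coordinates of a smoothing, in terms of the chart. -/
def coordNum {R : Type} [CommRing R] [Algebra ℂ R] (v : ChartIndex C → R) (k : Index n) : R :=
  C.smoothNum (fun w => v (.inl w)) (F.nodeOf v) (F.markOf v) k

variable (F) in
/-- Denominators of the coordinates of a smoothing, in terms of the chart. -/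
def coordDen {R : Type} [CommRing R] [Algebra ℂ R] (v : ChartIndex C → R) (k : Index n) : R :=
  C.smoothDen (fun _ => 1) (fun w => v (.inl w)) (F.nodeOf v) (F.markOf v) k

open Classical in
/-- A component that separates two markings. -/
def sepPair (C : ScaledLine ℂ n) (i j : Fin n) : C.V :=
  if h : i ≠ j then (C.exists_fpt_ne h).choose else ⊤

theorem sepPair_spec {i j : Fin n} (h : i ≠ j) : C.comp i ≤ sepPair C i j ∧
    C.comp j ≤ sepPair C i j ∧ C.fpt (sepPair C i j) i ≠ C.fpt (sepPair C i j) j := by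
  rw [sepPair, dif_pos h]
  exact (C.exists_fpt_ne h).choose_spec

variable (F) in
/-- The difference of two markings on a smoothing, on the component that separates them. -/
def pairPos {R : Type} [CommRing R] [Algebra ℂ R] (v : ChartIndex C → R) (i j : Fin n) : R :=
  pos (fun w => v (.inl w)) (F.nodeOf v) (C.comp j) (F.markOf v j) (sepPair C i j) -
    pos (fun w => v (.inl w)) (F.nodeOf v) (C.comp i) (F.markOf v i) (sepPair C i j)

variable (F) in
theorem map_nodeOf {R : Type} [CommRing R] [Algebra ℂ R] (φ : R →ₐ[ℂ] ℂ) (v : ChartIndex C → R) :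
    (fun w => φ (F.nodeOf v w)) = F.nodeOf fun j => φ (v j) := by
  funext w
  unfold nodeOf
  split_ifs
  · rfl
  · exact φ.commutes _

variable (F) in
theorem map_markOf {R : Type} [CommRing R] [Algebra ℂ R] (φ : R →ₐ[ℂ] ℂ) (v : ChartIndex C → R) :
    (fun w => φ (F.markOf v w)) = F.markOf fun j => φ (v j) := by
  funext w
  unfold markOf
  split_ifs
  · rfl
  · exact φ.commutes _

variable (F) in
-- Gluing is defined over any commutative ring and commutes with homomorphisms of algebras. Applied
-- to evaluations of polynomials, this exhibits the coordinates as polynomials in the chart.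
theorem map_coord {R : Type} [CommRing R] [Algebra ℂ R] (φ : R →ₐ[ℂ] ℂ) (v : ChartIndex C → R) :
    (∀ k, φ (F.coordNum v k) = F.coordNum (fun j => φ (v j)) k) ∧
    (∀ k, φ (F.coordDen v k) = F.coordDen (fun j => φ (v j)) k) ∧
    ∀ i j, φ (F.pairPos v i j) = F.pairPos (fun j => φ (v j)) i j := by
  refine ⟨fun k => ?_, fun k => ?_, fun i j => ?_⟩
  · have := C.map_smoothNum φ.toRingHom (fun w => v (.inl w)) (F.nodeOf v) (F.markOf v) k
    refine this.trans ?_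
    change C.smoothNum _ (fun w => φ (F.nodeOf v w)) (fun w => φ (F.markOf v w)) k = _
    rw [map_nodeOf, map_markOf]; rfl
  · have := C.map_smoothDen φ.toRingHom (fun _ => 1) (fun w => v (.inl w)) (F.nodeOf v) (F.markOf v) k
    refine this.trans ?_
    change C.smoothDen (fun _ => φ 1) _ (fun w => φ (F.nodeOf v w)) (fun w => φ (F.markOf v w)) k = _
    rw [map_nodeOf, map_markOf, map_one]; rfl
  · unfold pairPos
    rw [map_sub]
    congr 1
    · refine (map_pos φ.toRingHom _ _ _ _ _).trans ?_
      change pos _ (fun w => φ (F.nodeOf v w)) _ ((fun w => φ (F.markOf v w)) j) _ = _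
      rw [map_nodeOf, map_markOf]; rfl
    · refine (map_pos φ.toRingHom _ _ _ _ _).trans ?_
      change pos _ (fun w => φ (F.nodeOf v w)) _ ((fun w => φ (F.markOf v w)) i) _ = _
      rw [map_nodeOf, map_markOf]; rfl

/-- The points at which the chart is defined. -/
def chartDomain (F : Frame C) (e : ChartIndex C ≃ Fin m) : Set (Fin m → OnePoint ℂ) :=
  {y | (∀ i, y i ≠ ∞) ∧ (∀ i j, i ≠ j → F.pairPos (value e y) i j ≠ 0) ∧
    ∀ k, ¬ (F.coordNum (value e y) k = 0 ∧ F.coordDen (value e y) k = 0)}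

/-- The map from the chart to the coordinates. -/
def chartMap (F : Frame C) (e : ChartIndex C ≃ Fin m) (y : Fin m → OnePoint ℂ) :
    Index n → OnePoint ℂ :=
  fun k => ofPair (F.coordNum (value e y) k) (F.coordDen (value e y) k)

/-- The map from the coordinates to the chart. -/
def chartInv (F : Frame C) (e : ChartIndex C ≃ Fin m) (x : Index n → OnePoint ℂ) :
    Fin m → OnePoint ℂ :=
  fun i => ofPair (F.chartNum x (e.symm i)) (F.chartDen x (e.symm i))

variable (e : ChartIndex C ≃ Fin m)

theorem eval_generic (y : Fin m → OnePoint ℂ) :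
    (∀ k, MvPolynomial.eval (fun i => homPair (y i) 0)
      (F.coordNum (fun j => MvPolynomial.X (e j)) k) = F.coordNum (value e y) k) ∧
    (∀ k, MvPolynomial.eval (fun i => homPair (y i) 0)
      (F.coordDen (fun j => MvPolynomial.X (e j)) k) = F.coordDen (value e y) k) ∧
    ∀ i j, MvPolynomial.eval (fun i => homPair (y i) 0)
      (F.pairPos (fun j => MvPolynomial.X (e j)) i j) = F.pairPos (value e y) i j := by
  have h := F.map_coord (MvPolynomial.aeval fun i => homPair (y i) 0)
    (fun j => (MvPolynomial.X (e j) : MvPolynomial (Fin m) ℂ))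
  simp only [MvPolynomial.aeval_X] at h
  have hc : ∀ P : MvPolynomial (Fin m) ℂ, MvPolynomial.aeval (fun i => homPair (y i) 0) P =
      MvPolynomial.eval (fun i => homPair (y i) 0) P := fun P => by
    rw [MvPolynomial.aeval_eq_eval]
  simp only [hc] at h
  exact h

theorem isOpen_chartDomain : IsOpen[zariski (Fin m)] (chartDomain F e) := by
  let _ := zariski (Fin m)
  obtain ⟨h1, h2, h3⟩ : _ ∧ _ ∧ _ :=
    ⟨fun y => (eval_generic (F := F) e y).1, fun y => (eval_generic (F := F) e y).2.1,
      fun y => (eval_generic (F := F) e y).2.2⟩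
  have h : chartDomain F e = {y : Fin m → OnePoint ℂ | ∀ i, y i ≠ ∞} ∩
      ((⋂ i : Fin n, ⋂ j : Fin n, ⋂ _ : i ≠ j, {y | (∀ i, y i ≠ ∞) ∧
        MvPolynomial.eval (fun i => homPair (y i) 0)
          (F.pairPos (fun j => (MvPolynomial.X (e j) : MvPolynomial (Fin m) ℂ)) i j) ≠ 0}) ∩
      ⋂ k : Index n, ({y | (∀ i, y i ≠ ∞) ∧ MvPolynomial.eval (fun i => homPair (y i) 0)
          (F.coordNum (fun j => (MvPolynomial.X (e j) : MvPolynomial (Fin m) ℂ)) k) ≠ 0} ∪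
        {y | (∀ i, y i ≠ ∞) ∧ MvPolynomial.eval (fun i => homPair (y i) 0)
          (F.coordDen (fun j => (MvPolynomial.X (e j) : MvPolynomial (Fin m) ℂ)) k) ≠ 0})) := by
    ext y
    simp only [chartDomain, Set.mem_ofPred_eq, Set.mem_inter_iff, Set.mem_iInter, Set.mem_union,
      h1, h2, h3, not_and_or]
    constructor
    · rintro ⟨a, b, c⟩
      exact ⟨a, fun i j hij => ⟨a, b i j hij⟩, fun k => (c k).imp (fun h => ⟨a, h⟩) fun h => ⟨a, h⟩⟩
    · rintro ⟨a, b, c⟩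
      exact ⟨a, fun i j hij => (b i j hij).2, fun k => (c k).imp (fun h => h.2) fun h => h.2⟩
  rw [h]
  refine isOpen_finite.inter (IsOpen.inter ?_ ?_)
  · exact isOpen_iInter_of_finite fun i => isOpen_iInter_of_finite fun j =>
      isOpen_iInter_of_finite fun _ => isOpen_polynomial_ne _
  · exact isOpen_iInter_of_finite fun k => (isOpen_polynomial_ne _).union (isOpen_polynomial_ne _)

theorem isRegularMap_chartMap : IsRegularMap (chartDomain F e) (chartMap F e) := by
  have h := isRegularMap_of_polynomial (U := chartDomain F e) (fun y hy => hy.1)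
    (F.coordNum (fun j => (MvPolynomial.X (e j) : MvPolynomial (Fin m) ℂ)))
    (F.coordDen (fun j => (MvPolynomial.X (e j) : MvPolynomial (Fin m) ℂ)))
    (fun y hy k => by
      rw [(eval_generic e y).1, (eval_generic e y).2.1]
      exact hy.2.2 k)
  simp only [(eval_generic e _).1, (eval_generic e _).2.1] at h
  exact h

theorem exists_isForm_chart (j : ChartIndex C) : ∃ d, IsForm d (fun x => F.chartNum x j) ∧
    IsForm d (fun x => F.chartDen x j) := by
  rcases j with w | w | i
  · simp only [chartNum, chartDen]
    split_ifs
    · exact ⟨_, IsForm.const 1, IsForm.const 1⟩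
    · exact isForm_ratioNum _ _ _
    · obtain ⟨d, h1, h2⟩ := isForm_ratioNum (F.rep w) (F.ext w) (some (F.rep (C.par w)))
      obtain ⟨d', h1', h2'⟩ := isForm_ratioNum (F.rep (C.par w)) (some (F.rep w)) (F.ext (C.par w))
      exact ⟨_, (h1.mul h1').neg, h2.mul h2'⟩
  · simp only [chartNum, chartDen]
    split_ifs
    · exact isForm_ratioNum _ _ _
    · exact ⟨_, IsForm.const 1, IsForm.const 1⟩
  · simp only [chartNum, chartDen]
    split_ifs
    · exact isForm_ratioNum _ _ _
    · exact ⟨_, IsForm.const 1, IsForm.const 1⟩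

theorem isOpen_chartDen_ne :
    IsOpen[zariski (Index n)] {x : Index n → OnePoint ℂ | ∀ j, F.chartDen x j ≠ 0} := by
  let _ := zariski (Index n)
  simp only [Set.ofPred_forall]
  refine isOpen_iInter_of_finite fun j => ?_
  obtain ⟨d, -, h⟩ := exists_isForm_chart (F := F) j
  exact isOpen_form_ne h

theorem isRegularMap_chartInv :
    IsRegularMap {x : Index n → OnePoint ℂ | ∀ j, F.chartDen x j ≠ 0} (chartInv F e) := by
  rw [isRegularMap_iff]
  intro x hx i
  obtain ⟨d, h1, h2⟩ := exists_isForm_chart (F := F) (e.symm i)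
  exact ⟨d, _, _, h1, h2, Or.inr (hx _), fun y _ _ => rfl⟩

theorem value_of_eq {v : ChartIndex C → ℂ} {y : Fin m → OnePoint ℂ}
    (h : ∀ j, y (e j) = (v j : OnePoint ℂ)) : value e y = v := by
  funext j
  rw [value, h, homPair_coe_zero]

theorem chartInv_apply {x : Index n → OnePoint ℂ} (hx : ∀ j, F.chartDen x j ≠ 0)
    (j : ChartIndex C) :
    chartInv F e x (e j) = ((F.chartNum x j / F.chartDen x j : ℂ) : OnePoint ℂ) := by
  rw [chartInv, e.symm_apply_apply, ofPair_of_ne _ (hx j)]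

theorem rhoOfPoints_sub_const (z : Fin n → ℂ) (c : ℂ) :
    rhoOfPoints (fun i => z i - c) = rhoOfPoints z := by
  funext k
  rcases k with q | p
  · have h : ∀ a, (Fin.cases ∞ (fun i => ((z i - c : ℂ) : OnePoint ℂ)) a : OnePoint ℂ) =
        (Fin.cases ∞ (fun i => (z i : OnePoint ℂ)) a : OnePoint ℂ).map
          fun w => ((1 : ℂˣ) : ℂ) * w + -c := by
      intro a
      refine Fin.cases ?_ (fun i => ?_) a
      · simp
      · simp [sub_eq_add_neg]
    simp only [rhoOfPoints, h, crossRatio_affine]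
  · simp [rhoOfPoints]

theorem chartMap_of_torus {v : ChartIndex C → ℂ} {d : C.V → ℂ} (h0 : ∀ w, d w ≠ 0)
    (h1 : ∀ w, Nondegenerate (C.scale w) → d w = 1) (h2 : ∀ w u, w ⋖ u → v (.inl w) * d u = d w)
    {y : Fin m → OnePoint ℂ} (h : ∀ j, y (e j) = (v j : OnePoint ℂ)) :
    chartMap F e y =
      rhoOfPoints (C.smoothPt (fun w => v (.inl w)) (F.nodeOf v) d (F.markOf v)) := by
  funext k
  unfold chartMap
  rw [value_of_eq e h]
  exact ScaledLine.smooth_eq h0 h2 _ (fun w hw => (h1 w hw).symm) k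

/-- Marked affine lines give points of the torus. -/
theorem chartInv_mem_torus {z : Fin n → ℂ} (hz : Function.Injective z) :
    F.IsTorusPoint (fun j => F.chartNum (rhoOfPoints z) j / F.chartDen (rhoOfPoints z) j) := by
  obtain ⟨h1, h2, h3, h4⟩ := F.chart_rhoOfPoints hz
  have hd : ∀ w, offset z (F.rep w) (F.ext w) ≠ 0 := fun w => offset_ne_zero hz (ext_ne_rep w)
  have htop : F.chartNum (rhoOfPoints z) (.inl ⊤) / F.chartDen (rhoOfPoints z) (.inl ⊤) = 1 := by
    simp [chartNum, chartDen]
  refine ⟨?_, htop, fun w hw => by simp [chartNum, chartDen, hw],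
    fun i hi => by simp [chartNum, chartDen, hi], _, hd, fun w hw => ?_, h2⟩
  · rintro (w | w | i) h
    · by_cases hw : w = ⊤
      · subst hw
        rw [htop] at h
        exact one_ne_zero h
      · have := h2 _ _ (covBy_par hw)
        rw [h, zero_mul] at this
        exact hd w this.symm
    · by_cases hw : F.NodeFree w
      · have := h3 w hw
        rw [h, zero_mul] at this
        exact hw.1 (hz (sub_eq_zero.1 this.symm))
      · simp [chartNum, chartDen, hw] at h
    · by_cases hi : F.MarkFree i
      · have := h4 i hi
        rw [h, zero_mul] at this
        exact hi.1 (hz (sub_eq_zero.1 this.symm)).symm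
      · simp [chartNum, chartDen, hi] at h
  · rw [(F.ext_eq_none w).2 hw]
    rfl

/-- For the chart values of `z` the units are the offsets of the reference markings, and gluing with
them gives back `z` up to the translation that moves the base marking of the root component to `0`.
-/
theorem chartMap_chartInv (hF : F.IsNormalized) {z : Fin n → ℂ} (hz : Function.Injective z) :
    chartMap F e (chartInv F e (rhoOfPoints z)) = rhoOfPoints z := by
  obtain ⟨h1, h2, h3, h4⟩ := F.chart_rhoOfPoints hz
  set v : ChartIndex C → ℂ :=
    fun j => F.chartNum (rhoOfPoints z) j / F.chartDen (rhoOfPoints z) j with hv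
  have hd : ∀ w, offset z (F.rep w) (F.ext w) ≠ 0 := fun w => offset_ne_zero hz (ext_ne_rep w)
  rw [chartMap_of_torus e (v := v) (d := fun w => offset z (F.rep w) (F.ext w)) hd
    (fun w hw => by rw [(F.ext_eq_none w).2 hw]; rfl) h2 (chartInv_apply e h1)]
  have hs : C.smoothPt (fun w => v (.inl w)) (F.nodeOf v)
      (fun w => offset z (F.rep w) (F.ext w)) (F.markOf v) = fun i => z i - z (F.rep ⊤) := by
    funext i
    refine smoothPt_eq h2 (fun w u hw => ?_) (fun i => ?_) i
    · by_cases hf : F.NodeFree w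
      · have := h3 w hf
        rw [par_eq hw] at this
        rw [nodeOf, if_pos hf, mul_comm]
        exact this
      · have hf' := hf
        unfold NodeFree at hf'
        rw [par_eq hw, not_and_or, not_not, not_not] at hf'
        rcases hf' with h | h
        · rw [nodeOf_eq_zero hF hw h, h]; ring
        · rw [nodeOf_eq_one hF hw h, h]
          simp [offset]
    · by_cases hf : F.MarkFree i
      · rw [markOf, if_pos hf, mul_comm]
        exact h4 i hf
      · have hf' := hf
        unfold MarkFree at hf'
        rw [not_and_or, not_not, not_not] at hf'
        rcases hf' with h | h
        · rw [markOf_eq_zero hF h, h]; ring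
        · rw [markOf_eq_one hF h, h]
          simp [offset]
  rw [hs, rhoOfPoints_sub_const]

/-- A point of the torus at which the chart is defined gives a marked affine line. -/
theorem exists_chartMap_eq (hF : F.IsNormalized) {v : ChartIndex C → ℂ} (hv : F.IsTorusPoint v)
    {y : Fin m → OnePoint ℂ} (hy : y ∈ chartDomain F e) (h : ∀ j, y (e j) = (v j : OnePoint ℂ)) :
    ∃ z : Fin n → ℂ, Function.Injective z ∧ chartMap F e y = rhoOfPoints z ∧
      chartInv F e (rhoOfPoints z) = y := by
  obtain ⟨d, d0, d1, hd⟩ := hv.exists_units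
  have hval := value_of_eq e h
  set z := C.smoothPt (fun w => v (.inl w)) (F.nodeOf v) d (F.markOf v) with hz
  -- A difference of two markings is a unit times `pairPos` on the separating component, which does
  -- not vanish on the domain of the chart.
  have hinj : Function.Injective z := by
    intro i j hij
    by_contra hne
    have h1 := hy.2.1 i j hne
    obtain ⟨hi, hj, -⟩ := sepPair_spec (C := C) hne
    have h2 := smoothPt_sub (nd := F.nodeOf v) hd (F.markOf v) hi hj
    rw [← hz, hij, sub_self] at h2
    rw [hval] at h1
    exact mul_ne_zero (d0 _) h1 h2.symm
  refine ⟨z, hinj, chartMap_of_torus e d0 d1 hd h, ?_⟩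
  obtain ⟨h1, h2, h3, h4⟩ := F.chart_rhoOfPoints hinj
  obtain ⟨o1, o2, o3⟩ := offset_smoothPt hF hd d1 hz
  -- The reference markings of the glued line have the units as offsets, so the ratios of
  -- differences return the gluing parameters and positions.
  have key : ∀ j, F.chartNum (rhoOfPoints z) j / F.chartDen (rhoOfPoints z) j = v j := by
    rintro (w | w | i)
    · by_cases hw : w = ⊤
      · subst hw
        rw [hv.top]
        simp [chartNum, chartDen]
      · have hc := covBy_par hw
        have := h2 _ _ hc
        rw [o1, o1, ← hd _ _ hc] at this
        exact mul_right_cancel₀ (d0 _) this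
    · by_cases hw : F.NodeFree w
      · have hc := covBy_par hw.ne_top
        have := h3 w hw
        rw [o1, o2 _ _ hc, nodeOf, if_pos hw, mul_comm (d _)] at this
        exact mul_right_cancel₀ (d0 _) this
      · rw [hv.node w hw]
        simp [chartNum, chartDen, hw]
    · by_cases hi : F.MarkFree i
      · have := h4 i hi
        rw [o1, o3, markOf, if_pos hi, mul_comm (d _)] at this
        exact mul_right_cancel₀ (d0 _) this
      · rw [hv.mark i hi]
        simp [chartNum, chartDen, hi]
  funext i
  obtain ⟨j, rfl⟩ := e.surjective i
  rw [chartInv_apply e h1, key, h]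

open Classical in
/-- The points of the chart near the nodal curve, on a curve through it. -/
def curve (F : Frame C) (ε : ℂ) : ChartIndex C → ℂ
  | .inl w => if w = ⊤ then 1 else C.gluing ε w
  -- The shift by `ε` makes the positions nonzero, as required in the torus, even if the position on
  -- the nodal curve is `0`.
  | .inr (.inl w) => if F.NodeFree w then C.node w + ε else 1
  | .inr (.inr i) => if F.MarkFree i then C.mark i + ε else 1

theorem unit_eq_one (hF : F.IsNormalized) (v : C.V) : C.unit v = 1 := by
  by_cases h : Nondegenerate (C.scale v)
  · exact OnePoint.coe_injective ((ScaledLine.scale_eq_unit h).symm.trans (hF.scale_eq v h))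
  · exact if_neg h

theorem eventually_isTorusPoint_curve (hF : F.IsNormalized) :
    ∀ᶠ ε in 𝓝[≠] (0 : ℂ), F.IsTorusPoint (F.curve ε) := by
  have hne : ∀ a : ℂ, ∀ᶠ ε in 𝓝[≠] (0 : ℂ), a + ε ≠ 0 := by
    intro a
    by_cases ha : a = 0
    · subst ha
      filter_upwards [self_mem_nhdsWithin] with ε h
      simpa using h
    · have : Tendsto (fun ε : ℂ => a + ε) (𝓝 0) (𝓝 (a + 0)) :=
        tendsto_const_nhds.add tendsto_id
      rw [add_zero] at this
      exact (this.eventually_ne ha).filter_mono nhdsWithin_le_nhds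
  filter_upwards [eventually_all.2 fun w : C.V => hne (C.node w),
    eventually_all.2 fun i : Fin n => hne (C.mark i), self_mem_nhdsWithin] with ε h1 h2 h3
  have hg : ∀ w u, w ⋖ u → F.curve ε (.inl w) * C.units ε u = C.units ε w := by
    intro w u hw
    simp only [curve, if_neg hw.lt.ne_top]
    exact ScaledLine.gluing_mul_units h3 w u hw
  refine ⟨?_, by simp [curve], fun w hw => by simp [curve, hw], fun i hi => by simp [curve, hi],
    C.units ε, ScaledLine.units_ne_zero h3, fun w hw => ?_, hg⟩
  · rintro (w | w | i)
    · by_cases hw : w = ⊤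
      · simp [curve, hw]
      · intro h
        have := hg _ _ (covBy_par hw)
        rw [h, zero_mul] at this
        exact ScaledLine.units_ne_zero h3 w this.symm
    · simp only [curve]
      split_ifs
      · exact h1 w
      · exact one_ne_zero
    · simp only [curve]
      split_ifs
      · exact h2 i
      · exact one_ne_zero
  · rw [← ScaledLine.units_eq_of_nondegenerate ε w hw, unit_eq_one hF]

theorem continuous_curve (j : ChartIndex C) : Continuous fun ε => F.curve ε j := by
  rcases j with w | w | i <;> simp only [curve] <;> split_ifs
  · exact continuous_const
  · exact ScaledLine.continuous_gluing w
  · exact continuous_const.add continuous_id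
  · exact continuous_const
  · exact continuous_const.add continuous_id
  · exact continuous_const

theorem nodeOf_curve_zero : F.nodeOf (F.curve 0) = C.node := by
  funext w
  unfold nodeOf
  split_ifs with h
  · simp [curve, h]
  · rfl

theorem markOf_curve_zero : F.markOf (F.curve 0) = C.mark := by
  funext i
  unfold markOf
  split_ifs with h
  · simp [curve, h]
  · rfl

theorem curve_zero_of_covBy (w u : C.V) (h : w ⋖ u) : F.curve 0 (.inl w) = 0 := by
  simp only [curve, if_neg h.lt.ne_top]
  exact ScaledLine.gluing_zero w u h

/-- At parameter `0` all gluing parameters vanish and the positions are those of `C`, so the chart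
returns the nodal curve itself. -/
theorem chart_center (hF : F.IsNormalized) {y : Fin m → OnePoint ℂ}
    (hy : ∀ j, y (e j) = (F.curve 0 j : OnePoint ℂ)) :
    y ∈ chartDomain F e ∧ chartMap F e y = C.rho := by
  have hval := value_of_eq e hy
  have h := fun k => ScaledLine.smooth_zero (C := C) (κ := fun _ => 1)
    (t := fun w => F.curve 0 (.inl w)) curve_zero_of_covBy hF.scale_eq k
  refine ⟨⟨fun i => ?_, fun i j hij => ?_, fun k => ?_⟩, funext fun k => ?_⟩
  · obtain ⟨j, rfl⟩ := e.surjective i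
    rw [hy]; exact OnePoint.coe_ne_infty _
  · obtain ⟨hi, hj, hne⟩ := sepPair_spec (C := C) hij
    rw [hval, pairPos, nodeOf_curve_zero, markOf_curve_zero,
      pos_zero_eq_fpt (t := fun w => F.curve 0 (.inl w)) curve_zero_of_covBy hi,
      pos_zero_eq_fpt (t := fun w => F.curve 0 (.inl w)) curve_zero_of_covBy hj]
    exact sub_ne_zero.2 hne.symm
  · rw [hval, coordNum, coordDen, nodeOf_curve_zero, markOf_curve_zero]
    exact (h k).1
  · rw [chartMap, hval, coordNum, coordDen, nodeOf_curve_zero, markOf_curve_zero]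
    exact (h k).2

end ToricChart

end Frame

/-! ### Comparison with the affine toric variety -/

section ToricSingularities

open Filter Topology

variable {n : ℕ}

/-- The maps `f` and `g` exchange the open stratum with the part of the torus in the chart domain,
and are inverse to each other there. On suitable open sets these identities, and the inclusions of
images, extend to the closures, which are the moduli space and the toric variety. -/
theorem hasToricSingularities_range_rho (hn : 1 ≤ n) :
    HasToricSingularities (Set.range (Moduli.rho : Moduli ℂ n → Index n → OnePoint ℂ)) := by
  rintro _ ⟨⟨C₀⟩, rfl⟩
  obtain ⟨C, F, hC, hF⟩ := exists_isNormalized C₀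
  change ∃ (m d : ℕ) (A : Fin m → Fin d → ℤ), IsSaturated A ∧
    ∃ (U : Set (Index n → OnePoint ℂ)) (W : Set (Fin m → OnePoint ℂ)),
      IsOpen[zariski _] U ∧ C₀.rho ∈ U ∧ IsOpen[zariski (Fin m)] W ∧ AreIsomorphic (_ ∩ U) _
  rw [← hC, range_rho_eq_closure hn]
  let e := Finite.equivFin (ChartIndex C)
  refine ⟨_, _, _, F.isSaturated_character e, ?_⟩
  set T : Set (Fin (Nat.card (ChartIndex C)) → OnePoint ℂ) :=
    {x | ∃ t : Fin (Nat.card (ChartIndex C)) → ℂˣ, ∀ j, x j =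
      (((∏ k, t k ^ F.character (e.symm j) (e.symm k) : ℂˣ) : ℂ) : OnePoint ℂ)} with hT
  let _ := zariski (Index n)
  let _ := zariski (Fin (Nat.card (ChartIndex C)))
  have hdef : affineToric (fun j k => F.character (e.symm j) (e.symm k)) =
      closure T ∩ {x | ∀ j, x j ≠ ∞} := rfl
  rw [hdef]
  set U₀ : Set (Index n → OnePoint ℂ) := {x | ∀ j, F.chartDen x j ≠ 0} with hU₀
  set W₀ := F.chartDomain e with hW₀
  set f := F.chartInv e with hf
  set g := F.chartMap e with hg
  have oU₀ : IsOpen U₀ := Frame.isOpen_chartDen_ne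
  have oW₀ : IsOpen W₀ := Frame.isOpen_chartDomain e
  have rf : IsRegularMap U₀ f := Frame.isRegularMap_chartInv e
  have rg : IsRegularMap W₀ g := Frame.isRegularMap_chartMap e
  have hfX : ∀ x ∈ openStratum n, x ∈ U₀ ∧ f x ∈ T ∧ g (f x) = x := by
    rintro x ⟨z, hz, rfl⟩
    have h1 := (F.chart_rhoOfPoints hz).1
    exact ⟨h1, (Frame.mem_torus_iff e).2 ⟨_, Frame.chartInv_mem_torus hz, Frame.chartInv_apply e h1⟩,
      Frame.chartMap_chartInv e hF hz⟩
  have hgT : ∀ y ∈ T, y ∈ W₀ → g y ∈ openStratum n ∧ f (g y) = y := by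
    intro y hy hy'
    obtain ⟨v, hv, h⟩ := (Frame.mem_torus_iff e).1 hy
    obtain ⟨z, hz, h1, h2⟩ := Frame.exists_chartMap_eq e hF hv hy' h
    rw [hg, h1]
    exact ⟨⟨z, hz, rfl⟩, h2⟩
  have oU : IsOpen (U₀ ∩ f ⁻¹' W₀) := rf.continuousOn.isOpen_inter_preimage oU₀ oW₀
  have oW : IsOpen (W₀ ∩ g ⁻¹' U₀) := rg.continuousOn.isOpen_inter_preimage oW₀ oU₀
  -- A point of the closure in an open set is a limit of points of the stratum in that open set.
  -- Regular maps that agree on these points agree at the limit.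
  have gf : ∀ x ∈ closure (openStratum n) ∩ (U₀ ∩ f ⁻¹' W₀), g (f x) = x := by
    rintro x ⟨hx, hxU⟩
    have hx' := oU.inter_closure ⟨hxU, hx⟩
    exact (rg.comp (rf.mono Set.inter_subset_left) (fun y hy => hy.2)).eq_of_mem_closure
      (isRegularMap_id (U₀ ∩ f ⁻¹' W₀)) Set.inter_subset_left (fun y hy => (hfX y hy.2).2.2) hxU hx'
  have fg : ∀ y ∈ closure T ∩ (W₀ ∩ g ⁻¹' U₀), f (g y) = y := by
    rintro y ⟨hy, hyW⟩
    have hy' := oW.inter_closure ⟨hyW, hy⟩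
    exact (rf.comp (rg.mono Set.inter_subset_left) (fun y hy => hy.2)).eq_of_mem_closure
      (isRegularMap_id (W₀ ∩ g ⁻¹' U₀)) Set.inter_subset_left
      (fun y hy => (hgT y hy.2 hy.1.1).2) hyW hy'
  refine ⟨U₀ ∩ f ⁻¹' W₀, W₀ ∩ g ⁻¹' U₀, oU, ?_, oW, f, g, ?_, ?_, ⟨?_, ?_⟩, ?_, ?_⟩
  -- The chart point of the nodal curve is a limit of torus points. Hence `f` inverts `g` there, and
  -- `f C.rho` is this point, which lies in the chart domain.
  · let y₀ : Fin (Nat.card (ChartIndex C)) → OnePoint ℂ := fun i => (F.curve 0 (e.symm i) : OnePoint ℂ)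
    have hy₀ : ∀ j, y₀ (e j) = (F.curve 0 j : OnePoint ℂ) := fun j => by
      simp only [y₀, e.symm_apply_apply]
    obtain ⟨h1, h2⟩ := Frame.chart_center e hF hy₀
    have h3 : C.rho ∈ U₀ := Frame.chartDen_rho_ne_zero
    have h4 : y₀ ∈ closure T := by
      have := mem_zariski_closure_of_tendsto (l := 𝓝[≠] (0 : ℂ)) (S := T)
        (p := fun ε i => F.curve ε (e.symm i)) (q := fun _ _ => 1)
        (p₀ := fun i => F.curve 0 (e.symm i)) (q₀ := fun _ => 1)
        (fun i => ((Frame.continuous_curve (e.symm i)).tendsto 0).mono_left nhdsWithin_le_nhds)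
        (fun i => tendsto_const_nhds) (fun i h => one_ne_zero h.2) (by
          filter_upwards [Frame.eventually_isTorusPoint_curve hF] with ε hε
          exact (Frame.mem_torus_iff e).2 ⟨_, hε, fun j => by
            simp only [ofPair_one_right, e.symm_apply_apply]⟩)
      simpa only [ofPair_one_right] using this
    have h5 : f (g y₀) = y₀ := fg y₀ ⟨h4, h1, by rw [Set.mem_preimage, hg, h2]; exact h3⟩
    refine ⟨h3, ?_⟩
    rw [hg, h2] at h5
    rw [Set.mem_preimage, h5]
    exact h1
  -- Continuity carries the closure of the stratum into the closure of the torus.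
  · rintro x ⟨hx, hxU⟩
    have hx' := oU.inter_closure ⟨hxU, hx⟩
    have hc : ContinuousWithinAt f ((U₀ ∩ f ⁻¹' W₀) ∩ openStratum n) x :=
      (rf.continuousOn x hxU.1).mono fun y hy => hy.1.1
    have h1 := hc.mem_closure_image hx'
    refine ⟨⟨closure_mono ?_ h1, hxU.2.1⟩, hxU.2, ?_⟩
    · rintro _ ⟨y, hy, rfl⟩
      exact (hfX y hy.2).2.1
    · rw [Set.mem_preimage, gf x ⟨hx, hxU⟩]
      exact hxU.1
  · rintro y ⟨⟨hy, -⟩, hyW⟩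
    have hy' := oW.inter_closure ⟨hyW, hy⟩
    have hc : ContinuousWithinAt g ((W₀ ∩ g ⁻¹' U₀) ∩ T) y :=
      (rg.continuousOn y hyW.1).mono fun y hy => hy.1.1
    have h1 := hc.mem_closure_image hy'
    refine ⟨closure_mono ?_ h1, hyW.2, ?_⟩
    · rintro _ ⟨y, hy, rfl⟩
      exact (hgT y hy.2 hy.1.1).1
    · rw [Set.mem_preimage, fg y ⟨hy, hyW⟩]
      exact hyW.1
  · exact gf
  · rintro y ⟨⟨hy, -⟩, hyW⟩
    exact fg y ⟨hy, hyW⟩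
  · exact rf.mono fun x hx => hx.2.1
  · exact rg.mono fun y hy => hy.2.1

end ToricSingularities

/-! ### Real scaled lines -/

section BaseChange

variable {K L : Type} [Field K] [Field L] {n : ℕ} (φ : K →+* L)

open Classical in
theorem NodalLine.pt_map (C : NodalLine K n) (v : C.V) (k : Fin (n + 1)) :
    (C.map φ).pt v k = (C.pt v k).map φ := by
  refine Fin.cases rfl (fun i => ?_) k
  change (if C.comp i = v then (φ (C.mark i) : OnePoint L)
    else if h : ∃ w, w ⋖ v ∧ C.comp i ≤ w then (φ (C.node h.choose) : OnePoint L) else ∞) =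
      OnePoint.map φ (if C.comp i = v then (C.mark i : OnePoint K)
    else if h : ∃ w, w ⋖ v ∧ C.comp i ≤ w then (C.node h.choose : OnePoint K) else ∞)
  split_ifs <;> rfl

theorem invLength_map (c : OnePoint K) (d : K) :
    ScaledLine.invLength (c.map φ) (φ d) = (ScaledLine.invLength c d).map φ := by
  induction c using OnePoint.rec with
  | infty => simp [ScaledLine.invLength]
  | coe c =>
    by_cases hc : c = 0
    · simp [ScaledLine.invLength, hc]
    · simp [ScaledLine.invLength, hc, map_inv₀]

theorem ScaledLine.rho_map (C : ScaledLine K n) :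
    (C.map φ).rho = fun e => (C.rho e).map φ := by
  have hpt : ∀ (v : C.V) k, (C.map φ).pt v k = (C.pt v k).map φ := C.toNodalLine.pt_map φ
  funext e
  rcases e with q | p
  · obtain ⟨v, hv⟩ := C.toNodalLine.exists_three_le_ncard q.injective
    have hv' : 3 ≤ (Set.range fun t => (C.map φ).pt v (q t)).ncard := by
      simp only [hpt]
      rw [show (Set.range fun t => (C.pt v (q t)).map φ) =
        OnePoint.map φ '' Set.range fun t => C.pt v (q t) by rw [← Set.range_comp]; rfl,
        Set.ncard_image_of_injective _ (onePoint_map_injective φ.injective)]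
      exact hv
    change (C.map φ).rhoFour q = (C.rhoFour q).map φ
    rw [rhoFour_eq hv, rhoFour_eq hv', ← crossRatio_map]
    simp only [hpt]
  · have hne : p 0 ≠ p 1 := fun h => absurd (p.injective h) (by decide)
    obtain ⟨v, h0, h1, h⟩ := C.toNodalLine.exists_fpt_ne hne
    have hf : ∀ i, C.comp i ≤ v → (C.map φ).fpt v i = φ (C.fpt v i) := fun i hi => by
      have h2 := hpt v i.succ
      rw [NodalLine.pt_succ_of_le hi] at h2
      exact (NodalLine.le_of_pt_succ_eq h2).2
    change (C.map φ).rhoTwo p = (C.rhoTwo p).map φ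
    rw [rhoTwo_eq h0 h1 h, rhoTwo_eq (C := C.map φ) (v := v) h0 h1
      (by rw [hf _ h0, hf _ h1]; exact fun he => h (φ.injective he)), ← invLength_map,
      hf _ h0, hf _ h1, map_sub]
    rfl

end BaseChange

/-! ### Real coordinates on the real locus -/

section RealCoordinates

open Topology Filter

variable {n : ℕ}

/-- The map extends continuously to `∞` because `ℝ` is closed in `ℂ`. An injective continuous map
from a compact space to a Hausdorff space is an embedding. -/
theorem isEmbedding_map_ofReal :
    IsEmbedding (OnePoint.map Complex.ofRealHom : OnePoint ℝ → OnePoint ℂ) := by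
  have hc : Continuous (OnePoint.map Complex.ofRealHom : OnePoint ℝ → OnePoint ℂ) := by
    refine OnePoint.continuous_map Complex.continuous_ofReal ?_
    rw [coclosedCompact_eq_cocompact, coclosedCompact_eq_cocompact]
    exact Complex.isometry_ofReal.isClosedEmbedding.tendsto_cocompact
  exact (hc.isClosedEmbedding (onePoint_map_injective Complex.ofRealHom.injective)).isEmbedding

theorem exists_real_of_conj {x : OnePoint ℂ} (h : x.map (starRingEnd ℂ) = x) :
    ∃ y : OnePoint ℝ, y.map Complex.ofRealHom = x := by
  induction x using OnePoint.rec with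
  | infty => exact ⟨∞, rfl⟩
  | coe z =>
    obtain ⟨r, hr⟩ := Complex.conj_eq_iff_real.1 (OnePoint.coe_injective h)
    exact ⟨r, by rw [OnePoint.map_some, hr]; rfl⟩

theorem ScaledLine.isConsistent_rho_real (C : ScaledLine ℝ n) : IsConsistent C.rho := by
  rw [← isConsistent_map Complex.ofRealHom, ← ScaledLine.rho_map]
  exact ScaledLine.isConsistent_rho _

theorem exists_real_scaledLine_rho_eq (hn : 1 ≤ n) {x : Index n → OnePoint ℝ}
    (hx : IsConsistent x) : ∃ C : ScaledLine ℝ n, C.rho = x := by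
  obtain ⟨C, h1, h2⟩ := hx.exists_scaledLine hn
  exact ⟨C, C.isConsistent_rho_real.ext hx h1 h2⟩

namespace RealLocus

theorem exists_realCoord (y : RealLocus n) :
    ∃ x : Index n → OnePoint ℝ, y.1.rho = fun e => (x e).map Complex.ofRealHom := by
  obtain ⟨⟨D⟩, hD⟩ := y
  have h : (D.map (starRingEnd ℂ)).rho = D.rho := congrArg Moduli.rho hD
  rw [ScaledLine.rho_map] at h
  choose x hx using fun e => exists_real_of_conj (congrFun h e)
  exact ⟨x, funext fun e => (hx e).symm⟩

/-- The real coordinates of a point of the real locus. -/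
def realCoord (y : RealLocus n) : Index n → OnePoint ℝ := y.exists_realCoord.choose

theorem rho_eq (y : RealLocus n) : y.1.rho = fun e => (y.realCoord e).map Complex.ofRealHom :=
  y.exists_realCoord.choose_spec

theorem realCoord_eq_iff {y : RealLocus n} {x : Index n → OnePoint ℝ} :
    y.realCoord = x ↔ y.1.rho = fun e => (x e).map Complex.ofRealHom := by
  rw [rho_eq]
  refine ⟨fun h => by rw [h], fun h => funext fun e => ?_⟩
  exact onePoint_map_injective Complex.ofRealHom.injective (congrFun h e)

theorem realCoord_injective : Function.Injective (realCoord : RealLocus n → _) := by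
  intro y y' h
  refine Subtype.ext (Moduli.rho_injective ?_)
  rw [rho_eq, rho_eq, h]

/-- The topology of the real locus comes from complex coordinates, and the real projective line has
the subspace topology of the complex one. -/
theorem isInducing_realCoord : IsInducing (realCoord : RealLocus n → _) := by
  have h1 : IsInducing fun y : RealLocus n => y.1.rho :=
    (IsInducing.mk rfl : IsInducing (Moduli.rho : Moduli ℂ n → _)).comp
      (IsInducing.mk rfl : IsInducing (Subtype.val : RealLocus n → Moduli ℂ n))
  have h2 : IsEmbedding (Pi.map fun _ : Index n =>
      (OnePoint.map Complex.ofRealHom : OnePoint ℝ → OnePoint ℂ)) :=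
    IsEmbedding.piMap fun _ => isEmbedding_map_ofReal
  refine (h2.isInducing.of_comp_iff (f := realCoord)).1 ?_
  convert h1 using 1
  funext y
  exact (rho_eq y).symm

/-- The point of the real locus given by a real scaled line. -/
def ofReal (C : ScaledLine ℝ n) : RealLocus n :=
  ⟨Quotient.mk _ (C.map Complex.ofRealHom), by
    refine Moduli.rho_injective ?_
    change ((C.map Complex.ofRealHom).map (starRingEnd ℂ)).rho = (C.map Complex.ofRealHom).rho
    rw [ScaledLine.rho_map, ScaledLine.rho_map]
    funext e
    change ((C.rho e).map Complex.ofRealHom).map (starRingEnd ℂ) = _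
    induction C.rho e using OnePoint.rec with
    | infty => rfl
    | coe c => simp⟩

theorem realCoord_ofReal (C : ScaledLine ℝ n) : (ofReal C).realCoord = C.rho :=
  realCoord_eq_iff.2 (C.rho_map Complex.ofRealHom)

/-- Being fixed by conjugation only says that a curve is isomorphic to its conjugate. Its
coordinates are then real and consistent, and the reconstruction over `ℝ` produces a real
representative. -/
theorem exists_eq_ofReal (hn : 1 ≤ n) (y : RealLocus n) : ∃ C, y = ofReal C := by
  have hx : IsConsistent y.realCoord := by
    rw [← isConsistent_map Complex.ofRealHom, ← rho_eq]
    obtain ⟨⟨D⟩, hD⟩ := y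
    exact D.isConsistent_rho
  obtain ⟨C, hC⟩ := exists_real_scaledLine_rho_eq hn hx
  exact ⟨C, realCoord_injective (by rw [realCoord_ofReal, hC])⟩

theorem smul_ofReal (σ : Equiv.Perm (Fin n)) (C : ScaledLine ℝ n) :
    σ • ofReal C = ofReal (C.permute σ) := rfl

end RealLocus

end RealCoordinates

/-! ### The embedding of the multiplihedron -/

section Embedding

open Topology

variable {n : ℕ}

namespace QuiltedDisk

theorem fpt_le (C : QuiltedDisk n) {v : C.V} {i j : Fin n} (h : i < j) (hi : C.comp i ≤ v)
    (hj : C.comp j ≤ v) : C.fpt v i ≤ C.fpt v j :=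
  C.ordered v i j _ _ h (NodalLine.pt_succ_of_le hi) (NodalLine.pt_succ_of_le hj)

/-- An isomorphism of scaled lines might reflect components. Positivity of the seams excludes this
on quilted components, and the order of the markings on the others. -/
theorem isomorphic_of_toScaledLine {C D : QuiltedDisk n}
    (h : C.toScaledLine.Isomorphic D.toScaledLine) : C.Isomorphic D := by
  obtain ⟨e, he⟩ := h
  change NodalLine.Iso C.toNodalLine D.toNodalLine at e
  change ∀ v : C.V, C.form v = (D.form (e.f v)).map (fun c => c * (e.a v : ℝ)) at he
  have hcol : ∀ v y, C.seam v = some y → 0 < (e.a v : ℝ) ∧ D.seam (e.f v) = some (e.a v * y) := by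
    intro v y hy
    have hy0 := C.seam_pos v y hy
    have h1 := he v
    have h2 : C.form v = ((y⁻¹ : ℝ) : OnePoint ℝ) := by unfold form; rw [hy]
    have h3 : Nondegenerate (D.form (e.f v)) := by
      constructor
      · intro h0
        rw [h0, h2, OnePoint.map_some, zero_mul] at h1
        exact (inv_pos.2 hy0).ne' (OnePoint.coe_injective h1)
      · intro h0
        rw [h0, h2] at h1
        exact OnePoint.coe_ne_infty _ h1
    rw [nondegenerate_form] at h3
    obtain ⟨y', hy'⟩ := Option.ne_none_iff_exists'.1 h3
    have hy0' := D.seam_pos _ y' hy'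
    have h4 : D.form (e.f v) = ((y'⁻¹ : ℝ) : OnePoint ℝ) := by unfold form; rw [hy']
    rw [h2, h4, OnePoint.map_some] at h1
    have h5 : y⁻¹ = y'⁻¹ * (e.a v : ℝ) := OnePoint.coe_injective h1
    have h6 : (e.a v : ℝ) = y' * y⁻¹ := by rw [h5]; field_simp
    refine ⟨by rw [h6]; positivity, ?_⟩
    rw [hy', h6]
    congr 1
    field_simp
  refine ⟨e, fun v => ?_, fun v => ?_⟩
  · cases hv : C.seam v with
    | some y => exact (hcol v y hv).1
    | none =>
      obtain ⟨i, j, hi, hj, hne⟩ := C.toScaledLine.exists_fpt_ne_of_uncolored (v := v)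
        (fun h => (C.nondegenerate_form v).1 h hv)
      change C.comp i ≤ v at hi
      change C.comp j ≤ v at hj
      change C.fpt v i ≠ C.fpt v j at hne
      -- An unquilted component has two markings in different finite directions. Their order is the
      -- same on both disks, so the affine map cannot reverse it.
      have key : ∀ i j, i < j → C.comp i ≤ v → C.comp j ≤ v → C.fpt v i ≠ C.fpt v j →
          0 < (e.a v : ℝ) := by
        intro i j hij hi hj hne
        have h1 := lt_of_le_of_ne (C.fpt_le hij hi hj) hne
        have hf : ∀ i, C.comp i ≤ v → D.comp i ≤ e.f v ∧
            D.fpt (e.f v) i = e.a v * C.fpt v i + e.b v := by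
          intro i hi
          have h2 := NodalLine.pt_iso e v i.succ
          rw [NodalLine.pt_succ_of_le hi] at h2
          exact NodalLine.le_of_pt_succ_eq h2
        have h3 := D.fpt_le hij (hf i hi).1 (hf j hj).1
        rw [(hf i hi).2, (hf j hj).2] at h3
        refine lt_of_le_of_ne ?_ (e.a v).ne_zero.symm
        by_contra hneg
        have := mul_lt_mul_of_neg_left h1 (not_le.1 hneg)
        linarith
      rcases lt_or_gt_of_ne (fun h : i = j => hne (by rw [h])) with h | h
      · exact key i j h hi hj hne
      · exact key j i h hj hi hne.symm
  · cases hv : C.seam v with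
    | some y => rw [(hcol v y hv).2]; rfl
    | none =>
      rw [Option.map_none]
      by_contra hs
      have h1 : Nondegenerate (C.form v) := by
        have h2 := (D.nondegenerate_form _).2 hs
        rw [he]
        obtain ⟨c, hc⟩ := OnePoint.ne_infty_iff_exists.1 h2.2
        rw [← hc] at h2 ⊢
        rw [OnePoint.map_some]
        refine ⟨fun h => h2.1 ?_, OnePoint.coe_ne_infty _⟩
        rw [(mul_eq_zero.1 (OnePoint.coe_injective h)).resolve_right (e.a v).ne_zero]
      exact (C.nondegenerate_form v).1 h1 hv

end QuiltedDisk

namespace Multiplihedron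

theorem toRealLocus_mk (C : QuiltedDisk n) :
    toRealLocus (Quotient.mk _ C) = RealLocus.ofReal C.toScaledLine := rfl

theorem realCoord_toRealLocus (x : Multiplihedron n) :
    x.toRealLocus.realCoord = x.toReal.rho := by
  obtain ⟨C⟩ := x
  exact RealLocus.realCoord_ofReal C.toScaledLine

theorem isEmbedding_toRealLocus :
    IsEmbedding (toRealLocus : Multiplihedron n → RealLocus n) := by
  refine ⟨(RealLocus.isInducing_realCoord.of_comp_iff).1 ?_, fun x y h => ?_⟩
  · convert (IsInducing.mk rfl : IsInducing fun x : Multiplihedron n => x.toReal.rho) using 1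
    exact funext realCoord_toRealLocus
  · obtain ⟨C⟩ := x
    obtain ⟨D⟩ := y
    refine Quotient.sound (QuiltedDisk.isomorphic_of_toScaledLine
      (ScaledLine.isomorphic_of_rho_eq ?_))
    rw [← RealLocus.realCoord_ofReal, ← RealLocus.realCoord_ofReal]
    exact congrArg RealLocus.realCoord h

end Multiplihedron

end Embedding

/-! ### Limits and signs in the real projective line -/

section RealLine

open Topology Filter

theorem tendsto_ofPair {Y : Type} {l : Filter Y} {p q : Y → ℝ} {p₀ q₀ : ℝ}
    (hp : Tendsto p l (𝓝 p₀)) (hq : Tendsto q l (𝓝 q₀)) (h : ¬ (p₀ = 0 ∧ q₀ = 0)) :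
    Tendsto (fun y => ofPair (p y) (q y)) l (𝓝 (ofPair p₀ q₀)) := by
  by_cases h0 : q₀ = 0
  · subst h0
    have hp0 : p₀ ≠ 0 := fun hp => h ⟨hp, rfl⟩
    rw [ofPair_zero_right, Tendsto, OnePoint.le_nhds_infty]
    intro s _ hs
    obtain ⟨R, hR⟩ := hs.isBounded.exists_norm_le
    -- As `q` tends to `0` and `p` does not, eventually `R * |q| < |p|`, so the quotient leaves the
    -- ball of radius `R`.
    have h1 : Tendsto (fun y => R * |q y|) l (𝓝 (R * |0|)) := (hq.abs).const_mul R
    rw [abs_zero, mul_zero] at h1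
    refine mem_map.2 ?_
    filter_upwards [h1.eventually_lt hp.abs (abs_pos.2 hp0)] with y hy
    by_cases hq0 : q y = 0
    · exact Or.inr (by simp [hq0, ofPair_zero_right])
    · refine Or.inl ⟨p y / q y, fun hr => ?_, (ofPair_of_ne _ hq0).symm⟩
      have h2 := hR _ hr
      rw [Real.norm_eq_abs, abs_div, div_le_iff₀ (abs_pos.2 hq0)] at h2
      exact absurd hy (not_lt_of_ge h2)
  · rw [ofPair_of_ne _ h0]
    have h1 : Tendsto (fun y => ((p y / q y : ℝ) : OnePoint ℝ)) l
        (𝓝 ((p₀ / q₀ : ℝ) : OnePoint ℝ)) :=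
      (OnePoint.continuous_coe.tendsto _).comp (hp.div hq h0)
    refine h1.congr' ?_
    filter_upwards [hq.eventually_ne h0] with y hy
    rw [ofPair_of_ne _ hy]

/-- The sign of a point of the real projective line. -/
def lineSign (x : OnePoint ℝ) : ℝ := homPair x 0 * homPair x 1

@[simp] theorem lineSign_infty : lineSign ∞ = 0 := by simp [lineSign]

@[simp] theorem lineSign_coe (r : ℝ) : lineSign (r : OnePoint ℝ) = r := by simp [lineSign]

/-- The quotient and the product of two reals have the same sign. Both `0` and `∞` have sign zero,
which is what makes the sign conditions closed. -/
theorem lineSign_nonneg_iff {x : OnePoint ℝ} {p q : ℝ} (h : x = ofPair p q) :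
    0 ≤ lineSign x ↔ 0 ≤ p * q := by
  subst h
  by_cases hq : q = 0
  · simp [hq, ofPair_zero_right]
  · rw [ofPair_of_ne _ hq, lineSign_coe, ← mul_div_mul_right _ _ hq]
    exact ⟨fun h => by
      have := mul_nonneg h (mul_self_nonneg q)
      rwa [div_mul_cancel₀ _ (mul_self_ne_zero.2 hq)] at this,
      fun h => div_nonneg h (mul_self_nonneg q)⟩

theorem lineSign_nonpos_iff {x : OnePoint ℝ} {p q : ℝ} (h : x = ofPair p (-q)) :
    lineSign x ≤ 0 ↔ 0 ≤ p * q := by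
  subst h
  by_cases hq : q = 0
  · simp [hq, ofPair_zero_right]
  · rw [ofPair_of_ne _ (neg_ne_zero.2 hq), lineSign_coe, div_neg, neg_nonpos,
      ← mul_div_mul_right _ _ hq]
    exact ⟨fun h => by
      have := mul_nonneg h (mul_self_nonneg q)
      rwa [div_mul_cancel₀ _ (mul_self_ne_zero.2 hq)] at this,
      fun h => div_nonneg h (mul_self_nonneg q)⟩

theorem isClosed_lineSign_nonneg : IsClosed {x : OnePoint ℝ | 0 ≤ lineSign x} := by
  rw [← isOpen_compl_iff]
  convert OnePoint.isOpen_image_coe.2 (isOpen_gt' (0 : ℝ)) using 1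
  ext x
  induction x using OnePoint.rec <;> simp

theorem isClosed_lineSign_nonpos : IsClosed {x : OnePoint ℝ | lineSign x ≤ 0} := by
  rw [← isOpen_compl_iff]
  convert OnePoint.isOpen_image_coe.2 (isOpen_lt' (0 : ℝ)) using 1
  ext x
  induction x using OnePoint.rec <;> simp

theorem isOpen_lineSign_pos : IsOpen {x : OnePoint ℝ | 0 < lineSign x} := by
  convert isClosed_lineSign_nonpos.isOpen_compl using 1
  ext x
  simp

end RealLine

/-! ### The coordinates of quilted disks -/

section Ordered

open Topology Filter

variable {n : ℕ}

/-- The points whose coordinates have the signs of the coordinates of ordered real markings. -/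
def orderedCoords (n : ℕ) : Set (Index n → OnePoint ℝ) :=
  {x | (∀ p, 0 ≤ lineSign (x (.inr p))) ∧ ∀ q : Fin 4 ↪o Fin (n + 1), q 0 = 0 →
    lineSign (x (.inl q)) ≤ 0}

/-- The points all of whose coordinates `ρ_{ij}` are positive. -/
def positiveCoords (n : ℕ) : Set (Index n → OnePoint ℝ) := {x | ∀ p, 0 < lineSign (x (.inr p))}

theorem isClosed_orderedCoords : IsClosed (orderedCoords n) := by
  have : orderedCoords n = (⋂ p, {x | 0 ≤ lineSign (x (.inr p))}) ∩
      ⋂ q : Fin 4 ↪o Fin (n + 1), ⋂ _ : q 0 = 0, {x | lineSign (x (.inl q)) ≤ 0} := by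
    ext x; simp [orderedCoords]
  rw [this]
  exact (isClosed_iInter fun p => isClosed_lineSign_nonneg.preimage (continuous_apply _)).inter
    (isClosed_iInter fun q => isClosed_iInter fun _ =>
      isClosed_lineSign_nonpos.preimage (continuous_apply _))

theorem isOpen_positiveCoords : IsOpen (positiveCoords n) := by
  have : positiveCoords n = ⋂ p, {x | 0 < lineSign (x (.inr p))} := by
    ext x; simp [positiveCoords]
  rw [this]
  exact isOpen_iInter_of_finite fun p =>
    isOpen_lineSign_pos.preimage (continuous_apply (A := fun _ => OnePoint ℝ) _)

theorem exists_pairEmb {i j : Fin n} (h : i < j) : ∃ p : Fin 2 ↪o Fin n, p 0 = i ∧ p 1 = j :=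
  ⟨_, orderEmb_pair h (card_pair h.ne)⟩

theorem exists_quadEmb {i j k : Fin n} (hij : i < j) (hjk : j < k) :
    ∃ q : Fin 4 ↪o Fin (n + 1), q 0 = 0 ∧ q 1 = i.succ ∧ q 2 = j.succ ∧ q 3 = k.succ := by
  refine ⟨OrderEmbedding.ofStrictMono ![0, i.succ, j.succ, k.succ] ?_, rfl, rfl, rfl, rfl⟩
  rw [Fin.strictMono_iff_lt_succ]
  intro t
  fin_cases t
  · exact Fin.succ_pos i
  · exact Fin.succ_lt_succ_iff.2 hij
  · exact Fin.succ_lt_succ_iff.2 hjk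

/-- For finite markings `ρ_{0ijk}` is `-(z_j - z_i)/(z_k - z_j)`, so its sign condition says that
`z_j` lies between `z_i` and `z_k`. -/
theorem mem_orderedCoords {x : Index n → OnePoint ℝ} :
    x ∈ orderedCoords n ↔ (∀ i j, i < j → 0 ≤ pairUnit x i j * pairDiff x i j) ∧
      ∀ i j k, i < j → j < k → 0 ≤ tripleDiff x i j k * tripleDiff x j k i := by
  constructor
  · rintro ⟨h1, h2⟩
    refine ⟨fun i j hij => ?_, fun i j k hij hjk => ?_⟩
    · obtain ⟨p, rfl, rfl⟩ := exists_pairEmb hij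
      exact (lineSign_nonneg_iff (apply_inr_eq x p)).1 (h1 p)
    · obtain ⟨q, h0, hi, hj, hk⟩ := exists_quadEmb hij hjk
      exact (lineSign_nonpos_iff (apply_inl_eq x q i j k h0 hi hj hk)).1 (h2 q h0)
  · rintro ⟨h1, h2⟩
    refine ⟨fun p => ?_, fun q h0 => ?_⟩
    · exact (lineSign_nonneg_iff (apply_inr_eq x p)).2 (h1 _ _ (p.strictMono (by decide)))
    · have hne : ∀ t, t ≠ 0 → q t ≠ 0 := fun t ht h => ht (q.injective (h.trans h0.symm))
      obtain ⟨i, hi⟩ := Fin.exists_succ_eq.2 (hne 1 (by decide))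
      obtain ⟨j, hj⟩ := Fin.exists_succ_eq.2 (hne 2 (by decide))
      obtain ⟨k, hk⟩ := Fin.exists_succ_eq.2 (hne 3 (by decide))
      refine (lineSign_nonpos_iff (apply_inl_eq x q i j k h0 hi.symm hj.symm hk.symm)).2
        (h2 i j k ?_ ?_)
      · rw [← Fin.succ_lt_succ_iff, hi, hj]; exact q.strictMono (by decide)
      · rw [← Fin.succ_lt_succ_iff, hj, hk]; exact q.strictMono (by decide)

theorem rhoOfPoints_mem_orderedCoords {z : Fin n → ℝ} (hz : Function.Injective z) :
    rhoOfPoints z ∈ orderedCoords n ↔ StrictMono z := by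
  rw [mem_orderedCoords]
  constructor
  · rintro ⟨h, -⟩ i j hij
    obtain ⟨r, hr, h1, h2⟩ := pair_rhoOfPoints z i j
    have h3 := h i j hij
    rw [h1, h2, ← mul_assoc] at h3
    have h4 : 0 ≤ z j - z i := nonneg_of_mul_nonneg_right h3 (mul_self_pos.2 hr)
    exact lt_of_le_of_ne (sub_nonneg.1 h4) fun he => hij.ne (hz he)
  · intro hm
    refine ⟨fun i j hij => ?_, fun i j k hij hjk => ?_⟩
    · obtain ⟨r, -, h1, h2⟩ := pair_rhoOfPoints z i j
      rw [h1, h2, ← mul_assoc]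
      exact mul_nonneg (mul_self_nonneg r) (sub_pos.2 (hm hij)).le
    · obtain ⟨r, -, h1, -, h3⟩ :=
        tripleDiff_rhoOfPoints hz hij.ne (hij.trans hjk).ne hjk.ne
      rw [h1, h3, mul_mul_mul_comm]
      exact mul_nonneg (mul_self_nonneg r)
        (mul_nonneg (sub_pos.2 (hm hij)).le (sub_pos.2 (hm hjk)).le)

theorem rhoOfPoints_mem_positiveCoords {z : Fin n → ℝ} (hz : StrictMono z) :
    rhoOfPoints z ∈ positiveCoords n := by
  intro p
  have : 0 < z (p 1) - z (p 0) := sub_pos.2 (hz (p.strictMono (by decide)))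
  change 0 < lineSign (ofPair 1 _)
  rw [ofPair_of_ne _ this.ne', lineSign_coe]
  positivity

/-- A scaled line with positive coordinates `ρ_{ij}` is an affine line with ordered markings. -/
theorem ScaledLine.rho_mem_orderedCoords_of_positive (hn : 1 ≤ n) {C : ScaledLine ℝ n}
    (h : C.rho ∈ positiveCoords n) : C.rho ∈ orderedCoords n := by
  have hu : ∀ i j, i ≠ j → pairUnit C.rho i j ≠ 0 ∧ pairDiff C.rho i j ≠ 0 := by
    have key : ∀ i j, i < j → pairUnit C.rho i j ≠ 0 ∧ pairDiff C.rho i j ≠ 0 := by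
      intro i j hij
      obtain ⟨p, rfl, rfl⟩ := exists_pairEmb hij
      have h1 := h p
      have h2 := apply_inr_eq C.rho p
      constructor
      · intro h0
        have h3 := (lineSign_nonpos_iff (x := C.rho (.inr p)) (p := pairUnit C.rho (p 0) (p 1))
          (q := -pairDiff C.rho (p 0) (p 1)) (by rw [neg_neg]; exact h2)).2 (by simp [h0])
        exact absurd h1 (not_lt_of_ge h3)
      · intro h0
        rw [h0, ofPair_zero_right] at h2
        rw [h2] at h1
        simp at h1
    intro i j hij
    rcases lt_or_gt_of_ne hij with h' | h'
    · exact key i j h'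
    · rw [pairUnit_comm, pairDiff_comm, neg_ne_zero]
      exact key j i h'
  let i₀ : Fin n := ⟨0, hn⟩
  set v := C.col i₀ with hv
  obtain ⟨c, hc⟩ := OnePoint.ne_infty_iff_exists.1 (nondegenerate_col (C := C) i₀).2
  have hc0 : c ≠ 0 := fun h0 => (nondegenerate_col (C := C) i₀).1 (by rw [← hc, h0])
  -- Since no `ρ_{ij}` is `0`, all markings are behind one coloured component; since none is `∞`,
  -- this component separates them.
  have hle : ∀ j, C.comp j ≤ v := by
    intro j
    by_cases hj : i₀ = j
    · rw [← hj]; exact comp_le_col _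
    · by_contra hn
      exact (hu i₀ j hj).1 ((pair_rho_col hc.symm).2 hn)
  have hcol : ∀ j, v = C.col j := fun j => eq_col (hle j) (nondegenerate_col i₀)
  have hinj : Function.Injective (C.fpt v) := by
    intro i j hij
    by_contra hne
    refine (hu i j hne).2 ?_
    rw [((pair_rho_col (C := C) (i := i) (j := j) (c := c) (by rw [← hcol i, hc])).1
      (by rw [← hcol i]; exact hle j)).2, ← hcol i, hij, sub_self, mul_zero, mul_zero]
  have hz : Function.Injective fun i => c * C.fpt v i :=
    fun i j hij => hinj (mul_left_cancel₀ hc0 hij)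
  have hr := rho_eq_rhoOfPoints hle hinj hc.symm hc0
  rw [hr] at h ⊢
  rw [rhoOfPoints_mem_orderedCoords hz]
  intro i j hij
  obtain ⟨p, rfl, rfl⟩ := exists_pairEmb hij
  have h1 := (lineSign_nonneg_iff rfl).1 (h p).le
  rw [one_mul, sub_nonneg] at h1
  exact lt_of_le_of_ne h1 fun he => hij.ne (hz he)

end Ordered

/-! ### Quilted disks with given coordinates -/

section Quilting

variable {n : ℕ}

namespace ScaledLine

/-- The markings on a component of an ordered scaled line are in monotone or antitone order. -/
theorem monotone_or_antitone_fpt {C : ScaledLine ℝ n} (h : C.rho ∈ orderedCoords n) (v : C.V) :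
    Monotone (fun i : {i // C.comp i ≤ v} => C.fpt v i) ∨
      Antitone (fun i : {i // C.comp i ≤ v} => C.fpt v i) := by
  rw [mem_orderedCoords] at h
  -- The sign of `ρ_{0ijk}` gives betweenness for each triple. A function on a linear order that
  -- preserves betweenness is monotone or antitone.
  have key : ∀ i j k, C.comp i ≤ v → C.comp j ≤ v → C.comp k ≤ v → i ≤ j → j ≤ k →
      C.fpt v j ∈ Set.uIcc (C.fpt v i) (C.fpt v k) := by
    intro i j k hi hj hk hij hjk
    rcases hij.eq_or_lt with rfl | hij
    · exact Set.left_mem_uIcc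
    rcases hjk.eq_or_lt with rfl | hjk
    · exact Set.right_mem_uIcc
    by_cases hne : C.fpt v i = C.fpt v j ∧ C.fpt v i = C.fpt v k
    · rw [← hne.1]; exact Set.left_mem_uIcc
    obtain ⟨r, hr, h1, -, h3⟩ := tripleDiff_rho hij.ne (hij.trans hjk).ne hjk.ne hi hj hk hne
    have h4 := h.2 i j k hij hjk
    rw [h1, h3, mul_mul_mul_comm] at h4
    have h5 := nonneg_of_mul_nonneg_right h4 (mul_self_pos.2 hr)
    rw [Set.mem_uIcc]
    rcases mul_nonneg_iff.1 h5 with h6 | h6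
    · exact Or.inl ⟨sub_nonneg.1 h6.1, sub_nonneg.1 h6.2⟩
    · exact Or.inr ⟨sub_nonpos.1 h6.2, sub_nonpos.1 h6.1⟩
  rw [Set.monotone_or_antitone_iff_uIcc]
  rintro ⟨i, hi⟩ ⟨k, hk⟩ ⟨j, hj⟩ hm
  rcases Set.mem_uIcc.1 hm with hm | hm
  · exact key i j k hi hj hk hm.1 hm.2
  · rw [Set.uIcc_comm]
    exact key k j i hk hj hi hm.1 hm.2

/-- A component of an ordered scaled line can be reflected so that the markings are in order and
the form is positive. -/
theorem exists_orientation {C : ScaledLine ℝ n} (h : C.rho ∈ orderedCoords n) (v : C.V) :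
    ∃ a : ℝˣ, (∀ i j, i < j → C.comp i ≤ v → C.comp j ≤ v →
      (a : ℝ) * C.fpt v i ≤ a * C.fpt v j) ∧
      ∀ c : ℝ, C.scale v = (c : OnePoint ℝ) → 0 ≤ c * ((a⁻¹ : ℝˣ) : ℝ) := by
  by_cases hv : Nondegenerate (C.scale v)
  · obtain ⟨c, hc⟩ := OnePoint.ne_infty_iff_exists.1 hv.2
    have hc0 : c ≠ 0 := fun h0 => hv.1 (by rw [← hc, h0])
    -- Scaling by `c` turns the form into `dz`, and the order of the markings is then given by the
    -- signs of `ρ_{ij}`.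
    refine ⟨Units.mk0 c hc0, fun i j hij hi hj => ?_, fun c' hc' => ?_⟩
    · by_cases hne : C.fpt v i = C.fpt v j
      · rw [hne]
      obtain ⟨r, hr, h1, h2⟩ := pair_rho hi hj hne
      have h3 := (mem_orderedCoords.1 h).1 i j hij
      rw [h1, h2, mul_mul_mul_comm, ← hc, homPair_coe_zero, homPair_coe_one, one_mul] at h3
      have h4 := nonneg_of_mul_nonneg_right h3 (mul_self_pos.2 hr)
      rw [mul_sub, sub_nonneg] at h4
      exact h4
    · rw [← hc] at hc'
      rw [← OnePoint.coe_injective hc', Units.val_inv_eq_inv_val, Units.val_mk0,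
        mul_inv_cancel₀ hc0]
      exact zero_le_one
  · have hc : ∀ c : ℝ, C.scale v = (c : OnePoint ℝ) → c = 0 := by
      intro c hc
      by_contra h0
      rw [hc] at hv
      exact hv ⟨fun he => h0 (OnePoint.coe_injective he), OnePoint.coe_ne_infty _⟩
    -- A form that is zero or infinite imposes no orientation, so the component may be reflected if
    -- its markings are in antitone order.
    rcases monotone_or_antitone_fpt h v with hm | hm
    · refine ⟨1, fun i j hij hi hj => ?_, fun c hc' => by rw [hc c hc', zero_mul]⟩
      rw [Units.val_one, one_mul, one_mul]
      exact hm (a := ⟨i, hi⟩) (b := ⟨j, hj⟩) hij.le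
    · refine ⟨-1, fun i j hij hi hj => ?_, fun c hc' => by rw [hc c hc', zero_mul]⟩
      rw [Units.val_neg, Units.val_one, neg_one_mul, neg_one_mul, neg_le_neg_iff]
      exact hm (a := ⟨i, hi⟩) (b := ⟨j, hj⟩) hij.le

open Classical in
/-- The quilted disk associated to a real scaled line with ordered markings and positive forms. -/
def toQuiltedDisk (C : ScaledLine ℝ n)
    (ho : ∀ v i j, i < j → C.comp i ≤ v → C.comp j ≤ v → C.fpt v i ≤ C.fpt v j)
    (hp : ∀ v (c : ℝ), C.scale v = (c : OnePoint ℝ) → 0 ≤ c) : QuiltedDisk n where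
  toNodalLine := C.toNodalLine
  seam := fun v => if Nondegenerate (C.scale v) then some (homPair (C.scale v) 0)⁻¹ else none
  seam_pos := by
    intro v y hy
    split_ifs at hy with h
    obtain ⟨c, hc⟩ := OnePoint.ne_infty_iff_exists.1 h.2
    have h1 := hp v c hc.symm
    have h2 : c ≠ 0 := fun h0 => h.1 (by rw [← hc, h0])
    rw [← hc, homPair_coe_zero, Option.some.injEq] at hy
    rw [← hy]
    exact inv_pos.2 (lt_of_le_of_ne h1 h2.symm)
  quilted_path := by
    simp only [ne_eq, ite_eq_right_iff, reduceCtorEq, imp_false, not_not]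
    exact C.colored_path
  stable_quilted := by
    simp only [ne_eq, ite_eq_right_iff, reduceCtorEq, imp_false, not_not]
    exact C.stable_colored
  stable_unquilted := by
    simp only [ite_eq_right_iff, reduceCtorEq, imp_false]
    exact C.stable_uncolored
  ordered := by
    intro v i j x y hij hi hj
    obtain ⟨hi', rfl⟩ := NodalLine.le_of_pt_succ_eq hi
    obtain ⟨hj', rfl⟩ := NodalLine.le_of_pt_succ_eq hj
    exact ho v i j hij hi' hj'

theorem form_toQuiltedDisk (C : ScaledLine ℝ n)
    (ho : ∀ v i j, i < j → C.comp i ≤ v → C.comp j ≤ v → C.fpt v i ≤ C.fpt v j)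
    (hp : ∀ v (c : ℝ), C.scale v = (c : OnePoint ℝ) → 0 ≤ c) (v : C.V) :
    (C.toQuiltedDisk ho hp).form v = C.scale v := by
  have hseam : ∀ w, (C.toQuiltedDisk ho hp).seam w ≠ none ↔ Nondegenerate (C.scale w) := by
    intro w
    simp [toQuiltedDisk]
  by_cases hv : Nondegenerate (C.scale v)
  · have h1 : (C.toQuiltedDisk ho hp).seam v = some (homPair (C.scale v) 0)⁻¹ := if_pos hv
    unfold QuiltedDisk.form
    rw [h1]
    obtain ⟨c, hc⟩ := OnePoint.ne_infty_iff_exists.1 hv.2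
    simp only [← hc, homPair_coe_zero, inv_inv]
  · have h1 : (C.toQuiltedDisk ho hp).seam v = none := if_neg hv
    unfold QuiltedDisk.form
    rw [h1]
    by_cases hs : C.scale v = ∞
    · obtain ⟨i, hi⟩ := C.exists_comp_le v
      rw [hs]
      exact if_pos ⟨C.col i, (col_lt_iff hi).2 hs, (hseam _).2 (nondegenerate_col i)⟩
    · have hs' : C.scale v = ((0 : ℝ) : OnePoint ℝ) := by
        by_contra h0
        exact hv ⟨h0, hs⟩
      rw [hs']
      refine if_neg ?_
      rintro ⟨w, hw, hw'⟩
      exact hs (C.scale_above w v ((hseam w).1 hw') hw)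

theorem isomorphic_toQuiltedDisk (C : ScaledLine ℝ n)
    (ho : ∀ v i j, i < j → C.comp i ≤ v → C.comp j ≤ v → C.fpt v i ≤ C.fpt v j)
    (hp : ∀ v (c : ℝ), C.scale v = (c : OnePoint ℝ) → 0 ≤ c) :
    Isomorphic (C.toQuiltedDisk ho hp).toScaledLine C := by
  refine ⟨NodalLine.Iso.refl _, fun v => ?_⟩
  refine (form_toQuiltedDisk C ho hp v).trans ?_
  change C.scale v = (C.scale v).map fun c => c * ((1 : ℝˣ) : ℝ)
  induction C.scale v using OnePoint.rec <;> simp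

theorem exists_quiltedDisk {C : ScaledLine ℝ n} (h : C.rho ∈ orderedCoords n) :
    ∃ Q : QuiltedDisk n, Q.toScaledLine.rho = C.rho := by
  choose a ha ha' using exists_orientation h
  have ho : ∀ (v : C.V) (i j : Fin n), i < j → C.comp i ≤ v → C.comp j ≤ v →
      (C.affine a 0).fpt v i ≤ (C.affine a 0).fpt v j := by
    intro v i j hij hi hj
    have hf : ∀ i, C.comp i ≤ v → (C.affine a 0).fpt v i = a v * C.fpt v i + 0 :=
      fun i hi => C.toNodalLine.fpt_affine a 0 hi
    rw [hf i hi, hf j hj, add_zero, add_zero]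
    exact ha v i j hij hi hj
  have hp : ∀ (v : C.V) (c : ℝ), (C.affine a 0).scale v = (c : OnePoint ℝ) → 0 ≤ c := by
    intro v c hc
    change ((C.scale v).map fun c => c * (((a v)⁻¹ : ℝˣ) : ℝ)) = _ at hc
    have h1 := ha' v
    induction hs : C.scale v using OnePoint.rec with
    | infty =>
      rw [hs] at hc
      exact absurd hc (OnePoint.infty_ne_coe c)
    | coe c' =>
      rw [hs, OnePoint.map_some] at hc
      rw [← OnePoint.coe_injective hc]
      exact h1 c' hs
  refine ⟨(C.affine a 0).toQuiltedDisk ho hp, ?_⟩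
  rw [ScaledLine.rho_eq (isomorphic_toQuiltedDisk (C.affine a 0) ho hp)]
  exact (ScaledLine.rho_eq (C.isomorphic_affine a 0)).symm

end ScaledLine

namespace QuiltedDisk

theorem form_nonneg (Q : QuiltedDisk n) {v : Q.V} {c : ℝ} (h : Q.form v = (c : OnePoint ℝ)) :
    0 ≤ c := by
  unfold form at h
  cases hs : Q.seam v with
  | some y =>
    rw [hs] at h
    rw [← OnePoint.coe_injective h]
    exact (inv_pos.2 (Q.seam_pos v y hs)).le
  | none =>
    simp only [hs] at h
    split_ifs at h with h1
    · exact absurd h (OnePoint.infty_ne_coe c)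
    · exact (OnePoint.coe_injective h).le

theorem rho_mem_orderedCoords (Q : QuiltedDisk n) : Q.toScaledLine.rho ∈ orderedCoords n := by
  set C := Q.toScaledLine with hC
  have hle : ∀ {v : C.V} {i j}, i < j → C.comp i ≤ v → C.comp j ≤ v →
      0 ≤ C.fpt v j - C.fpt v i := fun h hi hj => sub_nonneg.2 (Q.fpt_le h hi hj)
  rw [mem_orderedCoords]
  refine ⟨fun i j hij => ?_, fun i j k hij hjk => ?_⟩
  · obtain ⟨v, hi, hj, hne⟩ := C.toNodalLine.exists_fpt_ne hij.ne
    obtain ⟨r, -, h1, h2⟩ := ScaledLine.pair_rho hi hj hne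
    rw [h1, h2, mul_mul_mul_comm, ← mul_assoc (homPair _ _)]
    refine mul_nonneg (mul_self_nonneg r) (mul_nonneg ?_ (hle hij hi hj))
    have h3 : ∀ c : ℝ, C.scale v = (c : OnePoint ℝ) → 0 ≤ c := fun c hc => Q.form_nonneg hc
    induction hs : C.scale v using OnePoint.rec with
    | infty => simp
    | coe c => simpa using h3 c hs
  · obtain ⟨v, hi, hj, hk, hne⟩ :=
      C.toNodalLine.exists_not_all_fpt_eq hij.ne (hij.trans hjk).ne
    obtain ⟨r, -, h1, -, h3⟩ :=
      ScaledLine.tripleDiff_rho hij.ne (hij.trans hjk).ne hjk.ne hi hj hk hne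
    rw [h1, h3, mul_mul_mul_comm]
    exact mul_nonneg (mul_self_nonneg r) (mul_nonneg (hle hij hi hj) (hle hjk hj hk))

end QuiltedDisk

/-- A point of the real locus whose coordinates have the right signs comes from a real curve, and
reorienting its components makes it a quilted disk. -/
theorem range_toRealLocus (hn : 1 ≤ n) :
    Set.range (Multiplihedron.toRealLocus : Multiplihedron n → RealLocus n) =
      RealLocus.realCoord ⁻¹' orderedCoords n := by
  ext y
  constructor
  · rintro ⟨⟨Q⟩, rfl⟩
    change (RealLocus.ofReal Q.toScaledLine).realCoord ∈ orderedCoords n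
    rw [RealLocus.realCoord_ofReal]
    exact Q.rho_mem_orderedCoords
  · intro h
    obtain ⟨C, rfl⟩ := y.exists_eq_ofReal hn
    rw [Set.mem_preimage, RealLocus.realCoord_ofReal] at h
    obtain ⟨Q, hQ⟩ := ScaledLine.exists_quiltedDisk h
    refine ⟨Quotient.mk _ Q, RealLocus.realCoord_injective ?_⟩
    rw [Multiplihedron.toRealLocus_mk, RealLocus.realCoord_ofReal, RealLocus.realCoord_ofReal, hQ]

end Quilting

/-! ### The fundamental domain -/

section FundamentalDomain

open Topology Filter

variable {n : ℕ}

theorem ScaledLine.tendsto_rhoOfPoints_smoothing (C : ScaledLine ℝ n) :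
    Tendsto (fun ε => rhoOfPoints (C.smoothing ε)) (𝓝[>] 0) (𝓝 C.rho) := by
  rw [tendsto_pi_nhds]
  intro e
  obtain ⟨h1, h2⟩ := C.smooth_gluing_zero e
  have h := tendsto_ofPair ((C.continuous_smoothNum_gluing e).tendsto 0)
    ((C.continuous_smoothDen_gluing e).tendsto 0) h1
  rw [h2] at h
  refine (h.mono_left nhdsWithin_le_nhds).congr' ?_
  filter_upwards [self_mem_nhdsWithin] with ε hε
  exact ofPair_smooth_eq_smoothing (ne_of_gt hε) e

/-- The smoothings of a quilted disk are ordered. -/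
theorem QuiltedDisk.eventually_strictMono_smoothing (Q : QuiltedDisk n) :
    ∀ᶠ ε in 𝓝[>] (0 : ℝ), StrictMono (Q.toScaledLine.smoothing ε) := by
  set C := Q.toScaledLine with hC
  have hunit : ∀ v, 0 < C.unit v := by
    intro v
    by_cases h : Nondegenerate (C.scale v)
    · exact lt_of_le_of_ne (Q.form_nonneg (ScaledLine.scale_eq_unit h))
        (ScaledLine.unit_ne_zero v).symm
    · rw [ScaledLine.unit, if_neg h]; exact one_pos
  have key : ∀ i j, i < j → ∀ᶠ ε in 𝓝[>] (0 : ℝ), C.smoothing ε i < C.smoothing ε j := by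
    intro i j hij
    obtain ⟨v, hi, hj, hne⟩ := C.toNodalLine.exists_fpt_ne hij.ne
    have h1 : 0 < C.fpt v j - C.fpt v i :=
      sub_pos.2 (lt_of_le_of_ne (Q.fpt_le hij hi hj) hne)
    have h2 := (ScaledLine.tendsto_pos_sub hi hj).eventually_const_lt h1
    filter_upwards [h2.filter_mono nhdsWithin_le_nhds, self_mem_nhdsWithin] with ε hε hε0
    rw [← sub_pos, ScaledLine.smoothing_sub (ne_of_gt hε0) hi hj]
    exact mul_pos (mul_pos (hunit v) (zpow_pos hε0 _)) hε
  simp only [← eventually_all] at key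
  filter_upwards [key] with ε h i j hij using h i j hij

/-- Positions after gluing depend on the tree and not on the numbering of the markings. -/
theorem NodalLine.pos_permute (σ : Equiv.Perm (Fin n)) (C : NodalLine ℝ n) (t nd : C.V → ℝ)
    (p : C.V) (x : ℝ) (u : C.V) :
    NodalLine.pos (C := C.permute σ) t nd p x u = NodalLine.pos (C := C) t nd p x u := by
  induction u using WellFoundedLT.induction with
  | ind u ih =>
    by_cases h : p ≤ u
    · rcases h.eq_or_lt with rfl | h
      · rw [NodalLine.pos_self]
        exact NodalLine.pos_self (C := C.permute σ) t nd p x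
      · rw [NodalLine.pos_of_lt t nd x h, ← ih _ (NodalLine.child_lt h)]
        exact NodalLine.pos_of_lt (C := C.permute σ) t nd x h
    · rw [NodalLine.pos_of_not_le t nd x h]
      exact NodalLine.pos_of_not_le (C := C.permute σ) t nd x h

theorem ScaledLine.smoothing_permute (σ : Equiv.Perm (Fin n)) (C : ScaledLine ℝ n) (ε : ℝ) :
    (C.permute σ).smoothing ε = fun i => C.smoothing ε (σ⁻¹ i) :=
  funext fun _ => congrArg (C.units ε ⊤ * ·) (C.toNodalLine.pos_permute σ _ _ _ _ _)

theorem exists_realCoord_eq_rhoOfPoints (hn : 1 ≤ n) {z : Fin n → ℝ} (hz : Function.Injective z) :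
    ∃ y : RealLocus n, y.realCoord = rhoOfPoints z :=
  ⟨RealLocus.ofReal (ScaledLine.single hn z hz), by
    rw [RealLocus.realCoord_ofReal, ScaledLine.rho_single]⟩

theorem isFundamentalDomain_range_toRealLocus (hn : 1 ≤ n) :
    IsFundamentalDomain (Equiv.Perm (Fin n))
      (Set.range (Multiplihedron.toRealLocus : Multiplihedron n → RealLocus n)) := by
  have hind := RealLocus.isInducing_realCoord (n := n)
  have hD := range_toRealLocus hn
  have hclosed : IsClosed
      (Set.range (Multiplihedron.toRealLocus : Multiplihedron n → RealLocus n)) := by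
    rw [hD]
    exact isClosed_orderedCoords.preimage hind.continuous
  -- Positivity of all `ρ_{ij}` is an open condition in the real locus, and it already forces the
  -- order of the markings.
  have hpos : RealLocus.realCoord ⁻¹' positiveCoords n ⊆
      interior (Set.range (Multiplihedron.toRealLocus : Multiplihedron n → RealLocus n)) := by
    refine interior_maximal ?_ (isOpen_positiveCoords.preimage hind.continuous)
    intro y hy
    rw [hD]
    obtain ⟨C, rfl⟩ := y.exists_eq_ofReal hn
    rw [Set.mem_preimage, RealLocus.realCoord_ofReal] at hy ⊢
    exact ScaledLine.rho_mem_orderedCoords_of_positive hn hy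
  refine ⟨hclosed, ?_, fun y => ?_, fun σ hσ => ?_⟩
  · refine Set.Subset.antisymm (hclosed.closure_subset_iff.2 interior_subset) ?_
    rintro y ⟨⟨Q⟩, rfl⟩
    -- Smoothings of a quilted disk have increasing markings, hence positive coordinates, and tend
    -- to the disk.
    refine closure_mono hpos ?_
    rw [hind.closure_eq_preimage_closure_image, Set.mem_preimage]
    change (RealLocus.ofReal Q.toScaledLine).realCoord ∈ _
    rw [RealLocus.realCoord_ofReal]
    refine mem_closure_of_tendsto Q.toScaledLine.tendsto_rhoOfPoints_smoothing ?_
    filter_upwards [Q.eventually_strictMono_smoothing] with ε hε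
    obtain ⟨y, hy⟩ := exists_realCoord_eq_rhoOfPoints hn hε.injective
    exact ⟨y, by rw [Set.mem_preimage, hy]; exact rhoOfPoints_mem_positiveCoords hε, hy⟩
  · obtain ⟨C, rfl⟩ := y.exists_eq_ofReal hn
    have hsort : ∃ᶠ ε in 𝓝[>] (0 : ℝ), ∃ σ : Equiv.Perm (Fin n),
        StrictMono (C.smoothing ε ∘ σ) := by
      refine Eventually.frequently ?_
      filter_upwards [(C.eventually_injective_smoothing).filter_mono
        (nhdsWithin_mono 0 fun ε hε => ne_of_gt hε)] with ε hε
      exact ⟨Tuple.sort _, (Tuple.monotone_sort _).strictMono_of_injective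
        (hε.comp (Equiv.injective _))⟩
    -- There are finitely many permutations, so one of them sorts the markings of smoothings for
    -- arbitrarily small parameters. As the sign conditions are closed, they pass to the limit.
    obtain ⟨σ, hσ⟩ := frequently_exists.1 hsort
    refine ⟨σ, RealLocus.ofReal (C.permute σ⁻¹), ?_, ?_⟩
    · rw [hD, Set.mem_preimage, RealLocus.realCoord_ofReal]
      refine isClosed_orderedCoords.mem_of_frequently_of_tendsto (hσ.mono fun ε hε => ?_)
        (C.permute σ⁻¹).tendsto_rhoOfPoints_smoothing
      rw [ScaledLine.smoothing_permute, inv_inv]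
      exact (rhoOfPoints_mem_orderedCoords hε.injective).2 hε
    · rw [← RealLocus.smul_ofReal, smul_inv_smul]
  · rw [Set.disjoint_left]
    rintro _ hy ⟨y, hy', rfl⟩
    obtain ⟨⟨Q⟩, rfl⟩ := interior_subset hy'
    set C := Q.toScaledLine with hC
    change RealLocus.ofReal (C.permute σ) ∈ _ at hy
    obtain ⟨U, hU, hU'⟩ := hind.isOpen_iff.1
      (isOpen_interior (s := Set.range (Multiplihedron.toRealLocus : Multiplihedron n → _)))
    rw [← hU', Set.mem_preimage, RealLocus.realCoord_ofReal] at hy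
    have h1 := (C.permute σ).tendsto_rhoOfPoints_smoothing.eventually (hU.mem_nhds hy)
    -- For a small parameter the smoothing has increasing markings, while its translate by `σ` is
    -- still in the interior of the domain.
    obtain ⟨ε, h2, h3⟩ := (h1.and Q.eventually_strictMono_smoothing).exists
    rw [ScaledLine.smoothing_permute] at h2
    have hinj : Function.Injective fun i => C.smoothing ε (σ⁻¹ i) :=
      h3.injective.comp (Equiv.injective _)
    obtain ⟨y, hy⟩ := exists_realCoord_eq_rhoOfPoints hn hinj
    have h4 : y ∈ interior (Set.range Multiplihedron.toRealLocus) := by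
      rw [← hU', Set.mem_preimage, hy]
      exact h2
    have h5 := interior_subset h4
    rw [hD, Set.mem_preimage, hy, rhoOfPoints_mem_orderedCoords hinj] at h5
    -- The markings increase both before and after the renumbering, so the permutation is monotone,
    -- hence trivial.
    have h6 : StrictMono (σ⁻¹ : Equiv.Perm (Fin n)) := fun i j hij => h3.lt_iff_lt.1 (h5 hij)
    exact hσ (inv_eq_one.1 ((Equiv.Perm.monotone_iff _).1 h6.monotone))

end FundamentalDomain

end

end ScaledLines

theorem theorem1p2 (n : ℕ) (hn : 1 ≤ n) :
    Function.Injective (Moduli.rho : Moduli ℂ n → Index n → OnePoint ℂ) ∧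
    IsProjectiveVariety (Set.range (Moduli.rho : Moduli ℂ n → Index n → OnePoint ℂ)) ∧
    HasToricSingularities (Set.range (Moduli.rho : Moduli ℂ n → Index n → OnePoint ℂ)) ∧
    Topology.IsEmbedding (Multiplihedron.toRealLocus : Multiplihedron n → RealLocus n) ∧
    ScaledLines.IsFundamentalDomain (Equiv.Perm (Fin n))
      (Set.range (Multiplihedron.toRealLocus : Multiplihedron n → RealLocus n)) :=
  ⟨Moduli.rho_injective, isProjectiveVariety_range_rho hn, hasToricSingularities_range_rho hn,
    Multiplihedron.isEmbedding_toRealLocus, isFundamentalDomain_range_toRealLocus hn⟩
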